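/- Let $k,j\ge 0$ be integers and let $0<\mu_1<\mu_0-\mu_1$. Put $I_1=(-\mu_1,\mu_1)$ (the large interval) and $I_0=(\mu_1,\mu_0-\mu_1)$ (the small interval) on the circle $\mathbb R/\mu_0\mathbb Z$; they meet at the jump points $\pm\mu_1$. **Nahm data.** Let $T_0,\dots,T_3$ be skew-adjoint matrix functions, of size $k+j$ on $I_1$ and of size $k$ on $I_0$, satisfying Nahm's equations $T_a'+[T_0,T_a]=[T_b,T_c]$ for $(a,b,c)$ a cyclic permutation of $(1,2,3)$. At each jump point the fibres are glued by an isometric injection $\iota:\mathbb C^k\to\mathbb C^{k+j}$ (small into large) with adjoint $\pi=\iota^*$. $T_0$ is smooth up to the ends of each interval, and at the jump points $\pi T_0\iota$ (large side) equals $T_0$ (small side). * If $j>0$: at each jump point, with $\hat z$ the coordinate centred there and in the $d/dz+T_0$-parallel frame of the large side that is the identity at that point, $T_1,T_2,T_3$ have with respect to $\mathrm{im}\,\iota\oplus\ker\pi$ the form $\begin{pmatrix}\hat T_i&O(\hat z^{(j-1)/2})\\ O(\hat z^{(j-1)/2})&R_i\end{pmatrix}$. Here $\hat T_i$ has a limit,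 equal to the limit of $T_i$ from the small side, and $R_i=r_i/\hat z+O(1)$, where $r_1,r_2,r_3$ form an irreducible representation of $\mathfrak{su}(2)$ on $\ker\pi\cong\mathbb C^j$ (so $[r_1,r_2]=-r_3$ and cyclically). * If $j=0$: $T_1,T_2,T_3$ have limits from both sides at $\pm\mu_1$, and $A(\zeta)=(T_1+iT_2)-2iT_3\zeta+(T_1-iT_2)\zeta^2$ has jump (limit from the right minus limit from the left, the fibres being identified by $\iota$) $\Delta_\pm A(\zeta)=(\alpha_{\pm,0}+\alpha_{\pm,1}\zeta)(\bar\alpha_{\pm,1}-\bar\alpha_{\pm,0}\zeta)^T$ for given vectors $\alpha_{\pm,0},\alpha_{\pm,1}\in\mathbb C^k$. **The complex.** Fix $(x_0,\dots,x_3)\in\mathbb R^4$ and put $\alpha=T_0-iT_3$, $\beta=T_1+iT_2$, $y=\mu_0x_0-ix_3$, $w=x_1+ix_2$. Consider $$\tilde L^2_2\xrightarrow{\ D_1\ }(\tilde L^2_1)^{\oplus2}\xrightarrow{\ D_2\ }\tilde L^2,\qquad D_1=\begin{pmatrix}i(d_z+\alpha-iy)\\-\beta+iw\end{pmatrix},\quad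 D_2=\begin{pmatrix}\beta-iw& i(d_z+\alpha-iy)\end{pmatrix},$$ and the formal adjoint $D_1^*(s_1,s_2)=i(d_z-\alpha^*-i\bar y)s_1-(\beta^*+i\bar w)s_2$. A section is a pair of functions, $\mathbb C^{k+j}$-valued on $I_1$ and $\mathbb C^k$-valued on $I_0$; derivatives are taken on the open intervals, and $\Delta$ (right minus left) is formed at $\pm\mu_1$ after applying $\pi$ to the limit from the large side. * $\tilde L^2$ is the space of $L^2$ sections. * *Jump condition (J)* for a pair $(s_1,s_2)$: at both jump points the limits of $\pi s_{m,\rm large}$ and $s_{m,\rm small}$ ($m=1,2$) exist; if $j>0$, $\pi(s_{m,\rm large})=s_{m,\rm small}$; if $j=0$, $\Delta_\pm(s_1,s_2)=c_\pm v_\pm$ for some scalars $c_\pm$, where $v_\pm=(i\alpha_{\pm,1},-\alpha_{\pm,0})$. * $(\tilde L^2_1)^{\oplus 2}$ is the space of pairs $u=(s_1,s_2)$ of sections that are in $L^2_1$ on each interval, satisfy (J), and have $D_2u\in L^2$. * $\tilde L^2_2$ is the space of sections $s$ that are in $L^2_2$ on each interval, with $D_1s\in(\tilde L^2_1)^{\oplus2}$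 and, at both jump points, $s_{\rm large}=\iota(s_{\rm small})$ together with $\pi(d_zs_{\rm large})=d_zs_{\rm small}$ if $j>0$, and $\Delta_\pm(d_zs)=\frac12(\alpha_{\pm,1}\bar\alpha_{\pm,1}^T+\alpha_{\pm,0}\bar\alpha_{\pm,0}^T)s(\pm\mu_1)$ if $j=0$. * When $j=2$, "$u\in L^2_1$ on each interval" is replaced by "$u$ is locally absolutely continuous on the open intervals and $u,\ D_1^*u,\ D_2u\in L^2$", and "$s\in L^2_2$ on each interval" by "$s\in L^2$ is differentiable with locally absolutely continuous derivative on the open intervals". Let $\mathcal H$ be the space of $L^2$ solutions of the Dirac equation: pairs $u=(s_1,s_2)$ of $L^2$ sections, locally absolutely continuous on the open intervals, satisfying (J) and $D_2u=0=D_1^*u$. On $(\tilde L^2_1)^{\oplus2}$ use the norm $\|u\|^2=\|u\|_{L^2}^2$ if $j>0$, and $\|u\|^2=\|u\|_{L^2}^2+|c_+|^2+|c_-|^2$ if $j=0$ (with $c_\pm=0$ if $v_\pm=0$). **Proposition.** $D_2D_1=0$; $\mathcal H\subset\ker D_2$; and the map $\mathcal H\to\ker(D_2)/\mathrm{Im}(D_1)$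 sending a solution to its cohomology class is an isomorphism of complex vector spaces. Every $h\in\mathcal H$ has minimal norm in its cohomology class, and it is the only element of the class with that norm. -/

import Mathlib

open Set Filter Topology MeasureTheory
open scoped ContDiff

namespace CaloronNahm

noncomputable section

/-- The Hermitian space `ℂⁿ`. -/
abbrev V (n : ℕ) := EuclideanSpace ℂ (Fin n)

/-- Endomorphisms of `ℂⁿ`. -/
abbrev EndV (n : ℕ) := V n →L[ℂ] V n

/-- The two jump points `+μ₁` and `-μ₁` of the circle `ℝ / μ₀ℤ`. -/
inductive Jump
  | plus
  | minus

/-- The jump point as an end of the large interval `(-μ₁, μ₁)`. -/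
def largePt (μ₁ : ℝ) : Jump → ℝ
  | .plus => μ₁
  | .minus => -μ₁

/-- The jump point as an end of the small interval `(μ₁, μ₀ - μ₁)`; on the circle `μ₀ - μ₁` is
the point `-μ₁`. -/
def smallPt (μ₀ μ₁ : ℝ) : Jump → ℝ
  | .plus => μ₁
  | .minus => μ₀ - μ₁

/-- Approach to the jump point from inside the large interval. -/
def largeNhds (μ₁ : ℝ) : Jump → Filter ℝ
  | .plus => 𝓝[<] μ₁
  | .minus => 𝓝[>] (-μ₁)

/-- Approach to the jump point from inside the small interval. -/
def smallNhds (μ₀ μ₁ : ℝ) : Jump → Filter ℝ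
  | .plus => 𝓝[>] μ₁
  | .minus => 𝓝[<] (μ₀ - μ₁)

/-- `Δ = (limit from the right) - (limit from the left)`.  At `+μ₁` the small interval is on the
right, at `-μ₁` it is on the left. -/
def jumpSign : Jump → ℂ
  | .plus => 1
  | .minus => -1

/-- Nahm's equations `T₁' + [T₀, T₁] = [T₂, T₃]` and cyclic permutations, on `I`. -/
def IsNahm {n : ℕ} (T : Fin 4 → ℝ → EndV n) (I : Set ℝ) : Prop :=
  ∀ a b c : Fin 4, (a, b, c) ∈ ({(1, 2, 3), (2, 3, 1), (3, 1, 2)} : Set (Fin 4 × Fin 4 × Fin 4)) →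
    ∀ z ∈ I, HasDerivAt (T a)
      ((T b z * T c z - T c z * T b z) - (T 0 z * T a z - T a z * T 0 z)) z

/-- The endomorphisms `r₁, r₂, r₃` of `ℂⁿ` live on the subspace `W` (they are `Q rᵢ Q` for `Q` the
orthogonal projection on `W`), satisfy the `su(2)` relations in the normalisation forced by Nahm's
equations for residues, and act irreducibly on `W`. -/
def IsIrreducibleSU2 {n : ℕ} (Q : EndV n) (r : Fin 4 → EndV n) : Prop :=
  (∀ i, i ≠ 0 → Q * r i * Q = r i) ∧
  r 2 * r 3 - r 3 * r 2 = -r 1 ∧ r 3 * r 1 - r 1 * r 3 = -r 2 ∧ r 1 * r 2 - r 2 * r 1 = -r 3 ∧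
  ∀ W : Submodule ℂ (V n), W ≤ LinearMap.range (Q : V n →ₗ[ℂ] V n) →
    (∀ i, i ≠ 0 → ∀ w ∈ W, r i w ∈ W) → W = ⊥ ∨ W = LinearMap.range (Q : V n →ₗ[ℂ] V n)

/-- The surjection `π` from the large fibre onto the small one: the adjoint of the isometric
injection `ι`, so that `π ι = 1` and `ker π` is the orthogonal complement of the image of `ι`. -/
def proj {k m : ℕ} (ι : V k →ₗᵢ[ℂ] V m) : V m →L[ℂ] V k :=
  ContinuousLinearMap.adjoint ι.toContinuousLinearMap

/-- The orthogonal projection `1 - ι π` of the large fibre on the complement of the small one. -/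
def coproj {k m : ℕ} (ι : V k →ₗᵢ[ℂ] V m) : EndV m :=
  1 - ι.toContinuousLinearMap ∘L proj ι

/-- The boundary condition at a jump point for `j > 0`.  Here `g` is the `d/dz + T₀`-parallel
frame of the large side which is the identity at the end point; in this frame `T₀` is gauged to
zero and the parallel decomposition into subbundles of rank `k` and `j` is the constant
decomposition `range ι ⊕ ker π`.  In it the `Tᵢ` have the block form with a diagonal `k × k`
block whose limit is the limit from the small side, off-diagonal blocks `O(ẑ^{(j-1)/2})`, and a
`j × j` block with a simple pole, the residues being an irreducible representation of `su(2)`. -/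
def PolarCondition {k j : ℕ} (μ₀ μ₁ : ℝ) (TL : Fin 4 → ℝ → EndV (k + j)) (TS : Fin 4 → ℝ → EndV k)
    (p : Jump) (ι : V k →ₗᵢ[ℂ] V (k + j)) : Prop :=
  ∃ g : ℝ → EndV (k + j),
    g (largePt μ₁ p) = 1 ∧
    (∀ z ∈ Icc (-μ₁) μ₁, HasDerivWithinAt g (-(TL 0 z * g z)) (Icc (-μ₁) μ₁) z) ∧
    ∃ r : Fin 4 → EndV (k + j), IsIrreducibleSU2 (coproj ι) r ∧
      ∀ i, i ≠ 0 →
        let T' : ℝ → EndV (k + j) := fun z => ContinuousLinearMap.adjoint (g z) * TL i z * g z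
        (∃ t : EndV k,
          Tendsto (fun z => proj ι ∘L T' z ∘L ι.toContinuousLinearMap) (largeNhds μ₁ p) (𝓝 t) ∧
          Tendsto (TS i) (smallNhds μ₀ μ₁ p) (𝓝 t)) ∧
        ((fun z => proj ι ∘L T' z ∘L coproj ι)
          =O[largeNhds μ₁ p] fun z => |z - largePt μ₁ p| ^ (((j : ℝ) - 1) / 2)) ∧
        ((fun z => coproj ι ∘L T' z ∘L ι.toContinuousLinearMap)
          =O[largeNhds μ₁ p] fun z => |z - largePt μ₁ p| ^ (((j : ℝ) - 1) / 2)) ∧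
        ((fun z => coproj ι * T' z * coproj ι - (z - largePt μ₁ p)⁻¹ • r i)
          =O[largeNhds μ₁ p] fun _ => (1 : ℝ))

/-- `A(ζ) = (T₁ + iT₂) - 2iT₃ζ + (T₁ - iT₂)ζ²`. -/
def laxA {n : ℕ} (t : Fin 4 → EndV n) (ζ : ℂ) : EndV n :=
  (t 1 + Complex.I • t 2) - (2 * Complex.I * ζ) • t 3 + ζ ^ 2 • (t 1 - Complex.I • t 2)

/-- The boundary condition at a jump point for `j = 0`: the `Tᵢ` have limits from both sides and
`A(ζ)₊ - A(ζ)₋ = (α₀ + α₁ζ)(ᾱ₁ - ᾱ₀ζ)ᵀ` for all `ζ`.  The fibres are identified by the unitary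
map `ι`. -/
def RankOneCondition {k j : ℕ} (μ₀ μ₁ : ℝ) (TL : Fin 4 → ℝ → EndV (k + j))
    (TS : Fin 4 → ℝ → EndV k) (p : Jump) (ι : V k →ₗᵢ[ℂ] V (k + j)) (α : Fin 2 → V k) : Prop :=
  ∃ tL tS : Fin 4 → EndV k,
    (∀ i, i ≠ 0 →
      Tendsto (fun z => proj ι ∘L TL i z ∘L ι.toContinuousLinearMap) (largeNhds μ₁ p)
        (𝓝 (tL i)) ∧
      Tendsto (TS i) (smallNhds μ₀ μ₁ p) (𝓝 (tS i))) ∧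
    ∀ (ζ : ℂ) (v : V k),
      jumpSign p • (laxA tS ζ v - laxA tL ζ v) =
        (inner ℂ (α 1) v - ζ * inner ℂ (α 0) v) • (α 0 + ζ • α 1)

/-- A solution of Nahm's equations on the circle `ℝ / μ₀ℤ` with the caloron boundary conditions
of charge `(k, j)`: skew-adjoint matrices `TL i` of size `k + j` on `(-μ₁, μ₁)` and `TS i` of size
`k` on `(μ₁, μ₀ - μ₁)`, and the isometric gluing maps `ι` at the two jump points.  The connection
`d/dz + T₀` is smooth up to the ends of each interval and continuous along the glued part.  The
vectors `α p 0, α p 1` describe the jump of the `Tᵢ` for `j = 0`; they play no role for `j > 0`. -/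
structure NahmSolution (k j : ℕ) (μ₀ μ₁ : ℝ) where
  TL : Fin 4 → ℝ → EndV (k + j)
  TS : Fin 4 → ℝ → EndV k
  ι : Jump → V k →ₗᵢ[ℂ] V (k + j)
  α : Jump → Fin 2 → V k
  skewL : ∀ i, ∀ z ∈ Ioo (-μ₁) μ₁, ContinuousLinearMap.adjoint (TL i z) = -TL i z
  skewS : ∀ i, ∀ z ∈ Ioo μ₁ (μ₀ - μ₁), ContinuousLinearMap.adjoint (TS i z) = -TS i z
  smoothL : ContDiffOn ℝ ∞ (TL 0) (Icc (-μ₁) μ₁)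
  smoothS : ContDiffOn ℝ ∞ (TS 0) (Icc μ₁ (μ₀ - μ₁))
  nahmL : IsNahm TL (Ioo (-μ₁) μ₁)
  nahmS : IsNahm TS (Ioo μ₁ (μ₀ - μ₁))
  glue : ∀ p, proj (ι p) ∘L TL 0 (largePt μ₁ p) ∘L (ι p).toContinuousLinearMap =
    TS 0 (smallPt μ₀ μ₁ p)
  polar : 0 < j → ∀ p, PolarCondition μ₀ μ₁ TL TS p (ι p)
  rankOne : j = 0 → ∀ p, RankOneCondition μ₀ μ₁ TL TS p (ι p) (α p)

/-! ### Functions on one interval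

A function on the open interval `(a, b)` is represented by its extension by zero to `ℝ`. -/

section Interval

variable {n : ℕ} (a b : ℝ)

/-- The derivative on `(a, b)`, extended by zero. -/
def dz (u : ℝ → V n) : ℝ → V n := (Ioo a b).indicator (deriv u)

/-- Local absolute continuity on `(a, b)` (i.e. being the continuous representative of a function
with locally integrable weak derivative): the derivative exists almost everywhere, is integrable on
compact subintervals, and `u` is its indefinite integral. -/
def LocAC (u : ℝ → V n) : Prop :=
  (∀ᵐ z ∂(volume.restrict (Ioo a b)), DifferentiableAt ℝ u z) ∧
  ∀ x ∈ Ioo a b, ∀ y ∈ Ioo a b,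
    IntervalIntegrable (deriv u) volume x y ∧ u y - u x = ∫ t in x..y, deriv u t

/-- Square integrability on `(a, b)`. -/
def IsL2 (u : ℝ → V n) : Prop := MemLp u 2 (volume.restrict (Ioo a b))

/-- `i (d_z + α - i y)` with `α = T₀ - iT₃`. -/
def nabla (T : Fin 4 → ℝ → EndV n) (y : ℂ) (u : ℝ → V n) (z : ℝ) : V n :=
  Complex.I • (dz a b u z + (T 0 z - Complex.I • T 3 z) (u z) - (Complex.I * y) • u z)

/-- The formal adjoint `i (d_z - α* - i ȳ)` of `i (d_z + α - i y)`. -/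
def nablaAdj (T : Fin 4 → ℝ → EndV n) (y : ℂ) (u : ℝ → V n) (z : ℝ) : V n :=
  Complex.I • (dz a b u z - ContinuousLinearMap.adjoint (T 0 z - Complex.I • T 3 z) (u z)
    - (Complex.I * (starRingEnd ℂ) y) • u z)

/-- `β - i w` with `β = T₁ + iT₂`. -/
def mult (T : Fin 4 → ℝ → EndV n) (w : ℂ) (u : ℝ → V n) (z : ℝ) : V n :=
  (T 1 z + Complex.I • T 2 z) (u z) - (Complex.I * w) • u z

/-- The adjoint `β* + i w̄` of `β - i w`. -/
def multAdj (T : Fin 4 → ℝ → EndV n) (w : ℂ) (u : ℝ → V n) (z : ℝ) : V n :=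
  ContinuousLinearMap.adjoint (T 1 z + Complex.I • T 2 z) (u z)
    + (Complex.I * (starRingEnd ℂ) w) • u z

end Interval

section IntervalLemmas

variable {n : ℕ} {a b : ℝ}

theorem dz_add_apply {u v : ℝ → V n} {z : ℝ} (hu : DifferentiableAt ℝ u z)
    (hv : DifferentiableAt ℝ v z) : dz a b (u + v) z = dz a b u z + dz a b v z := by
  unfold dz
  by_cases hz : z ∈ Ioo a b
  · simp only [indicator_of_mem hz]
    exact deriv_add hu hv
  · simp only [indicator_of_notMem hz, add_zero]

theorem dz_add {u v : ℝ → V n} (hu : ∀ z ∈ Ioo a b, DifferentiableAt ℝ u z)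
    (hv : ∀ z ∈ Ioo a b, DifferentiableAt ℝ v z) : dz a b (u + v) = dz a b u + dz a b v := by
  funext z
  by_cases hz : z ∈ Ioo a b
  · exact dz_add_apply (hu z hz) (hv z hz)
  · simp [dz, indicator_of_notMem hz]

theorem deriv_csmul (c : ℂ) (u : ℝ → V n) : deriv (c • u) = c • deriv u := by
  funext z
  exact deriv_const_smul_field c u

theorem dz_smul (c : ℂ) (u : ℝ → V n) : dz a b (c • u) = c • dz a b u := by
  unfold dz
  rw [deriv_csmul]
  exact indicator_const_smul _ c (deriv u)

theorem LocAC.zero : LocAC a b (0 : ℝ → V n) := by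
  have h : deriv (0 : ℝ → V n) = 0 := by
    funext z; exact deriv_const z (0 : V n)
  refine ⟨Eventually.of_forall fun z => differentiableAt_const (0 : V n), ?_⟩
  intro x _ y _
  rw [h]
  exact ⟨intervalIntegrable_const, by simp⟩

theorem ae_uIoc {P : ℝ → Prop} (h : ∀ᵐ z ∂(volume.restrict (Ioo a b)), P z) {x y : ℝ}
    (hx : x ∈ Ioo a b) (hy : y ∈ Ioo a b) : ∀ᵐ z ∂volume, z ∈ uIoc x y → P z := by
  rw [ae_restrict_iff' measurableSet_Ioo] at h
  filter_upwards [h] with z hz hzm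
  exact hz (ordConnected_Ioo.uIcc_subset hx hy (uIoc_subset_uIcc hzm))

theorem LocAC.add {u v : ℝ → V n} (hu : LocAC a b u) (hv : LocAC a b v) :
    LocAC a b (u + v) := by
  have hd : ∀ᵐ z ∂(volume.restrict (Ioo a b)), deriv (u + v) z = deriv u z + deriv v z := by
    filter_upwards [hu.1, hv.1] with z h1 h2
    exact deriv_add h1 h2
  refine ⟨by filter_upwards [hu.1, hv.1] with z h1 h2 using h1.add h2, ?_⟩
  intro x hx y hy
  have hd' := ae_uIoc hd hx hy
  obtain ⟨iu, eu⟩ := hu.2 x hx y hy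
  obtain ⟨iv, ev⟩ := hv.2 x hx y hy
  refine ⟨?_, ?_⟩
  · refine (iu.add iv).congr_ae ?_
    rw [EventuallyEq, ae_restrict_iff' measurableSet_uIoc]
    filter_upwards [hd'] with z hz hm
    exact (hz hm).symm
  · rw [intervalIntegral.integral_congr_ae hd', intervalIntegral.integral_add iu iv, ← eu, ← ev]
    simp only [Pi.add_apply]
    abel

theorem LocAC.smul (c : ℂ) {u : ℝ → V n} (hu : LocAC a b u) : LocAC a b (c • u) := by
  refine ⟨by filter_upwards [hu.1] with z h1 using h1.const_smul c, ?_⟩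
  intro x hx y hy
  obtain ⟨iu, eu⟩ := hu.2 x hx y hy
  rw [deriv_csmul]
  refine ⟨iu.smul c, ?_⟩
  simp only [Pi.smul_apply, intervalIntegral.integral_smul]
  rw [← eu, smul_sub]

theorem dz_add_ae {u v : ℝ → V n} (hu : LocAC a b u) (hv : LocAC a b v) :
    dz a b (u + v) =ᵐ[volume.restrict (Ioo a b)] dz a b u + dz a b v := by
  filter_upwards [hu.1, hv.1] with z h1 h2
  exact dz_add_apply h1 h2

theorem nabla_add_apply {T : Fin 4 → ℝ → EndV n} {y : ℂ} {u v : ℝ → V n} {z : ℝ}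
    (h : dz a b (u + v) z = dz a b u z + dz a b v z) :
    nabla a b T y (u + v) z = nabla a b T y u z + nabla a b T y v z := by
  simp only [nabla, h, Pi.add_apply, map_add, smul_add, smul_sub]
  abel

theorem nablaAdj_add_apply {T : Fin 4 → ℝ → EndV n} {y : ℂ} {u v : ℝ → V n} {z : ℝ}
    (h : dz a b (u + v) z = dz a b u z + dz a b v z) :
    nablaAdj a b T y (u + v) z = nablaAdj a b T y u z + nablaAdj a b T y v z := by
  simp only [nablaAdj, h, Pi.add_apply, map_add, smul_add, smul_sub]
  abel

theorem nabla_smul (T : Fin 4 → ℝ → EndV n) (y c : ℂ) (u : ℝ → V n) :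
    nabla a b T y (c • u) = c • nabla a b T y u := by
  funext z
  simp only [nabla, dz_smul, Pi.smul_apply, map_smul]
  module

theorem nablaAdj_smul (T : Fin 4 → ℝ → EndV n) (y c : ℂ) (u : ℝ → V n) :
    nablaAdj a b T y (c • u) = c • nablaAdj a b T y u := by
  funext z
  simp only [nablaAdj, dz_smul, Pi.smul_apply, map_smul]
  module

theorem mult_add (T : Fin 4 → ℝ → EndV n) (w : ℂ) (u v : ℝ → V n) :
    mult T w (u + v) = mult T w u + mult T w v := by
  funext z
  simp only [mult, Pi.add_apply, map_add, smul_add]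
  abel

theorem mult_smul (T : Fin 4 → ℝ → EndV n) (w c : ℂ) (u : ℝ → V n) :
    mult T w (c • u) = c • mult T w u := by
  funext z
  simp only [mult, Pi.smul_apply, map_smul]
  module

theorem multAdj_add (T : Fin 4 → ℝ → EndV n) (w : ℂ) (u v : ℝ → V n) :
    multAdj T w (u + v) = multAdj T w u + multAdj T w v := by
  funext z
  simp only [multAdj, Pi.add_apply, map_add, smul_add]
  abel

theorem multAdj_smul (T : Fin 4 → ℝ → EndV n) (w c : ℂ) (u : ℝ → V n) :
    multAdj T w (c • u) = c • multAdj T w u := by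
  funext z
  simp only [multAdj, Pi.smul_apply, map_smul]
  module

end IntervalLemmas

/-! ### Sections over the circle -/

/-- Sections of `K`: a function on the large interval and one on the small interval (each extended
by zero). -/
abbrev Sec (k j : ℕ) := (ℝ → V (k + j)) × (ℝ → V k)

/-- The space `L̃²` of square integrable sections of `K`. -/
abbrev L2Sec (k j : ℕ) (μ₀ μ₁ : ℝ) :=
  Lp (V (k + j)) 2 (volume.restrict (Ioo (-μ₁) μ₁)) ×
    Lp (V k) 2 (volume.restrict (Ioo μ₁ (μ₀ - μ₁)))

/-- The section is supported in the union of the two open intervals. -/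
def SuppOK {k j : ℕ} (μ₀ μ₁ : ℝ) (s : Sec k j) : Prop :=
  (∀ z ∉ Ioo (-μ₁) μ₁, s.1 z = 0) ∧ (∀ z ∉ Ioo μ₁ (μ₀ - μ₁), s.2 z = 0)

/-- The section is locally absolutely continuous on each interval. -/
def SecAC {k j : ℕ} (μ₀ μ₁ : ℝ) (s : Sec k j) : Prop :=
  LocAC (-μ₁) μ₁ s.1 ∧ LocAC μ₁ (μ₀ - μ₁) s.2

/-- The section is square integrable. -/
def SecL2 {k j : ℕ} (μ₀ μ₁ : ℝ) (s : Sec k j) : Prop :=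
  IsL2 (-μ₁) μ₁ s.1 ∧ IsL2 μ₁ (μ₀ - μ₁) s.2

/-- The section is differentiable at every point of each open interval. -/
def SecDiff {k j : ℕ} (μ₀ μ₁ : ℝ) (s : Sec k j) : Prop :=
  (∀ z ∈ Ioo (-μ₁) μ₁, DifferentiableAt ℝ s.1 z) ∧
  (∀ z ∈ Ioo μ₁ (μ₀ - μ₁), DifferentiableAt ℝ s.2 z)

/-- The derivative `d_z s` on the two intervals. -/
def secDz {k j : ℕ} (μ₀ μ₁ : ℝ) (s : Sec k j) : Sec k j :=
  (dz (-μ₁) μ₁ s.1, dz μ₁ (μ₀ - μ₁) s.2)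

/-- Almost everywhere equality of sections. -/
def SecAEEq {k j : ℕ} (μ₀ μ₁ : ℝ) (s t : Sec k j) : Prop :=
  s.1 =ᵐ[volume.restrict (Ioo (-μ₁) μ₁)] t.1 ∧ s.2 =ᵐ[volume.restrict (Ioo μ₁ (μ₀ - μ₁))] t.2

section SecLemmas

variable {k j : ℕ} {μ₀ μ₁ : ℝ} {s t : Sec k j}

theorem SuppOK.zero : SuppOK μ₀ μ₁ (0 : Sec k j) := ⟨fun _ _ => rfl, fun _ _ => rfl⟩

theorem SuppOK.add (hs : SuppOK μ₀ μ₁ s) (ht : SuppOK μ₀ μ₁ t) : SuppOK μ₀ μ₁ (s + t) :=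
  ⟨fun z hz => by simp [hs.1 z hz, ht.1 z hz], fun z hz => by simp [hs.2 z hz, ht.2 z hz]⟩

theorem SuppOK.smul (c : ℂ) (hs : SuppOK μ₀ μ₁ s) : SuppOK μ₀ μ₁ (c • s) :=
  ⟨fun z hz => by simp [hs.1 z hz], fun z hz => by simp [hs.2 z hz]⟩

theorem SecAC.zero : SecAC μ₀ μ₁ (0 : Sec k j) := ⟨LocAC.zero, LocAC.zero⟩

theorem SecAC.add (hs : SecAC μ₀ μ₁ s) (ht : SecAC μ₀ μ₁ t) : SecAC μ₀ μ₁ (s + t) :=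
  ⟨hs.1.add ht.1, hs.2.add ht.2⟩

theorem SecAC.smul (c : ℂ) (hs : SecAC μ₀ μ₁ s) : SecAC μ₀ μ₁ (c • s) :=
  ⟨hs.1.smul c, hs.2.smul c⟩

theorem SecL2.zero : SecL2 μ₀ μ₁ (0 : Sec k j) := ⟨MemLp.zero, MemLp.zero⟩

theorem SecL2.add (hs : SecL2 μ₀ μ₁ s) (ht : SecL2 μ₀ μ₁ t) : SecL2 μ₀ μ₁ (s + t) :=
  ⟨MemLp.add hs.1 ht.1, MemLp.add hs.2 ht.2⟩

theorem SecL2.smul (c : ℂ) (hs : SecL2 μ₀ μ₁ s) : SecL2 μ₀ μ₁ (c • s) :=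
  ⟨MemLp.const_smul hs.1 c, MemLp.const_smul hs.2 c⟩

theorem SecL2.congr (h : SecAEEq μ₀ μ₁ s t) (ht : SecL2 μ₀ μ₁ t) : SecL2 μ₀ μ₁ s :=
  ⟨(memLp_congr_ae h.1).2 ht.1, (memLp_congr_ae h.2).2 ht.2⟩

theorem SecDiff.zero : SecDiff μ₀ μ₁ (0 : Sec k j) :=
  ⟨fun _ _ => differentiableAt_const (0 : V (k + j)), fun _ _ => differentiableAt_const (0 : V k)⟩

theorem SecDiff.add (hs : SecDiff μ₀ μ₁ s) (ht : SecDiff μ₀ μ₁ t) : SecDiff μ₀ μ₁ (s + t) :=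
  ⟨fun z hz => (hs.1 z hz).add (ht.1 z hz), fun z hz => (hs.2 z hz).add (ht.2 z hz)⟩

theorem SecDiff.smul (c : ℂ) (hs : SecDiff μ₀ μ₁ s) : SecDiff μ₀ μ₁ (c • s) :=
  ⟨fun z hz => (hs.1 z hz).const_smul c, fun z hz => (hs.2 z hz).const_smul c⟩

theorem secDz_smul (c : ℂ) (s : Sec k j) : secDz μ₀ μ₁ (c • s) = c • secDz μ₀ μ₁ s :=
  Prod.ext (dz_smul c s.1) (dz_smul c s.2)

theorem secDz_zero : secDz μ₀ μ₁ (0 : Sec k j) = 0 := by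
  have h := secDz_smul (μ₀ := μ₀) (μ₁ := μ₁) 0 (0 : Sec k j)
  simpa only [zero_smul] using h

theorem secDz_add (hs : SecDiff μ₀ μ₁ s) (ht : SecDiff μ₀ μ₁ t) :
    secDz μ₀ μ₁ (s + t) = secDz μ₀ μ₁ s + secDz μ₀ μ₁ t :=
  Prod.ext (dz_add hs.1 ht.1) (dz_add hs.2 ht.2)

theorem secDz_add_ae (hs : SecAC μ₀ μ₁ s) (ht : SecAC μ₀ μ₁ t) :
    SecAEEq μ₀ μ₁ (secDz μ₀ μ₁ (s + t)) (secDz μ₀ μ₁ s + secDz μ₀ μ₁ t) :=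
  ⟨dz_add_ae hs.1 ht.1, dz_add_ae hs.2 ht.2⟩

/-- The element of `L̃²` given by a square integrable section. -/
def toL2 (s : Sec k j) (hs : SecL2 μ₀ μ₁ s) : L2Sec k j μ₀ μ₁ :=
  (MemLp.toLp s.1 hs.1, MemLp.toLp s.2 hs.2)

theorem toL2_add {r : Sec k j} (hs : SecL2 μ₀ μ₁ s) (ht : SecL2 μ₀ μ₁ t) (hr : SecL2 μ₀ μ₁ r)
    (h : SecAEEq μ₀ μ₁ r (s + t)) : toL2 r hr = toL2 s hs + toL2 t ht := by
  refine Prod.ext ?_ ?_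
  · change MemLp.toLp r.1 hr.1 = MemLp.toLp s.1 hs.1 + MemLp.toLp t.1 ht.1
    rw [← MemLp.toLp_add hs.1 ht.1]
    exact MemLp.toLp_congr _ _ h.1
  · change MemLp.toLp r.2 hr.2 = MemLp.toLp s.2 hs.2 + MemLp.toLp t.2 ht.2
    rw [← MemLp.toLp_add hs.2 ht.2]
    exact MemLp.toLp_congr _ _ h.2

theorem toL2_smul (c : ℂ) {r : Sec k j} (hs : SecL2 μ₀ μ₁ s) (hr : SecL2 μ₀ μ₁ r)
    (h : r = c • s) : toL2 r hr = c • toL2 s hs := by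
  subst h
  refine Prod.ext ?_ ?_
  · exact MemLp.toLp_const_smul c hs.1
  · exact MemLp.toLp_const_smul c hs.2

end SecLemmas

namespace NahmSolution

variable {k j : ℕ} {μ₀ μ₁ : ℝ} (N : NahmSolution k j μ₀ μ₁) (x : Fin 4 → ℝ)

/-- `y = μ₀x₀ - ix₃`. -/
def yy (_ : NahmSolution k j μ₀ μ₁) (x : Fin 4 → ℝ) : ℂ := (μ₀ * x 0 : ℝ) - Complex.I * (x 3 : ℝ)

/-- `w = x₁ + ix₂`. -/
def ww (_ : NahmSolution k j μ₀ μ₁) (x : Fin 4 → ℝ) : ℂ := (x 1 : ℝ) + Complex.I * (x 2 : ℝ)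

/-- The differential expression `D₁ s = (i(d_z + α - iy) s, (-β + iw) s)`. -/
def D1val (s : Sec k j) : Sec k j × Sec k j :=
  ((nabla (-μ₁) μ₁ N.TL (N.yy x) s.1, nabla μ₁ (μ₀ - μ₁) N.TS (N.yy x) s.2),
   (-mult N.TL (N.ww x) s.1, -mult N.TS (N.ww x) s.2))

/-- The differential expression `D₂ (s₁, s₂) = (β - iw) s₁ + i(d_z + α - iy) s₂`. -/
def D2val (u : Sec k j × Sec k j) : Sec k j :=
  (mult N.TL (N.ww x) u.1.1 + nabla (-μ₁) μ₁ N.TL (N.yy x) u.2.1,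
   mult N.TS (N.ww x) u.1.2 + nabla μ₁ (μ₀ - μ₁) N.TS (N.yy x) u.2.2)

/-- The formal adjoint `D₁* (s₁, s₂) = i(d_z - α* - iȳ) s₁ - (β* + iw̄) s₂` of `D₁`. -/
def D1adjVal (u : Sec k j × Sec k j) : Sec k j :=
  (nablaAdj (-μ₁) μ₁ N.TL (N.yy x) u.1.1 - multAdj N.TL (N.ww x) u.2.1,
   nablaAdj μ₁ (μ₀ - μ₁) N.TS (N.yy x) u.1.2 - multAdj N.TS (N.ww x) u.2.2)

/-- The vector `v = (iα₁, -α₀)` of allowed jumps for `j = 0`; no jump is allowed for `j > 0`. -/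
def jumpVec (p : Jump) : V k × V k :=
  if j = 0 then (Complex.I • N.α p 1, -N.α p 0) else 0

/-- `½(α₁ᾱ₁ᵀ + α₀ᾱ₀ᵀ) ℓ` for `j = 0`, and zero for `j > 0`. -/
def jumpOp (p : Jump) (ℓ : V k) : V k :=
  if j = 0 then
    (1 / 2 : ℂ) • ((inner ℂ (N.α p 1) ℓ : ℂ) • N.α p 1 + (inner ℂ (N.α p 0) ℓ : ℂ) • N.α p 0)
  else 0

/-- The condition at a jump point on elements of `(L̃²₁)^{⊕2}`: the limits exist and
`Δ(s₁, s₂) = c v` for a scalar `c`, the large side being projected by `π`.  For `j > 0` this says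
`π(s_large) = s_small`. -/
def JumpCond1 (u : Sec k j × Sec k j) (p : Jump) : Prop :=
  ∃ (a b : V k × V k) (c : ℂ),
    Tendsto (fun z => proj (N.ι p) (u.1.1 z)) (largeNhds μ₁ p) (𝓝 a.1) ∧
    Tendsto (fun z => proj (N.ι p) (u.2.1 z)) (largeNhds μ₁ p) (𝓝 a.2) ∧
    Tendsto u.1.2 (smallNhds μ₀ μ₁ p) (𝓝 b.1) ∧
    Tendsto u.2.2 (smallNhds μ₀ μ₁ p) (𝓝 b.2) ∧
    jumpSign p • (b - a) = c • N.jumpVec p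

/-- The condition at a jump point on elements of `L̃²₂`: `s_large = ι(s_small)`, and
`Δ(d_z s) = ½(α₁ᾱ₁ᵀ + α₀ᾱ₀ᵀ) s` for `j = 0`, `π(d_z s_large) = d_z s_small` for `j > 0`. -/
def JumpCond2 (s : Sec k j) (p : Jump) : Prop :=
  ∃ ℓ a b : V k,
    Tendsto s.1 (largeNhds μ₁ p) (𝓝 (N.ι p ℓ)) ∧
    Tendsto s.2 (smallNhds μ₀ μ₁ p) (𝓝 ℓ) ∧
    Tendsto (fun z => proj (N.ι p) ((secDz μ₀ μ₁ s).1 z)) (largeNhds μ₁ p) (𝓝 a) ∧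
    Tendsto (secDz μ₀ μ₁ s).2 (smallNhds μ₀ μ₁ p) (𝓝 b) ∧
    jumpSign p • (b - a) = N.jumpOp p ℓ

/-- Membership in `(L̃²₁)^{⊕2}`: `L²₁` on each interval (for `j = 2`, where harmonic spinors behave
like `|ẑ|^{1/2}`, the graph norm of the Dirac operator `(D₂, D₁*)` replaces the `L²₁` norm), with
the jump conditions, in the natural domain of `D₂`. -/
structure MemE1 (u : Sec k j × Sec k j) : Prop where
  supp₁ : SuppOK μ₀ μ₁ u.1
  supp₂ : SuppOK μ₀ μ₁ u.2
  ac₁ : SecAC μ₀ μ₁ u.1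
  ac₂ : SecAC μ₀ μ₁ u.2
  l2₁ : SecL2 μ₀ μ₁ u.1
  l2₂ : SecL2 μ₀ μ₁ u.2
  sobolev : j ≠ 2 → SecL2 μ₀ μ₁ (secDz μ₀ μ₁ u.1) ∧ SecL2 μ₀ μ₁ (secDz μ₀ μ₁ u.2)
  graph : j = 2 → SecL2 μ₀ μ₁ (N.D1adjVal x u)
  dom : SecL2 μ₀ μ₁ (N.D2val x u)
  jump : ∀ p, N.JumpCond1 u p

/-- Membership in `L̃²₂`: `L²₂` on each interval (for `j = 2` the graph norm is used, see
`MemE1`), with the jump conditions, in the natural domain of `D₁`. -/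
structure MemE0 (s : Sec k j) : Prop where
  supp : SuppOK μ₀ μ₁ s
  diff : SecDiff μ₀ μ₁ s
  ac : SecAC μ₀ μ₁ (secDz μ₀ μ₁ s)
  l2 : SecL2 μ₀ μ₁ s
  sobolev : j ≠ 2 →
    SecL2 μ₀ μ₁ (secDz μ₀ μ₁ s) ∧ SecL2 μ₀ μ₁ (secDz μ₀ μ₁ (secDz μ₀ μ₁ s))
  jump : ∀ p, N.JumpCond2 s p
  dom : N.MemE1 x (N.D1val x s)

/-- An `L²` solution of the Dirac equation `D₂ u = 0 = D₁* u`, with the jump conditions. -/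
structure MemHarmonic (u : Sec k j × Sec k j) : Prop where
  supp₁ : SuppOK μ₀ μ₁ u.1
  supp₂ : SuppOK μ₀ μ₁ u.2
  ac₁ : SecAC μ₀ μ₁ u.1
  ac₂ : SecAC μ₀ μ₁ u.2
  l2₁ : SecL2 μ₀ μ₁ u.1
  l2₂ : SecL2 μ₀ μ₁ u.2
  d2 : SecAEEq μ₀ μ₁ (N.D2val x u) 0
  d1adj : SecAEEq μ₀ μ₁ (N.D1adjVal x u) 0
  jump : ∀ p, N.JumpCond1 u p

section Linearity

variable {N x}

theorem D1val_smul (c : ℂ) (s : Sec k j) : N.D1val x (c • s) = c • N.D1val x s := by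
  refine Prod.ext (Prod.ext ?_ ?_) (Prod.ext ?_ ?_)
  · exact nabla_smul _ _ c s.1
  · exact nabla_smul _ _ c s.2
  · exact (congrArg Neg.neg (mult_smul _ _ c s.1)).trans (smul_neg _ _).symm
  · exact (congrArg Neg.neg (mult_smul _ _ c s.2)).trans (smul_neg _ _).symm

theorem D1val_zero : N.D1val x 0 = 0 := by
  have h := D1val_smul (N := N) (x := x) 0 0
  simpa only [zero_smul] using h

theorem D1val_add {s t : Sec k j} (hs : SecDiff μ₀ μ₁ s) (ht : SecDiff μ₀ μ₁ t) :
    N.D1val x (s + t) = N.D1val x s + N.D1val x t := by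
  refine Prod.ext (Prod.ext ?_ ?_) (Prod.ext ?_ ?_)
  · exact funext fun z => nabla_add_apply (congrFun (dz_add hs.1 ht.1) z)
  · exact funext fun z => nabla_add_apply (congrFun (dz_add hs.2 ht.2) z)
  · exact (congrArg Neg.neg (mult_add _ _ s.1 t.1)).trans (neg_add _ _)
  · exact (congrArg Neg.neg (mult_add _ _ s.2 t.2)).trans (neg_add _ _)

theorem D2val_smul (c : ℂ) (u : Sec k j × Sec k j) : N.D2val x (c • u) = c • N.D2val x u := by
  refine Prod.ext ?_ ?_
  · exact (congrArg₂ (· + ·) (mult_smul _ _ c u.1.1) (nabla_smul _ _ c u.2.1)).trans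
      (smul_add _ _ _).symm
  · exact (congrArg₂ (· + ·) (mult_smul _ _ c u.1.2) (nabla_smul _ _ c u.2.2)).trans
      (smul_add _ _ _).symm

theorem D1adjVal_smul (c : ℂ) (u : Sec k j × Sec k j) :
    N.D1adjVal x (c • u) = c • N.D1adjVal x u := by
  refine Prod.ext ?_ ?_
  · exact (congrArg₂ (· - ·) (nablaAdj_smul _ _ c u.1.1) (multAdj_smul _ _ c u.2.1)).trans
      (smul_sub _ _ _).symm
  · exact (congrArg₂ (· - ·) (nablaAdj_smul _ _ c u.1.2) (multAdj_smul _ _ c u.2.2)).trans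
      (smul_sub _ _ _).symm

theorem D2val_zero : N.D2val x 0 = 0 := by
  have h := D2val_smul (N := N) (x := x) 0 0
  simpa only [zero_smul] using h

theorem D1adjVal_zero : N.D1adjVal x 0 = 0 := by
  have h := D1adjVal_smul (N := N) (x := x) 0 0
  simpa only [zero_smul] using h

theorem D2val_add {u v : Sec k j × Sec k j} (hu : SecAC μ₀ μ₁ u.2) (hv : SecAC μ₀ μ₁ v.2) :
    SecAEEq μ₀ μ₁ (N.D2val x (u + v)) (N.D2val x u + N.D2val x v) := by
  constructor
  · filter_upwards [dz_add_ae hu.1 hv.1] with z hz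
    have h1 := congrFun (mult_add N.TL (N.ww x) u.1.1 v.1.1) z
    have h2 := nabla_add_apply (T := N.TL) (y := N.yy x) hz
    calc _ = mult N.TL (N.ww x) (u.1.1 + v.1.1) z
              + nabla (-μ₁) μ₁ N.TL (N.yy x) (u.2.1 + v.2.1) z := rfl
      _ = _ := by rw [h1, h2]; exact add_add_add_comm _ _ _ _
  · filter_upwards [dz_add_ae hu.2 hv.2] with z hz
    have h1 := congrFun (mult_add N.TS (N.ww x) u.1.2 v.1.2) z
    have h2 := nabla_add_apply (T := N.TS) (y := N.yy x) hz
    calc _ = mult N.TS (N.ww x) (u.1.2 + v.1.2) z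
              + nabla μ₁ (μ₀ - μ₁) N.TS (N.yy x) (u.2.2 + v.2.2) z := rfl
      _ = _ := by rw [h1, h2]; exact add_add_add_comm _ _ _ _

theorem D1adjVal_add {u v : Sec k j × Sec k j} (hu : SecAC μ₀ μ₁ u.1) (hv : SecAC μ₀ μ₁ v.1) :
    SecAEEq μ₀ μ₁ (N.D1adjVal x (u + v)) (N.D1adjVal x u + N.D1adjVal x v) := by
  constructor
  · filter_upwards [dz_add_ae hu.1 hv.1] with z hz
    have h1 := congrFun (multAdj_add N.TL (N.ww x) u.2.1 v.2.1) z
    have h2 := nablaAdj_add_apply (T := N.TL) (y := N.yy x) hz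
    calc _ = nablaAdj (-μ₁) μ₁ N.TL (N.yy x) (u.1.1 + v.1.1) z
              - multAdj N.TL (N.ww x) (u.2.1 + v.2.1) z := rfl
      _ = _ := by rw [h1, h2]; exact add_sub_add_comm _ _ _ _
  · filter_upwards [dz_add_ae hu.2 hv.2] with z hz
    have h1 := congrFun (multAdj_add N.TS (N.ww x) u.2.2 v.2.2) z
    have h2 := nablaAdj_add_apply (T := N.TS) (y := N.yy x) hz
    calc _ = nablaAdj μ₁ (μ₀ - μ₁) N.TS (N.yy x) (u.1.2 + v.1.2) z
              - multAdj N.TS (N.ww x) (u.2.2 + v.2.2) z := rfl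
      _ = _ := by rw [h1, h2]; exact add_sub_add_comm _ _ _ _

theorem JumpCond1.zero (p : Jump) : N.JumpCond1 0 p := by
  refine ⟨0, 0, 0, ?_, ?_, ?_, ?_, by simp⟩
  · simpa using (tendsto_const_nhds : Tendsto (fun _ : ℝ => (0 : V k)) (largeNhds μ₁ p) (𝓝 0))
  · simpa using (tendsto_const_nhds : Tendsto (fun _ : ℝ => (0 : V k)) (largeNhds μ₁ p) (𝓝 0))
  · exact (tendsto_const_nhds : Tendsto (fun _ : ℝ => (0 : V k)) (smallNhds μ₀ μ₁ p) (𝓝 0))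
  · exact (tendsto_const_nhds : Tendsto (fun _ : ℝ => (0 : V k)) (smallNhds μ₀ μ₁ p) (𝓝 0))

theorem JumpCond1.add {u v : Sec k j × Sec k j} {p : Jump} (hu : N.JumpCond1 u p)
    (hv : N.JumpCond1 v p) : N.JumpCond1 (u + v) p := by
  obtain ⟨a, b, c, h1, h2, h3, h4, h5⟩ := hu
  obtain ⟨a', b', c', h1', h2', h3', h4', h5'⟩ := hv
  refine ⟨a + a', b + b', c + c', ?_, ?_, h3.add h3', h4.add h4', ?_⟩
  · simpa using h1.add h1'
  · simpa using h2.add h2'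
  · rw [add_smul, ← h5, ← h5']
    module

theorem JumpCond1.smul (d : ℂ) {u : Sec k j × Sec k j} {p : Jump} (hu : N.JumpCond1 u p) :
    N.JumpCond1 (d • u) p := by
  obtain ⟨a, b, c, h1, h2, h3, h4, h5⟩ := hu
  refine ⟨d • a, d • b, d * c, ?_, ?_, h3.const_smul d, h4.const_smul d, ?_⟩
  · simpa using h1.const_smul d
  · simpa using h2.const_smul d
  · rw [mul_smul, ← h5]
    module

theorem jumpOp_add (p : Jump) (ℓ ℓ' : V k) :
    N.jumpOp p (ℓ + ℓ') = N.jumpOp p ℓ + N.jumpOp p ℓ' := by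
  unfold jumpOp
  split_ifs
  · simp only [inner_add_right]
    module
  · simp

theorem jumpOp_smul (p : Jump) (d : ℂ) (ℓ : V k) :
    N.jumpOp p (d • ℓ) = d • N.jumpOp p ℓ := by
  unfold jumpOp
  split_ifs
  · simp only [inner_smul_right]
    module
  · simp

theorem JumpCond2.zero (p : Jump) : N.JumpCond2 0 p := by
  refine ⟨0, 0, 0, ?_, ?_, ?_, ?_, ?_⟩
  · rw [map_zero]
    exact (tendsto_const_nhds : Tendsto (fun _ : ℝ => (0 : V (k + j))) (largeNhds μ₁ p) (𝓝 0))
  · exact (tendsto_const_nhds : Tendsto (fun _ : ℝ => (0 : V k)) (smallNhds μ₀ μ₁ p) (𝓝 0))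
  · rw [secDz_zero]
    simpa using (tendsto_const_nhds : Tendsto (fun _ : ℝ => (0 : V k)) (largeNhds μ₁ p) (𝓝 0))
  · rw [secDz_zero]
    exact (tendsto_const_nhds : Tendsto (fun _ : ℝ => (0 : V k)) (smallNhds μ₀ μ₁ p) (𝓝 0))
  · have h := jumpOp_smul (N := N) p 0 0
    rw [zero_smul, zero_smul] at h
    rw [h]
    simp

theorem JumpCond2.add {s t : Sec k j} {p : Jump} (ds : SecDiff μ₀ μ₁ s) (dt : SecDiff μ₀ μ₁ t)
    (hs : N.JumpCond2 s p) (ht : N.JumpCond2 t p) : N.JumpCond2 (s + t) p := by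
  obtain ⟨l, a, b, h1, h2, h3, h4, h5⟩ := hs
  obtain ⟨l', a', b', h1', h2', h3', h4', h5'⟩ := ht
  refine ⟨l + l', a + a', b + b', ?_, h2.add h2', ?_, ?_, ?_⟩
  · rw [map_add]
    exact h1.add h1'
  · rw [secDz_add ds dt]
    simpa using h3.add h3'
  · rw [secDz_add ds dt]
    exact h4.add h4'
  · rw [jumpOp_add, ← h5, ← h5']
    module

theorem JumpCond2.smul (d : ℂ) {s : Sec k j} {p : Jump} (hs : N.JumpCond2 s p) :
    N.JumpCond2 (d • s) p := by
  obtain ⟨l, a, b, h1, h2, h3, h4, h5⟩ := hs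
  refine ⟨d • l, d • a, d • b, ?_, h2.const_smul d, ?_, ?_, ?_⟩
  · rw [map_smul]
    exact h1.const_smul d
  · rw [secDz_smul]
    simpa using h3.const_smul d
  · rw [secDz_smul]
    exact h4.const_smul d
  · rw [jumpOp_smul, ← h5]
    module

theorem MemE1.zero : N.MemE1 x 0 where
  supp₁ := SuppOK.zero
  supp₂ := SuppOK.zero
  ac₁ := SecAC.zero
  ac₂ := SecAC.zero
  l2₁ := SecL2.zero
  l2₂ := SecL2.zero
  sobolev _ := by
    constructor
    · exact secDz_zero (k := k) (j := j) (μ₀ := μ₀) (μ₁ := μ₁) ▸ SecL2.zero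
    · exact secDz_zero (k := k) (j := j) (μ₀ := μ₀) (μ₁ := μ₁) ▸ SecL2.zero
  graph _ := by rw [D1adjVal_zero]; exact SecL2.zero
  dom := by rw [D2val_zero]; exact SecL2.zero
  jump := JumpCond1.zero

theorem MemE1.add {u v : Sec k j × Sec k j} (hu : N.MemE1 x u) (hv : N.MemE1 x v) :
    N.MemE1 x (u + v) where
  supp₁ := hu.supp₁.add hv.supp₁
  supp₂ := hu.supp₂.add hv.supp₂
  ac₁ := hu.ac₁.add hv.ac₁
  ac₂ := hu.ac₂.add hv.ac₂
  l2₁ := hu.l2₁.add hv.l2₁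
  l2₂ := hu.l2₂.add hv.l2₂
  sobolev hj :=
    ⟨((hu.sobolev hj).1.add (hv.sobolev hj).1).congr (secDz_add_ae hu.ac₁ hv.ac₁),
      ((hu.sobolev hj).2.add (hv.sobolev hj).2).congr (secDz_add_ae hu.ac₂ hv.ac₂)⟩
  graph hj := ((hu.graph hj).add (hv.graph hj)).congr (D1adjVal_add hu.ac₁ hv.ac₁)
  dom := (hu.dom.add hv.dom).congr (D2val_add hu.ac₂ hv.ac₂)
  jump p := (hu.jump p).add (hv.jump p)

theorem MemE1.smul (c : ℂ) {u : Sec k j × Sec k j} (hu : N.MemE1 x u) : N.MemE1 x (c • u) where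
  supp₁ := hu.supp₁.smul c
  supp₂ := hu.supp₂.smul c
  ac₁ := hu.ac₁.smul c
  ac₂ := hu.ac₂.smul c
  l2₁ := hu.l2₁.smul c
  l2₂ := hu.l2₂.smul c
  sobolev hj := by
    constructor
    · exact (secDz_smul (μ₀ := μ₀) (μ₁ := μ₁) c u.1) ▸ (hu.sobolev hj).1.smul c
    · exact (secDz_smul (μ₀ := μ₀) (μ₁ := μ₁) c u.2) ▸ (hu.sobolev hj).2.smul c
  graph hj := by rw [D1adjVal_smul]; exact (hu.graph hj).smul c
  dom := by rw [D2val_smul]; exact hu.dom.smul c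
  jump p := (hu.jump p).smul c

theorem MemE0.zero : N.MemE0 x 0 where
  supp := SuppOK.zero
  diff := SecDiff.zero
  ac := by rw [secDz_zero]; exact SecAC.zero
  l2 := SecL2.zero
  sobolev _ := by rw [secDz_zero, secDz_zero]; exact ⟨SecL2.zero, SecL2.zero⟩
  jump := JumpCond2.zero
  dom := by rw [D1val_zero]; exact MemE1.zero

theorem MemE0.add {s t : Sec k j} (hs : N.MemE0 x s) (ht : N.MemE0 x t) :
    N.MemE0 x (s + t) where
  supp := hs.supp.add ht.supp
  diff := hs.diff.add ht.diff
  ac := by rw [secDz_add hs.diff ht.diff]; exact hs.ac.add ht.ac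
  l2 := hs.l2.add ht.l2
  sobolev hj := by
    rw [secDz_add hs.diff ht.diff]
    exact ⟨(hs.sobolev hj).1.add (ht.sobolev hj).1,
      ((hs.sobolev hj).2.add (ht.sobolev hj).2).congr (secDz_add_ae hs.ac ht.ac)⟩
  jump p := (hs.jump p).add hs.diff ht.diff (ht.jump p)
  dom := by rw [D1val_add hs.diff ht.diff]; exact hs.dom.add ht.dom

theorem MemE0.smul (c : ℂ) {s : Sec k j} (hs : N.MemE0 x s) : N.MemE0 x (c • s) where
  supp := hs.supp.smul c
  diff := hs.diff.smul c
  ac := by rw [secDz_smul]; exact hs.ac.smul c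
  l2 := hs.l2.smul c
  sobolev hj := by
    rw [secDz_smul, secDz_smul]
    exact ⟨(hs.sobolev hj).1.smul c, (hs.sobolev hj).2.smul c⟩
  jump p := (hs.jump p).smul c
  dom := by rw [D1val_smul]; exact hs.dom.smul c

theorem SecAEEq.add_zero' {s t r : Sec k j} (h : SecAEEq μ₀ μ₁ r (s + t)) (hs : SecAEEq μ₀ μ₁ s 0)
    (ht : SecAEEq μ₀ μ₁ t 0) : SecAEEq μ₀ μ₁ r 0 := by
  constructor
  · filter_upwards [h.1, hs.1, ht.1] with z h1 h2 h3
    simpa [h2, h3] using h1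
  · filter_upwards [h.2, hs.2, ht.2] with z h1 h2 h3
    simpa [h2, h3] using h1

theorem SecAEEq.smul_zero' (c : ℂ) {s : Sec k j} (hs : SecAEEq μ₀ μ₁ s 0) :
    SecAEEq μ₀ μ₁ (c • s) 0 := by
  constructor
  · filter_upwards [hs.1] with z h2
    simp [h2]
  · filter_upwards [hs.2] with z h2
    simp [h2]

theorem MemHarmonic.zero : N.MemHarmonic x 0 where
  supp₁ := SuppOK.zero
  supp₂ := SuppOK.zero
  ac₁ := SecAC.zero
  ac₂ := SecAC.zero
  l2₁ := SecL2.zero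
  l2₂ := SecL2.zero
  d2 := by rw [D2val_zero]; exact ⟨EventuallyEq.rfl, EventuallyEq.rfl⟩
  d1adj := by rw [D1adjVal_zero]; exact ⟨EventuallyEq.rfl, EventuallyEq.rfl⟩
  jump := JumpCond1.zero

theorem MemHarmonic.add {u v : Sec k j × Sec k j} (hu : N.MemHarmonic x u)
    (hv : N.MemHarmonic x v) : N.MemHarmonic x (u + v) where
  supp₁ := hu.supp₁.add hv.supp₁
  supp₂ := hu.supp₂.add hv.supp₂
  ac₁ := hu.ac₁.add hv.ac₁
  ac₂ := hu.ac₂.add hv.ac₂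
  l2₁ := hu.l2₁.add hv.l2₁
  l2₂ := hu.l2₂.add hv.l2₂
  d2 := SecAEEq.add_zero' (D2val_add hu.ac₂ hv.ac₂) hu.d2 hv.d2
  d1adj := SecAEEq.add_zero' (D1adjVal_add hu.ac₁ hv.ac₁) hu.d1adj hv.d1adj
  jump p := (hu.jump p).add (hv.jump p)

theorem MemHarmonic.smul (c : ℂ) {u : Sec k j × Sec k j} (hu : N.MemHarmonic x u) :
    N.MemHarmonic x (c • u) where
  supp₁ := hu.supp₁.smul c
  supp₂ := hu.supp₂.smul c
  ac₁ := hu.ac₁.smul c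
  ac₂ := hu.ac₂.smul c
  l2₁ := hu.l2₁.smul c
  l2₂ := hu.l2₂.smul c
  d2 := by rw [D2val_smul]; exact SecAEEq.smul_zero' c hu.d2
  d1adj := by rw [D1adjVal_smul]; exact SecAEEq.smul_zero' c hu.d1adj
  jump p := (hu.jump p).smul c

end Linearity

/-- The space `L̃²₂`. -/
def E0 : Submodule ℂ (Sec k j) where
  carrier := {s | N.MemE0 x s}
  zero_mem' := MemE0.zero
  add_mem' := MemE0.add
  smul_mem' c _ hs := MemE0.smul c hs

/-- The space `(L̃²₁)^{⊕2}`. -/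
def E1 : Submodule ℂ (Sec k j × Sec k j) where
  carrier := {u | N.MemE1 x u}
  zero_mem' := MemE1.zero
  add_mem' := MemE1.add
  smul_mem' c _ hu := MemE1.smul c hu

/-- The space of `L²` solutions of the Dirac equation `D₂ u = 0 = D₁* u`. -/
def harmonic : Submodule ℂ (Sec k j × Sec k j) where
  carrier := {u | N.MemHarmonic x u}
  zero_mem' := MemHarmonic.zero
  add_mem' := MemHarmonic.add
  smul_mem' c _ hu := MemHarmonic.smul c hu

/-- The operator `D₁ : L̃²₂ → (L̃²₁)^{⊕2}`. -/
def D1 : N.E0 x →ₗ[ℂ] N.E1 x where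
  toFun s := ⟨N.D1val x s.1, s.2.dom⟩
  map_add' s t := Subtype.ext (D1val_add s.2.diff t.2.diff)
  map_smul' c s := Subtype.ext (D1val_smul c s.1)

/-- The operator `D₂ : (L̃²₁)^{⊕2} → L̃²`. -/
def D2 : N.E1 x →ₗ[ℂ] L2Sec k j μ₀ μ₁ where
  toFun u := toL2 (N.D2val x u.1) u.2.dom
  map_add' u v := toL2_add u.2.dom v.2.dom (MemE1.add u.2 v.2).dom
    (D2val_add (N := N) (x := x) u.2.ac₂ v.2.ac₂)
  map_smul' c u := toL2_smul c u.2.dom (MemE1.smul c u.2).dom (D2val_smul c u.1)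

/-- The cocycles `ker D₂`, as a subspace of the space of pairs of sections. -/
def cocycles : Submodule ℂ (Sec k j × Sec k j) :=
  (LinearMap.ker (N.D2 x)).map (N.E1 x).subtype

/-- The coboundaries `Im D₁`, as a subspace of the space of pairs of sections. -/
def coboundaries : Submodule ℂ (Sec k j × Sec k j) :=
  (LinearMap.range (N.D1 x)).map (N.E1 x).subtype

/-- The cohomology `ker D₂ / Im D₁` at the middle term of the complex (`Im D₁` is contained in
`ker D₂` as soon as `D₂ D₁ = 0`). -/
abbrev Cohomology := ↥(N.cocycles x) ⧸ (N.coboundaries x).submoduleOf (N.cocycles x)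

/-- The cohomology class of a cocycle. -/
def cls (u : N.cocycles x) : N.Cohomology x := Submodule.Quotient.mk u

/-- The jump `Δ(s₁, s₂)` at a jump point, the large side being projected by `π`. -/
def jumpOf (u : Sec k j × Sec k j) (p : Jump) : V k × V k :=
  jumpSign p •
    (limUnder (smallNhds μ₀ μ₁ p) u.1.2
        - limUnder (largeNhds μ₁ p) (fun z => proj (N.ι p) (u.1.1 z)),
     limUnder (smallNhds μ₀ μ₁ p) u.2.2
        - limUnder (largeNhds μ₁ p) (fun z => proj (N.ι p) (u.2.1 z)))

/-- `|c|²` for the jump coefficient `c` in `Δ(s₁, s₂) = c v`, i.e. `|Δ(s₁, s₂)|² / |v|²`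
(zero if `v = 0`). -/
def jumpCoeffSq (u : Sec k j × Sec k j) (p : Jump) : ℝ :=
  (‖(N.jumpOf u p).1‖ ^ 2 + ‖(N.jumpOf u p).2‖ ^ 2)
    / (‖(N.jumpVec p).1‖ ^ 2 + ‖(N.jumpVec p).2‖ ^ 2)

/-- The norm on the middle term: the `L²` norm for `j > 0`; for `j = 0` the norm of
`L² ⊕ ℂ²`, the coefficients `c₊, c₋` of the jumps being included. -/
def midNorm (u : Sec k j × Sec k j) : ℝ :=
  Real.sqrt ((∫ z in Ioo (-μ₁) μ₁, (‖u.1.1 z‖ ^ 2 + ‖u.2.1 z‖ ^ 2))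
    + (∫ z in Ioo μ₁ (μ₀ - μ₁), (‖u.1.2 z‖ ^ 2 + ‖u.2.2 z‖ ^ 2))
    + (N.jumpCoeffSq u .plus + N.jumpCoeffSq u .minus))

end NahmSolution

end

end CaloronNahm

namespace CaloronNahm

section WeakDerivative

variable {E F G : Type*} [NormedAddCommGroup E] [NormedSpace ℝ E]
  [NormedAddCommGroup F] [NormedSpace ℝ F] [NormedAddCommGroup G] [NormedSpace ℝ G]
  {a b : ℝ} {f f' : ℝ → E}

/-- `f'` is a locally integrable derivative of `f` on `(a, b)`, in the sense that `f` is its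
indefinite integral. -/
def HasWeakDeriv (a b : ℝ) (f f' : ℝ → E) : Prop :=
  ∀ x ∈ Ioo a b, ∀ y ∈ Ioo a b,
    IntervalIntegrable f' volume x y ∧ f y - f x = ∫ t in x..y, f' t

theorem ae_Ioo_of_forall_subinterval {P : ℝ → Prop}
    (h : ∀ c ∈ Ioo a b, ∀ d ∈ Ioo a b, c < d → ∀ᵐ z ∂volume, z ∈ Ioo c d → P z) :
    ∀ᵐ z ∂(volume.restrict (Ioo a b)), P z := by
  rw [ae_restrict_iff' measurableSet_Ioo]
  have : volume {z | ¬ (z ∈ Ioo a b → P z)} = 0 := by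
    apply measure_null_of_locally_null
    intro z hz
    simp only [mem_ofPred_eq, Classical.not_imp] at hz
    obtain ⟨⟨h1, h2⟩, -⟩ := hz
    obtain ⟨c, hc, hc'⟩ := exists_between h1
    obtain ⟨d, hd, hd'⟩ := exists_between h2
    refine ⟨{x | ¬ (x ∈ Ioo c d → P x)},
      ?_, ae_iff.1 (h c ⟨hc, by linarith⟩ d ⟨by linarith, hd'⟩ (by linarith))⟩
    have : Ioo c d ∈ 𝓝 z := Ioo_mem_nhds hc' hd
    filter_upwards [mem_nhdsWithin_of_mem_nhds this, self_mem_nhdsWithin] with x hx hx'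
    simp only [Classical.not_imp] at hx' ⊢
    exact ⟨hx, hx'.2⟩
  exact ae_iff.2 this

theorem ae_uIoc_of_ae_Ioo {P : ℝ → Prop} (h : ∀ᵐ z ∂(volume.restrict (Ioo a b)), P z) {x y : ℝ}
    (hx : x ∈ Icc a b) (hy : y ∈ Icc a b) : ∀ᵐ z ∂volume, z ∈ uIoc x y → P z := by
  rw [ae_restrict_iff' measurableSet_Ioo] at h
  have h₂ : ∀ᵐ z : ℝ, z ≠ b := by simp [ae_iff, measure_singleton]
  filter_upwards [h, h₂] with z hz hb hzm
  rw [mem_uIoc] at hzm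
  refine hz ⟨?_, lt_of_le_of_ne ?_ hb⟩
  · rcases hzm with h | h
    · exact lt_of_le_of_lt hx.1 h.1
    · exact lt_of_le_of_lt hy.1 h.1
  · rcases hzm with h | h
    · exact h.2.trans hy.2
    · exact h.2.trans hx.2

namespace HasWeakDeriv

theorem mono {c d : ℝ} (h : HasWeakDeriv a b f f') (hcd : Ioo c d ⊆ Ioo a b) :
    HasWeakDeriv c d f f' := fun x hx y hy => h x (hcd hx) y (hcd hy)

theorem congr_deriv {f'' : ℝ → E} (h : HasWeakDeriv a b f f')
    (hf : f' =ᵐ[volume.restrict (Ioo a b)] f'') : HasWeakDeriv a b f f'' := by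
  intro x hx y hy
  obtain ⟨h1, h2⟩ := h x hx y hy
  have hd := ae_uIoc (a := a) (b := b) hf hx hy
  refine ⟨h1.congr_ae ?_, ?_⟩
  · rw [EventuallyEq, ae_restrict_iff' measurableSet_uIoc]
    exact hd
  · rw [h2]
    exact intervalIntegral.integral_congr_ae hd

theorem congr {g : ℝ → E} (h : HasWeakDeriv a b f f') (hf : EqOn g f (Ioo a b)) :
    HasWeakDeriv a b g f' := by
  intro x hx y hy
  rw [hf hx, hf hy]
  exact h x hx y hy

theorem const (c : E) : HasWeakDeriv a b (fun _ => c) (fun _ => 0) := by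
  intro x _ y _
  exact ⟨intervalIntegrable_const, by simp⟩

theorem add {g g' : ℝ → E} (hf : HasWeakDeriv a b f f') (hg : HasWeakDeriv a b g g') :
    HasWeakDeriv a b (fun z => f z + g z) (fun z => f' z + g' z) := by
  intro x hx y hy
  obtain ⟨h1, h2⟩ := hf x hx y hy
  obtain ⟨h3, h4⟩ := hg x hx y hy
  refine ⟨h1.add h3, ?_⟩
  rw [intervalIntegral.integral_add h1 h3, ← h2, ← h4]
  beta_reduce
  abel

theorem neg (hf : HasWeakDeriv a b f f') :
    HasWeakDeriv a b (fun z => - f z) (fun z => - f' z) := by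
  intro x hx y hy
  obtain ⟨h1, h2⟩ := hf x hx y hy
  refine ⟨h1.neg, ?_⟩
  rw [intervalIntegral.integral_neg, ← h2]
  beta_reduce
  abel

theorem sub {g g' : ℝ → E} (hf : HasWeakDeriv a b f f') (hg : HasWeakDeriv a b g g') :
    HasWeakDeriv a b (fun z => f z - g z) (fun z => f' z - g' z) := by
  simpa only [sub_eq_add_neg] using hf.add hg.neg

theorem of_integral (h : ∀ x ∈ Ioo a b, ∀ y ∈ Ioo a b, IntervalIntegrable f' volume x y)
    {c : ℝ} (hc : ∀ x ∈ Ioo a b, IntervalIntegrable f' volume c x) (e : E) :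
    HasWeakDeriv a b (fun z => e + ∫ t in c..z, f' t) f' := by
  intro x hx y hy
  refine ⟨h x hx y hy, ?_⟩
  rw [← intervalIntegral.integral_interval_sub_left (hc y hy) (hc x hx)]
  beta_reduce
  abel

theorem continuousOn (h : HasWeakDeriv a b f f') : ContinuousOn f (Ioo a b) := by
  intro z hz
  obtain ⟨c, hc, hc'⟩ := exists_between hz.1
  obtain ⟨d, hd, hd'⟩ := exists_between hz.2
  have hcm : c ∈ Ioo a b := ⟨hc, hc'.trans hz.2⟩
  have hdm : d ∈ Ioo a b := ⟨hz.1.trans hd, hd'⟩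
  have hcd : c ≤ d := (hc'.trans hd).le
  have h1 := intervalIntegral.continuousOn_primitive_interval (μ := volume) (f := f') (a := c)
    (b := d) ((intervalIntegrable_iff_integrableOn_Icc_of_le hcd).1 (h c hcm d hdm).1 |>.congr_set_ae
      (by rw [uIcc_of_le hcd]; exact EventuallyEq.rfl))
  rw [uIcc_of_le hcd] at h1
  have h2 : ContinuousOn f (Icc c d) := by
    refine ((continuousOn_const (c := f c)).add h1).congr fun y hy => ?_
    have := (h c hcm y ⟨hc.trans_le hy.1, hy.2.trans_lt hd'⟩).2
    rw [Pi.add_apply, ← this]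
    abel
  exact (h2.continuousAt (Icc_mem_nhds hc' hd)).continuousWithinAt

theorem aestronglyMeasurable (h : HasWeakDeriv a b f f') :
    AEStronglyMeasurable f (volume.restrict (Ioo a b)) :=
  h.continuousOn.aestronglyMeasurable measurableSet_Ioo

theorem aestronglyMeasurable_deriv (h : HasWeakDeriv a b f f') :
    AEStronglyMeasurable f' (volume.restrict (Ioo a b)) := by
  rcases le_or_gt b a with hab | hab
  · simp [Ioo_eq_empty_of_le hab]
  have key : Ioo a b = ⋃ n : ℕ, Ioc (a + (b - a) / (n + 3)) (b - (b - a) / (n + 3)) := by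
    ext z
    simp only [mem_Ioo, mem_iUnion, mem_Ioc]
    constructor
    · rintro ⟨h1, h2⟩
      have hm : 0 < min (z - a) (b - z) := lt_min (by linarith) (by linarith)
      obtain ⟨n, hn⟩ := exists_nat_gt ((b - a) / min (z - a) (b - z))
      refine ⟨n, ?_⟩
      have hn3 : (0 : ℝ) < n + 3 := by positivity
      have : (b - a) / (n + 3) < min (z - a) (b - z) := by
        rw [div_lt_iff₀ hn3]
        rw [div_lt_iff₀ hm] at hn
        nlinarith
      have h3 := this.trans_le (min_le_left _ _)
      have h4 := this.trans_le (min_le_right _ _)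
      exact ⟨by linarith, by linarith⟩
    · rintro ⟨n, h1, h2⟩
      have : 0 < (b - a) / (n + 3) := div_pos (by linarith) (by positivity)
      exact ⟨by linarith, by linarith⟩
  rw [key, aestronglyMeasurable_iUnion_iff]
  intro n
  have h0 : 0 < (b - a) / (n + 3) := div_pos (by linarith) (by positivity)
  have h1 : (b - a) / (n + 3) ≤ (b - a) / 3 :=
    div_le_div_of_nonneg_left (by linarith) (by norm_num) (by linarith [Nat.cast_nonneg (α := ℝ) n])
  have := (h (a + (b - a) / (n + 3)) ⟨by linarith, by linarith⟩
    (b - (b - a) / (n + 3)) ⟨by linarith, by linarith⟩).1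
  exact this.1.aestronglyMeasurable

theorem ae_hasDerivAt [CompleteSpace E] (h : HasWeakDeriv a b f f') :
    ∀ᵐ z ∂(volume.restrict (Ioo a b)), HasDerivAt f (f' z) z := by
  apply ae_Ioo_of_forall_subinterval
  intro c hc d hd hcd
  filter_upwards [(h c hc d hd).1.ae_hasDerivAt_integral] with z hz hzm
  have hz1 := hz (by rw [uIcc_of_le hcd.le]; exact Ioo_subset_Icc_self hzm) c left_mem_uIcc
  refine (hz1.const_add (f c)).congr_of_eventuallyEq ?_
  filter_upwards [Ioo_mem_nhds hzm.1 hzm.2] with y hy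
  rw [← (h c hc y ⟨hc.1.trans hy.1, hy.2.trans hd.2⟩).2]
  abel

theorem of_hasDerivAt [CompleteSpace E] (h : ∀ z ∈ Ioo a b, HasDerivAt f (f' z) z)
    (hc : ContinuousOn f' (Ioo a b)) : HasWeakDeriv a b f f' := by
  intro x hx y hy
  have hsub : uIcc x y ⊆ Ioo a b := ordConnected_Ioo.uIcc_subset hx hy
  have hi : IntervalIntegrable f' volume x y := (hc.mono hsub).intervalIntegrable
  exact ⟨hi, (intervalIntegral.integral_eq_sub_of_hasDerivAt (fun z hz => h z (hsub hz)) hi).symm⟩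

theorem deriv_unique [CompleteSpace E] {f'' : ℝ → E} (h : HasWeakDeriv a b f f')
    (h' : HasWeakDeriv a b f f'') : f' =ᵐ[volume.restrict (Ioo a b)] f'' := by
  filter_upwards [h.ae_hasDerivAt, h'.ae_hasDerivAt] with z h1 h2 using h1.unique h2

end HasWeakDeriv

theorem absolutelyContinuousOnInterval_of_dist_le {X Y : Type*} [PseudoMetricSpace X]
    [PseudoMetricSpace Y] {f : ℝ → X} {g : ℝ → Y} {x y : ℝ}
    (hg : AbsolutelyContinuousOnInterval g x y)
    (h : ∀ u ∈ uIcc x y, ∀ v ∈ uIcc x y, dist (f u) (f v) ≤ dist (g u) (g v)) :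
    AbsolutelyContinuousOnInterval f x y := by
  rw [absolutelyContinuousOnInterval_iff] at hg ⊢
  intro ε hε
  obtain ⟨δ, hδ, H⟩ := hg ε hε
  refine ⟨δ, hδ, fun I hI hs => lt_of_le_of_lt (Finset.sum_le_sum fun i hi => ?_) (H I hI hs)⟩
  exact h _ (hI.1 i hi).1 _ (hI.1 i hi).2

/-- The product rule for a bounded bilinear map. -/
theorem HasWeakDeriv.bilin [CompleteSpace E] [CompleteSpace F] [CompleteSpace G]
    {B : E × F → G} (hB : IsBoundedBilinearMap ℝ B) {g g' : ℝ → F}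
    (hf : HasWeakDeriv a b f f') (hg : HasWeakDeriv a b g g') :
    HasWeakDeriv a b (fun z => B (f z, g z)) (fun z => B (f' z, g z) + B (f z, g' z)) := by
  intro x hx y hy
  have hsub : uIcc x y ⊆ Ioo a b := ordConnected_Ioo.uIcc_subset hx hy
  have hsub' : uIoc x y ⊆ Ioo a b := uIoc_subset_uIcc.trans hsub
  obtain ⟨C, hC⟩ := isCompact_uIcc.exists_bound_of_continuousOn (hf.continuousOn.mono hsub)
  obtain ⟨D, hD⟩ := isCompact_uIcc.exists_bound_of_continuousOn (hg.continuousOn.mono hsub)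
  obtain ⟨M, hM, hMB⟩ := hB.bound
  have hC0 : 0 ≤ C := (norm_nonneg _).trans (hC x left_mem_uIcc)
  have hD0 : 0 ≤ D := (norm_nonneg _).trans (hD x left_mem_uIcc)
  set ψ : ℝ → ℝ := fun t => M * (D * ‖f' t‖ + C * ‖g' t‖) with hψ
  have hψi : IntervalIntegrable ψ volume x y :=
    ((((hf x hx y hy).1.norm.const_mul D).add ((hg x hx y hy).1.norm.const_mul C)).const_mul M)
  have hψ0 : ∀ t, 0 ≤ ψ t := fun t => by positivity
  have hint : IntervalIntegrable (fun z => B (f' z, g z) + B (f z, g' z)) volume x y := by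
    refine hψi.mono_fun ?_ ?_
    · have m : Measure.restrict volume (uIoc x y) ≤ volume.restrict (Ioo a b) :=
        Measure.restrict_mono hsub' le_rfl
      exact ((hB.continuous.comp_aestronglyMeasurable
        (hf.aestronglyMeasurable_deriv.prodMk hg.aestronglyMeasurable)).add
        (hB.continuous.comp_aestronglyMeasurable
        (hf.aestronglyMeasurable.prodMk hg.aestronglyMeasurable_deriv))).mono_measure m
    · rw [EventuallyLE, ae_restrict_iff' measurableSet_uIoc]
      refine Eventually.of_forall fun z hz => ?_
      have hz' := uIoc_subset_uIcc hz
      rw [Real.norm_of_nonneg (hψ0 z)]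
      calc _ ≤ M * ‖f' z‖ * ‖g z‖ + M * ‖f z‖ * ‖g' z‖ :=
            (norm_add_le _ _).trans (add_le_add (hMB _ _) (hMB _ _))
        _ ≤ M * ‖f' z‖ * D + M * C * ‖g' z‖ := by
            gcongr
            · exact hD z hz'
            · exact hC z hz'
        _ = ψ z := by simp only [hψ]; ring
  refine ⟨hint, ?_⟩
  set H : ℝ → G := fun z => B (f z, g z) - ∫ t in x..z, (B (f' t, g t) + B (f t, g' t)) with hH
  have hdist : ∀ u ∈ uIcc x y, ∀ v ∈ uIcc x y, dist (H u) (H v) ≤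
      dist (∫ t in x..u, 2 * ψ t) (∫ t in x..v, 2 * ψ t) := by
    intro u hu v hv
    have hxu : uIcc x u ⊆ uIcc x y := uIcc_subset_uIcc_left hu
    have hxv : uIcc x v ⊆ uIcc x y := uIcc_subset_uIcc_left hv
    have huv : uIcc v u ⊆ uIcc x y := uIcc_subset_uIcc hv hu
    rw [Real.dist_eq, dist_eq_norm, intervalIntegral.integral_interval_sub_left
      ((hψi.const_mul 2).mono_set hxu) ((hψi.const_mul 2).mono_set hxv)]
    have e1 : H u - H v = (B (f u - f v, g u) + B (f v, g u - g v))
        - ∫ t in v..u, (B (f' t, g t) + B (f t, g' t)) := by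
      rw [← intervalIntegral.integral_interval_sub_left (hint.mono_set hxu) (hint.mono_set hxv)]
      have h1 : B (f u - f v, g u) = B (f u, g u) - B (f v, g u) := by
        rw [sub_eq_add_neg, hB.add_left, ← neg_one_smul ℝ (f v), hB.smul_left]; simp [sub_eq_add_neg]
      have h2 : B (f v, g u - g v) = B (f v, g u) - B (f v, g v) := by
        rw [sub_eq_add_neg, hB.add_right, ← neg_one_smul ℝ (g v), hB.smul_right]
        simp [sub_eq_add_neg]
      simp only [hH, h1, h2]
      abel
    have b1 : ‖f u - f v‖ ≤ |∫ t in v..u, ‖f' t‖| := by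
      rw [(hf v (hsub hv) u (hsub hu)).2]
      exact intervalIntegral.norm_integral_le_abs_integral_norm
    have b2 : ‖g u - g v‖ ≤ |∫ t in v..u, ‖g' t‖| := by
      rw [(hg v (hsub hv) u (hsub hu)).2]
      exact intervalIntegral.norm_integral_le_abs_integral_norm
    have b3 : ‖∫ t in v..u, (B (f' t, g t) + B (f t, g' t))‖ ≤ |∫ t in v..u, ψ t| := by
      refine intervalIntegral.norm_integral_le_abs_of_norm_le ?_ (hψi.mono_set huv)
      rw [ae_restrict_iff' measurableSet_uIoc]
      refine Eventually.of_forall fun z hz => ?_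
      have hz' := huv (uIoc_subset_uIcc hz)
      calc _ ≤ M * ‖f' z‖ * ‖g z‖ + M * ‖f z‖ * ‖g' z‖ :=
            (norm_add_le _ _).trans (add_le_add (hMB _ _) (hMB _ _))
        _ ≤ M * ‖f' z‖ * D + M * C * ‖g' z‖ := by
            gcongr
            · exact hD z hz'
            · exact hC z hz'
        _ = ψ z := by simp only [hψ]; ring
    have hfi := (hf v (hsub hv) u (hsub hu)).1.norm
    have hgi := (hg v (hsub hv) u (hsub hu)).1.norm
    have b4 : |∫ t in v..u, ψ t| = M * (D * |∫ t in v..u, ‖f' t‖| + C * |∫ t in v..u, ‖g' t‖|) := by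
      simp only [hψ]
      rw [intervalIntegral.integral_const_mul, intervalIntegral.integral_add (hfi.const_mul D)
        (hgi.const_mul C), intervalIntegral.integral_const_mul, intervalIntegral.integral_const_mul]
      rcases le_total v u with h | h
      · have p1 := intervalIntegral.integral_nonneg (μ := volume) h (fun t _ => norm_nonneg (f' t))
        have p2 := intervalIntegral.integral_nonneg (μ := volume) h (fun t _ => norm_nonneg (g' t))
        rw [abs_of_nonneg p1, abs_of_nonneg p2, abs_of_nonneg (by positivity)]
      · have p1 := intervalIntegral.integral_nonneg (μ := volume) h (fun t _ => norm_nonneg (f' t))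
        have p2 := intervalIntegral.integral_nonneg (μ := volume) h (fun t _ => norm_nonneg (g' t))
        rw [intervalIntegral.integral_symm, intervalIntegral.integral_symm (f := fun t => ‖g' t‖),
          abs_neg, abs_neg, abs_of_nonneg p1, abs_of_nonneg p2, mul_neg, mul_neg, ← neg_add, mul_neg,
          abs_neg, abs_of_nonneg (by positivity)]
    rw [e1, intervalIntegral.integral_const_mul, abs_mul, abs_two]
    calc _ ≤ (M * ‖f u - f v‖ * ‖g u‖ + M * ‖f v‖ * ‖g u - g v‖) + |∫ t in v..u, ψ t| :=
          (norm_sub_le _ _).trans (add_le_add ((norm_add_le _ _).trans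
            (add_le_add (hMB _ _) (hMB _ _))) b3)
      _ ≤ (M * |∫ t in v..u, ‖f' t‖| * D + M * C * |∫ t in v..u, ‖g' t‖|) + |∫ t in v..u, ψ t| := by
          gcongr
          · exact hD u hu
          · exact hC v hv
      _ = _ := by rw [b4]; ring
  have hac : AbsolutelyContinuousOnInterval H x y :=
    absolutelyContinuousOnInterval_of_dist_le
      ((hψi.const_mul 2).absolutelyContinuousOnInterval_intervalIntegral left_mem_uIcc) hdist
  have hder : ∀ᵐ z, z ∈ uIcc x y → HasDerivAt H 0 z := by
    have d1 := (ae_restrict_iff' measurableSet_Ioo).1 hf.ae_hasDerivAt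
    have d2 := (ae_restrict_iff' measurableSet_Ioo).1 hg.ae_hasDerivAt
    filter_upwards [d1, d2, hint.ae_hasDerivAt_integral] with z h1 h2 h3 hz
    have k1 := (hB.hasFDerivAt (f z, g z)).comp_hasDerivAt z ((h1 (hsub hz)).prodMk (h2 (hsub hz)))
    have k2 := k1.sub (h3 hz x left_mem_uIcc)
    refine HasDerivAt.congr_deriv k2 ?_
    change B (f z, g' z) + B (f' z, g z) - (B (f' z, g z) + B (f z, g' z)) = 0
    abel
  obtain ⟨K, hK⟩ := hac.const_of_ae_hasDerivAt_zero hder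
  have e1 := hK x left_mem_uIcc
  have e2 := hK y right_mem_uIcc
  simp only [hH, intervalIntegral.integral_same, sub_zero] at e1 e2
  rw [← e1] at e2
  rw [sub_eq_iff_eq_add] at e2
  beta_reduce
  rw [e2]
  abel

end WeakDerivative

end CaloronNahm

namespace CaloronNahm

section WeakDerivative

variable {E F : Type*} [NormedAddCommGroup E] [NormedSpace ℝ E]
  [NormedAddCommGroup F] [NormedSpace ℝ F]
  {a b : ℝ} {f f' : ℝ → E}

theorem HasWeakDeriv.clm [CompleteSpace E] [CompleteSpace F] (L : E →L[ℝ] F) (hf : HasWeakDeriv a b f f') :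
    HasWeakDeriv a b (fun z => L (f z)) (fun z => L (f' z)) := by
  intro x hx y hy
  obtain ⟨h1, h2⟩ := hf x hx y hy
  refine ⟨⟨L.integrable_comp h1.1, L.integrable_comp h1.2⟩, ?_⟩
  rw [L.intervalIntegral_comp_comm h1, ← h2, map_sub]

theorem HasWeakDeriv.exists_eq_integral (hab : a < b) (hf : HasWeakDeriv a b f f')
    (hi : IntegrableOn f' (Ioo a b)) :
    ∃ e, (∀ z ∈ Ioo a b, f z = e + ∫ t in a..z, f' t) ∧ Tendsto f (𝓝[>] a) (𝓝 e) ∧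
      Tendsto f (𝓝[<] b) (𝓝 (e + ∫ t in a..b, f' t)) := by
  obtain ⟨c, hc1, hc2⟩ := exists_between hab
  have hi' : IntegrableOn f' (Icc a b) := (integrableOn_Icc_iff_integrableOn_Ioo (by simp) (by simp)).2 hi
  have hI : ∀ x ∈ Icc a b, IntervalIntegrable f' volume a x := fun x hx => by
    rw [intervalIntegrable_iff_integrableOn_Icc_of_le hx.1]
    exact hi'.mono_set (Icc_subset_Icc_right hx.2)
  have key : ∀ z ∈ Ioo a b, f z = (f c - ∫ t in a..c, f' t) + ∫ t in a..z, f' t := by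
    intro z hz
    have := (hf c ⟨hc1, hc2⟩ z hz).2
    rw [← intervalIntegral.integral_interval_sub_left (hI z (Ioo_subset_Icc_self hz))
      (hI c ⟨hc1.le, hc2.le⟩)] at this
    rw [sub_eq_iff_eq_add] at this
    rw [this]
    abel
  have hcont := intervalIntegral.continuousOn_primitive_interval (μ := volume) (f := f') (a := a)
    (b := b) (by rwa [uIcc_of_le hab.le])
  rw [uIcc_of_le hab.le] at hcont
  have hcont' := (continuousOn_const (c := f c - ∫ t in a..c, f' t)).add hcont
  refine ⟨_, key, ?_, ?_⟩
  · have h1 := (hcont' a (left_mem_Icc.2 hab.le)).mono_left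
      (nhdsWithin_mono a (Ioo_subset_Icc_self : Ioo a b ⊆ Icc a b))
    rw [nhdsWithin_Ioo_eq_nhdsGT hab] at h1
    simp only [Pi.add_apply, intervalIntegral.integral_same, add_zero] at h1
    refine h1.congr' ?_
    filter_upwards [Ioo_mem_nhdsGT hab] with z hz
    exact (key z hz).symm
  · have h1 := (hcont' b (right_mem_Icc.2 hab.le)).mono_left
      (nhdsWithin_mono b (Ioo_subset_Icc_self : Ioo a b ⊆ Icc a b))
    rw [nhdsWithin_Ioo_eq_nhdsLT hab] at h1
    refine h1.congr' ?_
    filter_upwards [Ioo_mem_nhdsLT hab] with z hz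
    exact (key z hz).symm

theorem intervalIntegrable_of_integrableOn_Ioo {E : Type*} [NormedAddCommGroup E] {f' : ℝ → E}
    (hi : IntegrableOn f' (Ioo a b)) {x y : ℝ}
    (hx : x ∈ Icc a b) (hy : y ∈ Icc a b) : IntervalIntegrable f' volume x y := by
  rw [intervalIntegrable_iff]
  exact ((integrableOn_Icc_iff_integrableOn_Ioo (by simp) (by simp)).2 hi).mono_set
    (uIoc_subset_uIcc.trans (ordConnected_Icc.uIcc_subset hx hy))

theorem intervalIntegrable_comp_affine {E : Type*} [NormedAddCommGroup E] {f' : ℝ → E}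
    {p σ : ℝ} (hσ : σ = 1 ∨ σ = -1) {x y : ℝ}
    (h : IntervalIntegrable f' volume (p + σ * x) (p + σ * y)) :
    IntervalIntegrable (fun t => f' (p + σ * t)) volume x y := by
  rcases hσ with rfl | rfl
  · simpa using! h.comp_add_left p
  · simpa [← sub_eq_add_neg] using! h.comp_sub_left p

theorem HasWeakDeriv.comp_affine {p σ δ : ℝ} (hσ : σ = 1 ∨ σ = -1) (hf : HasWeakDeriv a b f f')
    (hsub : ∀ t ∈ Ioo 0 δ, p + σ * t ∈ Ioo a b) :
    HasWeakDeriv 0 δ (fun t => f (p + σ * t)) (fun t => σ • f' (p + σ * t)) := by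
  intro x hx y hy
  obtain ⟨h1, h2⟩ := hf _ (hsub x hx) _ (hsub y hy)
  refine ⟨(intervalIntegrable_comp_affine hσ h1).smul σ, ?_⟩
  rw [intervalIntegral.integral_smul, intervalIntegral.smul_integral_comp_add_mul]
  exact h2

theorem measurePreserving_affine {p σ : ℝ} (hσ : σ = 1 ∨ σ = -1) :
    MeasurePreserving (fun t : ℝ => p + σ * t) volume volume := by
  rcases hσ with rfl | rfl
  · simpa using! measurePreserving_add_left (volume : Measure ℝ) p
  · have := (measurePreserving_add_left (volume : Measure ℝ) p).comp
      (Measure.measurePreserving_neg (volume : Measure ℝ))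
    convert this using 2 with t
    simp [Function.comp]

theorem measurableEmbedding_affine {p σ : ℝ} (hσ : σ = 1 ∨ σ = -1) :
    MeasurableEmbedding (fun t : ℝ => p + σ * t) := by
  have h0 : σ ≠ 0 := by rcases hσ with rfl | rfl <;> norm_num
  exact ((Homeomorph.mulLeft₀ σ h0).trans (Homeomorph.addLeft p)).measurableEmbedding

theorem affine_injective {p σ : ℝ} (hσ : σ = 1 ∨ σ = -1) :
    Function.Injective (fun t : ℝ => p + σ * t) := (measurableEmbedding_affine hσ).injective

theorem measurePreserving_affine_restrict {p σ : ℝ} (hσ : σ = 1 ∨ σ = -1) (S : Set ℝ) :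
    MeasurePreserving (fun t : ℝ => p + σ * t) (volume.restrict S)
      (volume.restrict ((fun t : ℝ => p + σ * t) '' S)) := by
  have h := (measurePreserving_affine (p := p) hσ).restrict_preimage_emb
    (measurableEmbedding_affine hσ) ((fun t : ℝ => p + σ * t) '' S)
  rwa [preimage_image_eq _ (affine_injective hσ)] at h

theorem eLpNorm_comp_affine {E : Type*} [NormedAddCommGroup E] {p σ : ℝ} (hσ : σ = 1 ∨ σ = -1) (S : Set ℝ) (f : ℝ → E) :
    eLpNorm (fun t => f (p + σ * t)) 2 (volume.restrict S) =
      eLpNorm f 2 (volume.restrict ((fun t : ℝ => p + σ * t) '' S)) := by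
  rw [← (measurePreserving_affine_restrict (p := p) hσ S).map_eq,
    (measurableEmbedding_affine hσ).eLpNorm_map_measure]
  rfl

theorem ae_comp_affine {p σ : ℝ} (hσ : σ = 1 ∨ σ = -1) (S : Set ℝ) {P : ℝ → Prop} :
    (∀ᵐ t ∂(volume.restrict S), P (p + σ * t)) ↔
      ∀ᵐ z ∂(volume.restrict ((fun t : ℝ => p + σ * t) '' S)), P z := by
  rw [← (measurePreserving_affine_restrict (p := p) hσ S).map_eq,
    (measurableEmbedding_affine hσ).ae_map_iff]

end WeakDerivative

section LocallyAbsolutelyContinuous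

variable {n : ℕ} {a b : ℝ} {u u' : ℝ → V n}

theorem dz_ae_eq (u : ℝ → V n) : dz a b u =ᵐ[volume.restrict (Ioo a b)] deriv u := by
  filter_upwards [ae_restrict_mem measurableSet_Ioo] with z hz
  simp [dz, hz]

theorem LocAC.hasWeakDeriv (h : LocAC a b u) : HasWeakDeriv a b u (dz a b u) :=
  HasWeakDeriv.congr_deriv (f' := deriv u) (fun x hx y hy => h.2 x hx y hy) (dz_ae_eq u).symm

theorem HasWeakDeriv.dz_ae (h : HasWeakDeriv a b u u') :
    dz a b u =ᵐ[volume.restrict (Ioo a b)] u' := by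
  filter_upwards [h.ae_hasDerivAt, dz_ae_eq (a := a) (b := b) u] with z h1 h2
  rw [h2, h1.deriv]

theorem HasWeakDeriv.locAC (h : HasWeakDeriv a b u u') : LocAC a b u := by
  refine ⟨?_, ?_⟩
  · filter_upwards [h.ae_hasDerivAt] with z h1 using h1.differentiableAt
  · have : u' =ᵐ[volume.restrict (Ioo a b)] deriv u := by
      filter_upwards [h.ae_hasDerivAt] with z h1 using h1.deriv.symm
    exact fun x hx y hy => h.congr_deriv this x hx y hy

theorem IsL2.integrableOn (h : IsL2 a b u) : IntegrableOn u (Ioo a b) := by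
  have : IsFiniteMeasure (volume.restrict (Ioo a b)) := ⟨by simp⟩
  exact MemLp.integrable one_le_two h

theorem isBoundedBilinearMap_endV_apply (n : ℕ) :
    IsBoundedBilinearMap ℝ (fun q : EndV n × V n => q.1 q.2) where
  add_left := fun _ _ _ => rfl
  smul_left := fun _ _ _ => rfl
  add_right := fun x y z => map_add x y z
  smul_right := fun c x y => x.map_smul_of_tower c y
  bound := ⟨1, one_pos, fun x y => by simpa using x.le_opNorm y⟩

theorem HasWeakDeriv.apply {T T' : ℝ → EndV n} (hT : HasWeakDeriv a b T T')
    (hu : HasWeakDeriv a b u u') :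
    HasWeakDeriv a b (fun z => T z (u z)) (fun z => T' z (u z) + T z (u' z)) := by
  exact hT.bilin (isBoundedBilinearMap_endV_apply n) hu

theorem HasWeakDeriv.inner_prod {v v' : ℝ → V n} (hu : HasWeakDeriv a b u u')
    (hv : HasWeakDeriv a b v v') :
    HasWeakDeriv a b (fun z => inner ℂ (u z) (v z))
      (fun z => inner ℂ (u' z) (v z) + inner ℂ (u z) (v' z)) :=
  hu.bilin (B := fun q : V n × V n => (inner ℂ q.1 q.2 : ℂ)) isBoundedBilinearMap_inner hv

theorem HasWeakDeriv.norm_sq (hu : HasWeakDeriv a b u u') :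
    HasWeakDeriv a b (fun z => ‖u z‖ ^ 2) (fun z => 2 * (inner ℂ (u z) (u' z) : ℂ).re) := by
  have h := (hu.inner_prod hu).clm Complex.reCLM
  have e : ∀ z, Complex.reCLM (inner ℂ (u z) (u z)) = ‖u z‖ ^ 2 := fun z => by
    rw [Complex.reCLM_apply, ← inner_self_eq_norm_sq (𝕜 := ℂ)]; rfl
  have e' : ∀ z, Complex.reCLM (inner ℂ (u' z) (u z) + inner ℂ (u z) (u' z))
      = 2 * (inner ℂ (u z) (u' z) : ℂ).re := fun z => by
    rw [Complex.reCLM_apply, Complex.add_re, ← inner_conj_symm, Complex.conj_re]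
    ring
  simpa only [e, e'] using h

theorem HasWeakDeriv.csmul (c : ℂ) (hu : HasWeakDeriv a b u u') :
    HasWeakDeriv a b (fun z => c • u z) (fun z => c • u' z) :=
  hu.clm ((c • ContinuousLinearMap.id ℂ (V n)).restrictScalars ℝ)

theorem HasWeakDeriv.rclm {m : ℕ} (L : V n →L[ℂ] V m) (hu : HasWeakDeriv a b u u') :
    HasWeakDeriv a b (fun z => L (u z)) (fun z => L (u' z)) :=
  hu.clm (L.restrictScalars ℝ)

theorem HasWeakDeriv.mul {f f' g g' : ℝ → ℝ} (hf : HasWeakDeriv a b f f')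
    (hg : HasWeakDeriv a b g g') :
    HasWeakDeriv a b (fun z => f z * g z) (fun z => f' z * g z + f z * g' z) :=
  hf.bilin (B := fun q : ℝ × ℝ => q.1 • q.2) isBoundedBilinearMap_smul hg

theorem HasWeakDeriv.rsmul {f f' : ℝ → ℝ} (hf : HasWeakDeriv a b f f')
    (hu : HasWeakDeriv a b u u') :
    HasWeakDeriv a b (fun z => f z • u z) (fun z => f' z • u z + f z • u' z) :=
  hf.bilin (B := fun q : ℝ × V n => q.1 • q.2) isBoundedBilinearMap_smul hu

end LocallyAbsolutelyContinuous

end CaloronNahm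

namespace CaloronNahm

section Hardy

variable {n : ℕ} {δ : ℝ} {s s' : ℝ → V n} {g : ℝ → ℝ}

theorem lintegral_le_of_tendsto_intervals {C : ℝ} {φ : ℝ → ℝ} {φn : ℕ → ℝ → ℝ} {η θ Cn : ℕ → ℝ}
    (hη : Tendsto η atTop (𝓝 0)) (hθ : Tendsto θ atTop (𝓝 δ)) (hη' : ∀ m, η m ∈ Ioo 0 δ)
    (hθ' : ∀ m, θ m ∈ Ioo 0 δ) (hle : ∀ m, η m ≤ θ m)
    (hc : ∀ m, ContinuousOn (φn m) (Ioo 0 δ)) (h0 : ∀ m, ∀ t ∈ Ioo 0 δ, 0 ≤ φn m t)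
    (hlim : ∀ t ∈ Ioo 0 δ, Tendsto (fun m => φn m t) atTop (𝓝 (φ t)))
    (hint : ∀ m, ∫ t in η m..θ m, φn m t ≤ Cn m) (hC : Tendsto Cn atTop (𝓝 C)) :
    ∫⁻ t in Ioo 0 δ, ENNReal.ofReal (φ t) ≤ ENNReal.ofReal C := by
  set ψ : ℕ → ℝ → ENNReal := fun m =>
    (Ioc (η m) (θ m)).indicator (fun t => ENNReal.ofReal (φn m t)) with hψ
  have h1 : ∫⁻ t in Ioo 0 δ, ENNReal.ofReal (φ t) = ∫⁻ t in Ioo 0 δ, liminf (fun m => ψ m t) atTop := by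
    refine setLIntegral_congr_fun measurableSet_Ioo fun t ht => ?_
    refine (Tendsto.liminf_eq ?_).symm
    refine (ENNReal.tendsto_ofReal (hlim t ht)).congr' ?_
    filter_upwards [hη.eventually_lt_const ht.1, hθ.eventually_const_lt ht.2] with m h1 h2
    simp [hψ, h1, h2.le]
  rw [h1]
  refine (lintegral_liminf_le' fun m => ?_).trans ?_
  · exact (((hc m).aemeasurable measurableSet_Ioo).ennreal_ofReal).indicator measurableSet_Ioc
  have h2 : ∀ m, ∫⁻ t in Ioo 0 δ, ψ m t ≤ ENNReal.ofReal (Cn m) := by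
    intro m
    have hsub : Icc (η m) (θ m) ⊆ Ioo 0 δ := Icc_subset_Ioo (hη' m).1 (hθ' m).2
    have hsub' := Ioc_subset_Icc_self.trans hsub
    simp only [hψ]
    rw [setLIntegral_indicator measurableSet_Ioc, inter_eq_left.2 hsub',
      ← ofReal_integral_eq_lintegral_ofReal]
    · rw [← intervalIntegral.integral_of_le (hle m)]
      exact ENNReal.ofReal_le_ofReal (hint m)
    · exact (((hc m).mono hsub).integrableOn_Icc).mono_set Ioc_subset_Icc_self
    · filter_upwards [ae_restrict_mem measurableSet_Ioc] with t ht using h0 m t (hsub' ht)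
  calc _ ≤ liminf (fun m => ENNReal.ofReal (Cn m)) atTop := by
        refine liminf_le_liminf (Eventually.of_forall h2)
    _ = _ := (ENNReal.tendsto_ofReal hC).liminf_eq

theorem integral_le_of_deriv_le {F F' P R : ℝ → ℝ} (hF : HasWeakDeriv 0 δ F F') {x y : ℝ}
    (hx : x ∈ Ioo 0 δ) (hy : y ∈ Ioo 0 δ) (hxy : x ≤ y) (hP : ContinuousOn P (Ioo 0 δ))
    (hR : IntegrableOn R (Ioo 0 δ)) (hR0 : ∀ t, 0 ≤ R t)
    (h : ∀ᵐ t ∂(volume.restrict (Ioo 0 δ)), F' t ≤ R t - P t) :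
    ∫ t in x..y, P t ≤ F x - F y + ∫ t in Ioo 0 δ, R t := by
  have hsub : Icc x y ⊆ Ioo 0 δ := Icc_subset_Ioo hx.1 hy.2
  have iP : IntervalIntegrable P volume x y :=
    (hP.mono (by rwa [uIcc_of_le hxy])).intervalIntegrable
  have iR : IntervalIntegrable R volume x y :=
    intervalIntegrable_of_integrableOn_Ioo hR (Ioo_subset_Icc_self hx) (Ioo_subset_Icc_self hy)
  obtain ⟨iF, eF⟩ := hF x hx y hy
  have h1 : ∫ t in x..y, F' t ≤ ∫ t in x..y, (R t - P t) := by
    refine intervalIntegral.integral_mono_ae_restrict hxy iF (iR.sub iP) ?_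
    exact ae_restrict_of_ae_restrict_of_subset hsub h
  rw [intervalIntegral.integral_sub iR iP, ← eF] at h1
  have h2 : ∫ t in x..y, R t ≤ ∫ t in Ioo 0 δ, R t := by
    rw [intervalIntegral.integral_of_le hxy]
    exact setIntegral_mono_set hR (Eventually.of_forall hR0)
      (Ioc_subset_Icc_self.trans hsub).eventuallyLE
  linarith

theorem exists_mul_lt_of_integrableOn {φ : ℝ → ℝ} (hδ : 0 < δ) (hφ : IntegrableOn φ (Ioo 0 δ))
    {m : ℝ} (hm : 0 < m) : ∃ t ∈ Ioo 0 (min m δ), t * φ t < m := by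
  by_contra! H
  have hd : 0 < min m δ := lt_min hm hδ
  have h1 : IntegrableOn φ (Ioo 0 (min m δ)) := hφ.mono_set (Ioo_subset_Ioo_right (min_le_right _ _))
  have h2 : IntegrableOn (fun t : ℝ => m * t⁻¹) (Ioo 0 (min m δ)) := by
    refine Integrable.mono h1 (by fun_prop) ?_
    filter_upwards [ae_restrict_mem measurableSet_Ioo] with t ht
    have h3 := H t ht
    have h4 : m * t⁻¹ ≤ φ t := by
      rw [← div_eq_mul_inv, div_le_iff₀ ht.1]; linarith
    rw [Real.norm_of_nonneg (by have := ht.1; positivity)]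
    exact h4.trans (le_abs_self _)
  have h3 : IntervalIntegrable (fun t : ℝ => t⁻¹) volume 0 (min m δ) := by
    have := (h2.const_mul m⁻¹)
    rw [intervalIntegrable_iff_integrableOn_Ioo_of_le hd.le (by simp) (by simp)]
    refine this.congr (Eventually.of_forall fun t => ?_)
    field_simp
  rw [intervalIntegrable_inv_iff] at h3
  rcases h3 with h3 | h3
  · exact hd.ne h3
  · exact h3 left_mem_uIcc

theorem exists_seq_intervals (hδ : 0 < δ) {Q : ℝ → ℝ → Prop}
    (hQ : ∀ m : ℝ, 0 < m → ∃ t ∈ Ioo 0 (min m δ), Q m t) :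
    ∃ η θ : ℕ → ℝ, Tendsto η atTop (𝓝 0) ∧ Tendsto θ atTop (𝓝 δ) ∧ (∀ m, η m ∈ Ioo 0 δ) ∧
      (∀ m, θ m ∈ Ioo 0 δ) ∧ (∀ m, η m ≤ θ m) ∧ ∀ m : ℕ, Q (min (1 / ((m : ℝ) + 1)) (δ / 2)) (η m) := by
  have hpos : ∀ m : ℕ, 0 < min (1 / ((m : ℝ) + 1)) (δ / 2) := fun m =>
    lt_min (by positivity) (by positivity)
  choose η hη hηQ using fun m : ℕ => hQ (min (1 / ((m : ℝ) + 1)) (δ / 2)) (hpos m)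
  have hη1 : ∀ m, η m < 1 / ((m : ℝ) + 1) := fun m =>
    (hη m).2.trans_le ((min_le_left _ _).trans (min_le_left _ _))
  have hη2 : ∀ m, η m < δ / 2 := fun m =>
    (hη m).2.trans_le ((min_le_left _ _).trans (min_le_right _ _))
  have ht := tendsto_one_div_add_atTop_nhds_zero_nat (𝕜 := ℝ)
  refine ⟨η, fun m => δ - δ / 2 * (1 / ((m : ℝ) + 1)), ?_, ?_, ?_, ?_, ?_, hηQ⟩
  · exact squeeze_zero (fun m => (hη m).1.le) (fun m => (hη1 m).le) ht
  · simpa using (ht.const_mul (δ / 2)).const_sub δ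
  · exact fun m => ⟨(hη m).1, by linarith [hη2 m]⟩
  · intro m
    have h1 : 1 / ((m : ℝ) + 1) ≤ 1 := by
      rw [div_le_one (by positivity)]; linarith [Nat.cast_nonneg (α := ℝ) m]
    have h2 : 0 < 1 / ((m : ℝ) + 1) := by positivity
    constructor <;> nlinarith
  · intro m
    have h1 : 1 / ((m : ℝ) + 1) ≤ 1 := by
      rw [div_le_one (by positivity)]; linarith [Nat.cast_nonneg (α := ℝ) m]
    nlinarith [hη2 m]

theorem eLpNorm_two_sq {α E : Type*} [MeasurableSpace α] [NormedAddCommGroup E] (μ : Measure α)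
    (f : α → E) : eLpNorm f 2 μ ^ 2 = ∫⁻ x, ENNReal.ofReal (‖f x‖ ^ 2) ∂μ := by
  have h := eLpNorm_nnreal_pow_eq_lintegral (μ := μ) (f := f) (p := 2) (by norm_num)
  norm_num at h
  rw [h]
  refine lintegral_congr fun x => ?_
  rw [← ofReal_norm, ENNReal.ofReal_pow (norm_nonneg _)]

theorem eLpNorm_restrict_union_le {E : Type*} [NormedAddCommGroup E] (f : ℝ → E) (S T : Set ℝ) :
    eLpNorm f 2 (volume.restrict (S ∪ T)) ≤
      eLpNorm f 2 (volume.restrict S) + eLpNorm f 2 (volume.restrict T) := by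
  refine (ENNReal.pow_le_pow_left_iff two_ne_zero).1 ?_
  rw [eLpNorm_two_sq]
  refine (lintegral_union_le _ S T).trans ?_
  rw [← eLpNorm_two_sq, ← eLpNorm_two_sq, add_sq]
  exact add_le_add le_self_add le_rfl

theorem inv_smul_norm_sq (t : ℝ) (v : V n) : ‖t⁻¹ • v‖ ^ 2 = ‖v‖ ^ 2 / t ^ 2 := by
  rw [norm_smul, mul_pow, norm_inv, inv_pow, Real.norm_eq_abs, sq_abs]
  field_simp

theorem HasWeakDeriv.aestronglyMeasurable_inv_smul {m : ℝ} (hs : HasWeakDeriv 0 δ s s') (hm : m ≤ δ) :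
    AEStronglyMeasurable (fun t => t⁻¹ • s t) (volume.restrict (Ioo 0 m)) := by
  have h : ContinuousOn (fun t : ℝ => t⁻¹) (Ioo 0 m) := fun t ht =>
    (continuousAt_inv₀ ht.1.ne').continuousWithinAt
  exact (h.smul (hs.continuousOn.mono (Ioo_subset_Ioo_right hm))).aestronglyMeasurable
    measurableSet_Ioo

theorem HasWeakDeriv.weighted_norm_sq {w w' : ℝ → ℝ} (hs : HasWeakDeriv 0 δ s s')
    (hw : ∀ t ∈ Ioo 0 δ, HasDerivAt w (w' t) t) (hw' : ContinuousOn w' (Ioo 0 δ)) :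
    HasWeakDeriv 0 δ (fun t => w t * ‖s t‖ ^ 2)
      (fun t => w' t * ‖s t‖ ^ 2 + w t * (2 * (inner ℂ (s t) (s' t) : ℂ).re)) :=
  (HasWeakDeriv.of_hasDerivAt hw hw').mul hs.norm_sq

/-- Hardy's inequality, for a function vanishing at the end point. -/
theorem hardy_of_tendsto_zero (hδ : 0 < δ) (hs : HasWeakDeriv 0 δ s s')
    (h0 : Tendsto s (𝓝[>] 0) (𝓝 0)) (hg : AEStronglyMeasurable g (volume.restrict (Ioo 0 δ)))
    (h : ∀ᵐ t ∂(volume.restrict (Ioo 0 δ)), (inner ℂ (s t) (s' t) : ℂ).re ≤ ‖s t‖ * g t) :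
    eLpNorm (fun t => t⁻¹ • s t) 2 (volume.restrict (Ioo 0 δ)) ≤
      2 * eLpNorm g 2 (volume.restrict (Ioo 0 δ)) := by
  by_cases hgt : eLpNorm g 2 (volume.restrict (Ioo 0 δ)) = ⊤
  · simp [hgt]
  have hg2 : MemLp g 2 (volume.restrict (Ioo 0 δ)) := ⟨hg, lt_top_iff_ne_top.2 hgt⟩
  have hgi : IntegrableOn (fun t => 2 * g t ^ 2) (Ioo 0 δ) := hg2.integrable_sq.const_mul 2
  obtain ⟨η, θ, hη, hθ, hη', hθ', hle, -⟩ := exists_seq_intervals (Q := fun _ _ => True) hδ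
    (fun m hm => by obtain ⟨t, ht⟩ := exists_between (lt_min hm hδ); exact ⟨t, ht, trivial⟩)
  have hηs : Tendsto (fun m => ‖s (η m)‖) atTop (𝓝 0) := by
    have := h0.comp (tendsto_nhdsWithin_iff.2 ⟨hη, Eventually.of_forall fun m => (hη' m).1⟩)
    simpa using this.norm
  set ε : ℕ → ℝ := fun m => η m + ‖s (η m)‖ with hε
  have hε0 : ∀ m, 0 < ε m := fun m => by have := (hη' m).1; positivity
  have hεt : Tendsto ε atTop (𝓝 0) := by simpa using hη.add hηs
  have key := lintegral_le_of_tendsto_intervals (δ := δ) (φ := fun t => 1 / 2 * (‖s t‖ ^ 2 / t ^ 2))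
    (φn := fun m t => 1 / 2 * (‖s t‖ ^ 2 / (t + ε m) ^ 2))
    (Cn := fun m => ‖s (η m)‖ + ∫ t in Ioo 0 δ, 2 * g t ^ 2)
    (C := ∫ t in Ioo 0 δ, 2 * g t ^ 2) hη hθ hη' hθ' hle ?_ ?_ ?_ ?_ ?_
  · have e1 : eLpNorm (fun t => t⁻¹ • s t) 2 (volume.restrict (Ioo 0 δ)) ^ 2 ≤
        (2 * eLpNorm g 2 (volume.restrict (Ioo 0 δ))) ^ 2 := by
      rw [mul_pow, eLpNorm_two_sq, eLpNorm_two_sq]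
      simp only [inv_smul_norm_sq, Real.norm_eq_abs, sq_abs]
      rw [← ofReal_integral_eq_lintegral_ofReal hg2.integrable_sq
        (Eventually.of_forall fun t => sq_nonneg _)]
      have e2 : ∀ t, ENNReal.ofReal (‖s t‖ ^ 2 / t ^ 2) =
          2 * ENNReal.ofReal (1 / 2 * (‖s t‖ ^ 2 / t ^ 2)) := fun t => by
        have h2 : ENNReal.ofReal 2 = 2 := by simp
        have h3 := ENNReal.ofReal_mul (p := 2) (q := 1 / 2 * (‖s t‖ ^ 2 / t ^ 2)) (by norm_num)
        rw [h2] at h3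
        rw [← h3]
        congr 1; ring
      simp only [e2]
      rw [lintegral_const_mul' _ _ (by norm_num)]
      refine (mul_le_mul_right key 2).trans ?_
      rw [integral_const_mul, ENNReal.ofReal_mul (by norm_num), ← mul_assoc]
      norm_num
    exact (ENNReal.pow_le_pow_left_iff two_ne_zero).1 e1
  · intro m
    refine continuousOn_const.mul (hs.continuousOn.norm.pow 2 |>.div (by fun_prop) ?_)
    intro t ht
    have := hε0 m; have := ht.1
    positivity
  · intro m t _
    positivity
  · intro t ht
    have : Tendsto (fun m => (t + ε m) ^ 2) atTop (𝓝 (t ^ 2)) := by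
      simpa using (hεt.const_add t).pow 2
    exact (tendsto_const_nhds.div this (pow_ne_zero 2 ht.1.ne')).const_mul _
  · intro m
    have hd : ∀ t ∈ Ioo 0 δ, HasDerivAt (fun t => (t + ε m)⁻¹) (-1 / (t + ε m) ^ 2) t := by
      intro t ht
      exact ((hasDerivAt_id t).add_const (ε m)).inv (by have := ht.1; have := hε0 m; simp; positivity)
    have hd' : ContinuousOn (fun t => -1 / (t + ε m) ^ 2) (Ioo 0 δ) := by
      refine continuousOn_const.div (by fun_prop) fun t ht => ?_
      have := hε0 m; have := ht.1
      positivity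
    have hP : ContinuousOn (fun t => 1 / 2 * (‖s t‖ ^ 2 / (t + ε m) ^ 2)) (Ioo 0 δ) := by
      refine continuousOn_const.mul (hs.continuousOn.norm.pow 2 |>.div (by fun_prop) ?_)
      intro t ht
      have := hε0 m; have := ht.1
      positivity
    have := integral_le_of_deriv_le (hs.weighted_norm_sq hd hd') (hη' m) (hθ' m) (hle m) hP hgi
      (fun t => by positivity) ?_
    · refine this.trans (add_le_add ?_ le_rfl)
      have h1 : 0 ≤ (θ m + ε m)⁻¹ * ‖s (θ m)‖ ^ 2 := by
        have := hε0 m; have := (hθ' m).1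
        positivity
      have h2 : (η m + ε m)⁻¹ * ‖s (η m)‖ ^ 2 ≤ ‖s (η m)‖ := by
        have h3 := (hη' m).1
        have h4 := norm_nonneg (s (η m))
        rw [inv_mul_le_iff₀ (by have := hε0 m; positivity)]
        simp only [hε]
        nlinarith
      linarith
    · filter_upwards [h, ae_restrict_mem measurableSet_Ioo] with t ht htm
      have hp : 0 < t + ε m := by have := hε0 m; have := htm.1; positivity
      have e1 : -1 / (t + ε m) ^ 2 * ‖s t‖ ^ 2 = - ((t + ε m)⁻¹ * ‖s t‖) ^ 2 := by field_simp
      have e2 : 1 / 2 * (‖s t‖ ^ 2 / (t + ε m) ^ 2) = 1 / 2 * ((t + ε m)⁻¹ * ‖s t‖) ^ 2 := by field_simp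
      have e3 : (t + ε m)⁻¹ * (2 * (inner ℂ (s t) (s' t) : ℂ).re) ≤
          2 * ((t + ε m)⁻¹ * ‖s t‖) * g t := by
        have : 0 < (t + ε m)⁻¹ := by positivity
        calc _ ≤ (t + ε m)⁻¹ * (2 * (‖s t‖ * g t)) := by gcongr
          _ = _ := by ring
      rw [e1, e2]
      nlinarith [sq_nonneg ((t + ε m)⁻¹ * ‖s t‖ - 2 * g t)]
  · simpa using hηs.add_const (∫ t in Ioo 0 δ, 2 * g t ^ 2)

theorem memLp_inv_smul_of_lintegral_le {m c C : ℝ} (hm : m ≤ δ) (hc : 0 < c)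
    (hs : HasWeakDeriv 0 δ s s')
    (h : ∫⁻ t in Ioo 0 m, ENNReal.ofReal (c * (‖s t‖ ^ 2 / t ^ 2)) ≤ ENNReal.ofReal C) :
    MemLp (fun t => t⁻¹ • s t) 2 (volume.restrict (Ioo 0 m)) := by
  refine ⟨hs.aestronglyMeasurable_inv_smul hm, ?_⟩
  have e1 : eLpNorm (fun t => t⁻¹ • s t) 2 (volume.restrict (Ioo 0 m)) ^ 2 < ⊤ := by
    rw [eLpNorm_two_sq]
    simp only [inv_smul_norm_sq]
    have e2 : ∀ t, ENNReal.ofReal (‖s t‖ ^ 2 / t ^ 2) =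
        ENNReal.ofReal c⁻¹ * ENNReal.ofReal (c * (‖s t‖ ^ 2 / t ^ 2)) := fun t => by
      rw [← ENNReal.ofReal_mul (by positivity)]
      congr 1
      field_simp
    simp only [e2]
    rw [lintegral_const_mul' _ _ ENNReal.ofReal_ne_top]
    exact ENNReal.mul_lt_top ENNReal.ofReal_lt_top (h.trans_lt ENNReal.ofReal_lt_top)
  by_contra hcon
  rw [not_lt, top_le_iff] at hcon
  simp [hcon] at e1

/-- Hardy's inequality for a square integrable function governed by a decaying equation. -/
theorem hardy_of_decay {lam : ℝ} (hlam : 1 / 2 < lam) (hδ : 0 < δ) (hs : HasWeakDeriv 0 δ s s')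
    (hL2 : MemLp s 2 (volume.restrict (Ioo 0 δ))) (hg : MemLp g 2 (volume.restrict (Ioo 0 δ)))
    (h : ∀ᵐ t ∂(volume.restrict (Ioo 0 δ)),
      (inner ℂ (s t) (s' t) : ℂ).re ≤ -lam * (‖s t‖ ^ 2 / t) + ‖s t‖ * g t) :
    MemLp (fun t => t⁻¹ • s t) 2 (volume.restrict (Ioo 0 δ)) := by
  set κ := 2 * lam - 1 with hκ
  have hκ0 : 0 < κ := by linarith
  have hgi : IntegrableOn (fun t => 2 / κ * g t ^ 2) (Ioo 0 δ) := hg.integrable_sq.const_mul _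
  obtain ⟨η, θ, hη, hθ, hη', hθ', hle, hQ⟩ :=
    exists_seq_intervals (Q := fun m t => t * ‖s t‖ ^ 2 < m) hδ
      (fun m hm => exists_mul_lt_of_integrableOn hδ hL2.norm.integrable_sq hm)
  set ε : ℕ → ℝ := fun m => η m + √(η m * ‖s (η m)‖ ^ 2) with hε
  have hηs : Tendsto (fun m => η m * ‖s (η m)‖ ^ 2) atTop (𝓝 0) :=
    squeeze_zero (fun m => by have := (hη' m).1; positivity)
      (fun m => (hQ m).le.trans (min_le_left _ _)) tendsto_one_div_add_atTop_nhds_zero_nat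
  have hε0 : ∀ m, 0 < ε m := fun m => by have := (hη' m).1; positivity
  have hεt : Tendsto ε atTop (𝓝 0) := by
    have := hη.add hηs.sqrt
    rwa [Real.sqrt_zero, add_zero] at this
  have hP : ∀ m, ContinuousOn (fun t => κ / 2 * (‖s t‖ ^ 2 / (t ^ 2 + ε m ^ 2))) (Ioo 0 δ) := by
    intro m
    refine continuousOn_const.mul (hs.continuousOn.norm.pow 2 |>.div (by fun_prop) ?_)
    intro t ht
    have := hε0 m; have := ht.1
    positivity
  have key := lintegral_le_of_tendsto_intervals (δ := δ) (φ := fun t => κ / 2 * (‖s t‖ ^ 2 / t ^ 2))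
    (φn := fun m t => κ / 2 * (‖s t‖ ^ 2 / (t ^ 2 + ε m ^ 2)))
    (Cn := fun m => 1 + ∫ t in Ioo 0 δ, 2 / κ * g t ^ 2)
    (C := 1 + ∫ t in Ioo 0 δ, 2 / κ * g t ^ 2) hη hθ hη' hθ' hle hP ?_ ?_ ?_ tendsto_const_nhds
  · exact memLp_inv_smul_of_lintegral_le le_rfl (by positivity) hs key
  · intro m t _
    positivity
  · intro t ht
    have : Tendsto (fun m => t ^ 2 + ε m ^ 2) atTop (𝓝 (t ^ 2)) := by
      simpa using (hεt.pow 2).const_add (t ^ 2)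
    exact (tendsto_const_nhds.div this (pow_ne_zero 2 ht.1.ne')).const_mul _
  · intro m
    have hd : ∀ t ∈ Ioo 0 δ, HasDerivAt (fun t => t / (t ^ 2 + ε m ^ 2))
        ((ε m ^ 2 - t ^ 2) / (t ^ 2 + ε m ^ 2) ^ 2) t := by
      intro t ht
      have hne : t ^ 2 + ε m ^ 2 ≠ 0 := by have := ht.1; have := hε0 m; positivity
      refine ((hasDerivAt_id t).div ((hasDerivAt_pow 2 t).add_const (ε m ^ 2)) hne).congr_deriv ?_
      simp only [id]
      congr 1
      push_cast
      ring
    have hd' : ContinuousOn (fun t => (ε m ^ 2 - t ^ 2) / (t ^ 2 + ε m ^ 2) ^ 2) (Ioo 0 δ) := by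
      refine ContinuousOn.div (by fun_prop) (by fun_prop) fun t ht => ?_
      have := hε0 m; have := ht.1
      positivity
    have := integral_le_of_deriv_le (hs.weighted_norm_sq hd hd') (hη' m) (hθ' m) (hle m) (hP m) hgi
      (fun t => by positivity) ?_
    · refine this.trans (add_le_add ?_ le_rfl)
      have h1 : 0 ≤ θ m / (θ m ^ 2 + ε m ^ 2) * ‖s (θ m)‖ ^ 2 := by
        have := (hθ' m).1
        positivity
      have h2 : η m / (η m ^ 2 + ε m ^ 2) * ‖s (η m)‖ ^ 2 ≤ 1 := by
        have h3 := (hη' m).1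
        have h4 : 0 ≤ η m * ‖s (η m)‖ ^ 2 := by positivity
        have h5 := Real.sqrt_nonneg (η m * ‖s (η m)‖ ^ 2)
        have h6 := Real.sq_sqrt h4
        have h7 : η m * ‖s (η m)‖ ^ 2 ≤ ε m ^ 2 := by simp only [hε]; nlinarith
        rw [div_mul_eq_mul_div, div_le_one (by have := hε0 m; positivity)]
        nlinarith
      linarith
    · filter_upwards [h, ae_restrict_mem measurableSet_Ioo] with t ht htm
      have htp := htm.1
      have hεp := hε0 m
      set D := t ^ 2 + ε m ^ 2 with hD
      have hDp : 0 < D := by positivity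
      set N := ‖s t‖ with hN
      have e1 : (ε m ^ 2 - t ^ 2) / D ^ 2 ≤ 1 / D := by
        rw [div_le_div_iff₀ (by positivity) hDp]
        nlinarith [sq_nonneg t, mul_nonneg (sq_nonneg t) hDp.le]
      have e3 : t / D * (2 * (inner ℂ (s t) (s' t) : ℂ).re) ≤
          -(2 * lam) * (N ^ 2 / D) + 2 * (t / D) * N * g t := by
        calc _ ≤ t / D * (2 * (-lam * (N ^ 2 / t) + N * g t)) := by gcongr
          _ = _ := by field_simp
      have e4 : 2 * (t / D) * N * g t ≤ κ / 2 * (N ^ 2 / D) + 2 / κ * g t ^ 2 := by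
        have : κ / 2 * (N ^ 2 / D) + 2 / κ * g t ^ 2 - 2 * (t / D) * N * g t =
            1 / (2 * κ * D) * ((κ * N - 2 * t * g t) ^ 2 + 4 * ε m ^ 2 * g t ^ 2) := by
          rw [hD]; field_simp; ring
        have h2 : 0 ≤ 1 / (2 * κ * D) * ((κ * N - 2 * t * g t) ^ 2 + 4 * ε m ^ 2 * g t ^ 2) := by
          positivity
        linarith
      have e5 : (ε m ^ 2 - t ^ 2) / D ^ 2 * N ^ 2 ≤ 1 / D * N ^ 2 := by gcongr
      have e6 : 1 / D * N ^ 2 = N ^ 2 / D := by ring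
      have e7 : 0 ≤ N ^ 2 / D := by positivity
      rw [e6] at e5
      nlinarith

/-- Hardy's inequality for a function governed by a growing equation. -/
theorem hardy_of_growth {lam : ℝ} (hlam : 1 / 2 < lam) (hδ : 0 < δ) (hs : HasWeakDeriv 0 δ s s')
    (hL2 : MemLp s 2 (volume.restrict (Ioo 0 δ))) (hg : MemLp g 2 (volume.restrict (Ioo 0 δ)))
    (h : ∀ᵐ t ∂(volume.restrict (Ioo 0 δ)),
      lam * (‖s t‖ ^ 2 / t) - ‖s t‖ * g t ≤ (inner ℂ (s t) (s' t) : ℂ).re) :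
    MemLp (fun t => t⁻¹ • s t) 2 (volume.restrict (Ioo 0 δ)) := by
  set κ := 2 * lam - 1 with hκ
  have hκ0 : 0 < κ := by linarith
  have hδ2 : (0 : ℝ) < δ / 2 := by positivity
  have hδ2' : δ / 2 ≤ δ := by linarith
  have hsub : Ioo 0 (δ / 2) ⊆ Ioo 0 δ := Ioo_subset_Ioo_right hδ2'
  have hgi : IntegrableOn (fun t => 2 / κ * g t ^ 2) (Ioo 0 (δ / 2)) :=
    IntegrableOn.mono_set (hg.integrable_sq.const_mul _) hsub
  obtain ⟨η, θ, hη, hθ, hη', hθ', hle, -⟩ := exists_seq_intervals (Q := fun _ _ => True) hδ2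
    (fun m hm => by obtain ⟨t, ht⟩ := exists_between (lt_min hm hδ2); exact ⟨t, ht, trivial⟩)
  have hs2 := hs.mono hsub
  have hP : ContinuousOn (fun t => κ / 2 * (‖s t‖ ^ 2 / t ^ 2)) (Ioo 0 (δ / 2)) := by
    refine continuousOn_const.mul (hs2.continuousOn.norm.pow 2 |>.div (by fun_prop) ?_)
    intro t ht
    have := ht.1
    positivity
  have hmid : δ / 2 ∈ Ioo 0 δ := ⟨hδ2, by linarith⟩
  have key := lintegral_le_of_tendsto_intervals (δ := δ / 2)
    (φ := fun t => κ / 2 * (‖s t‖ ^ 2 / t ^ 2))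
    (φn := fun m t => κ / 2 * (‖s t‖ ^ 2 / t ^ 2))
    (Cn := fun m => (θ m)⁻¹ * ‖s (θ m)‖ ^ 2 + ∫ t in Ioo 0 (δ / 2), 2 / κ * g t ^ 2)
    (C := (δ / 2)⁻¹ * ‖s (δ / 2)‖ ^ 2 + ∫ t in Ioo 0 (δ / 2), 2 / κ * g t ^ 2)
    hη hθ hη' hθ' hle (fun _ => hP) ?_ ?_ ?_ ?_
  · have h1 := memLp_inv_smul_of_lintegral_le hδ2' (by positivity) hs key
    have hmono : volume.restrict (Ico (δ / 2) δ) ≤ volume.restrict (Ioo 0 δ) :=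
      Measure.restrict_mono (fun t ht => mem_Ioo.2 ⟨hδ2.trans_le ht.1, ht.2⟩) le_rfl
    have h2 : MemLp (fun t => t⁻¹ • s t) 2 (volume.restrict (Ico (δ / 2) δ)) := by
      refine (hL2.mono_measure hmono).of_le_mul (c := 2 / δ) ?_ ?_
      · exact (hs.aestronglyMeasurable_inv_smul le_rfl).mono_measure hmono
      · filter_upwards [ae_restrict_mem measurableSet_Ico] with t ht
        have htp : 0 < t := hδ2.trans_le ht.1
        rw [norm_smul, norm_inv, Real.norm_of_nonneg htp.le]
        gcongr
        rw [inv_le_comm₀ htp (by positivity), inv_div]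
        exact ht.1
    have h3 : Ioo 0 δ = Ioo 0 (δ / 2) ∪ Ico (δ / 2) δ := (Ioo_union_Ico_eq_Ioo hδ2 hδ2').symm
    rw [h3]
    refine ⟨by rw [← h3]; exact hs.aestronglyMeasurable_inv_smul le_rfl, ?_⟩
    exact (eLpNorm_restrict_union_le _ _ _).trans_lt (ENNReal.add_lt_top.2 ⟨h1.2, h2.2⟩)
  · intro m t _
    positivity
  · exact fun t _ => tendsto_const_nhds
  · intro m
    have hd : ∀ t ∈ Ioo 0 (δ / 2), HasDerivAt (fun t : ℝ => -t⁻¹) (- (-(t ^ 2)⁻¹)) t :=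
      fun t ht => (hasDerivAt_inv ht.1.ne').neg
    have hd' : ContinuousOn (fun t : ℝ => - (-(t ^ 2)⁻¹)) (Ioo 0 (δ / 2)) := by
      refine ContinuousOn.neg (ContinuousOn.neg (ContinuousOn.inv₀ (by fun_prop) fun t ht => ?_))
      have := ht.1
      positivity
    have := integral_le_of_deriv_le (hs2.weighted_norm_sq hd hd') (hη' m) (hθ' m) (hle m) hP hgi
      (fun t => by positivity) ?_
    · refine this.trans (add_le_add ?_ le_rfl)
      have h1 : 0 ≤ (η m)⁻¹ * ‖s (η m)‖ ^ 2 := by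
        have := (hη' m).1
        positivity
      linarith
    · filter_upwards [ae_restrict_of_ae_restrict_of_subset hsub h,
        ae_restrict_mem measurableSet_Ioo] with t ht htm
      have htp := htm.1
      set N := ‖s t‖ with hN
      have e3 : 2 * lam * (N ^ 2 / t ^ 2) - 2 * (N / t) * g t ≤
          t⁻¹ * (2 * (inner ℂ (s t) (s' t) : ℂ).re) := by
        calc _ = t⁻¹ * (2 * (lam * (N ^ 2 / t) - N * g t)) := by field_simp
          _ ≤ _ := by gcongr
      have e4 : 2 * (N / t) * g t ≤ κ / 2 * (N ^ 2 / t ^ 2) + 2 / κ * g t ^ 2 := by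
        have : κ / 2 * (N ^ 2 / t ^ 2) + 2 / κ * g t ^ 2 - 2 * (N / t) * g t =
            1 / (2 * κ) * (κ * (N / t) - 2 * g t) ^ 2 := by
          field_simp; ring
        have h2 : 0 ≤ 1 / (2 * κ) * (κ * (N / t) - 2 * g t) ^ 2 := by positivity
        linarith
      have e5 : -(-(t ^ 2)⁻¹) * N ^ 2 = N ^ 2 / t ^ 2 := by field_simp
      rw [e5, neg_mul]
      nlinarith
  · refine Tendsto.add_const _ ?_
    have hc : ContinuousAt (fun t => t⁻¹ * ‖s t‖ ^ 2) (δ / 2) :=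
      (continuousAt_inv₀ hδ2.ne').mul
        (((hs.continuousOn.continuousAt (Ioo_mem_nhds hmid.1 hmid.2)).norm).pow 2)
    exact hc.tendsto.comp hθ

end Hardy

end CaloronNahm

namespace CaloronNahm

section Residue

variable {n : ℕ} {Q A B : EndV n}

/-- The residues `A`, `B` at a simple pole of `α = T₀ - iT₃`, `β = T₁ + iT₂`, supported on the range
of the orthogonal projection `Q`. -/
structure IsResidue (Q A B : EndV n) : Prop where
  proj_sq : Q * Q = Q
  proj_star : star Q = Q
  proj_mul_left : Q * A = A
  mul_proj_left : A * Q = A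
  proj_mul_right : Q * B = B
  mul_proj_right : B * Q = B
  star_left : star A = A
  comm : A * B - B * A = B
  comm_star : B * star B - star B * B = (2 : ℂ) • A

theorem EndV.star_sub (X Y : EndV n) : star (X - Y) = star X - star Y := _root_.star_sub X Y

theorem EndV.star_add (X Y : EndV n) : star (X + Y) = star X + star Y := StarAddMonoid.star_add X Y

theorem EndV.star_zero : star (0 : EndV n) = 0 := _root_.star_zero (EndV n)

theorem EndV.star_smul (c : ℂ) (X : EndV n) : star (c • X) = (starRingEnd ℂ) c • star X :=
  StarModule.star_smul c X

theorem EndV.norm_star (X : EndV n) : ‖star X‖ = ‖X‖ := _root_.norm_star X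

theorem inner_star_left (X : EndV n) (v w : V n) : inner ℂ (star X v) w = inner ℂ v (X w) := by
  rw [ContinuousLinearMap.star_eq_adjoint, ContinuousLinearMap.adjoint_inner_left]

theorem inner_star_right (X : EndV n) (v w : V n) : inner ℂ v (star X w) = inner ℂ (X v) w := by
  rw [ContinuousLinearMap.star_eq_adjoint, ContinuousLinearMap.adjoint_inner_right]

theorem isResidue_zero (h : Q * Q = Q) (h' : star Q = Q) : IsResidue Q 0 0 :=
  ⟨h, h', mul_zero _, zero_mul _, mul_zero _, zero_mul _, EndV.star_zero, by simp,
    by rw [EndV.star_zero, mul_zero, sub_zero]; exact (smul_zero (2 : ℂ)).symm⟩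

namespace IsResidue

theorem comm_apply (h : IsResidue Q A B) (v : V n) : A (B v) = B (A v) + B v := by
  have := congrArg (fun X : EndV n => X v) h.comm
  simp only [sub_apply, mul_apply_eq_comp] at this
  rw [sub_eq_iff_eq_add] at this
  rw [this, add_comm]

theorem comm_star_apply (h : IsResidue Q A B) (v : V n) :
    B (star B v) = star B (B v) + (2 : ℂ) • A v := by
  have := congrArg (fun X : EndV n => X v) h.comm_star
  simp only [sub_apply, mul_apply_eq_comp, smul_apply] at this
  rw [sub_eq_iff_eq_add] at this
  rw [this, add_comm]

theorem comm_star' (h : IsResidue Q A B) : star B * A - A * star B = star B := by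
  have := congrArg star h.comm
  rwa [EndV.star_sub, star_mul, star_mul, h.star_left] at this

theorem comm_star_apply' (h : IsResidue Q A B) (v : V n) :
    A (star B v) = star B (A v) - star B v := by
  have := congrArg (fun X : EndV n => X v) h.comm_star'
  simp only [sub_apply, mul_apply_eq_comp] at this
  rw [sub_eq_iff_eq_add] at this
  rw [this, add_sub_cancel_left]

theorem proj_mul_star (h : IsResidue Q A B) : Q * star B = star B := by
  have := congrArg star h.mul_proj_right
  simpa [h.proj_star] using this

theorem star_mul_proj (h : IsResidue Q A B) : star B * Q = star B := by
  have := congrArg star h.proj_mul_right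
  simpa [h.proj_star] using this

theorem exists_decomposition (h : IsResidue Q A B) : ∃ P L : EndV n, Q = L * B + P ∧ star P = P ∧
    P * Q = P ∧ Q * P = P ∧ P * P = P ∧ A * P = P * A ∧ ∀ v, 0 ≤ (inner ℂ (P v) (A (P v)) : ℂ).re := by
  set K : Submodule ℂ (V n) := LinearMap.ker (B : V n →ₗ[ℂ] V n) with hK
  set E : EndV n := K.starProjection with hE
  have hBE : ∀ v, B (E v) = 0 := fun v => by
    have : E v ∈ K := Submodule.starProjection_apply_mem K v
    exact this
  have hEK : ∀ v, B v = 0 → E v = v := fun v hv =>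
    Submodule.starProjection_eq_self_iff.2 (show v ∈ K from hv)
  have hEE : E * E = E := by ext1 v; exact hEK _ (hBE v)
  have hEs : star E = E := by
    rw [ContinuousLinearMap.star_eq_adjoint]
    exact (isSelfAdjoint_starProjection K)
  have hEQ : E * Q = Q * E := by
    have e1 : E * (1 - Q) = 1 - Q := by
      ext1 v
      apply hEK
      change B (v - Q v) = 0
      rw [map_sub, sub_eq_zero]
      exact (congrArg (fun X : EndV n => X v) h.mul_proj_right).symm
    have e2 : (1 - Q) * E = 1 - Q := by
      have := congrArg star e1
      rwa [star_mul, EndV.star_sub, star_one, hEs, h.proj_star] at this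
    rw [mul_sub, mul_one] at e1
    rw [sub_mul, one_mul] at e2
    have : E - E * Q = E - Q * E := e1.trans e2.symm
    exact sub_right_injective this
  have hEA : A * E = E * A := by
    have e1 : E * (A * E) = A * E := by
      ext1 v
      apply hEK
      change B (A (E v)) = 0
      have := h.comm_apply (E v)
      rw [hBE, map_zero, add_zero] at this
      exact this.symm
    have e2 : E * A * E = E * A := by
      have := congrArg star e1
      simpa [hEs, h.star_left, mul_assoc] using this
    rw [← e1, ← mul_assoc, e2]
  obtain ⟨g, hg⟩ := LinearMap.exists_leftInverse_of_injective
    ((B : V n →ₗ[ℂ] V n).prod (E : V n →ₗ[ℂ] V n)) (by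
      rw [LinearMap.ker_eq_bot']
      intro v hv
      have h1 : B v = 0 := congrArg Prod.fst hv
      have h2 : E v = 0 := congrArg Prod.snd hv
      rw [← hEK v h1, h2])
  have hg' : ∀ v, g (B v, E v) = v := fun v => LinearMap.congr_fun hg v
  set L : EndV n := LinearMap.toContinuousLinearMap (g ∘ₗ LinearMap.inl ℂ (V n) (V n)) with hL
  have hLB : L * B = 1 - E := by
    ext1 v
    have h1 : g (B v, E v) = g (B v, 0) + g (0, E v) := by rw [← map_add]; simp
    have h2 : g (0, E v) = E v := by
      have := hg' (E v)
      rwa [hBE, hEK _ (hBE v)] at this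
    change g (B v, 0) = v - E v
    rw [eq_sub_iff_add_eq, ← h2, ← h1, hg']
  refine ⟨E * Q, L, ?_, ?_, ?_, ?_, ?_, ?_, ?_⟩
  · have : L * B * Q + E * Q = Q := by rw [hLB, ← add_mul, sub_add_cancel, one_mul]
    rw [mul_assoc, h.mul_proj_right] at this
    exact this.symm
  · rw [star_mul, hEs, h.proj_star, hEQ]
  · rw [mul_assoc, h.proj_sq]
  · rw [hEQ, ← mul_assoc, h.proj_sq]
  · rw [mul_assoc, ← mul_assoc Q, ← hEQ, mul_assoc, h.proj_sq, ← mul_assoc, hEE]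
  · rw [← mul_assoc, hEA, mul_assoc, mul_assoc, h.mul_proj_left, h.proj_mul_left]
  · intro v
    set u := (E * Q) v with hu
    have hBu : B u = 0 := hBE (Q v)
    have h1 : (2 : ℂ) * inner ℂ u (A u) = (‖star B u‖ ^ 2 : ℝ) := by
      have h2 := h.comm_star_apply u
      rw [hBu, map_zero, zero_add] at h2
      rw [← inner_smul_right, ← h2, ← inner_star_left, inner_self_eq_norm_sq_to_K]
      push_cast
      rfl
    have h2 := congrArg Complex.re h1
    rw [Complex.ofReal_re, ← Complex.ofReal_ofNat, Complex.re_ofReal_mul] at h2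
    nlinarith [sq_nonneg ‖star B u‖]

theorem casimir_comm_left (h : IsResidue Q A B) (v : V n) :
    A (A (A v) + A v + star B (B v)) = A (A (A v)) + A (A v) + star B (B (A v)) := by
  rw [map_add, map_add, h.comm_star_apply', h.comm_apply, map_add]
  abel

theorem casimir_comm_right (h : IsResidue Q A B) (v : V n) :
    B (A (A v) + A v + star B (B v)) = A (A (B v)) + A (B v) + star B (B (B v)) := by
  have e1 := h.comm_star_apply (B v)
  rw [map_add, map_add, e1, h.comm_apply v, map_add, h.comm_apply (A v), h.comm_apply v]
  module

theorem casimir_comm_star (h : IsResidue Q A B) (v : V n) :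
    star B (A (A v) + A v + star B (B v)) =
      A (A (star B v)) + A (star B v) + star B (B (star B v)) := by
  have e1 := h.comm_star_apply v
  rw [map_add, map_add, e1, h.comm_star_apply', map_sub, h.comm_star_apply', h.comm_star_apply',
    map_add, map_smul]
  module

theorem exists_highest_weight (h : IsResidue Q A B) (hQ : Q ≠ 0) :
    ∃ (v : V n) (m : ℝ), v ≠ 0 ∧ Q v = v ∧ B v = 0 ∧ A v = (m : ℂ) • v ∧
      ‖star B v‖ ^ 2 = 2 * m * ‖v‖ ^ 2 := by
  set S : Set ℂ := {μ | ∃ v : V n, v ≠ 0 ∧ Q v = v ∧ A v = μ • v} with hS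
  have hSf : S.Finite := by
    refine (Module.End.finite_hasEigenvalue (A : V n →ₗ[ℂ] V n)).subset ?_
    rintro μ ⟨v, h1, -, h2⟩
    exact Module.End.hasEigenvalue_of_hasEigenvector (x := v)
      ⟨Module.End.mem_eigenspace_iff.2 h2, h1⟩
  have hSn : S.Nonempty := by
    set W : Submodule ℂ (V n) := LinearMap.range (Q : V n →ₗ[ℂ] V n) with hW
    have hWA : ∀ w ∈ W, (A : V n →ₗ[ℂ] V n) w ∈ W := by
      intro w _
      exact ⟨A w, congrArg (fun X : EndV n => X w) h.proj_mul_left⟩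
    have : Nontrivial W := by
      obtain ⟨v, hv⟩ : ∃ v, Q v ≠ 0 := by
        by_contra! hcon
        exact hQ (ContinuousLinearMap.ext hcon)
      exact ⟨⟨⟨Q v, v, rfl⟩, 0, fun e => hv (congrArg Subtype.val e)⟩⟩
    obtain ⟨μ, hμ⟩ := Module.End.exists_eigenvalue ((A : V n →ₗ[ℂ] V n).restrict hWA)
    obtain ⟨⟨v, ⟨v', hv'⟩⟩, hv1, hv2⟩ := hμ.exists_hasEigenvector
    refine ⟨μ, v, fun e => hv2 (Subtype.ext e), ?_, ?_⟩
    · rw [← hv']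
      exact congrArg (fun X : EndV n => X v') h.proj_sq
    · exact congrArg Subtype.val (Module.End.mem_eigenspace_iff.1 hv1)
  obtain ⟨μ, ⟨v, hv0, hvQ, hvA⟩, hmax⟩ := hSf.exists_maximalFor Complex.re S hSn
  have hBv : B v = 0 := by
    by_contra hB
    have : μ + 1 ∈ S := by
      refine ⟨B v, hB, congrArg (fun X : EndV n => X v) h.proj_mul_right, ?_⟩
      rw [h.comm_apply, hvA, map_smul]
      module
    have h1 := hmax this (by simp)
    simp at h1
    linarith
  have hnorm : (2 : ℂ) * μ * (‖v‖ ^ 2 : ℝ) = (‖star B v‖ ^ 2 : ℝ) := by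
    have h2 := h.comm_star_apply v
    rw [hBv, map_zero, zero_add, hvA] at h2
    have h3 : inner ℂ (star B v) (star B v) = (2 : ℂ) * μ * inner ℂ v v := by
      rw [inner_star_left, h2, inner_smul_right, inner_smul_right]
      ring
    rw [inner_self_eq_norm_sq_to_K, inner_self_eq_norm_sq_to_K] at h3
    push_cast
    exact h3.symm
  have hvn : (‖v‖ ^ 2 : ℝ) ≠ 0 := by simpa using hv0
  have hμ : μ = ((‖star B v‖ ^ 2 / (2 * ‖v‖ ^ 2) : ℝ) : ℂ) := by
    have : ((‖v‖ ^ 2 : ℝ) : ℂ) ≠ 0 := Complex.ofReal_ne_zero.2 hvn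
    push_cast at this hnorm ⊢
    rw [eq_div_iff (mul_ne_zero two_ne_zero this), ← hnorm]
    ring
  refine ⟨v, _, hv0, hvQ, hBv, by rw [← hμ]; exact hvA, ?_⟩
  field_simp

/-- The Casimir element of an irreducible representation of dimension other than two is either zero
or larger than `3/4`. -/
theorem casimir (h : IsResidue Q A B) {j : ℕ} (hj : j ≠ 2)
    (hrank : Module.finrank ℂ (LinearMap.range (Q : V n →ₗ[ℂ] V n)) = j)
    (hirr : ∀ W : Submodule ℂ (V n), W ≤ LinearMap.range (Q : V n →ₗ[ℂ] V n) →
      (∀ w ∈ W, A w ∈ W ∧ B w ∈ W ∧ star B w ∈ W) → W = ⊥ ∨ W = LinearMap.range (Q : V n →ₗ[ℂ] V n)) :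
    (A = 0 ∧ B = 0) ∨ ∃ c : ℝ, 3 / 4 < c ∧ A * A + A + star B * B = (c : ℂ) • Q := by
  by_cases hQ : Q = 0
  · left
    exact ⟨by rw [← h.proj_mul_left, hQ, zero_mul], by rw [← h.proj_mul_right, hQ, zero_mul]⟩
  obtain ⟨v, m, hv0, hvQ, hvB, hvA, hvm⟩ := h.exists_highest_weight hQ
  have hvn : 0 < ‖v‖ ^ 2 := by positivity
  have hm0 : 0 ≤ m := by
    by_contra! hm
    have := sq_nonneg ‖star B v‖
    rw [hvm] at this
    nlinarith
  set v' := star B v with hv'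
  have hv'B : B v' = (2 * m : ℂ) • v := by
    rw [hv', h.comm_star_apply, hvB, map_zero, hvA, smul_smul, zero_add]
  have hv'A : A v' = ((m : ℂ) - 1) • v' := by
    rw [hv', h.comm_star_apply', hvA, map_smul]
    module
  have hv'' : (‖star B v'‖ ^ 2 : ℝ) = (4 * m - 2) * ‖v'‖ ^ 2 := by
    have h1 : inner ℂ (star B v') (star B v') = ((4 * m - 2 : ℝ) : ℂ) * inner ℂ v' v' := by
      rw [inner_star_left, h.comm_star_apply, hv'B, hv'A, map_smul, ← hv', smul_smul, ← add_smul,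
        inner_smul_right]
      push_cast
      ring
    rw [inner_self_eq_norm_sq_to_K, inner_self_eq_norm_sq_to_K] at h1
    refine Complex.ofReal_injective ?_
    push_cast at h1 ⊢
    exact h1
  set R := LinearMap.range (Q : V n →ₗ[ℂ] V n) with hR
  have hQv : ∀ w, Q w = w → w ∈ R := fun w hw => ⟨w, hw⟩
  have hRQ : ∀ w ∈ R, Q w = w := by
    rintro _ ⟨w, rfl⟩
    exact congrArg (fun X : EndV n => X w) h.proj_sq
  have hvR : v ∈ R := hQv v hvQ
  have hv'R : v' ∈ R := hQv v' (congrArg (fun X : EndV n => X v) h.proj_mul_star)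
  have hAB : (∀ w ∈ R, B w = 0) → A = 0 ∧ B = 0 := by
    intro hB
    have hB0 : B = 0 := by
      ext1 w
      rw [← h.mul_proj_right]
      exact hB _ ⟨w, rfl⟩
    refine ⟨?_, hB0⟩
    have := h.comm_star
    rw [hB0] at this
    rw [EndV.star_zero, mul_zero, sub_zero] at this
    exact (smul_eq_zero.1 this.symm).resolve_left two_ne_zero
  have hspan : ∀ W : Submodule ℂ (V n), v ∈ W → W ≤ R → (∀ w ∈ W, A w ∈ W ∧ B w ∈ W ∧ star B w ∈ W) →
      W = R := by
    intro W hvW hWR hinv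
    refine (hirr W hWR hinv).resolve_left fun e => hv0 ?_
    rw [e] at hvW
    exact (Submodule.mem_bot ℂ).1 hvW
  rcases hm0.eq_or_lt with hm | hm
  · left
    have hv'0 : v' = 0 := by
      rw [← hm, mul_zero, zero_mul] at hvm
      simpa using hvm
    have hW := hspan (Submodule.span ℂ {v}) (Submodule.mem_span_singleton_self v)
      (by rw [Submodule.span_singleton_le_iff_mem]; exact hvR) (by
        intro w hw
        obtain ⟨c, rfl⟩ := Submodule.mem_span_singleton.1 hw
        rw [map_smul, map_smul, map_smul, hvA, hvB, ← hv', hv'0, ← hm]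
        simp)
    refine hAB fun w hw => ?_
    rw [← hW] at hw
    obtain ⟨c, rfl⟩ := Submodule.mem_span_singleton.1 hw
    rw [map_smul, hvB, smul_zero]
  · have hv'n : 0 < ‖v'‖ ^ 2 := by rw [hvm]; positivity
    have hm2 : 1 / 2 ≤ m := by
      by_contra! hcon
      have := sq_nonneg ‖star B v'‖
      rw [hv''] at this
      nlinarith
    rcases hm2.eq_or_lt with hm2 | hm2
    · have hv''0 : star B v' = 0 := by
        have : ‖star B v'‖ ^ 2 = 0 := by rw [hv'', ← hm2]; norm_num
        simpa using this
      have hW := hspan (Submodule.span ℂ {v, v'}) (Submodule.subset_span (by simp))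
        (by
          rw [Submodule.span_le]
          rintro w (rfl | rfl)
          · exact hvR
          · exact hv'R) (by
          intro w hw
          obtain ⟨c, d, rfl⟩ := Submodule.mem_span_pair.1 hw
          simp only [map_add, map_smul, hvA, hvB, ← hv', hv''0, hv'A, hv'B, smul_zero, zero_add,
            add_zero]
          refine ⟨?_, ?_, ?_⟩
          · exact Submodule.mem_span_pair.2 ⟨c * m, d * (m - 1), by module⟩
          · exact Submodule.mem_span_pair.2 ⟨d * (2 * m), 0, by module⟩
          · exact Submodule.mem_span_pair.2 ⟨0, c, by module⟩)
      have h2 : Module.finrank ℂ R ≤ 2 := by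
        rw [← hW]
        classical
        have := (finrank_span_finset_le_card (R := ℂ) ({v, v'} : Finset (V n))).trans
          Finset.card_le_two
        rwa [Finset.coe_pair] at this
      left
      rw [hrank] at h2
      have hj1 : j ≤ 1 := by omega
      refine hAB fun w hw => ?_
      have h3 := (finrank_le_one_iff (K := ℂ) (V := R)).1 (by omega)
      obtain ⟨u, hu⟩ := h3
      obtain ⟨c, hc⟩ := hu ⟨v, hvR⟩
      obtain ⟨d, hd⟩ := hu ⟨w, hw⟩
      have hc' : c • (u : V n) = v := congrArg Subtype.val hc
      have hd' : d • (u : V n) = w := congrArg Subtype.val hd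
      have hc0 : c ≠ 0 := by
        rintro rfl
        rw [zero_smul] at hc'
        exact hv0 hc'.symm
      have hBu : B (u : V n) = 0 := by
        have := congrArg B hc'
        rw [map_smul, hvB] at this
        exact (smul_eq_zero.1 this).resolve_left hc0
      rw [← hd', map_smul, hBu, smul_zero]
    · right
      refine ⟨m * m + m, by nlinarith, ?_⟩
      set W : Submodule ℂ (V n) := R ⊓ LinearMap.ker
        ((A * A + A + star B * B - (((m * m + m : ℝ) : ℂ) • (1 : EndV n)) : EndV n) :
          V n →ₗ[ℂ] V n) with hWdef
      have hmemW : ∀ w, w ∈ W ↔ w ∈ R ∧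
          A (A w) + A w + star B (B w) = ((m * m + m : ℝ) : ℂ) • w := by
        intro w
        rw [hWdef, Submodule.mem_inf, LinearMap.mem_ker]
        refine and_congr_right fun _ => ?_
        change A (A w) + A w + star B (B w) - ((m * m + m : ℝ) : ℂ) • w = 0 ↔ _
        rw [sub_eq_zero]
      have hW := hspan W (by
          rw [hmemW]
          refine ⟨hvR, ?_⟩
          rw [hvB, map_zero, hvA, map_smul, hvA]
          push_cast
          module) inf_le_left (by
          intro w hw
          obtain ⟨hw1, hw2⟩ := (hmemW w).1 hw
          refine ⟨(hmemW _).2 ⟨?_, ?_⟩, (hmemW _).2 ⟨?_, ?_⟩, (hmemW _).2 ⟨?_, ?_⟩⟩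
          · exact hQv _ (congrArg (fun X : EndV n => X w) h.proj_mul_left)
          · rw [← h.casimir_comm_left, hw2, map_smul]
          · exact hQv _ (congrArg (fun X : EndV n => X w) h.proj_mul_right)
          · rw [← h.casimir_comm_right, hw2, map_smul]
          · exact hQv _ (congrArg (fun X : EndV n => X w) h.proj_mul_star)
          · rw [← h.casimir_comm_star, hw2, map_smul])
      ext1 w
      have hw : Q w ∈ W := by rw [hW]; exact ⟨w, rfl⟩
      have h1 := ((hmemW _).1 hw).2
      have e1 : A (Q w) = A w := congrArg (fun X : EndV n => X w) h.mul_proj_left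
      have e2 : B (Q w) = B w := congrArg (fun X : EndV n => X w) h.mul_proj_right
      rw [e1, e2] at h1
      exact h1

end IsResidue

end Residue

end CaloronNahm

namespace CaloronNahm

theorem eLpNorm_le_of_norm_le_add {Ω E F₁ F₂ F₃ : Type*} [MeasurableSpace Ω] {μ : Measure Ω}
    [NormedAddCommGroup E] [NormedAddCommGroup F₁] [NormedAddCommGroup F₂] [NormedAddCommGroup F₃]
    {f : Ω → E} {g₁ : Ω → F₁} {g₂ : Ω → F₂} {g₃ : Ω → F₃} {c : ℝ}
    (h₁ : AEStronglyMeasurable g₁ μ) (h₂ : AEStronglyMeasurable g₂ μ)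
    (h₃ : AEStronglyMeasurable g₃ μ)
    (h : ∀ᵐ t ∂μ, ‖f t‖ ≤ c * (‖g₁ t‖ + ‖g₂ t‖ + ‖g₃ t‖)) :
    eLpNorm f 2 μ ≤ ENNReal.ofReal c * (eLpNorm g₁ 2 μ + eLpNorm g₂ 2 μ + eLpNorm g₃ 2 μ) := by
  have h1 : eLpNorm f 2 μ ≤ ENNReal.ofReal c * eLpNorm (fun t => ‖g₁ t‖ + ‖g₂ t‖ + ‖g₃ t‖) 2 μ := by
    refine eLpNorm_le_mul_eLpNorm_of_ae_le_mul ?_ 2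
    filter_upwards [h] with t ht
    rwa [Real.norm_of_nonneg (by positivity : 0 ≤ ‖g₁ t‖ + ‖g₂ t‖ + ‖g₃ t‖)]
  refine h1.trans (mul_le_mul_right ?_ _)
  refine (eLpNorm_add_le (h₁.norm.add h₂.norm) h₃.norm one_le_two).trans ?_
  rw [eLpNorm_norm g₃]
  gcongr
  refine (eLpNorm_add_le h₁.norm h₂.norm one_le_two).trans ?_
  rw [eLpNorm_norm, eLpNorm_norm]

theorem eLpNorm_le_of_norm_le_add₂ {Ω E F₁ F₂ : Type*} [MeasurableSpace Ω] {μ : Measure Ω}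
    [NormedAddCommGroup E] [NormedAddCommGroup F₁] [NormedAddCommGroup F₂]
    {f : Ω → E} {g₁ : Ω → F₁} {g₂ : Ω → F₂} {c : ℝ}
    (h₁ : AEStronglyMeasurable g₁ μ) (h₂ : AEStronglyMeasurable g₂ μ)
    (h : ∀ᵐ t ∂μ, ‖f t‖ ≤ c * (‖g₁ t‖ + ‖g₂ t‖)) :
    eLpNorm f 2 μ ≤ ENNReal.ofReal c * (eLpNorm g₁ 2 μ + eLpNorm g₂ 2 μ) := by
  have := eLpNorm_le_of_norm_le_add (f := f) (c := c) h₁ h₂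
    (aestronglyMeasurable_zero (β := ℝ) (μ := μ)) (by simpa using h)
  simpa using this

section Pole

variable {n : ℕ} {δ K : ℝ} {α β : ℝ → EndV n} {Q A B : EndV n} {s s' : ℝ → V n}

/-- On `(0, δ)` the endomorphisms `α`, `β` have at most a simple pole at `0`, with residues
`A`, `B` of `su(2)` type. -/
structure Pole (δ K : ℝ) (α β : ℝ → EndV n) (Q A B : EndV n) : Prop where
  pos : 0 < δ
  res : IsResidue Q A B
  cont_left : ContinuousOn α (Ioo 0 δ)
  cont_right : ContinuousOn β (Ioo 0 δ)
  bound_left : ∀ t ∈ Ioo 0 δ, ‖α t - t⁻¹ • A‖ ≤ K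
  bound_right : ∀ t ∈ Ioo 0 δ, ‖β t - t⁻¹ • B‖ ≤ K

theorem aestronglyMeasurable_apply {a b : ℝ} {T : ℝ → EndV n} {u : ℝ → V n}
    (hT : ContinuousOn T (Ioo a b)) (hu : AEStronglyMeasurable u (volume.restrict (Ioo a b))) :
    AEStronglyMeasurable (fun t => T t (u t)) (volume.restrict (Ioo a b)) :=
  (isBoundedBilinearMap_apply (𝕜 := ℂ) (E := V n) (F := V n)).continuous.comp_aestronglyMeasurable
    ((hT.aestronglyMeasurable measurableSet_Ioo).prodMk hu)

theorem rsmul_apply_eq (X : EndV n) (r : ℝ) (v : V n) : (r • X) v = r • X v := rfl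

theorem norm_apply_le_of_norm_sub_le {X Y : EndV n} {t : ℝ} (h : ‖X - t⁻¹ • Y‖ ≤ K) (v : V n) :
    ‖X v - t⁻¹ • Y v‖ ≤ K * ‖v‖ :=
  (ContinuousLinearMap.le_opNorm (X - t⁻¹ • Y) v).trans (by gcongr)

namespace Pole

theorem bound_nonneg (h : Pole δ K α β Q A B) : 0 ≤ K := by
  obtain ⟨t, ht⟩ := exists_between h.pos
  exact (norm_nonneg _).trans (h.bound_left t ht)

theorem aestronglyMeasurable_left (h : Pole δ K α β Q A B) (hs : HasWeakDeriv 0 δ s s') :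
    AEStronglyMeasurable (fun t => α t (s t)) (volume.restrict (Ioo 0 δ)) :=
  aestronglyMeasurable_apply h.cont_left hs.aestronglyMeasurable

theorem aestronglyMeasurable_right (h : Pole δ K α β Q A B) (hs : HasWeakDeriv 0 δ s s') :
    AEStronglyMeasurable (fun t => β t (s t)) (volume.restrict (Ioo 0 δ)) :=
  aestronglyMeasurable_apply h.cont_right hs.aestronglyMeasurable

theorem norm_left_le (h : Pole δ K α β Q A B) {t : ℝ} (ht : t ∈ Ioo 0 δ) (v : V n) :
    ‖α t v‖ ≤ ‖A‖ * ‖t⁻¹ • Q v‖ + K * ‖v‖ := by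
  have h1 := norm_apply_le_of_norm_sub_le (h.bound_left t ht) v
  have h2 : t⁻¹ • A v = A (t⁻¹ • Q v) := by
    rw [ContinuousLinearMap.map_smul_of_tower]
    exact congrArg (fun X : EndV n => t⁻¹ • X v) h.res.mul_proj_left.symm
  have h3 := A.le_opNorm (t⁻¹ • Q v)
  rw [h2] at h1
  have h4 := norm_add_le (A (t⁻¹ • Q v)) (α t v - A (t⁻¹ • Q v))
  rw [add_sub_cancel] at h4
  linarith

theorem norm_right_le (h : Pole δ K α β Q A B) {t : ℝ} (ht : t ∈ Ioo 0 δ) (v : V n) :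
    ‖β t v‖ ≤ ‖B‖ * ‖t⁻¹ • Q v‖ + K * ‖v‖ := by
  have h1 := norm_apply_le_of_norm_sub_le (h.bound_right t ht) v
  have h2 : t⁻¹ • B v = B (t⁻¹ • Q v) := by
    rw [ContinuousLinearMap.map_smul_of_tower]
    exact congrArg (fun X : EndV n => t⁻¹ • X v) h.res.mul_proj_right.symm
  have h3 := B.le_opNorm (t⁻¹ • Q v)
  rw [h2] at h1
  have h4 := norm_add_le (B (t⁻¹ • Q v)) (β t v - B (t⁻¹ • Q v))
  rw [add_sub_cancel] at h4
  linarith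

/-- Multiplication by `α`, `β` is bounded on sections of class `L²₁` whose singular part vanishes
at the pole. -/
theorem exists_bound_mul (h : Pole δ K α β Q A B) : ∃ C : ℝ, 0 ≤ C ∧ ∀ s s' : ℝ → V n,
    HasWeakDeriv 0 δ s s' → Tendsto (fun t => Q (s t)) (𝓝[>] 0) (𝓝 0) →
    eLpNorm (fun t => t⁻¹ • Q (s t)) 2 (volume.restrict (Ioo 0 δ)) ≤ ENNReal.ofReal C *
      (eLpNorm s' 2 (volume.restrict (Ioo 0 δ)) + eLpNorm s 2 (volume.restrict (Ioo 0 δ))) ∧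
    eLpNorm (fun t => α t (s t)) 2 (volume.restrict (Ioo 0 δ)) ≤ ENNReal.ofReal C *
      (eLpNorm s' 2 (volume.restrict (Ioo 0 δ)) + eLpNorm s 2 (volume.restrict (Ioo 0 δ))) ∧
    eLpNorm (fun t => β t (s t)) 2 (volume.restrict (Ioo 0 δ)) ≤ ENNReal.ofReal C *
      (eLpNorm s' 2 (volume.restrict (Ioo 0 δ)) + eLpNorm s 2 (volume.restrict (Ioo 0 δ))) := by
  have hK := h.bound_nonneg
  set c₀ : ℝ := 2 * ‖Q‖ with hc₀
  set C : ℝ := c₀ + (‖A‖ + ‖B‖ + K) * (c₀ + 1) with hC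
  have hc₀' : 0 ≤ c₀ := by positivity
  refine ⟨C, by positivity, fun s s' hs h0 => ?_⟩
  set μ := volume.restrict (Ioo 0 δ)
  have hm := hs.aestronglyMeasurable
  have hm' := hs.aestronglyMeasurable_deriv
  have k1 : eLpNorm (fun t => t⁻¹ • Q (s t)) 2 μ ≤ ENNReal.ofReal c₀ * eLpNorm s' 2 μ := by
    have := hardy_of_tendsto_zero (g := fun t => ‖Q‖ * ‖s' t‖) h.pos (hs.rclm Q) h0
      (hm'.norm.const_mul _) (Eventually.of_forall fun t => by
        refine (Complex.re_le_norm _).trans ((norm_inner_le_norm _ _).trans ?_)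
        gcongr
        exact Q.le_opNorm _)
    refine this.trans (le_of_eq ?_)
    have e := eLpNorm_const_smul (p := 2) (μ := μ) ‖Q‖ (fun t => ‖s' t‖)
    rw [eLpNorm_norm] at e
    have e2 : (fun t => ‖Q‖ * ‖s' t‖) = ‖Q‖ • (fun t => ‖s' t‖) := rfl
    rw [e2, e, ← mul_assoc, hc₀, ENNReal.ofReal_mul zero_le_two]
    congr 2
    · simp
    · rw [← ofReal_norm, norm_norm]
  have hmQ : AEStronglyMeasurable (fun t => t⁻¹ • Q (s t)) μ :=
    (hs.rclm Q).aestronglyMeasurable_inv_smul le_rfl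
  have k2 : ∀ (T : ℝ → EndV n) (X : EndV n), (∀ t ∈ Ioo 0 δ, ∀ v, ‖T t v‖ ≤ ‖X‖ * ‖t⁻¹ • Q v‖ + K * ‖v‖) →
      ‖X‖ ≤ ‖A‖ + ‖B‖ →
      eLpNorm (fun t => T t (s t)) 2 μ ≤ ENNReal.ofReal C * (eLpNorm s' 2 μ + eLpNorm s 2 μ) := by
    intro T X hT hX
    have h1 : eLpNorm (fun t => T t (s t)) 2 μ ≤ ENNReal.ofReal (‖A‖ + ‖B‖ + K) *
        (eLpNorm (fun t => t⁻¹ • Q (s t)) 2 μ + eLpNorm s 2 μ) := by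
      refine eLpNorm_le_of_norm_le_add₂ hmQ hm ?_
      filter_upwards [ae_restrict_mem measurableSet_Ioo] with t ht
      refine (hT t ht (s t)).trans ?_
      have := norm_nonneg (t⁻¹ • Q (s t))
      have := norm_nonneg (s t)
      nlinarith [norm_nonneg A, norm_nonneg B]
    refine h1.trans ?_
    calc _ ≤ ENNReal.ofReal (‖A‖ + ‖B‖ + K) * (ENNReal.ofReal c₀ * eLpNorm s' 2 μ + eLpNorm s 2 μ) := by
          gcongr
      _ ≤ ENNReal.ofReal (‖A‖ + ‖B‖ + K) * (ENNReal.ofReal (c₀ + 1) * eLpNorm s' 2 μ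
            + ENNReal.ofReal (c₀ + 1) * eLpNorm s 2 μ) := by
          gcongr
          · linarith
          · refine le_mul_of_one_le_left zero_le ?_
            rw [ENNReal.one_le_ofReal]; linarith
      _ = ENNReal.ofReal ((‖A‖ + ‖B‖ + K) * (c₀ + 1)) * (eLpNorm s' 2 μ + eLpNorm s 2 μ) := by
          rw [ENNReal.ofReal_mul (by positivity), ← mul_add, mul_assoc]
      _ ≤ _ := by
          gcongr
          rw [hC]; linarith
  refine ⟨?_, k2 α A (fun t ht v => h.norm_left_le ht v) (by linarith [norm_nonneg B]),
    k2 β B (fun t ht v => h.norm_right_le ht v) (by linarith [norm_nonneg A])⟩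
  refine k1.trans ?_
  gcongr
  · rw [hC]
    have : 0 ≤ (‖A‖ + ‖B‖ + K) * (c₀ + 1) := by positivity
    linarith
  · exact le_self_add

/-- The elliptic estimate for `D₁` at a pole. -/
theorem exists_elliptic_bound (h : Pole δ K α β Q A B) : ∃ C : ℝ, 0 ≤ C ∧ ∀ s s' : ℝ → V n,
    HasWeakDeriv 0 δ s s' → Tendsto (fun t => Q (s t)) (𝓝[>] 0) (𝓝 0) →
    eLpNorm s' 2 (volume.restrict (Ioo 0 δ)) ≤ ENNReal.ofReal C *
      (eLpNorm (fun t => s' t + α t (s t)) 2 (volume.restrict (Ioo 0 δ)) +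
        eLpNorm (fun t => β t (s t)) 2 (volume.restrict (Ioo 0 δ)) +
        eLpNorm s 2 (volume.restrict (Ioo 0 δ))) := by
  have hK := h.bound_nonneg
  obtain ⟨P, L, hPL, hPs, hPQ, hQP, hPP, hAP, hpos⟩ := h.res.exists_decomposition
  set c₁ : ℝ := ‖L‖ * (1 + K) + 1 with hc₁
  set c₂ : ℝ := ‖P‖ * (1 + K) with hc₂
  set c₃ : ℝ := 1 + K + ‖A‖ with hc₃
  have hc₂' : 0 ≤ c₂ := by positivity
  refine ⟨c₃ * (1 + c₁ * (1 + 2 * c₂)), by positivity, fun s s' hs h0 => ?_⟩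
  set μ := volume.restrict (Ioo 0 δ)
  set G : ℝ → V n := fun t => s' t + α t (s t) with hG
  have hm := hs.aestronglyMeasurable
  have hmG : AEStronglyMeasurable G μ :=
    hs.aestronglyMeasurable_deriv.add (h.aestronglyMeasurable_left hs)
  have hmB := h.aestronglyMeasurable_right hs
  set N₁ := eLpNorm G 2 μ
  set N₂ := eLpNorm (fun t => β t (s t)) 2 μ
  set N₃ := eLpNorm s 2 μ
  have k1 : eLpNorm (fun t => t⁻¹ • P (s t)) 2 μ ≤ 2 * (ENNReal.ofReal c₂ * (N₁ + N₃)) := by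
    have hP0 : Tendsto (fun t => P (s t)) (𝓝[>] 0) (𝓝 0) := by
      have := (P.continuous.tendsto 0).comp h0
      rw [map_zero] at this
      refine this.congr fun t => ?_
      exact congrArg (fun X : EndV n => X (s t)) hPQ
    refine (hardy_of_tendsto_zero (g := fun t => ‖P‖ * (‖G t‖ + K * ‖s t‖)) h.pos (hs.rclm P) hP0
      ((hmG.norm.add (hm.norm.const_mul _)).const_mul _) ?_).trans ?_
    · filter_upwards [ae_restrict_mem measurableSet_Ioo] with t ht
      have e1 : P (s' t) = P (G t - (α t (s t) - t⁻¹ • A (s t))) - t⁻¹ • A (P (s t)) := by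
        have : A (P (s t)) = P (A (s t)) := congrArg (fun X : EndV n => X (s t)) hAP
        rw [this, hG, ← ContinuousLinearMap.map_smul_of_tower P, ← map_sub]
        refine congrArg P ?_
        dsimp only
        abel
      have e2 : (inner ℂ (P (s t)) (t⁻¹ • A (P (s t))) : ℂ).re =
          t⁻¹ * (inner ℂ (P (s t)) (A (P (s t))) : ℂ).re := by
        rw [← Complex.coe_smul, inner_smul_right, Complex.re_ofReal_mul]
      have e3 := hpos (s t)
      have ht0 : 0 < t⁻¹ := inv_pos.2 ht.1
      rw [e1, inner_sub_right, Complex.sub_re, e2]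
      have e4 : (inner ℂ (P (s t)) (P (G t - (α t (s t) - t⁻¹ • A (s t)))) : ℂ).re ≤
          ‖P (s t)‖ * (‖P‖ * (‖G t‖ + K * ‖s t‖)) := by
        refine (Complex.re_le_norm _).trans ((norm_inner_le_norm _ _).trans ?_)
        gcongr
        refine (P.le_opNorm _).trans ?_
        gcongr
        exact (norm_sub_le _ _).trans
          (add_le_add le_rfl (norm_apply_le_of_norm_sub_le (h.bound_left t ht) _))
      nlinarith [mul_nonneg ht0.le e3]
    · gcongr
      refine eLpNorm_le_of_norm_le_add₂ hmG hm (Eventually.of_forall fun t => ?_)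
      rw [Real.norm_of_nonneg (by positivity), hc₂]
      have := norm_nonneg (G t)
      have := norm_nonneg (s t)
      rw [mul_assoc]
      gcongr
      nlinarith
  have hmP : AEStronglyMeasurable (fun t => t⁻¹ • P (s t)) μ :=
    (hs.rclm P).aestronglyMeasurable_inv_smul le_rfl
  have hmQ : AEStronglyMeasurable (fun t => t⁻¹ • Q (s t)) μ :=
    (hs.rclm Q).aestronglyMeasurable_inv_smul le_rfl
  have k2 : eLpNorm (fun t => t⁻¹ • Q (s t)) 2 μ ≤
      ENNReal.ofReal (c₁ * (1 + 2 * c₂)) * (N₁ + N₂ + N₃) := by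
    have h1 : eLpNorm (fun t => t⁻¹ • Q (s t)) 2 μ ≤ ENNReal.ofReal c₁ *
        (N₂ + N₃ + eLpNorm (fun t => t⁻¹ • P (s t)) 2 μ) := by
      refine eLpNorm_le_of_norm_le_add hmB hm hmP ?_
      filter_upwards [ae_restrict_mem measurableSet_Ioo] with t ht
      have e1 : t⁻¹ • Q (s t) = L (t⁻¹ • B (s t)) + t⁻¹ • P (s t) := by
        have : Q (s t) = L (B (s t)) + P (s t) := congrArg (fun X : EndV n => X (s t)) hPL
        rw [this, smul_add, ContinuousLinearMap.map_smul_of_tower]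
      have e2 : ‖t⁻¹ • B (s t)‖ ≤ ‖β t (s t)‖ + K * ‖s t‖ := by
        have h1 := norm_apply_le_of_norm_sub_le (h.bound_right t ht) (s t)
        have h2 := norm_sub_le (β t (s t)) (β t (s t) - t⁻¹ • B (s t))
        rw [sub_sub_cancel] at h2
        linarith
      rw [e1]
      have e3 := (L.le_opNorm (t⁻¹ • B (s t))).trans (mul_le_mul_of_nonneg_left e2 (norm_nonneg L))
      have e4 := norm_nonneg (β t (s t))
      have e5 := norm_nonneg (s t)
      have e6 := norm_nonneg (t⁻¹ • P (s t))
      refine (norm_add_le _ _).trans ((add_le_add e3 le_rfl).trans ?_)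
      rw [hc₁]
      have e7 : 0 ≤ ‖L‖ * K * ‖β t (s t)‖ := by positivity
      have e8 : 0 ≤ ‖L‖ * (1 + K) * ‖t⁻¹ • P (s t)‖ := by positivity
      have e9 : 0 ≤ ‖L‖ * ‖s t‖ := by positivity
      nlinarith
    refine h1.trans ?_
    calc _ ≤ ENNReal.ofReal c₁ * ((N₁ + N₂ + N₃) + 2 * (ENNReal.ofReal c₂ * (N₁ + N₂ + N₃))) := by
          gcongr
          · exact le_add_self
          · refine k1.trans ?_
            gcongr
            exact le_self_add
      _ = _ := by
          have e : ENNReal.ofReal (1 + 2 * c₂) = 1 + 2 * ENNReal.ofReal c₂ := by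
            rw [ENNReal.ofReal_add (p := 1) (q := 2 * c₂) zero_le_one (by positivity),
              ENNReal.ofReal_mul zero_le_two, ENNReal.ofReal_one, ENNReal.ofReal_ofNat]
          rw [ENNReal.ofReal_mul (p := c₁) (by positivity), e]
          ring
  have h1 : eLpNorm s' 2 μ ≤ ENNReal.ofReal c₃ *
      (N₁ + N₃ + eLpNorm (fun t => t⁻¹ • Q (s t)) 2 μ) := by
    refine eLpNorm_le_of_norm_le_add hmG hm hmQ ?_
    filter_upwards [ae_restrict_mem measurableSet_Ioo] with t ht
    have e1 := h.norm_left_le ht (s t)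
    have e2 := norm_sub_le (G t) (α t (s t))
    rw [hG] at e2
    simp only [add_sub_cancel_right] at e2
    have e3 := norm_nonneg (G t)
    have e4 := norm_nonneg (s t)
    have e5 := norm_nonneg (t⁻¹ • Q (s t))
    rw [hc₃]
    have e6 : 0 ≤ (K + ‖A‖) * ‖G t‖ := by positivity
    have e7 : 0 ≤ (1 + ‖A‖) * ‖s t‖ := by positivity
    have e8 : 0 ≤ (1 + K) * ‖t⁻¹ • Q (s t)‖ := by positivity
    change ‖s' t‖ ≤ ‖G t‖ + _ at e2
    nlinarith
  refine h1.trans ?_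
  calc _ ≤ ENNReal.ofReal c₃ * ((N₁ + N₂ + N₃) +
          ENNReal.ofReal (c₁ * (1 + 2 * c₂)) * (N₁ + N₂ + N₃)) := by
        gcongr
        exact le_self_add
    _ = _ := by
        have e : ENNReal.ofReal (1 + c₁ * (1 + 2 * c₂)) = 1 + ENNReal.ofReal (c₁ * (1 + 2 * c₂)) := by
          rw [ENNReal.ofReal_add (p := 1) (q := c₁ * (1 + 2 * c₂)) zero_le_one (by positivity),
            ENNReal.ofReal_one]
        rw [ENNReal.ofReal_mul (p := c₃) (by positivity), e]
        ring

end Pole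

end Pole

end CaloronNahm

namespace CaloronNahm

namespace IsL2

variable {n m : ℕ} {a b : ℝ} {u v : ℝ → V n}

theorem fadd (hu : IsL2 a b u) (hv : IsL2 a b v) : IsL2 a b (fun z => u z + v z) := MemLp.add hu hv

theorem fsub (hu : IsL2 a b u) (hv : IsL2 a b v) : IsL2 a b (fun z => u z - v z) := MemLp.sub hu hv

theorem fneg (hu : IsL2 a b u) : IsL2 a b (fun z => -u z) := MemLp.neg hu

theorem csmul (c : ℂ) (hu : IsL2 a b u) : IsL2 a b (fun z => c • u z) := MemLp.const_smul hu c

theorem clm (L : V n →L[ℂ] V m) (hu : IsL2 a b u) : IsL2 a b (fun z => L (u z)) :=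
  ContinuousLinearMap.comp_memLp' L hu

theorem congr (hu : IsL2 a b u) (h : ∀ᵐ z ∂(volume.restrict (Ioo a b)), v z = u z) : IsL2 a b v :=
  (memLp_congr_ae h).2 hu

theorem mono {c d : ℝ} (hu : IsL2 a b u) (h : Ioo c d ⊆ Ioo a b) : IsL2 c d u :=
  MemLp.mono_measure (Measure.restrict_mono h le_rfl) hu

end IsL2

section Residue

variable {n : ℕ} {δ c : ℝ} {Q A B : EndV n} {h₁ h₁' h₂ h₂' e₁ e₂ : ℝ → V n}

namespace IsResidue

theorem star_mul_proj_apply (h : IsResidue Q A B) (v : V n) : star B (Q v) = star B v :=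
  congrArg (fun X : EndV n => X v) h.star_mul_proj

theorem mul_proj_left_apply (h : IsResidue Q A B) (v : V n) : A (Q v) = A v :=
  congrArg (fun X : EndV n => X v) h.mul_proj_left

theorem mul_proj_right_apply (h : IsResidue Q A B) (v : V n) : B (Q v) = B v :=
  congrArg (fun X : EndV n => X v) h.mul_proj_right

theorem proj_mul_left_apply (h : IsResidue Q A B) (v : V n) : Q (A v) = A v :=
  congrArg (fun X : EndV n => X v) h.proj_mul_left

theorem proj_mul_right_apply (h : IsResidue Q A B) (v : V n) : Q (B v) = B v :=
  congrArg (fun X : EndV n => X v) h.proj_mul_right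

theorem proj_mul_star_apply (h : IsResidue Q A B) (v : V n) : Q (star B v) = star B v :=
  congrArg (fun X : EndV n => X v) h.proj_mul_star

theorem casimir_apply (hc : A * A + A + star B * B = (c : ℂ) • Q) (v : V n) :
    A (A v) = (c : ℂ) • Q v - A v - star B (B v) := by
  have : A (A v) + A v + star B (B v) = (c : ℂ) • Q v := congrArg (fun X : EndV n => X v) hc
  rw [← this]; abel

theorem component_left (h : IsResidue Q A B) (hc : A * A + A + star B * B = (c : ℂ) • Q)
    {μ ν : ℝ} (hsum : μ + ν = 1) (hprod : μ * ν = -c) (v w e f : V n) (t : ℝ) :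
    -A (t • (A v - Complex.I • star B w) + e) +
      Complex.I • star B (t • (-A w + Complex.I • B v) + f) -
      (ν : ℂ) • Q (t • (A v - Complex.I • star B w) + e) =
    ((-μ * t : ℝ) : ℂ) • (-A v + Complex.I • star B w - (ν : ℂ) • Q v) +
      (-A e + Complex.I • star B f - (ν : ℂ) • Q e) := by
  have hμν : (c : ℂ) = -((μ : ℂ) * ν) := by
    rw [← Complex.ofReal_mul, hprod]; simp
  have hν : (ν : ℂ) = 1 - μ := by
    rw [eq_sub_iff_add_eq', ← Complex.ofReal_add, hsum, Complex.ofReal_one]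
  simp only [← Complex.coe_smul, map_add, map_sub, map_neg, map_smul, h.proj_mul_left_apply,
    h.proj_mul_star_apply, casimir_apply hc, h.comm_star_apply', hμν, hν]
  push_cast
  match_scalars <;> (ring_nf; try rw [Complex.I_sq]) <;> ring_nf

theorem component_right (h : IsResidue Q A B) (hc : A * A + A + star B * B = (c : ℂ) • Q)
    {μ ν : ℝ} (hsum : μ + ν = 1) (hprod : μ * ν = -c) (v w e f : V n) (t : ℝ) :
    -(Complex.I • B (t • (A v - Complex.I • star B w) + e)) +
      A (t • (-A w + Complex.I • B v) + f) -
      (ν : ℂ) • Q (t • (-A w + Complex.I • B v) + f) =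
    ((-μ * t : ℝ) : ℂ) • (-(Complex.I • B v) + A w - (ν : ℂ) • Q w) +
      (-(Complex.I • B e) + A f - (ν : ℂ) • Q f) := by
  have hμν : (c : ℂ) = -((μ : ℂ) * ν) := by
    rw [← Complex.ofReal_mul, hprod]; simp
  have hν : (ν : ℂ) = 1 - μ := by
    rw [eq_sub_iff_add_eq', ← Complex.ofReal_add, hsum, Complex.ofReal_one]
  simp only [← Complex.coe_smul, map_add, map_sub, map_neg, map_smul, h.proj_mul_left_apply,
    h.proj_mul_right_apply, h.comm_apply, h.comm_star_apply, casimir_apply hc, hμν, hν]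
  push_cast
  match_scalars <;> (ring_nf; try rw [Complex.I_sq]) <;> ring_nf

/-- Spectral components of a solution of the model equation `h' = -t⁻¹ S h + e`, where
`S² - S = c`, satisfy the Hardy inequality as soon as the exponent is not in `[-1/2, 1/2]`. -/
theorem memLp_component (h : IsResidue Q A B) (hc : A * A + A + star B * B = (c : ℂ) • Q)
    {μ ν : ℝ} (hsum : μ + ν = 1) (hprod : μ * ν = -c) (hμ : 1 / 2 < μ ∨ μ < -(1 / 2)) (hδ : 0 < δ)
    (w₁ : HasWeakDeriv 0 δ h₁ h₁') (w₂ : HasWeakDeriv 0 δ h₂ h₂')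
    (l₁ : IsL2 0 δ h₁) (l₂ : IsL2 0 δ h₂)
    (m₁ : IsL2 0 δ e₁) (m₂ : IsL2 0 δ e₂)
    (q₁ : ∀ᵐ t ∂(volume.restrict (Ioo 0 δ)),
      h₁' t = t⁻¹ • (A (h₁ t) - Complex.I • star B (h₂ t)) + e₁ t)
    (q₂ : ∀ᵐ t ∂(volume.restrict (Ioo 0 δ)),
      h₂' t = t⁻¹ • (-A (h₂ t) + Complex.I • B (h₁ t)) + e₂ t) :
    IsL2 0 δ (fun t => t⁻¹ • (-A (h₁ t) + Complex.I • star B (h₂ t) - (ν : ℂ) • Q (h₁ t))) ∧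
    IsL2 0 δ (fun t => t⁻¹ • (-(Complex.I • B (h₁ t)) + A (h₂ t) - (ν : ℂ) • Q (h₂ t))) := by
  have key : ∀ {Y Y' G : ℝ → V n}, HasWeakDeriv 0 δ Y Y' → IsL2 0 δ Y →
      IsL2 0 δ G →
      (∀ᵐ t ∂(volume.restrict (Ioo 0 δ)), Y' t = (((-μ * t⁻¹ : ℝ)) : ℂ) • Y t + G t) →
      IsL2 0 δ (fun t => t⁻¹ • Y t) := by
    intro Y Y' G hY lY lG hq
    have e : ∀ t, Y' t = (((-μ * t⁻¹ : ℝ)) : ℂ) • Y t + G t →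
        |(inner ℂ (Y t) (Y' t) : ℂ).re - -μ * (‖Y t‖ ^ 2 / t)| ≤ ‖Y t‖ * ‖G t‖ := by
      intro t ht
      have e1 : (inner ℂ (Y t) (Y' t) : ℂ).re - -μ * (‖Y t‖ ^ 2 / t) = (inner ℂ (Y t) (G t) : ℂ).re := by
        rw [ht, inner_add_right, inner_smul_right, inner_self_eq_norm_sq_to_K, Complex.add_re,
          Complex.re_ofReal_mul]
        rw [← RCLike.ofReal_pow]
        simp only [Complex.coe_algebraMap, Complex.ofReal_re, RCLike.ofReal]
        ring
      rw [e1]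
      exact (Complex.abs_re_le_norm _).trans (norm_inner_le_norm _ _)
    rcases hμ with hμ | hμ
    · refine hardy_of_decay hμ hδ hY lY (MemLp.norm lG) ?_
      filter_upwards [hq] with t ht
      linarith [(abs_le.1 (e t ht)).2]
    · refine hardy_of_growth (lam := -μ) (by linarith) hδ hY lY (MemLp.norm lG) ?_
      filter_upwards [hq] with t ht
      linarith [(abs_le.1 (e t ht)).1]
  constructor
  · refine key (((w₁.rclm A).neg.add ((w₂.rclm (star B)).csmul _)).sub ((w₁.rclm Q).csmul _))
      (((l₁.clm A).fneg.fadd ((l₂.clm (star B)).csmul _)).fsub ((l₁.clm Q).csmul _))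
      (((m₁.clm A).fneg.fadd ((m₂.clm (star B)).csmul Complex.I)).fsub ((m₁.clm Q).csmul (ν : ℂ))) ?_
    filter_upwards [q₁, q₂] with t h1 h2
    rw [h1, h2]
    exact h.component_left hc hsum hprod _ _ _ _ _
  · refine key ((((w₁.rclm B).csmul _).neg.add (w₂.rclm A)).sub ((w₂.rclm Q).csmul _))
      ((((l₁.clm B).csmul _).fneg.fadd (l₂.clm A)).fsub ((l₂.clm Q).csmul _))
      ((((m₁.clm B).csmul Complex.I).fneg.fadd (m₂.clm A)).fsub ((m₂.clm Q).csmul (ν : ℂ))) ?_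
    filter_upwards [q₁, q₂] with t h1 h2
    rw [h1, h2]
    exact h.component_right hc hsum hprod _ _ _ _ _

theorem memLp_inv_smul_proj (h : IsResidue Q A B) (hc : A * A + A + star B * B = (c : ℂ) • Q)
    (hc' : 3 / 4 < c) (hδ : 0 < δ)
    (w₁ : HasWeakDeriv 0 δ h₁ h₁') (w₂ : HasWeakDeriv 0 δ h₂ h₂')
    (l₁ : IsL2 0 δ h₁) (l₂ : IsL2 0 δ h₂)
    (m₁ : IsL2 0 δ e₁) (m₂ : IsL2 0 δ e₂)
    (q₁ : ∀ᵐ t ∂(volume.restrict (Ioo 0 δ)),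
      h₁' t = t⁻¹ • (A (h₁ t) - Complex.I • star B (h₂ t)) + e₁ t)
    (q₂ : ∀ᵐ t ∂(volume.restrict (Ioo 0 δ)),
      h₂' t = t⁻¹ • (-A (h₂ t) + Complex.I • B (h₁ t)) + e₂ t) :
    IsL2 0 δ (fun t => t⁻¹ • Q (h₁ t)) ∧
    IsL2 0 δ (fun t => t⁻¹ • Q (h₂ t)) := by
  set r := Real.sqrt (c + 1 / 4) with hr
  have hr1 : 1 < r := by
    rw [hr, Real.lt_sqrt zero_le_one]; linarith
  have hr2 : r ^ 2 = c + 1 / 4 := Real.sq_sqrt (by linarith)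
  obtain ⟨a₁, a₂⟩ := h.memLp_component hc (μ := 1 / 2 + r) (ν := 1 / 2 - r) (by ring)
    (by linear_combination -hr2) (Or.inl (by linarith)) hδ w₁ w₂ l₁ l₂ m₁ m₂ q₁ q₂
  obtain ⟨b₁, b₂⟩ := h.memLp_component hc (μ := 1 / 2 - r) (ν := 1 / 2 + r) (by ring)
    (by linear_combination -hr2) (Or.inr (by linarith)) hδ w₁ w₂ l₁ l₂ m₁ m₂ q₁ q₂
  have hr0 : (r : ℂ) ≠ 0 := by
    norm_cast; linarith
  constructor
  · refine ((a₁.fsub b₁).csmul ((2 * r : ℂ)⁻¹)).congr (Eventually.of_forall fun t => ?_)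
    simp only [← Complex.coe_smul]
    push_cast
    match_scalars <;> field_simp <;> ring
  · refine ((a₂.fsub b₂).csmul ((2 * r : ℂ)⁻¹)).congr (Eventually.of_forall fun t => ?_)
    simp only [← Complex.coe_smul]
    push_cast
    match_scalars <;> field_simp <;> ring

end IsResidue

end Residue

section Pole

variable {n : ℕ} {δ K c : ℝ} {α β : ℝ → EndV n} {Q A B : EndV n} {h₁ h₁' h₂ h₂' f₁ f₂ : ℝ → V n}

theorem memLp_of_norm_le_add {Ω E F₁ F₂ F₃ : Type*} [MeasurableSpace Ω] {μ : Measure Ω}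
    [NormedAddCommGroup E] [NormedAddCommGroup F₁] [NormedAddCommGroup F₂] [NormedAddCommGroup F₃]
    {f : Ω → E} {g₁ : Ω → F₁} {g₂ : Ω → F₂} {g₃ : Ω → F₃} {c : ℝ}
    (hf : AEStronglyMeasurable f μ) (h₁ : MemLp g₁ 2 μ) (h₂ : MemLp g₂ 2 μ) (h₃ : MemLp g₃ 2 μ)
    (h : ∀ᵐ t ∂μ, ‖f t‖ ≤ c * (‖g₁ t‖ + ‖g₂ t‖ + ‖g₃ t‖)) : MemLp f 2 μ := by
  refine ((h₁.norm.add h₂.norm).add h₃.norm).of_le_mul (c := c) hf ?_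
  filter_upwards [h] with t ht
  simpa [Real.norm_of_nonneg (by positivity : 0 ≤ ‖g₁ t‖ + ‖g₂ t‖ + ‖g₃ t‖)] using ht

namespace Pole

/-- A square integrable solution of the Dirac equation with square integrable right hand side
solves the model equation at the pole up to a square integrable error. -/
theorem exists_model (h : Pole δ K α β Q A B)
    (w₁ : HasWeakDeriv 0 δ h₁ h₁') (w₂ : HasWeakDeriv 0 δ h₂ h₂')
    (l₁ : IsL2 0 δ h₁) (l₂ : IsL2 0 δ h₂)
    (m₁ : IsL2 0 δ f₁) (m₂ : IsL2 0 δ f₂)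
    (q₁ : ∀ᵐ t ∂(volume.restrict (Ioo 0 δ)),
      h₁' t = star (α t) (h₁ t) - Complex.I • star (β t) (h₂ t) + f₁ t)
    (q₂ : ∀ᵐ t ∂(volume.restrict (Ioo 0 δ)),
      h₂' t = -α t (h₂ t) + Complex.I • β t (h₁ t) + f₂ t) :
    ∃ e₁ e₂ : ℝ → V n, IsL2 0 δ e₁ ∧
      IsL2 0 δ e₂ ∧
      (∀ᵐ t ∂(volume.restrict (Ioo 0 δ)),
        h₁' t = t⁻¹ • (A (h₁ t) - Complex.I • star B (h₂ t)) + e₁ t) ∧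
      (∀ᵐ t ∂(volume.restrict (Ioo 0 δ)),
        h₂' t = t⁻¹ • (-A (h₂ t) + Complex.I • B (h₁ t)) + e₂ t) := by
  have hK := h.bound_nonneg
  have n1 : ∀ t ∈ Ioo 0 δ, ∀ v, ‖star (α t) v - t⁻¹ • A v‖ ≤ K * ‖v‖ := by
    intro t ht v
    refine norm_apply_le_of_norm_sub_le ?_ v
    have := h.bound_left t ht
    rw [← EndV.norm_star, EndV.star_sub, ← Complex.coe_smul t⁻¹ A, EndV.star_smul, h.res.star_left,
      Complex.conj_ofReal] at this
    exact this
  have n2 : ∀ t ∈ Ioo 0 δ, ∀ v, ‖star (β t) v - t⁻¹ • star B v‖ ≤ K * ‖v‖ := by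
    intro t ht v
    refine norm_apply_le_of_norm_sub_le ?_ v
    have := h.bound_right t ht
    rw [← EndV.norm_star, EndV.star_sub, ← Complex.coe_smul t⁻¹ B, EndV.star_smul,
      Complex.conj_ofReal] at this
    exact this
  have n3 : ∀ t ∈ Ioo 0 δ, ∀ v, ‖α t v - t⁻¹ • A v‖ ≤ K * ‖v‖ :=
    fun t ht v => norm_apply_le_of_norm_sub_le (h.bound_left t ht) v
  have n4 : ∀ t ∈ Ioo 0 δ, ∀ v, ‖β t v - t⁻¹ • B v‖ ≤ K * ‖v‖ :=
    fun t ht v => norm_apply_le_of_norm_sub_le (h.bound_right t ht) v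
  refine ⟨fun t => h₁' t - t⁻¹ • (A (h₁ t) - Complex.I • star B (h₂ t)),
    fun t => h₂' t - t⁻¹ • (-A (h₂ t) + Complex.I • B (h₁ t)), ?_, ?_,
    Eventually.of_forall fun t => by simp, Eventually.of_forall fun t => by simp⟩
  · refine memLp_of_norm_le_add (c := K + 1) (w₁.aestronglyMeasurable_deriv.sub
      (((w₁.rclm A).sub ((w₂.rclm (star B)).csmul Complex.I)).aestronglyMeasurable_inv_smul le_rfl))
      l₁ l₂ m₁ ?_
    filter_upwards [q₁, ae_restrict_mem measurableSet_Ioo] with t ht ht0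
    have e : h₁' t - t⁻¹ • (A (h₁ t) - Complex.I • star B (h₂ t)) =
        (star (α t) (h₁ t) - t⁻¹ • A (h₁ t)) - Complex.I • (star (β t) (h₂ t) - t⁻¹ • star B (h₂ t))
          + f₁ t := by
      rw [ht]; module
    rw [e]
    refine (norm_add_le _ _).trans ((add_le_add (norm_sub_le _ _) le_rfl).trans ?_)
    rw [norm_smul, Complex.norm_I, one_mul]
    have := n1 t ht0 (h₁ t)
    have := n2 t ht0 (h₂ t)
    nlinarith [norm_nonneg (h₁ t), norm_nonneg (h₂ t), norm_nonneg (f₁ t)]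
  · refine memLp_of_norm_le_add (c := K + 1) (w₂.aestronglyMeasurable_deriv.sub
      (((w₂.rclm A).neg.add ((w₁.rclm B).csmul Complex.I)).aestronglyMeasurable_inv_smul le_rfl))
      l₁ l₂ m₂ ?_
    filter_upwards [q₂, ae_restrict_mem measurableSet_Ioo] with t ht ht0
    have e : h₂' t - t⁻¹ • (-A (h₂ t) + Complex.I • B (h₁ t)) =
        -(α t (h₂ t) - t⁻¹ • A (h₂ t)) + Complex.I • (β t (h₁ t) - t⁻¹ • B (h₁ t)) + f₂ t := by
      rw [ht]; module
    rw [e]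
    refine (norm_add_le _ _).trans ((add_le_add (norm_add_le _ _) le_rfl).trans ?_)
    rw [norm_smul, Complex.norm_I, one_mul, norm_neg]
    have := n3 t ht0 (h₂ t)
    have := n4 t ht0 (h₁ t)
    nlinarith [norm_nonneg (h₁ t), norm_nonneg (h₂ t), norm_nonneg (f₂ t)]

/-- Away from the singular part, the derivative of a solution is square integrable. -/
theorem memLp_deriv_sub_proj (h : Pole δ K α β Q A B)
    (w₁ : HasWeakDeriv 0 δ h₁ h₁') (w₂ : HasWeakDeriv 0 δ h₂ h₂')
    (l₁ : IsL2 0 δ h₁) (l₂ : IsL2 0 δ h₂)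
    (m₁ : IsL2 0 δ f₁) (m₂ : IsL2 0 δ f₂)
    (q₁ : ∀ᵐ t ∂(volume.restrict (Ioo 0 δ)),
      h₁' t = star (α t) (h₁ t) - Complex.I • star (β t) (h₂ t) + f₁ t)
    (q₂ : ∀ᵐ t ∂(volume.restrict (Ioo 0 δ)),
      h₂' t = -α t (h₂ t) + Complex.I • β t (h₁ t) + f₂ t) :
    IsL2 0 δ (fun t => h₁' t - Q (h₁' t)) ∧
      IsL2 0 δ (fun t => h₂' t - Q (h₂' t)) := by
  obtain ⟨e₁, e₂, k₁, k₂, r₁, r₂⟩ := h.exists_model w₁ w₂ l₁ l₂ m₁ m₂ q₁ q₂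
  constructor
  · refine (k₁.fsub (k₁.clm Q)).congr ?_
    filter_upwards [r₁] with t ht
    rw [ht]
    simp only [← Complex.coe_smul, map_add, map_sub, map_smul, h.res.proj_mul_left_apply,
      h.res.proj_mul_star_apply]
    module
  · refine (k₂.fsub (k₂.clm Q)).congr ?_
    filter_upwards [r₂] with t ht
    rw [ht]
    simp only [← Complex.coe_smul, map_add, map_neg, map_smul, h.res.proj_mul_left_apply,
      h.res.proj_mul_right_apply]
    module

/-- The derivative of a solution is square integrable if the Casimir operator of the residues is
larger than `3/4`, or if there is no pole. -/
theorem memLp_deriv (h : Pole δ K α β Q A B)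
    (hcas : (A = 0 ∧ B = 0) ∨ ∃ c : ℝ, 3 / 4 < c ∧ A * A + A + star B * B = (c : ℂ) • Q)
    (w₁ : HasWeakDeriv 0 δ h₁ h₁') (w₂ : HasWeakDeriv 0 δ h₂ h₂')
    (l₁ : IsL2 0 δ h₁) (l₂ : IsL2 0 δ h₂)
    (m₁ : IsL2 0 δ f₁) (m₂ : IsL2 0 δ f₂)
    (q₁ : ∀ᵐ t ∂(volume.restrict (Ioo 0 δ)),
      h₁' t = star (α t) (h₁ t) - Complex.I • star (β t) (h₂ t) + f₁ t)
    (q₂ : ∀ᵐ t ∂(volume.restrict (Ioo 0 δ)),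
      h₂' t = -α t (h₂ t) + Complex.I • β t (h₁ t) + f₂ t) :
    IsL2 0 δ h₁' ∧ IsL2 0 δ h₂' := by
  obtain ⟨e₁, e₂, k₁, k₂, r₁, r₂⟩ := h.exists_model w₁ w₂ l₁ l₂ m₁ m₂ q₁ q₂
  rcases hcas with ⟨rfl, rfl⟩ | ⟨c, hc, hcas⟩
  · constructor
    · refine k₁.congr ?_
      filter_upwards [r₁] with t ht
      rw [ht, EndV.star_zero]
      simp
    · refine k₂.congr ?_
      filter_upwards [r₂] with t ht
      rw [ht]
      simp
  · obtain ⟨g₁, g₂⟩ := h.res.memLp_inv_smul_proj hcas hc h.pos w₁ w₂ l₁ l₂ k₁ k₂ r₁ r₂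
    constructor
    · refine (((g₁.clm A).fsub ((g₂.clm (star B)).csmul Complex.I)).fadd k₁).congr ?_
      filter_upwards [r₁] with t ht
      rw [ht]
      simp only [← Complex.coe_smul, map_smul, h.res.mul_proj_left_apply,
        h.res.star_mul_proj_apply]
      module
    · refine (((g₂.clm A).fneg.fadd ((g₁.clm B).csmul Complex.I)).fadd k₂).congr ?_
      filter_upwards [r₂] with t ht
      rw [ht]
      simp only [← Complex.coe_smul, map_smul, h.res.mul_proj_left_apply,
        h.res.mul_proj_right_apply]
      module

end Pole

end Pole

end CaloronNahm

namespace CaloronNahm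

section Pole

variable {n : ℕ} {δ K K' : ℝ} {α β α' β' : ℝ → EndV n} {Q A B : EndV n} {s s' s'' : ℝ → V n}

theorem hasDerivAt_inv_of_mem {t : ℝ} (ht : t ∈ Ioo 0 δ) :
    HasDerivAt (fun t : ℝ => t⁻¹) (-(t⁻¹ ^ 2)) t := by
  simpa using hasDerivAt_inv ht.1.ne'

theorem hasWeakDeriv_inv : HasWeakDeriv 0 δ (fun t : ℝ => t⁻¹) (fun t => -(t⁻¹ ^ 2)) :=
  HasWeakDeriv.of_hasDerivAt (fun _ ht => hasDerivAt_inv_of_mem ht)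
    (((continuousOn_inv₀.mono fun _ ht => (ne_of_gt ht.1 : _ ≠ (0 : ℝ))).pow 2).neg)

theorem HasWeakDeriv.inv_smul (hs : HasWeakDeriv 0 δ s s') :
    HasWeakDeriv 0 δ (fun t => t⁻¹ • s t) (fun t => t⁻¹ • (s' t - t⁻¹ • s t)) :=
  (hasWeakDeriv_inv.rsmul hs).congr_deriv (Eventually.of_forall fun t => by module)

namespace Pole

/-- Differentiating a product with an endomorphism that has a simple pole: the derivative is the
residue applied to the derivative of `t⁻¹ Q s`, up to a square integrable error. -/
theorem memLp_deriv_sub_residue {X X' : ℝ → EndV n} {Y : EndV n} (hY : Y * Q = Y)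
    (hX : ∀ t ∈ Ioo 0 δ, ‖X t - t⁻¹ • Y‖ ≤ K)
    (wX : HasWeakDeriv 0 δ X X')
    (hX' : ∀ t ∈ Ioo 0 δ, ∀ v, ‖X' t v + t⁻¹ • t⁻¹ • Y v‖ ≤ K' * (‖t⁻¹ • Q v‖ + ‖v‖))
    (ws : HasWeakDeriv 0 δ s s')
    (ls : IsL2 0 δ s) (ls' : IsL2 0 δ s') (lQ : IsL2 0 δ (fun t => t⁻¹ • Q (s t))) :
    IsL2 0 δ (fun t => X' t (s t) + X t (s' t) - Y (t⁻¹ • (Q (s' t) - t⁻¹ • Q (s t)))) := by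
  have e : ∀ t, X' t (s t) + X t (s' t) - Y (t⁻¹ • (Q (s' t) - t⁻¹ • Q (s t))) =
      (X' t (s t) + t⁻¹ • t⁻¹ • Y (s t)) + (X t (s' t) - t⁻¹ • Y (s' t)) := by
    intro t
    have h1 : ∀ v, Y (Q v) = Y v := fun v => congrArg (fun X : EndV n => X v) hY
    simp only [← Complex.coe_smul, map_smul, map_sub, h1]
    module
  refine memLp_of_norm_le_add (c := |K'| + |K|) ?_ lQ ls ls' ?_
  · exact ((wX.apply ws).aestronglyMeasurable_deriv).sub
      (Y.continuous.comp_aestronglyMeasurable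
        (ws.rclm Q).inv_smul.aestronglyMeasurable_deriv)
  · filter_upwards [ae_restrict_mem measurableSet_Ioo] with t ht
    rw [e]
    have h1 := hX' t ht (s t)
    have h2 := norm_apply_le_of_norm_sub_le (hX t ht) (s' t)
    have h3 := norm_nonneg (t⁻¹ • Q (s t))
    have h4 := norm_nonneg (s t)
    have h5 := norm_nonneg (s' t)
    have h6 := norm_add_le (X' t (s t) + t⁻¹ • t⁻¹ • Y (s t)) (X t (s' t) - t⁻¹ • Y (s' t))
    have h7 : K' * (‖t⁻¹ • Q (s t)‖ + ‖s t‖) ≤ |K'| * (‖t⁻¹ • Q (s t)‖ + ‖s t‖) := by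
      gcongr; exact le_abs_self _
    have h8 : K * ‖s' t‖ ≤ |K| * ‖s' t‖ := by gcongr; exact le_abs_self _
    have h9 : 0 ≤ |K| * (‖t⁻¹ • Q (s t)‖ + ‖s t‖) := by positivity
    have h10 : 0 ≤ |K'| * ‖s' t‖ := by positivity
    linarith

/-- Regularity at a pole: if `s`, `s' + αs` and `βs` are of class `L²₁` then `s` is of class
`L²₂`. -/
theorem memLp_second_deriv (h : Pole δ K α β Q A B)
    (wα : HasWeakDeriv 0 δ α α') (wβ : HasWeakDeriv 0 δ β β')
    (hα : ∀ t ∈ Ioo 0 δ, ∀ v, ‖α' t v + t⁻¹ • t⁻¹ • A v‖ ≤ K' * (‖t⁻¹ • Q v‖ + ‖v‖))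
    (hβ : ∀ t ∈ Ioo 0 δ, ∀ v, ‖β' t v + t⁻¹ • t⁻¹ • B v‖ ≤ K' * (‖t⁻¹ • Q v‖ + ‖v‖))
    (ws : HasWeakDeriv 0 δ s s') (ws' : HasWeakDeriv 0 δ s' s'')
    (ls : IsL2 0 δ s) (ls' : IsL2 0 δ s') (lQ : IsL2 0 δ (fun t => t⁻¹ • Q (s t)))
    (lG : IsL2 0 δ (fun t => s'' t + (α' t (s t) + α t (s' t))))
    (lH : IsL2 0 δ (fun t => β' t (s t) + β t (s' t))) : IsL2 0 δ s'' := by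
  obtain ⟨P, L, hPL, hPs, hPQ, hQP, hPP, hAP, hpos⟩ := h.res.exists_decomposition
  have aPL : ∀ v, Q v = L (B v) + P v := fun v => congrArg (fun X : EndV n => X v) hPL
  have aPQ : ∀ v, P (Q v) = P v := fun v => congrArg (fun X : EndV n => X v) hPQ
  have aPP : ∀ v, P (P v) = P v := fun v => congrArg (fun X : EndV n => X v) hPP
  have aAP : ∀ v, A (P v) = P (A v) := fun v => congrArg (fun X : EndV n => X v) hAP
  have aQQ : ∀ v, Q (Q v) = Q v := fun v => congrArg (fun X : EndV n => X v) h.res.proj_sq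
  set v' : ℝ → V n := fun t => t⁻¹ • (Q (s' t) - t⁻¹ • Q (s t)) with hv'
  have lA := lG.fsub (memLp_deriv_sub_residue h.res.mul_proj_left h.bound_left wα hα ws
    ls ls' lQ)
  have lB := lH.fsub (memLp_deriv_sub_residue h.res.mul_proj_right h.bound_right wβ hβ ws
    ls ls' lQ)
  have lG' : IsL2 0 δ (fun t => s'' t + A (v' t)) :=
    lA.congr (Eventually.of_forall fun t => by simp only [hv']; abel)
  have lB' : IsL2 0 δ (fun t => B (v' t)) :=
    lB.congr (Eventually.of_forall fun t => by simp only [hv']; abel)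
  set m : ℝ → V n := fun t => P (s' t) - t⁻¹ • P (s t) with hm
  have wm : HasWeakDeriv 0 δ m (fun t => P (s'' t) - t⁻¹ • (P (s' t) - t⁻¹ • P (s t))) :=
    (ws'.rclm P).sub (ws.rclm P).inv_smul
  have lm : IsL2 0 δ m := ((ls'.clm P).fsub (lQ.clm P)).congr (Eventually.of_forall fun t => by
    simp only [hm, ← Complex.coe_smul, map_smul, aPQ])
  have hPv : ∀ t, P (v' t) = t⁻¹ • m t := by
    intro t
    simp only [hm, hv', ← Complex.coe_smul, map_smul, map_sub, aPQ]
  have lm' := hardy_of_decay (lam := 1) (g := fun t => ‖P (s'' t + A (v' t))‖) (by norm_num) h.pos wm lm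
    (lG'.clm P).norm (by
      filter_upwards [ae_restrict_mem measurableSet_Ioo] with t ht
      have e1 : P (s'' t) - t⁻¹ • (P (s' t) - t⁻¹ • P (s t)) =
          P (s'' t + A (v' t)) - ((t⁻¹ : ℝ) : ℂ) • (m t + A (m t)) := by
        have : P (A (v' t)) = t⁻¹ • A (m t) := by
          rw [← aAP, hPv, ContinuousLinearMap.map_smul_of_tower]
        rw [map_add, this, Complex.coe_smul]
        simp only [hm]
        module
      have e2 : P (m t) = m t := by
        simp only [hm, ← Complex.coe_smul, map_smul, map_sub, aPP]
      have e3 := hpos (m t)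
      rw [e2] at e3
      have e4 : (inner ℂ (m t) (m t) : ℂ).re = ‖m t‖ ^ 2 := inner_self_eq_norm_sq (𝕜 := ℂ) (m t)
      have e5 := (Complex.re_le_norm _).trans (norm_inner_le_norm (𝕜 := ℂ) (m t) (P (s'' t + A (v' t))))
      have e6 := mul_nonneg (inv_pos.2 ht.1).le e3
      rw [e1, inner_sub_right, inner_smul_right, inner_add_right, Complex.sub_re, Complex.re_ofReal_mul,
        Complex.add_re, e4, div_eq_mul_inv]
      linarith)
  have lP : IsL2 0 δ (fun t => P (v' t)) :=
    IsL2.congr (u := fun t => t⁻¹ • m t) lm' (Eventually.of_forall hPv)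
  refine (lG'.fsub (((lB'.clm L).fadd lP).clm A)).congr (Eventually.of_forall fun t => ?_)
  have : v' t = L (B (v' t)) + P (v' t) := by
    rw [← aPL]
    simp only [hv', ← Complex.coe_smul, map_smul, map_sub, aQQ]
  rw [← this]
  abel

end Pole

end Pole

end CaloronNahm

namespace CaloronNahm

namespace EndV

variable {n : ℕ} (X Y Z : EndV n)

theorem neg_mul : -X * Y = -(X * Y) := _root_.neg_mul X Y

theorem mul_neg : X * -Y = -(X * Y) := _root_.mul_neg X Y

theorem smul_mul (c : ℂ) : c • X * Y = c • (X * Y) := _root_.smul_mul_assoc c X Y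

theorem mul_smul (c : ℂ) : X * c • Y = c • (X * Y) := _root_.mul_smul_comm c X Y

theorem rsmul_mul (c : ℝ) : c • X * Y = c • (X * Y) := by
  ext1 v; rfl

theorem mul_rsmul (c : ℝ) : X * c • Y = c • (X * Y) := by
  ext1 v
  exact ContinuousLinearMap.map_smul_of_tower X c (Y v)

theorem star_neg : star (-X) = -star X := _root_.star_neg X

theorem star_rsmul (c : ℝ) : star (c • X) = c • star X := by
  rw [← Complex.coe_smul c X, EndV.star_smul, Complex.conj_ofReal]
  exact Complex.coe_smul c (star X)

theorem smul_neg (c : ℂ) : c • -X = -(c • X) := _root_.smul_neg c X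

end EndV

section Residue

variable {n : ℕ} {Q : EndV n} {r : Fin 4 → EndV n}

/-- `α = T₀ - iT₃`. -/
noncomputable abbrev nahmAlpha (T : Fin 4 → ℝ → EndV n) (t : ℝ) : EndV n := T 0 t - Complex.I • T 3 t

/-- `β = T₁ + iT₂`. -/
noncomputable abbrev nahmBeta (T : Fin 4 → ℝ → EndV n) (t : ℝ) : EndV n := T 1 t + Complex.I • T 2 t

theorem star_I_smul (X : EndV n) : star (Complex.I • X) = -(Complex.I • star X) := by
  rw [EndV.star_smul, Complex.conj_I]
  exact _root_.neg_smul Complex.I (star X)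

theorem IsIrreducibleSU2.proj_mul (h : IsIrreducibleSU2 Q r) (hQ : Q * Q = Q) {i : Fin 4}
    (hi : i ≠ 0) : Q * r i = r i := by
  rw [← h.1 i hi, ← mul_assoc, ← mul_assoc, hQ]

theorem IsIrreducibleSU2.mul_proj (h : IsIrreducibleSU2 Q r) (hQ : Q * Q = Q) {i : Fin 4}
    (hi : i ≠ 0) : r i * Q = r i := by
  rw [← h.1 i hi, mul_assoc, hQ]

theorem IsIrreducibleSU2.isResidue (h : IsIrreducibleSU2 Q r) (hQ : Q * Q = Q) (hQ' : star Q = Q)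
    (hr : ∀ i, i ≠ 0 → star (r i) = -r i) :
    IsResidue Q (-(Complex.I • r 3)) (r 1 + Complex.I • r 2) := by
  have l1 := h.proj_mul hQ (i := 1) (by decide)
  have l2 := h.proj_mul hQ (i := 2) (by decide)
  have l3 := h.proj_mul hQ (i := 3) (by decide)
  have m1 := h.mul_proj hQ (i := 1) (by decide)
  have m2 := h.mul_proj hQ (i := 2) (by decide)
  have m3 := h.mul_proj hQ (i := 3) (by decide)
  have s1 := hr 1 (by decide)
  have s2 := hr 2 (by decide)
  have s3 := hr 3 (by decide)
  obtain ⟨-, h1, h2, h3, -⟩ := h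
  refine ⟨hQ, hQ', ?_, ?_, ?_, ?_, ?_, ?_, ?_⟩
  · rw [EndV.mul_neg, EndV.mul_smul, l3]
  · rw [EndV.neg_mul, EndV.smul_mul, m3]
  · rw [mul_add, EndV.mul_smul, l1, l2]
  · rw [add_mul, EndV.smul_mul, m1, m2]
  · rw [EndV.star_neg, star_I_smul, s3, EndV.smul_neg, neg_neg]
  · simp only [EndV.neg_mul, EndV.mul_neg, add_mul, mul_add, EndV.smul_mul, EndV.mul_smul]
    have e : Complex.I • Complex.I • (r 3 * r 2 - r 2 * r 3) = -r 1 := by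
      rw [smul_smul, Complex.I_mul_I]
      exact (_root_.neg_one_smul ℂ (r 3 * r 2 - r 2 * r 3)).trans ((_root_.neg_sub _ _).trans h1)
    linear_combination (norm := module) (-Complex.I) • h2 - e
  · rw [EndV.star_add, star_I_smul, s1, s2]
    simp only [EndV.neg_mul, EndV.mul_neg, add_mul, mul_add, EndV.smul_mul, EndV.mul_smul,
      EndV.smul_neg]
    linear_combination (norm := module) (2 * Complex.I) • h3

theorem IsIrreducibleSU2.casimir (h : IsIrreducibleSU2 Q r) (hQ : Q * Q = Q) (hQ' : star Q = Q)
    (hr : ∀ i, i ≠ 0 → star (r i) = -r i) {j : ℕ} (hj : j ≠ 2)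
    (hrank : Module.finrank ℂ (LinearMap.range (Q : V n →ₗ[ℂ] V n)) = j) :
    (-(Complex.I • r 3) = 0 ∧ r 1 + Complex.I • r 2 = 0) ∨ ∃ c : ℝ, 3 / 4 < c ∧
      -(Complex.I • r 3) * -(Complex.I • r 3) + -(Complex.I • r 3) +
        star (r 1 + Complex.I • r 2) * (r 1 + Complex.I • r 2) = (c : ℂ) • Q := by
  refine IsResidue.casimir (h.isResidue hQ hQ' hr) hj hrank fun W hW hinv => h.2.2.2.2 W hW ?_
  have key : ∀ w ∈ W, r 1 w ∈ W ∧ r 2 w ∈ W ∧ r 3 w ∈ W := by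
    intro w hw
    obtain ⟨hA, hB, hC⟩ := hinv w hw
    rw [EndV.star_add, star_I_smul, hr 1 (by decide), hr 2 (by decide)] at hC
    have e1 : r 1 w = (1 / 2 : ℂ) • ((r 1 + Complex.I • r 2) w - (-r 1 + -(Complex.I • -r 2)) w) := by
      simp only [add_apply, neg_apply, smul_apply]
      module
    have e2 : r 2 w = (-(Complex.I / 2) : ℂ) •
        ((r 1 + Complex.I • r 2) w + (-r 1 + -(Complex.I • -r 2)) w) := by
      simp only [add_apply, neg_apply, smul_apply]
      match_scalars <;> ring_nf <;> simp
    have e3 : r 3 w = Complex.I • (-(Complex.I • r 3)) w := by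
      simp only [neg_apply, smul_apply]
      match_scalars; ring_nf; simp
    refine ⟨?_, ?_, ?_⟩
    · rw [e1]; exact W.smul_mem _ (W.sub_mem hB hC)
    · rw [e2]; exact W.smul_mem _ (W.add_mem hB hC)
    · rw [e3]; exact W.smul_mem _ hA
  intro i hi w hw
  obtain ⟨k1, k2, k3⟩ := key w hw
  fin_cases i
  · exact absurd rfl hi
  · exact k1
  · exact k2
  · exact k3

end Residue

section Affine

variable {n : ℕ} {a b p σ δ : ℝ} {T : Fin 4 → ℝ → EndV n}

theorem exists_bound_of_isBigO {E : Type*} [NormedAddCommGroup E] {f : ℝ → E}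
    (hc : ContinuousOn f (Ioc 0 δ)) (h : f =O[𝓝[>] 0] fun _ => (1 : ℝ)) :
    ∃ K, ∀ t ∈ Ioc 0 δ, ‖f t‖ ≤ K := by
  obtain ⟨C, hC⟩ := h.bound
  obtain ⟨ε, hε, hεC⟩ := mem_nhdsGT_iff_exists_Ioo_subset.1 hC
  obtain ⟨C', hC'⟩ := (isCompact_Icc (a := ε / 2) (b := δ)).exists_bound_of_continuousOn
    (hc.mono fun t ht => ⟨lt_of_lt_of_le (half_pos hε) ht.1, ht.2⟩)
  refine ⟨max C C', fun t ht => ?_⟩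
  by_cases hlt : t < ε
  · refine le_max_of_le_left ?_
    simpa using hεC ⟨ht.1, hlt⟩
  · exact le_max_of_le_right (hC' t ⟨by linarith [half_lt_self (show 0 < ε from hε)], ht.2⟩)

/-- The Nahm data in the coordinate `t`, `z = p + σt`, centred at an end. -/
noncomputable def pull (p σ : ℝ) (T : Fin 4 → ℝ → EndV n) : Fin 4 → ℝ → EndV n :=
  fun i t => σ • T i (p + σ * t)

theorem hasDerivAt_affine (t : ℝ) : HasDerivAt (fun t : ℝ => p + σ * t) σ t := by
  simpa using ((hasDerivAt_id t).const_mul σ).const_add p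

theorem HasDerivAt.comp_affine {E : Type*} [NormedAddCommGroup E] [NormedSpace ℝ E] {f : ℝ → E}
    {f' : E} {t : ℝ} (h : HasDerivAt f f' (p + σ * t)) :
    HasDerivAt (fun t => f (p + σ * t)) (σ • f') t :=
  HasDerivAt.scomp t h (hasDerivAt_affine t)

theorem IsNahm.pull (hσ : σ = 1 ∨ σ = -1) (h : IsNahm T (Ioo a b))
    (hsub : ∀ t ∈ Ioo 0 δ, p + σ * t ∈ Ioo a b) : IsNahm (pull p σ T) (Ioo 0 δ) := by
  intro i k l hikl t ht
  have hd := (HasDerivAt.comp_affine (h i k l hikl _ (hsub t ht))).const_smul σ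
  refine hd.congr_deriv ?_
  have hσ2 : σ * σ = 1 := by rcases hσ with rfl | rfl <;> norm_num
  simp only [CaloronNahm.pull, EndV.rsmul_mul, EndV.mul_rsmul, smul_smul, hσ2, one_smul]

theorem IsNahm.hasDerivAt {I : Set ℝ} (h : IsNahm T I) {t : ℝ} (ht : t ∈ I) :
    HasDerivAt (T 1) ((T 2 t * T 3 t - T 3 t * T 2 t) - (T 0 t * T 1 t - T 1 t * T 0 t)) t ∧
    HasDerivAt (T 2) ((T 3 t * T 1 t - T 1 t * T 3 t) - (T 0 t * T 2 t - T 2 t * T 0 t)) t ∧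
    HasDerivAt (T 3) ((T 1 t * T 2 t - T 2 t * T 1 t) - (T 0 t * T 3 t - T 3 t * T 0 t)) t :=
  ⟨h 1 2 3 (by simp) t ht, h 2 3 1 (by simp) t ht, h 3 1 2 (by simp) t ht⟩

theorem IsNahm.hasDerivAt_beta {I : Set ℝ} (h : IsNahm T I) {t : ℝ} (ht : t ∈ I) :
    HasDerivAt (nahmBeta T) (nahmBeta T t * nahmAlpha T t - nahmAlpha T t * nahmBeta T t) t := by
  obtain ⟨h1, h2, -⟩ := h.hasDerivAt ht
  refine (h1.add (h2.const_smul Complex.I)).congr_deriv ?_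
  simp only [add_mul, mul_add, sub_mul, mul_sub, EndV.smul_mul, EndV.mul_smul]
  match_scalars <;> ring_nf <;> simp

theorem IsNahm.continuousOn {I : Set ℝ} (h : IsNahm T I) {i : Fin 4} (hi : i ≠ 0) :
    ContinuousOn (T i) I := by
  intro t ht
  obtain ⟨h1, h2, h3⟩ := h.hasDerivAt ht
  fin_cases i
  · exact absurd rfl hi
  · exact h1.continuousAt.continuousWithinAt
  · exact h2.continuousAt.continuousWithinAt
  · exact h3.continuousAt.continuousWithinAt

end Affine

end CaloronNahm

namespace CaloronNahm

section Gauge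

variable {n : ℕ} {δ K : ℝ} {T : Fin 4 → ℝ → EndV n} {T₀' g : ℝ → EndV n} {Q : EndV n}
  {r : Fin 4 → EndV n}

/-- Regularity of second derivatives at an end: if `s`, `s' + αs`, `βs` are of class `L²₁` and `Qs`
vanishes at the end, then `s` is of class `L²₂`. -/
def SecondDerivRegular (δ : ℝ) (α β : ℝ → EndV n) (Q : EndV n) : Prop :=
  ∀ s s' s'' G' H' : ℝ → V n, HasWeakDeriv 0 δ s s' → HasWeakDeriv 0 δ s' s'' →
    HasWeakDeriv 0 δ (fun t => s' t + α t (s t)) G' → HasWeakDeriv 0 δ (fun t => β t (s t)) H' →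
    IsL2 0 δ s → IsL2 0 δ s' → IsL2 0 δ (fun t => t⁻¹ • Q (s t)) → IsL2 0 δ G' → IsL2 0 δ H' →
    IsL2 0 δ s''

theorem Pole.secondDerivRegular {K' : ℝ} {α β α' β' : ℝ → EndV n} {A B : EndV n}
    (h : Pole δ K α β Q A B) (wα : HasWeakDeriv 0 δ α α') (wβ : HasWeakDeriv 0 δ β β')
    (hα : ∀ t ∈ Ioo 0 δ, ∀ v, ‖α' t v + t⁻¹ • t⁻¹ • A v‖ ≤ K' * (‖t⁻¹ • Q v‖ + ‖v‖))
    (hβ : ∀ t ∈ Ioo 0 δ, ∀ v, ‖β' t v + t⁻¹ • t⁻¹ • B v‖ ≤ K' * (‖t⁻¹ • Q v‖ + ‖v‖)) :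
    SecondDerivRegular δ α β Q := by
  intro s s' s'' G' H' ws ws' wG wH ls ls' lQ lG lH
  exact h.memLp_second_deriv wα wβ hα hβ ws ws' ls ls' lQ
    (lG.congr ((ws'.add (wα.apply ws)).deriv_unique wG))
    (lH.congr ((wβ.apply ws).deriv_unique wH))

theorem norm_mul_apply_sub_le {X Y r s : EndV n} {t : ℝ} (ht : 0 < t) (hr : r * Q = r)
    (hs : s * Q = s) (hX : ‖X - t⁻¹ • r‖ ≤ K) (hY : ‖Y - t⁻¹ • s‖ ≤ K)
    (hoff : ‖Q * (Y - t⁻¹ • s) * (1 - Q)‖ ≤ K * t) (v : V n) :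
    ‖X (Y v) - t⁻¹ • t⁻¹ • r (s v)‖ ≤
      (‖r‖ * K + ‖s‖ * K + K * K) * (‖t⁻¹ • Q v‖ + ‖v‖) := by
  have hK : 0 ≤ K := (norm_nonneg _).trans hX
  set x := X - t⁻¹ • r with hx
  set y := Y - t⁻¹ • s with hy
  have hr' : ∀ w, r (Q w) = r w := fun w => congrArg (fun X : EndV n => X w) hr
  have hs' : ∀ w, s (Q w) = s w := fun w => congrArg (fun X : EndV n => X w) hs
  have e1 : X (Y v) - t⁻¹ • t⁻¹ • r (s v) =
      r (t⁻¹ • (Q * y * (1 - Q)) v) + r (y (t⁻¹ • Q v)) + x (s (t⁻¹ • Q v)) + x (y v) := by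
    have a1 : X = t⁻¹ • r + x := by rw [hx]; abel
    have a2 : Y = t⁻¹ • s + y := by rw [hy]; abel
    have a3 : (Q * y * (1 - Q)) v = Q (y v) - Q (y (Q v)) := by
      change Q (y (v - Q v)) = _
      rw [map_sub, map_sub]
    have a4 : ∀ w, X w = t⁻¹ • r w + x w := fun w => by
      conv_lhs => rw [a1]
      rfl
    have a5 : Y v = t⁻¹ • s v + y v := by
      conv_lhs => rw [a2]
      rfl
    rw [a3, a4, a5]
    simp only [map_add, map_sub, ContinuousLinearMap.map_smul_of_tower, smul_add, smul_sub, hr', hs']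
    abel
  have b1 : ‖r (t⁻¹ • (Q * y * (1 - Q)) v)‖ ≤ ‖r‖ * (K * ‖v‖) := by
    refine (r.le_opNorm _).trans ?_
    gcongr
    rw [norm_smul, norm_inv, Real.norm_of_nonneg ht.le]
    have := (ContinuousLinearMap.le_opNorm (Q * y * (1 - Q)) v).trans
      (mul_le_mul_of_nonneg_right hoff (norm_nonneg v))
    calc t⁻¹ * ‖(Q * y * (1 - Q)) v‖ ≤ t⁻¹ * (K * t * ‖v‖) := by
          have := (inv_pos.2 ht).le
          gcongr
      _ = K * ‖v‖ := by field_simp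
  have b2 : ‖r (y (t⁻¹ • Q v))‖ ≤ ‖r‖ * (K * ‖t⁻¹ • Q v‖) := by
    refine (r.le_opNorm _).trans ?_
    gcongr
    exact y.le_of_opNorm_le hY _
  have b3 : ‖x (s (t⁻¹ • Q v))‖ ≤ K * (‖s‖ * ‖t⁻¹ • Q v‖) := by
    refine (x.le_of_opNorm_le hX _).trans ?_
    gcongr
    exact s.le_opNorm _
  have b4 : ‖x (y v)‖ ≤ K * (K * ‖v‖) := by
    refine (x.le_of_opNorm_le hX _).trans ?_
    gcongr
    exact y.le_of_opNorm_le hY _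
  rw [e1]
  refine (norm_add_le _ _).trans ((add_le_add (norm_add₃_le.trans (add_le_add (add_le_add b1 b2) b3))
    b4).trans ?_)
  have c1 : 0 ≤ ‖s‖ * K * ‖v‖ := by positivity
  have c2 : 0 ≤ K * K * ‖t⁻¹ • Q v‖ := by positivity
  linarith

/-- Nahm data at an end, in a parallel gauge `g` for `d/dt + T₀`. -/
structure GaugedEnd (δ K : ℝ) (T : Fin 4 → ℝ → EndV n) (T₀' g : ℝ → EndV n) (Q : EndV n)
    (r : Fin 4 → EndV n) : Prop where
  pos : 0 < δ
  proj_sq : Q * Q = Q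
  proj_star : star Q = Q
  su2 : IsIrreducibleSU2 Q r
  skew : ∀ i, ∀ t ∈ Ioo 0 δ, star (T i t) = -T i t
  nahm : IsNahm T (Ioo 0 δ)
  deriv_zero : ∀ t ∈ Ioo 0 δ, HasDerivAt (T 0) (T₀' t) t
  cont_deriv : ContinuousOn T₀' (Ioo 0 δ)
  deriv_gauge : ∀ t ∈ Ioo 0 δ, HasDerivAt g (-(T 0 t * g t)) t
  gauge_star_mul : ∀ t ∈ Ioo 0 δ, star (g t) * g t = 1
  gauge_mul_star : ∀ t ∈ Ioo 0 δ, g t * star (g t) = 1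
  bound_zero : ∀ t ∈ Ioo 0 δ, ‖T 0 t‖ ≤ K
  bound_deriv : ∀ t ∈ Ioo 0 δ, ‖T₀' t‖ ≤ K
  bound_gauge : ∀ t ∈ Ioo 0 δ, ‖g t - 1‖ ≤ K * t
  pole : ∀ i, i ≠ 0 → ∀ t ∈ Ioo 0 δ, ‖star (g t) * T i t * g t - t⁻¹ • r i‖ ≤ K

/-- The Nahm data in the gauge `g`. -/
noncomputable def gauged (T : Fin 4 → ℝ → EndV n) (g : ℝ → EndV n) : Fin 4 → ℝ → EndV n :=
  fun i t => if i = 0 then 0 else star (g t) * T i t * g t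

theorem gauged_of_ne {i : Fin 4} (hi : i ≠ 0) (t : ℝ) :
    gauged T g i t = star (g t) * T i t * g t := if_neg hi

theorem gauged_zero (t : ℝ) : gauged T g 0 t = 0 := if_pos rfl

namespace GaugedEnd

theorem bound_nonneg (h : GaugedEnd δ K T T₀' g Q r) : 0 ≤ K := by
  obtain ⟨t, ht⟩ := exists_between h.pos
  exact (norm_nonneg _).trans (h.bound_zero t ht)

theorem hasDerivAt_star (h : GaugedEnd δ K T T₀' g Q r) {t : ℝ} (ht : t ∈ Ioo 0 δ) :
    HasDerivAt (fun t => star (g t)) (star (g t) * T 0 t) t := by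
  refine (h.deriv_gauge t ht).star.congr_deriv ?_
  rw [EndV.star_neg, star_mul, h.skew 0 t ht, EndV.mul_neg, neg_neg]

theorem isNahm_gauged (h : GaugedEnd δ K T T₀' g Q r) : IsNahm (gauged T g) (Ioo 0 δ) := by
  intro a b c habc t ht
  have hne : a ≠ 0 ∧ b ≠ 0 ∧ c ≠ 0 := by
    simp only [mem_insert_iff, mem_singleton_iff, Prod.mk.injEq] at habc
    rcases habc with ⟨rfl, rfl, rfl⟩ | ⟨rfl, rfl, rfl⟩ | ⟨rfl, rfl, rfl⟩ <;> decide
  have e : gauged T g a = fun t => star (g t) * T a t * g t :=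
    funext fun t => gauged_of_ne hne.1 t
  rw [gauged_of_ne hne.2.1, gauged_of_ne hne.2.2, gauged_zero, e]
  refine (((h.hasDerivAt_star ht).mul (h.nahm a b c habc t ht)).mul (h.deriv_gauge t ht)).congr_deriv ?_
  have k : ∀ X Y : EndV n, star (g t) * X * g t * (star (g t) * Y * g t) =
      star (g t) * (X * Y) * g t := by
    intro X Y
    calc _ = star (g t) * X * (g t * star (g t)) * Y * g t := by simp only [mul_assoc]
      _ = _ := by rw [h.gauge_mul_star t ht, mul_one, mul_assoc (star (g t))]
  rw [k, k, zero_mul, mul_zero, sub_zero, sub_zero]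
  simp only [Pi.mul_apply, mul_sub, sub_mul, add_mul, EndV.mul_neg, mul_assoc]
  abel

theorem pole_gauged (h : GaugedEnd δ K T T₀' g Q r) {i : Fin 4} (hi : i ≠ 0) {t : ℝ}
    (ht : t ∈ Ioo 0 δ) : ‖gauged T g i t - t⁻¹ • r i‖ ≤ K := by
  rw [gauged_of_ne hi]; exact h.pole i hi t ht

theorem star_residue (h : GaugedEnd δ K T T₀' g Q r) {i : Fin 4} (hi : i ≠ 0) :
    star (r i) = -r i := by
  have hmem : ∀ᶠ t in 𝓝[>] (0 : ℝ), t ∈ Ioo 0 δ := Ioo_mem_nhdsGT h.pos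
  have h1 : Tendsto (fun t : ℝ => t • gauged T g i t) (𝓝[>] 0) (𝓝 (r i)) := by
    rw [tendsto_iff_norm_sub_tendsto_zero]
    have hK : Tendsto (fun t : ℝ => t * K) (𝓝[>] 0) (𝓝 0) := by
      have : Tendsto (fun t : ℝ => t * K) (𝓝 0) (𝓝 (0 * K)) := (continuous_id.mul continuous_const).tendsto 0
      rw [zero_mul] at this
      exact this.mono_left nhdsWithin_le_nhds
    refine squeeze_zero' (Eventually.of_forall fun t => norm_nonneg _) ?_ hK
    filter_upwards [hmem] with t ht
    have e : t • gauged T g i t - r i = t • (gauged T g i t - t⁻¹ • r i) := by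
      rw [smul_sub, smul_smul, mul_inv_cancel₀ ht.1.ne', one_smul]
    rw [e, norm_smul, Real.norm_of_nonneg ht.1.le]
    exact mul_le_mul_of_nonneg_left (h.pole_gauged hi ht) ht.1.le
  have h2 : Tendsto (fun t : ℝ => star (t • gauged T g i t)) (𝓝[>] 0) (𝓝 (star (r i))) :=
    ((ContinuousLinearMap.adjoint (𝕜 := ℂ) (E := V n) (F := V n)).continuous.tendsto _).comp h1
  refine tendsto_nhds_unique h2 (h1.neg.congr' ?_)
  filter_upwards [hmem] with t ht
  rw [EndV.star_rsmul, gauged_of_ne hi, star_mul, star_mul, star_star, h.skew i t ht,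
    EndV.neg_mul, EndV.mul_neg, mul_assoc]
  exact (_root_.smul_neg t _).symm

theorem isResidue (h : GaugedEnd δ K T T₀' g Q r) :
    IsResidue Q (-(Complex.I • r 3)) (r 1 + Complex.I • r 2) :=
  h.su2.isResidue h.proj_sq h.proj_star fun _ hi => h.star_residue hi

end GaugedEnd

theorem pole_of_norm_le {T : Fin 4 → ℝ → EndV n} (hδ : 0 < δ)
    (hres : IsResidue Q (-(Complex.I • r 3)) (r 1 + Complex.I • r 2))
    (hT : IsNahm T (Ioo 0 δ)) (hT0 : ContinuousOn (T 0) (Ioo 0 δ))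
    (hb : ∀ t ∈ Ioo 0 δ, ‖T 0 t‖ ≤ K)
    (hp : ∀ i, i ≠ 0 → ∀ t ∈ Ioo 0 δ, ‖T i t - t⁻¹ • r i‖ ≤ K) :
    Pole δ (2 * K) (nahmAlpha T) (nahmBeta T) Q (-(Complex.I • r 3)) (r 1 + Complex.I • r 2) := by
  refine ⟨hδ, hres, ?_, ?_, ?_, ?_⟩
  · exact hT0.sub ((hT.continuousOn (by decide)).const_smul Complex.I)
  · exact (hT.continuousOn (by decide)).add ((hT.continuousOn (by decide)).const_smul Complex.I)
  · intro t ht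
    have e : nahmAlpha T t - t⁻¹ • -(Complex.I • r 3) = T 0 t - Complex.I • (T 3 t - t⁻¹ • r 3) := by
      simp only [nahmAlpha]
      module
    rw [e]
    refine (norm_sub_le _ _).trans ?_
    rw [norm_smul, Complex.norm_I, one_mul]
    linarith [hb t ht, hp 3 (by decide) t ht]
  · intro t ht
    have e : nahmBeta T t - t⁻¹ • (r 1 + Complex.I • r 2) =
        (T 1 t - t⁻¹ • r 1) + Complex.I • (T 2 t - t⁻¹ • r 2) := by
      simp only [nahmBeta]
      module
    rw [e]
    refine (norm_add_le _ _).trans ?_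
    rw [norm_smul, Complex.norm_I, one_mul]
    linarith [hp 1 (by decide) t ht, hp 2 (by decide) t ht]

end Gauge

end CaloronNahm

namespace CaloronNahm

section Gauge

variable {n : ℕ} {δ K : ℝ} {T : Fin 4 → ℝ → EndV n} {T₀' g : ℝ → EndV n} {Q : EndV n}
  {r : Fin 4 → EndV n}

theorem IsNahm.hasWeakDeriv {T : Fin 4 → ℝ → EndV n} (h : IsNahm T (Ioo 0 δ))
    (h0 : ContinuousOn (T 0) (Ioo 0 δ)) :
    HasWeakDeriv 0 δ (T 1) (fun t => (T 2 t * T 3 t - T 3 t * T 2 t) - (T 0 t * T 1 t - T 1 t * T 0 t)) ∧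
    HasWeakDeriv 0 δ (T 2) (fun t => (T 3 t * T 1 t - T 1 t * T 3 t) - (T 0 t * T 2 t - T 2 t * T 0 t)) ∧
    HasWeakDeriv 0 δ (T 3) (fun t => (T 1 t * T 2 t - T 2 t * T 1 t) - (T 0 t * T 3 t - T 3 t * T 0 t)) := by
  have c1 := h.continuousOn (i := 1) (by decide)
  have c2 := h.continuousOn (i := 2) (by decide)
  have c3 := h.continuousOn (i := 3) (by decide)
  refine ⟨HasWeakDeriv.of_hasDerivAt (fun t ht => (h.hasDerivAt ht).1) ?_,
    HasWeakDeriv.of_hasDerivAt (fun t ht => (h.hasDerivAt ht).2.1) ?_,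
    HasWeakDeriv.of_hasDerivAt (fun t ht => (h.hasDerivAt ht).2.2) ?_⟩
  · exact ((c2.mul c3).sub (c3.mul c2)).sub ((h0.mul c1).sub (c1.mul h0))
  · exact ((c3.mul c1).sub (c1.mul c3)).sub ((h0.mul c2).sub (c2.mul h0))
  · exact ((c1.mul c2).sub (c2.mul c1)).sub ((h0.mul c3).sub (c3.mul h0))

theorem norm_comm_add_le {X Y x y w : EndV n} {t M : ℝ} (ht : 0 < t) (hx : x * Q = x)
    (hy : y * Q = y) (hxy : x * y - y * x = -w) (hX : ‖X - t⁻¹ • x‖ ≤ K) (hY : ‖Y - t⁻¹ • y‖ ≤ K)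
    (oX : ‖Q * (X - t⁻¹ • x) * (1 - Q)‖ ≤ K * t) (oY : ‖Q * (Y - t⁻¹ • y) * (1 - Q)‖ ≤ K * t)
    (Mx : ‖x‖ ≤ M) (My : ‖y‖ ≤ M) (v : V n) :
    ‖(X * Y - Y * X) v + t⁻¹ • t⁻¹ • w v‖ ≤ 2 * (M * K + M * K + K * K) * (‖t⁻¹ • Q v‖ + ‖v‖) := by
  have hK : 0 ≤ K := (norm_nonneg _).trans hX
  have e : (X * Y - Y * X) v + t⁻¹ • t⁻¹ • w v =
      (X (Y v) - t⁻¹ • t⁻¹ • x (y v)) - (Y (X v) - t⁻¹ • t⁻¹ • y (x v)) := by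
    have : w v = -(x (y v) - y (x v)) := by
      have h1 := congrArg (fun X : EndV n => X v) hxy
      simp only [sub_apply, mul_apply_eq_comp, neg_apply] at h1
      rw [h1, neg_neg]
    rw [this]
    change X (Y v) - Y (X v) + _ = _
    module
  rw [e]
  have b1 := norm_mul_apply_sub_le ht hx hy hX hY oY v
  have b2 := norm_mul_apply_sub_le ht hy hx hY hX oX v
  have c : ∀ a b : ℝ, a ≤ M → b ≤ M → (a * K + b * K + K * K) * (‖t⁻¹ • Q v‖ + ‖v‖) ≤
      (M * K + M * K + K * K) * (‖t⁻¹ • Q v‖ + ‖v‖) := by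
    intro a b ha hb
    gcongr
  refine (norm_sub_le _ _).trans ((add_le_add (b1.trans (c _ _ Mx My)) (b2.trans (c _ _ My Mx))).trans ?_)
  linarith

theorem secondDerivRegular_of_off {T : Fin 4 → ℝ → EndV n} (hδ : 0 < δ) (hQ : Q * Q = Q)
    (hres : IsResidue Q (-(Complex.I • r 3)) (r 1 + Complex.I • r 2)) (hsu : IsIrreducibleSU2 Q r)
    (hT : IsNahm T (Ioo 0 δ)) (hT0 : ∀ t, T 0 t = 0)
    (hp : ∀ i, i ≠ 0 → ∀ t ∈ Ioo 0 δ, ‖T i t - t⁻¹ • r i‖ ≤ K)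
    (ho : ∀ i, i ≠ 0 → ∀ t ∈ Ioo 0 δ, ‖Q * (T i t - t⁻¹ • r i) * (1 - Q)‖ ≤ K * t) :
    SecondDerivRegular δ (nahmAlpha T) (nahmBeta T) Q := by
  have hK : 0 ≤ K := by
    obtain ⟨t, ht⟩ := exists_between hδ
    exact (norm_nonneg _).trans (hp 1 (by decide) t ht)
  have c0 : ContinuousOn (T 0) (Ioo 0 δ) := by
    rw [show T 0 = fun _ => 0 from funext hT0]; exact continuousOn_const
  have hpole := pole_of_norm_le hδ hres hT c0 (fun t _ => by rw [hT0, norm_zero]; exact hK) hp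
  obtain ⟨w1, w2, w3⟩ := hT.hasWeakDeriv c0
  have w0 : HasWeakDeriv 0 δ (T 0) (fun _ => 0) := by
    rw [show T 0 = fun _ => 0 from funext hT0]; exact HasWeakDeriv.const 0
  have clmI : ∀ {X X' : ℝ → EndV n}, HasWeakDeriv 0 δ X X' →
      HasWeakDeriv 0 δ (fun t => Complex.I • X t) (fun t => Complex.I • X' t) := fun hX =>
    hX.clm (((Complex.I : ℂ) • ContinuousLinearMap.id ℂ (EndV n)).restrictScalars ℝ)
  set M := ‖r 1‖ + ‖r 2‖ + ‖r 3‖ with hM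
  have M1 : ‖r 1‖ ≤ M := by rw [hM]; linarith [norm_nonneg (r 2), norm_nonneg (r 3)]
  have M2 : ‖r 2‖ ≤ M := by rw [hM]; linarith [norm_nonneg (r 1), norm_nonneg (r 3)]
  have M3 : ‖r 3‖ ≤ M := by rw [hM]; linarith [norm_nonneg (r 1), norm_nonneg (r 2)]
  have q1 := hsu.mul_proj hQ (i := 1) (by decide)
  have q2 := hsu.mul_proj hQ (i := 2) (by decide)
  have q3 := hsu.mul_proj hQ (i := 3) (by decide)
  obtain ⟨-, k1, k2, k3, -⟩ := hsu
  have key : ∀ i k l : Fin 4, i ≠ 0 → k ≠ 0 → r i * Q = r i → r k * Q = r k → ‖r i‖ ≤ M → ‖r k‖ ≤ M →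
      r i * r k - r k * r i = -r l → ∀ t ∈ Ioo 0 δ, ∀ v, ‖((T i t * T k t - T k t * T i t) -
        (T 0 t * T l t - T l t * T 0 t)) v + t⁻¹ • t⁻¹ • r l v‖ ≤
        2 * (M * K + M * K + K * K) * (‖t⁻¹ • Q v‖ + ‖v‖) := by
    intro i k l hi hk qi qk Mi Mk hik t ht v
    rw [hT0, zero_mul, mul_zero, sub_zero, sub_zero]
    exact norm_comm_add_le ht.1 qi qk hik (hp i hi t ht) (hp k hk t ht) (ho i hi t ht) (ho k hk t ht)
      Mi Mk v
  refine hpole.secondDerivRegular (K' := 4 * (M * K + M * K + K * K)) (w0.sub (clmI w3)) (w1.add (clmI w2)) ?_ ?_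
  · intro t ht v
    have b := key 1 2 3 (by decide) (by decide) q1 q2 M1 M2 k3 t ht v
    set X := (T 1 t * T 2 t - T 2 t * T 1 t) - (T 0 t * T 3 t - T 3 t * T 0 t)
    have e : (0 - Complex.I • X) v + t⁻¹ • t⁻¹ • (-(Complex.I • r 3)) v =
        -(Complex.I • (X v + t⁻¹ • t⁻¹ • r 3 v)) := by
      simp only [zero_sub, neg_apply, smul_apply]
      module
    rw [e, norm_neg, norm_smul, Complex.norm_I, one_mul]
    have : 0 ≤ 2 * (M * K + M * K + K * K) * (‖t⁻¹ • Q v‖ + ‖v‖) := (norm_nonneg _).trans b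
    linarith
  · intro t ht v
    have b1 := key 2 3 1 (by decide) (by decide) q2 q3 M2 M3 k1 t ht v
    have b2 := key 3 1 2 (by decide) (by decide) q3 q1 M3 M1 k2 t ht v
    set X := (T 2 t * T 3 t - T 3 t * T 2 t) - (T 0 t * T 1 t - T 1 t * T 0 t)
    set Y := (T 3 t * T 1 t - T 1 t * T 3 t) - (T 0 t * T 2 t - T 2 t * T 0 t)
    have e : (X + Complex.I • Y) v + t⁻¹ • t⁻¹ • (r 1 + Complex.I • r 2) v =
        (X v + t⁻¹ • t⁻¹ • r 1 v) + Complex.I • (Y v + t⁻¹ • t⁻¹ • r 2 v) := by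
      simp only [add_apply, smul_apply]
      module
    rw [e]
    refine (norm_add_le _ _).trans ?_
    rw [norm_smul, Complex.norm_I, one_mul]
    linarith

/-- If there is no pole, second derivatives are regular. -/
theorem secondDerivRegular_of_bounded {T : Fin 4 → ℝ → EndV n} (hδ : 0 < δ) (hQ : Q * Q = Q)
    (hQ' : star Q = Q) (hT : IsNahm T (Ioo 0 δ))
    (h0 : ∀ t ∈ Ioo 0 δ, HasDerivAt (T 0) (T₀' t) t) (hc : ContinuousOn T₀' (Ioo 0 δ))
    (hb : ∀ i, ∀ t ∈ Ioo 0 δ, ‖T i t‖ ≤ K) (hb' : ∀ t ∈ Ioo 0 δ, ‖T₀' t‖ ≤ K) :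
    SecondDerivRegular δ (nahmAlpha T) (nahmBeta T) Q := by
  have hK : 0 ≤ K := by
    obtain ⟨t, ht⟩ := exists_between hδ
    exact (norm_nonneg _).trans (hb 1 t ht)
  have w0 := HasWeakDeriv.of_hasDerivAt h0 hc
  obtain ⟨w1, w2, w3⟩ := hT.hasWeakDeriv w0.continuousOn
  have clmI : ∀ {X X' : ℝ → EndV n}, HasWeakDeriv 0 δ X X' →
      HasWeakDeriv 0 δ (fun t => Complex.I • X t) (fun t => Complex.I • X' t) := fun hX =>
    hX.clm (((Complex.I : ℂ) • ContinuousLinearMap.id ℂ (EndV n)).restrictScalars ℝ)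
  have z1 : -(Complex.I • (0 : Fin 4 → EndV n) 3) = 0 := by ext1 v; simp
  have z2 : (0 : Fin 4 → EndV n) 1 + Complex.I • (0 : Fin 4 → EndV n) 2 = 0 := by ext1 v; simp
  have z3 : ∀ (t : ℝ) i, t⁻¹ • (0 : Fin 4 → EndV n) i = 0 := fun t i => by ext1 v; simp
  have hpole := pole_of_norm_le (Q := Q) (r := 0) hδ (by rw [z1, z2]; exact isResidue_zero hQ hQ') hT
    w0.continuousOn (hb 0) (fun i _ t ht => by rw [z3, sub_zero]; exact hb i t ht)
  have m : ∀ i k t, t ∈ Ioo 0 δ → ‖T i t * T k t‖ ≤ K * K := fun i k t ht =>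
    (norm_mul_le _ _).trans (mul_le_mul (hb i t ht) (hb k t ht) (norm_nonneg _) hK)
  have key : ∀ i k l : Fin 4, ∀ t ∈ Ioo 0 δ, ‖(T i t * T k t - T k t * T i t) -
        (T 0 t * T l t - T l t * T 0 t)‖ ≤ 4 * (K * K) := fun i k l t ht =>
    (norm_sub_le _ _).trans (by
      have := norm_sub_le (T i t * T k t) (T k t * T i t)
      have := norm_sub_le (T 0 t * T l t) (T l t * T 0 t)
      linarith [m i k t ht, m k i t ht, m 0 l t ht, m l 0 t ht])
  have fin : ∀ (X : EndV n) (C t : ℝ), ‖X‖ ≤ C → C ≤ K + 8 * (K * K) → ∀ v : V n, ‖X v‖ ≤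
      (K + 8 * (K * K)) * (‖t⁻¹ • Q v‖ + ‖v‖) := by
    intro X C t hX hC v
    have h1 : 0 ≤ (K + 8 * (K * K)) * ‖t⁻¹ • Q v‖ := by positivity
    have h2 := X.le_of_opNorm_le (hX.trans hC) v
    linarith
  refine hpole.secondDerivRegular (K' := K + 8 * (K * K)) (w0.sub (clmI w3)) (w1.add (clmI w2)) ?_ ?_
  · intro t ht v
    have e : (-(Complex.I • (0 : Fin 4 → EndV n) 3)) v = 0 := by simp
    rw [e, smul_zero, smul_zero, add_zero]
    refine fin _ (K + 4 * (K * K)) t ((norm_sub_le _ _).trans ?_) (by nlinarith) v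
    rw [norm_smul, Complex.norm_I, one_mul]
    linarith [hb' t ht, key 1 2 3 t ht]
  · intro t ht v
    have e : ((0 : Fin 4 → EndV n) 1 + Complex.I • (0 : Fin 4 → EndV n) 2) v = 0 := by simp
    rw [e, smul_zero, smul_zero, add_zero]
    refine fin _ (8 * (K * K)) t ((norm_add_le _ _).trans ?_) (by linarith) v
    rw [norm_smul, Complex.norm_I, one_mul]
    linarith [key 2 3 1 t ht, key 3 1 2 t ht]

namespace GaugedEnd

theorem norm_gauge_le (h : GaugedEnd δ K T T₀' g Q r) {t : ℝ} (ht : t ∈ Ioo 0 δ) :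
    ‖g t‖ ≤ 1 + K * δ := by
  have h1 := norm_add_le (g t - 1) 1
  rw [sub_add_cancel] at h1
  have h2 : ‖(1 : EndV n)‖ ≤ 1 := ContinuousLinearMap.norm_id_le
  have h3 := h.bound_gauge t ht
  have h4 : K * t ≤ K * δ := mul_le_mul_of_nonneg_left ht.2.le h.bound_nonneg
  linarith

theorem exists_pole_bound (h : GaugedEnd δ K T T₀' g Q r) : ∃ K', ∀ i, i ≠ 0 → ∀ t ∈ Ioo 0 δ,
    ‖T i t - t⁻¹ • r i‖ ≤ K' := by
  have hK := h.bound_nonneg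
  have hδ := h.pos
  set M := 1 + K * δ with hM
  refine ⟨M * K * M + (‖r 1‖ + ‖r 2‖ + ‖r 3‖) * (K * M + K), fun i hi t ht => ?_⟩
  have hM0 : 0 ≤ M := by positivity
  have g1 := h.norm_gauge_le ht
  have g2 : ‖star (g t)‖ ≤ M := by rw [EndV.norm_star]; exact g1
  have g3 := h.bound_gauge t ht
  have g4 : ‖star (g t) - 1‖ ≤ K * t := by
    rw [← EndV.norm_star, EndV.star_sub, star_star, star_one]; exact g3
  have e : T i t - t⁻¹ • r i = g t * (gauged T g i t - t⁻¹ • r i) * star (g t) +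
      t⁻¹ • ((g t - 1) * r i * star (g t) + r i * (star (g t) - 1)) := by
    have e1 : g t * gauged T g i t * star (g t) = T i t := by
      rw [gauged_of_ne hi]
      calc _ = (g t * star (g t)) * T i t * (g t * star (g t)) := by simp only [mul_assoc]
        _ = _ := by rw [h.gauge_mul_star t ht, one_mul, mul_one]
    rw [mul_sub, sub_mul, e1, EndV.mul_rsmul, EndV.rsmul_mul, sub_mul, one_mul, sub_mul, mul_sub, mul_one]
    module
  have r1 : ‖r i‖ ≤ ‖r 1‖ + ‖r 2‖ + ‖r 3‖ := by
    have := norm_nonneg (r 1)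
    have := norm_nonneg (r 2)
    have := norm_nonneg (r 3)
    fin_cases i
    · exact absurd rfl hi
    all_goals dsimp; linarith
  have b1 : ‖g t * (gauged T g i t - t⁻¹ • r i) * star (g t)‖ ≤ M * K * M := by
    refine (norm_mul_le _ _).trans ?_
    gcongr
    refine (norm_mul_le _ _).trans ?_
    gcongr
    exact h.pole_gauged hi ht
  have b2 : ‖(g t - 1) * r i * star (g t)‖ ≤ K * t * ‖r i‖ * M := by
    refine (norm_mul_le _ _).trans ?_
    have := ht.1.le
    gcongr
    refine (norm_mul_le _ _).trans ?_
    gcongr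
  have b3 : ‖r i * (star (g t) - 1)‖ ≤ ‖r i‖ * (K * t) := by
    refine (norm_mul_le _ _).trans ?_
    gcongr
  rw [e]
  refine (norm_add_le _ _).trans (add_le_add b1 ?_)
  rw [norm_smul, norm_inv, Real.norm_of_nonneg ht.1.le]
  have ht0 := inv_pos.2 ht.1
  calc _ ≤ t⁻¹ * (K * t * ‖r i‖ * M + ‖r i‖ * (K * t)) := by
        gcongr
        exact (norm_add_le _ _).trans (add_le_add b2 b3)
    _ = ‖r i‖ * (K * M + K) := by
        have := ht.1.ne'
        field_simp
    _ ≤ _ := by gcongr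

end GaugedEnd

end Gauge

end CaloronNahm

namespace CaloronNahm

section Gauge

variable {n : ℕ} {δ K : ℝ} {T : Fin 4 → ℝ → EndV n} {T₀' g : ℝ → EndV n} {Q : EndV n}
  {r : Fin 4 → EndV n}

theorem IsL2.apply_bounded {a b C : ℝ} {X : ℝ → EndV n} {u : ℝ → V n} (hu : IsL2 a b u)
    (hX : ContinuousOn X (Ioo a b)) (hC : ∀ t ∈ Ioo a b, ‖X t‖ ≤ C) :
    IsL2 a b (fun t => X t (u t)) := by
  refine MemLp.of_le_mul (c := C) hu (aestronglyMeasurable_apply hX hu.aestronglyMeasurable) ?_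
  filter_upwards [ae_restrict_mem measurableSet_Ioo] with t ht
  exact (X t).le_of_opNorm_le (hC t ht) _

theorem Pole.isL2_left {α β : ℝ → EndV n} {A B : EndV n} {s : ℝ → V n} (h : Pole δ K α β Q A B)
    (ls : IsL2 0 δ s) (lQ : IsL2 0 δ (fun t => t⁻¹ • Q (s t))) : IsL2 0 δ (fun t => α t (s t)) := by
  refine memLp_of_norm_le_add (c := ‖A‖ + K)
    (aestronglyMeasurable_apply h.cont_left ls.aestronglyMeasurable) lQ ls ls ?_
  filter_upwards [ae_restrict_mem measurableSet_Ioo] with t ht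
  have := h.norm_left_le ht (s t)
  have hK := h.bound_nonneg
  have h1 : 0 ≤ K * ‖t⁻¹ • Q (s t)‖ := by positivity
  have h2 : 0 ≤ ‖A‖ * ‖s t‖ := by positivity
  have h3 : 0 ≤ K * ‖s t‖ := by positivity
  linarith

theorem Pole.isL2_right {α β : ℝ → EndV n} {A B : EndV n} {s : ℝ → V n} (h : Pole δ K α β Q A B)
    (ls : IsL2 0 δ s) (lQ : IsL2 0 δ (fun t => t⁻¹ • Q (s t))) : IsL2 0 δ (fun t => β t (s t)) := by
  refine memLp_of_norm_le_add (c := ‖B‖ + K)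
    (aestronglyMeasurable_apply h.cont_right ls.aestronglyMeasurable) lQ ls ls ?_
  filter_upwards [ae_restrict_mem measurableSet_Ioo] with t ht
  have := h.norm_right_le ht (s t)
  have hK := h.bound_nonneg
  have h1 : 0 ≤ K * ‖t⁻¹ • Q (s t)‖ := by positivity
  have h2 : 0 ≤ ‖B‖ * ‖s t‖ := by positivity
  have h3 : 0 ≤ K * ‖s t‖ := by positivity
  linarith

namespace GaugedEnd

theorem continuousOn_zero (h : GaugedEnd δ K T T₀' g Q r) : ContinuousOn (T 0) (Ioo 0 δ) :=
  fun t ht => (h.deriv_zero t ht).continuousAt.continuousWithinAt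

theorem continuousOn_gauge (h : GaugedEnd δ K T T₀' g Q r) : ContinuousOn g (Ioo 0 δ) :=
  fun t ht => (h.deriv_gauge t ht).continuousAt.continuousWithinAt

theorem continuousOn_star (h : GaugedEnd δ K T T₀' g Q r) :
    ContinuousOn (fun t => star (g t)) (Ioo 0 δ) :=
  fun _ ht => (h.hasDerivAt_star ht).continuousAt.continuousWithinAt

theorem exists_pole (h : GaugedEnd δ K T T₀' g Q r) : ∃ K', Pole δ K' (nahmAlpha T) (nahmBeta T) Q
    (-(Complex.I • r 3)) (r 1 + Complex.I • r 2) := by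
  obtain ⟨K', hK'⟩ := h.exists_pole_bound
  exact ⟨_, pole_of_norm_le h.pos h.isResidue h.nahm h.continuousOn_zero (K := max K K')
    (fun t ht => (h.bound_zero t ht).trans (le_max_left K K'))
    (fun i hi t ht => (hK' i hi t ht).trans (le_max_right K K'))⟩

theorem secondDerivRegular (h : GaugedEnd δ K T T₀' g Q r)
    (ho : ∀ i, i ≠ 0 → ∀ t ∈ Ioo 0 δ, ‖Q * (gauged T g i t - t⁻¹ • r i) * (1 - Q)‖ ≤ K * t) :
    SecondDerivRegular δ (nahmAlpha T) (nahmBeta T) Q := by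
  intro s s' s'' G' H' ws ws' wG wH ls ls' lQ lG lH
  obtain ⟨K', hpole⟩ := h.exists_pole
  have hreg := secondDerivRegular_of_off h.pos h.proj_sq h.isResidue h.su2 h.isNahm_gauged
    gauged_zero (fun i hi t ht => h.pole_gauged hi ht) ho
  have cs := h.continuousOn_star
  have c0 := h.continuousOn_zero
  have w0 : HasWeakDeriv 0 δ (T 0) T₀' := HasWeakDeriv.of_hasDerivAt h.deriv_zero h.cont_deriv
  have wg : HasWeakDeriv 0 δ (fun t => star (g t)) (fun t => star (g t) * T 0 t) :=
    HasWeakDeriv.of_hasDerivAt (fun t ht => h.hasDerivAt_star ht) (cs.mul c0)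
  have bs : ∀ t ∈ Ioo 0 δ, ‖star (g t)‖ ≤ 1 + K * δ := fun t ht => by
    rw [EndV.norm_star]; exact h.norm_gauge_le ht
  have app : ∀ {u : ℝ → V n}, IsL2 0 δ u → IsL2 0 δ (fun t => star (g t) (u t)) := fun hu =>
    hu.apply_bounded cs bs
  have app0 : ∀ {u : ℝ → V n}, IsL2 0 δ u → IsL2 0 δ (fun t => T 0 t (u t)) := fun hu =>
    hu.apply_bounded c0 h.bound_zero
  have cancel : ∀ t ∈ Ioo 0 δ, ∀ v, g t (star (g t) v) = v := fun t ht v =>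
    congrArg (fun X : EndV n => X v) (h.gauge_mul_star t ht)
  have wσ : HasWeakDeriv 0 δ (fun t => star (g t) (s t)) (fun t => star (g t) (T 0 t (s t) + s' t)) :=
    (wg.apply ws).congr_deriv (Eventually.of_forall fun t => (map_add (star (g t)) _ _).symm)
  have wσ' := wg.apply ((w0.apply ws).add ws')
  have wσG : HasWeakDeriv 0 δ (fun t => star (g t) (T 0 t (s t) + s' t) +
      nahmAlpha (gauged T g) t (star (g t) (s t))) _ := (wg.apply wG).congr fun t ht => by
    have : nahmAlpha (gauged T g) t (star (g t) (s t)) = star (g t) (-(Complex.I • T 3 t (s t))) := by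
      simp only [nahmAlpha, gauged_zero, gauged_of_ne (show (3 : Fin 4) ≠ 0 by decide), sub_apply,
        smul_apply, mul_apply_eq_comp, cancel t ht, zero_apply, map_neg, map_smul]
      abel
    simp only [this, ← map_add]
    refine congrArg (fun v => (star (g t) : EndV n) v) ?_
    simp only [nahmAlpha, sub_apply, smul_apply]
    abel
  have wσH : HasWeakDeriv 0 δ (fun t => nahmBeta (gauged T g) t (star (g t) (s t))) _ :=
    (wg.apply wH).congr fun t ht => by
      simp only [nahmBeta, gauged_of_ne (show (1 : Fin 4) ≠ 0 by decide),
        gauged_of_ne (show (2 : Fin 4) ≠ 0 by decide), add_apply,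
        smul_apply, mul_apply_eq_comp, cancel t ht, map_add, map_smul]
  have lα : IsL2 0 δ (fun t => nahmAlpha T t (s t)) := hpole.isL2_left ls lQ
  have lβ : IsL2 0 δ (fun t => nahmBeta T t (s t)) := hpole.isL2_right ls lQ
  have lQ' : IsL2 0 δ (fun t => t⁻¹ • Q (star (g t) (s t))) := by
    refine memLp_of_norm_le_add (c := 1 + ‖Q‖ * K) ((wσ.rclm Q).aestronglyMeasurable_inv_smul le_rfl)
      lQ ls ls ?_
    filter_upwards [ae_restrict_mem measurableSet_Ioo] with t ht
    have e : t⁻¹ • Q (star (g t) (s t)) = t⁻¹ • Q (s t) + t⁻¹ • Q ((star (g t) - 1) (s t)) := by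
      rw [← smul_add, ← map_add]
      simp
    have b1 : ‖star (g t) - 1‖ ≤ K * t := by
      rw [← EndV.norm_star, EndV.star_sub, star_star, star_one]; exact h.bound_gauge t ht
    have b2 : ‖t⁻¹ • Q ((star (g t) - 1) (s t))‖ ≤ ‖Q‖ * K * ‖s t‖ := by
      rw [norm_smul, norm_inv, Real.norm_of_nonneg ht.1.le]
      have ht0 := inv_pos.2 ht.1
      calc _ ≤ t⁻¹ * (‖Q‖ * (K * t * ‖s t‖)) := by
            gcongr
            refine (Q.le_opNorm _).trans ?_
            gcongr
            exact ContinuousLinearMap.le_of_opNorm_le _ b1 _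
        _ = _ := by
            have := ht.1.ne'
            field_simp
    rw [e]
    refine (norm_add_le _ _).trans ?_
    have hK := h.bound_nonneg
    have c1 : 0 ≤ ‖Q‖ * K * ‖t⁻¹ • Q (s t)‖ := by positivity
    have c2 : 0 ≤ ‖Q‖ * K * ‖s t‖ := by positivity
    linarith [norm_nonneg (s t)]
  have final := hreg _ _ _ _ _ wσ wσ' wσG wσH (app ls) (app ((app0 ls).fadd ls')) lQ'
    ((app (app0 (ls'.fadd lα))).fadd (app lG)) ((app (app0 lβ)).fadd (app lH))
  have bg : ∀ {u : ℝ → V n}, IsL2 0 δ u → IsL2 0 δ (fun t => g t (u t)) := fun hu =>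
    hu.apply_bounded h.continuousOn_gauge fun t ht => h.norm_gauge_le ht
  refine ((bg final).fsub ((app0 ((app0 ls).fadd ls')).fadd
    ((ls.apply_bounded h.cont_deriv h.bound_deriv).fadd (app0 ls')))).congr ?_
  filter_upwards [ae_restrict_mem measurableSet_Ioo] with t ht
  rw [map_add, cancel t ht]
  have : g t ((star (g t) * T 0 t) (T 0 t (s t) + s' t)) = T 0 t (T 0 t (s t) + s' t) := cancel t ht _
  rw [this]
  abel

theorem tendsto_block (h : GaugedEnd δ K T T₀' g Q r) {i : Fin 4} (hi : i ≠ 0) {τ : EndV n}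
    (hτ : Tendsto (fun t => (1 - Q) * gauged T g i t * (1 - Q)) (𝓝[>] 0) (𝓝 τ)) :
    Tendsto (fun t => (1 - Q) * T i t * (1 - Q)) (𝓝[>] 0) (𝓝 τ) := by
  have hK := h.bound_nonneg
  have hδ := h.pos
  set P : EndV n := 1 - Q with hP
  have hPr : P * r i = 0 := by rw [hP, sub_mul, one_mul, h.su2.proj_mul h.proj_sq hi, sub_self]
  have hrP : r i * P = 0 := by rw [hP, mul_sub, mul_one, h.su2.mul_proj h.proj_sq hi, sub_self]
  set M := 1 + K * δ with hM
  have hM0 : 0 ≤ M := by positivity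
  have hmem : ∀ᶠ t in 𝓝[>] (0 : ℝ), t ∈ Ioo 0 δ := Ioo_mem_nhdsGT h.pos
  have hb : ∀ t ∈ Ioo 0 δ, ‖P * T i t * P - P * gauged T g i t * P‖ ≤
      t * (‖P‖ * (K * K * M + K * K + K * ‖r i‖ * K) * ‖P‖) := by
    intro t ht
    have g2 : ‖star (g t)‖ ≤ M := by rw [EndV.norm_star]; exact h.norm_gauge_le ht
    have g3 := h.bound_gauge t ht
    have g4 : ‖star (g t) - 1‖ ≤ K * t := by
      rw [← EndV.norm_star, EndV.star_sub, star_star, star_one]; exact g3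
    set X := gauged T g i t - t⁻¹ • r i with hX
    have bX : ‖X‖ ≤ K := h.pole_gauged hi ht
    have e : P * T i t * P - P * gauged T g i t * P =
        P * ((g t - 1) * X * star (g t) + X * (star (g t) - 1) +
          t⁻¹ • ((g t - 1) * r i * (star (g t) - 1))) * P := by
      have e1 : T i t = g t * gauged T g i t * star (g t) := by
        rw [gauged_of_ne hi]
        symm
        calc _ = (g t * star (g t)) * T i t * (g t * star (g t)) := by simp only [mul_assoc]
          _ = _ := by rw [h.gauge_mul_star t ht, one_mul, mul_one]
      have e2 : gauged T g i t = X + t⁻¹ • r i := by rw [hX]; abel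
      have z1 : ∀ Z : EndV n, P * (r i * Z) = 0 := fun Z => by rw [← mul_assoc, hPr, zero_mul]
      rw [e1, e2]
      simp only [mul_add, add_mul, mul_sub, sub_mul, EndV.mul_rsmul, EndV.rsmul_mul, mul_one, one_mul,
        mul_assoc, hrP, mul_zero, z1, smul_sub]
      abel
    rw [e]
    have ht0 := ht.1.le
    have b1 : ‖(g t - 1) * X * star (g t)‖ ≤ K * t * K * M := by
      refine (norm_mul_le _ _).trans ?_
      gcongr
      refine (norm_mul_le _ _).trans ?_
      gcongr
    have b2 : ‖X * (star (g t) - 1)‖ ≤ K * (K * t) := by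
      refine (norm_mul_le _ _).trans ?_
      gcongr
    have b3 : ‖t⁻¹ • ((g t - 1) * r i * (star (g t) - 1))‖ ≤ K * ‖r i‖ * (K * t) := by
      rw [norm_smul, norm_inv, Real.norm_of_nonneg ht0]
      have := inv_pos.2 ht.1
      calc _ ≤ t⁻¹ * (K * t * ‖r i‖ * (K * t)) := by
            gcongr
            refine (norm_mul_le _ _).trans ?_
            gcongr
            refine (norm_mul_le _ _).trans ?_
            gcongr
        _ = _ := by
            have := ht.1.ne'
            field_simp
    calc _ ≤ ‖P‖ * (K * t * K * M + K * (K * t) + K * ‖r i‖ * (K * t)) * ‖P‖ := by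
          refine (norm_mul_le _ _).trans ?_
          gcongr
          refine (norm_mul_le _ _).trans ?_
          gcongr
          exact norm_add₃_le.trans (add_le_add (add_le_add b1 b2) b3)
      _ = _ := by ring
  have hlim : Tendsto (fun t => P * T i t * P - P * gauged T g i t * P) (𝓝[>] 0) (𝓝 0) := by
    rw [tendsto_zero_iff_norm_tendsto_zero]
    have h0 : Tendsto (fun t : ℝ => t * (‖P‖ * (K * K * M + K * K + K * ‖r i‖ * K) * ‖P‖)) (𝓝[>] 0)
        (𝓝 0) := by
      have : Tendsto (fun t : ℝ => t * (‖P‖ * (K * K * M + K * K + K * ‖r i‖ * K) * ‖P‖)) (𝓝 0)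
          (𝓝 (0 * _)) := (continuous_id.mul continuous_const).tendsto 0
      rw [zero_mul] at this
      exact this.mono_left nhdsWithin_le_nhds
    refine squeeze_zero' (Eventually.of_forall fun t => norm_nonneg _) ?_ h0
    filter_upwards [hmem] with t ht using hb t ht
  have := hlim.add hτ
  rw [zero_add] at this
  exact this.congr fun t => by abel

end GaugedEnd

end Gauge

end CaloronNahm

namespace CaloronNahm

section Coproj

variable {k m : ℕ} (ι : V k →ₗᵢ[ℂ] V m)

theorem proj_apply_map (v : V k) : proj ι (ι v) = v := by
  refine ext_inner_left ℂ fun w => ?_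
  rw [proj, ContinuousLinearMap.adjoint_inner_right]
  exact ι.inner_map_map w v

theorem coproj_apply (v : V m) : coproj ι v = v - ι (proj ι v) := rfl

theorem coproj_map (v : V k) : coproj ι (ι v) = 0 := by
  rw [coproj_apply, proj_apply_map, sub_self]

theorem proj_coproj (v : V m) : proj ι (coproj ι v) = 0 := by
  rw [coproj_apply, map_sub, proj_apply_map, sub_self]

theorem coproj_mul_self : coproj ι * coproj ι = coproj ι := by
  ext1 v
  change coproj ι (coproj ι v) = coproj ι v
  rw [coproj_apply ι (coproj ι v), proj_coproj, map_zero, sub_zero]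

theorem inner_proj_right (v : V k) (w : V m) : inner ℂ v (proj ι w) = inner ℂ (ι v) w :=
  ContinuousLinearMap.adjoint_inner_right ι.toContinuousLinearMap v w

theorem inner_proj_left (v : V k) (w : V m) : inner ℂ (proj ι w) v = inner ℂ w (ι v) :=
  ContinuousLinearMap.adjoint_inner_left ι.toContinuousLinearMap v w

theorem star_coproj : star (coproj ι) = coproj ι := by
  ext1 v
  refine ext_inner_left ℂ fun w => ?_
  rw [inner_star_right, coproj_apply, coproj_apply, inner_sub_left, inner_sub_right,
    ← inner_proj_right, ← inner_proj_left]

theorem one_sub_coproj_apply (v : V m) : (1 - coproj ι) v = ι (proj ι v) := by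
  change v - coproj ι v = _
  rw [coproj_apply, sub_sub_cancel]

theorem finrank_range_coproj {j : ℕ} (ι : V k →ₗᵢ[ℂ] V (k + j)) :
    Module.finrank ℂ (LinearMap.range (coproj ι : V (k + j) →ₗ[ℂ] V (k + j))) = j := by
  have h1 := LinearMap.finrank_range_add_finrank_ker (coproj ι : V (k + j) →ₗ[ℂ] V (k + j))
  have h2 : LinearMap.ker (coproj ι : V (k + j) →ₗ[ℂ] V (k + j)) = LinearMap.range ι.toLinearMap := by
    ext v
    constructor
    · intro hv
      have : v - ι (proj ι v) = 0 := hv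
      exact ⟨proj ι v, (sub_eq_zero.1 this).symm⟩
    · rintro ⟨w, rfl⟩
      exact coproj_map ι w
  rw [h2, LinearMap.finrank_range_of_inj ι.injective, finrank_euclideanSpace_fin,
    finrank_euclideanSpace_fin] at h1
  omega

theorem coproj_eq_zero (ι : V k →ₗᵢ[ℂ] V (k + 0)) : coproj ι = 0 := by
  have h := Submodule.finrank_eq_zero.1 (finrank_range_coproj ι)
  ext1 v
  have : coproj ι v ∈ LinearMap.range (coproj ι : V (k + 0) →ₗ[ℂ] V (k + 0)) := ⟨v, rfl⟩
  rw [h] at this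
  exact this

end Coproj

section Interval

variable {n : ℕ} {a b p σ δ : ℝ} {T : Fin 4 → ℝ → EndV n} {Q : EndV n} {j : ℕ}

/-- Behaviour of Nahm data at the end `p` of an interval, in the coordinate `t`, `z = p + σt`. -/
structure EndData (j : ℕ) (T : Fin 4 → ℝ → EndV n) (p σ δ : ℝ) (Q : EndV n) : Prop where
  pole : ∃ K A B, Pole δ K (nahmAlpha (pull p σ T)) (nahmBeta (pull p σ T)) Q A B ∧
    (j ≠ 2 → (A = 0 ∧ B = 0) ∨ ∃ c : ℝ, 3 / 4 < c ∧ A * A + A + star B * B = (c : ℂ) • Q)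
  regular : j ≠ 2 →
    SecondDerivRegular δ (nahmAlpha (pull p σ T)) (nahmBeta (pull p σ T)) Q

theorem exists_deriv_zero (hab : a < b) (h0 : ContDiffOn ℝ ∞ (T 0) (Icc a b)) :
    ∃ (C : ℝ) (D : ℝ → EndV n), ContinuousOn D (Icc a b) ∧
      (∀ z ∈ Ioo a b, HasDerivAt (T 0) (D z) z) ∧ (∀ z ∈ Icc a b, ‖T 0 z‖ ≤ C) ∧
      ∀ z ∈ Icc a b, ‖D z‖ ≤ C := by
  have hc : ContinuousOn (derivWithin (T 0) (Icc a b)) (Icc a b) :=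
    h0.continuousOn_derivWithin (uniqueDiffOn_Icc hab) (by simp)
  obtain ⟨C₁, h₁⟩ := isCompact_Icc.exists_bound_of_continuousOn h0.continuousOn
  obtain ⟨C₂, h₂⟩ := isCompact_Icc.exists_bound_of_continuousOn hc
  refine ⟨max C₁ C₂, derivWithin (T 0) (Icc a b), hc, fun z hz => ?_,
    fun z hz => (h₁ z hz).trans (le_max_left _ _), fun z hz => (h₂ z hz).trans (le_max_right _ _)⟩
  have hz' : Icc a b ∈ 𝓝 z := Icc_mem_nhds hz.1 hz.2
  rw [derivWithin_of_mem_nhds hz']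
  exact ((h0.differentiableOn (by simp)) z (Ioo_subset_Icc_self hz)).differentiableAt hz' |>.hasDerivAt

theorem exists_deriv_pull (hσ : σ = 1 ∨ σ = -1) (hab : a < b) (h0 : ContDiffOn ℝ ∞ (T 0) (Icc a b))
    (hsub : ∀ t ∈ Ioc 0 δ, p + σ * t ∈ Ioo a b) :
    ∃ (C : ℝ) (D : ℝ → EndV n), ContinuousOn D (Ioo 0 δ) ∧
      (∀ t ∈ Ioo 0 δ, HasDerivAt (pull p σ T 0) (D t) t) ∧ (∀ t ∈ Ioo 0 δ, ‖pull p σ T 0 t‖ ≤ C) ∧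
      ∀ t ∈ Ioo 0 δ, ‖D t‖ ≤ C := by
  obtain ⟨C, D, hD, hd, b0, b1⟩ := exists_deriv_zero hab h0
  have hsub' : ∀ t ∈ Ioo 0 δ, p + σ * t ∈ Ioo a b := fun t ht => hsub t ⟨ht.1, ht.2.le⟩
  have n1 : ‖σ‖ = 1 := by rcases hσ with rfl | rfl <;> simp
  refine ⟨C, fun t => σ • σ • D (p + σ * t), ?_, fun t ht => ?_, fun t ht => ?_, fun t ht => ?_⟩
  · refine ContinuousOn.const_smul (ContinuousOn.const_smul (hD.comp (by fun_prop) ?_) σ) σ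
    exact fun t ht => Ioo_subset_Icc_self (hsub' t ht)
  · exact (HasDerivAt.comp_affine (hd _ (hsub' t ht))).const_smul σ
  · rw [pull, norm_smul, n1, one_mul]
    exact b0 _ (Ioo_subset_Icc_self (hsub' t ht))
  · rw [norm_smul, n1, one_mul, norm_smul, n1, one_mul]
    exact b1 _ (Ioo_subset_Icc_self (hsub' t ht))

theorem endData_of_bound {K : ℝ} (hσ : σ = 1 ∨ σ = -1) (hδ : 0 < δ) (hab : a < b) (hQ : Q * Q = Q)
    (hQ' : star Q = Q) (hT : IsNahm T (Ioo a b)) (h0 : ContDiffOn ℝ ∞ (T 0) (Icc a b))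
    (hsub : ∀ t ∈ Ioc 0 δ, p + σ * t ∈ Ioo a b)
    (hb : ∀ i, i ≠ 0 → ∀ t ∈ Ioo 0 δ, ‖pull p σ T i t‖ ≤ K) : EndData j T p σ δ Q := by
  obtain ⟨C, D, hD, hd, b0, b1⟩ := exists_deriv_pull hσ hab h0 hsub
  have hN := hT.pull hσ (fun t ht => hsub t ⟨ht.1, ht.2.le⟩ : ∀ t ∈ Ioo 0 δ, _)
  have hb' : ∀ i, ∀ t ∈ Ioo 0 δ, ‖pull p σ T i t‖ ≤ max K C := by
    intro i t ht
    by_cases hi : i = 0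
    · rw [hi]; exact (b0 t ht).trans (le_max_right _ _)
    · exact (hb i hi t ht).trans (le_max_left _ _)
  have z1 : -(Complex.I • (0 : Fin 4 → EndV n) 3) = 0 := by ext1 v; simp
  have z2 : (0 : Fin 4 → EndV n) 1 + Complex.I • (0 : Fin 4 → EndV n) 2 = 0 := by ext1 v; simp
  have z3 : ∀ (t : ℝ) i, t⁻¹ • (0 : Fin 4 → EndV n) i = 0 := fun t i => by ext1 v; simp
  have c0 : ContinuousOn (pull p σ T 0) (Ioo 0 δ) :=
    fun t ht => (hd t ht).continuousAt.continuousWithinAt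
  refine ⟨⟨_, _, _, pole_of_norm_le (Q := Q) (r := 0) hδ (by rw [z1, z2]; exact isResidue_zero hQ hQ') hN
    c0 (hb' 0) (fun i _ t ht => by rw [z3, sub_zero]; exact hb' i t ht), fun _ => Or.inl ⟨z1, z2⟩⟩,
    fun _ => secondDerivRegular_of_bounded hδ hQ hQ' hN hd hD hb'
      (fun t ht => (b1 t ht).trans (le_max_right _ _))⟩

theorem continuousOn_pull (hT : IsNahm T (Ioo a b)) (hsub : ∀ t ∈ Ioc 0 δ, p + σ * t ∈ Ioo a b)
    {i : Fin 4} (hi : i ≠ 0) : ContinuousOn (pull p σ T i) (Ioc 0 δ) :=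
  ContinuousOn.const_smul ((hT.continuousOn hi).comp (by fun_prop) hsub) σ

theorem endData_of_isBigO (hσ : σ = 1 ∨ σ = -1) (hδ : 0 < δ) (hab : a < b) (hQ : Q * Q = Q)
    (hQ' : star Q = Q) (hT : IsNahm T (Ioo a b)) (h0 : ContDiffOn ℝ ∞ (T 0) (Icc a b))
    (hsub : ∀ t ∈ Ioc 0 δ, p + σ * t ∈ Ioo a b)
    (hb : ∀ i, i ≠ 0 → (fun t => pull p σ T i t) =O[𝓝[>] 0] fun _ => (1 : ℝ)) :
    EndData j T p σ δ Q := by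
  have hex : ∀ i : Fin 4, i ≠ 0 → ∃ K, ∀ t ∈ Ioc 0 δ, ‖pull p σ T i t‖ ≤ K := fun i hi =>
    exists_bound_of_isBigO (continuousOn_pull hT hsub hi) (hb i hi)
  obtain ⟨K₁, h₁⟩ := hex 1 (by decide)
  obtain ⟨K₂, h₂⟩ := hex 2 (by decide)
  obtain ⟨K₃, h₃⟩ := hex 3 (by decide)
  refine endData_of_bound (K := max K₁ (max K₂ K₃)) hσ hδ hab hQ hQ' hT h0 hsub fun i hi t ht => ?_
  have ht' : t ∈ Ioc 0 δ := ⟨ht.1, ht.2.le⟩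
  fin_cases i
  · exact absurd rfl hi
  · exact (h₁ t ht').trans (le_max_left _ _)
  · exact (h₂ t ht').trans ((le_max_left _ _).trans (le_max_right _ _))
  · exact (h₃ t ht').trans ((le_max_right _ _).trans (le_max_right _ _))

/-- The gauge is unitary. -/
theorem gauge_unitary {g : ℝ → EndV n} {q : ℝ} (hab : a < b) (hq : q ∈ Icc a b) (hg : g q = 1)
    (h0 : ContDiffOn ℝ ∞ (T 0) (Icc a b)) (hskew : ∀ z ∈ Ioo a b, star (T 0 z) = -T 0 z)
    (hd : ∀ z ∈ Icc a b, HasDerivWithinAt g (-(T 0 z * g z)) (Icc a b) z) :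
    ∀ z ∈ Icc a b, star (g z) * g z = 1 ∧ g z * star (g z) = 1 := by
  have hskew' : EqOn (fun z => star (T 0 z)) (fun z => -T 0 z) (Icc a b) := by
    refine EqOn.of_subset_closure (s := Ioo a b) hskew ?_ h0.continuousOn.neg Ioo_subset_Icc_self ?_
    · exact (ContinuousLinearMap.adjoint (𝕜 := ℂ) (E := V n) (F := V n)).continuous.comp_continuousOn
        h0.continuousOn
    · rw [closure_Ioo hab.ne]
  have hu : ∀ z ∈ Icc a b, HasDerivWithinAt (fun z => star (g z) * g z) 0 (Icc a b) z := by
    intro z hz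
    refine ((hd z hz).star.mul (hd z hz)).congr_deriv ?_
    have e : star (T 0 z) = -T 0 z := hskew' hz
    rw [EndV.star_neg, star_mul, e, EndV.mul_neg, EndV.mul_neg, EndV.neg_mul, EndV.neg_mul, neg_neg,
      mul_assoc, add_neg_cancel]
  have hconst := constant_of_has_deriv_right_zero (fun z hz => (hu z hz).continuousWithinAt)
    (fun z hz => (hu z ⟨hz.1, hz.2.le⟩).mono_of_mem_nhdsWithin (Icc_mem_nhdsGE_of_mem hz))
  have h1 : ∀ z ∈ Icc a b, star (g z) * g z = 1 := by
    intro z hz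
    rw [hconst z hz, ← hconst q hq, hg, star_one, mul_one]
  refine fun z hz => ⟨h1 z hz, ?_⟩
  have h2 : (star (g z) : V n →ₗ[ℂ] V n) * (g z : V n →ₗ[ℂ] V n) = 1 :=
    congrArg (fun X : EndV n => (X : V n →ₗ[ℂ] V n)) (h1 z hz)
  have h3 : (g z : V n →ₗ[ℂ] V n) * (star (g z) : V n →ₗ[ℂ] V n) = 1 := mul_eq_one_comm.1 h2
  exact ContinuousLinearMap.coe_injective h3

end Interval

section Filters

variable {p : ℝ}

theorem map_affine_one : map (fun t : ℝ => p + 1 * t) (𝓝[>] 0) = 𝓝[>] p := by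
  have h : (fun t : ℝ => p + 1 * t) = Homeomorph.addLeft p := by funext t; simp
  rw [h, (Homeomorph.addLeft p).isEmbedding.map_nhdsWithin_eq]
  simp

theorem map_affine_neg_one : map (fun t : ℝ => p + -1 * t) (𝓝[>] 0) = 𝓝[<] p := by
  have h : (fun t : ℝ => p + -1 * t) = Homeomorph.subLeft p := by funext t; simp [sub_eq_add_neg]
  rw [h, (Homeomorph.subLeft p).isEmbedding.map_nhdsWithin_eq]
  simp

/-- The direction from a jump point into the large interval. -/
def inward : Jump → ℝ
  | .plus => -1
  | .minus => 1

theorem inward_eq (p : Jump) : inward p = 1 ∨ inward p = -1 := by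
  cases p
  · exact Or.inr rfl
  · exact Or.inl rfl

theorem neg_inward_eq (p : Jump) : -inward p = 1 ∨ -inward p = -1 := by
  cases p
  · exact Or.inl (neg_neg 1)
  · exact Or.inr rfl

theorem largeNhds_eq (μ₁ : ℝ) (p : Jump) :
    largeNhds μ₁ p = map (fun t => largePt μ₁ p + inward p * t) (𝓝[>] 0) := by
  cases p
  · exact map_affine_neg_one.symm
  · exact map_affine_one.symm

theorem smallNhds_eq (μ₀ μ₁ : ℝ) (p : Jump) :
    smallNhds μ₀ μ₁ p = map (fun t => smallPt μ₀ μ₁ p + -inward p * t) (𝓝[>] 0) := by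
  cases p
  · have : -inward Jump.plus = 1 := neg_neg 1
    rw [this]
    exact map_affine_one.symm
  · exact map_affine_neg_one.symm

end Filters

end CaloronNahm

namespace CaloronNahm

theorem exists_uniform_bound {P : Fin 4 → ℝ → Prop} (hmono : ∀ i K K', K ≤ K' → P i K → P i K')
    (h : ∀ i, ∃ K, P i K) : ∃ K, ∀ i, P i K := by
  choose K hK using h
  refine ⟨∑ i, |K i|, fun i => hmono i _ _ ?_ (hK i)⟩
  exact (le_abs_self _).trans (Finset.single_le_sum (f := fun i => |K i|)
    (fun i _ => abs_nonneg _) (Finset.mem_univ i))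

theorem IsIrreducibleSU2.eq_zero_of_finrank_eq_one {n : ℕ} {Q : EndV n} {r : Fin 4 → EndV n}
    (h : IsIrreducibleSU2 Q r) (hQ : Q * Q = Q)
    (hrank : Module.finrank ℂ (LinearMap.range (Q : V n →ₗ[ℂ] V n)) = 1) :
    ∀ i, i ≠ 0 → r i = 0 := by
  obtain ⟨⟨e, he⟩, -, hspan⟩ := finrank_eq_one_iff'.1 hrank
  have hex : ∀ v, ∃ c : ℂ, Q v = c • e := by
    intro v
    obtain ⟨c, hc⟩ := hspan ⟨Q v, ⟨v, rfl⟩⟩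
    exact ⟨c, (congrArg Subtype.val hc).symm⟩
  have hr : ∀ i, i ≠ 0 → ∃ c : ℂ, r i e = c • e := by
    intro i hi
    obtain ⟨c, hc⟩ := hex (r i e)
    refine ⟨c, ?_⟩
    rw [← hc]
    exact (congrArg (fun X : EndV n => X e) (h.proj_mul hQ hi)).symm
  have hcomm : ∀ i k, i ≠ 0 → k ≠ 0 → ∀ v, (r i * r k - r k * r i) v = 0 := by
    intro i k hi hk v
    obtain ⟨c, hc⟩ := hex v
    obtain ⟨ci, hci⟩ := hr i hi
    obtain ⟨ck, hck⟩ := hr k hk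
    have e1 : ∀ l, l ≠ 0 → r l v = r l (Q v) := fun l hl =>
      (congrArg (fun X : EndV n => X v) (h.mul_proj hQ hl)).symm
    change r i (r k v) - r k (r i v) = 0
    rw [e1 i hi, e1 k hk, hc]
    simp only [map_smul, hci, hck]
    rw [smul_comm ck ci e, sub_self]
  obtain ⟨-, h1, h2, h3, -⟩ := h
  have fin : ∀ X Y : EndV n, X = -Y → (∀ v, X v = 0) → Y = 0 := by
    intro X Y hXY hX
    ext1 v
    have : X v = -Y v := congrArg (fun X : EndV n => X v) hXY
    rw [hX v] at this
    exact neg_eq_zero.1 this.symm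
  intro i hi
  fin_cases i
  · exact absurd rfl hi
  · exact fin _ _ h1 (hcomm 2 3 (by decide) (by decide))
  · exact fin _ _ h2 (hcomm 3 1 (by decide) (by decide))
  · exact fin _ _ h3 (hcomm 1 2 (by decide) (by decide))

theorem EndV.rsmul_zero {n : ℕ} (c : ℝ) : c • (0 : EndV n) = 0 := by
  ext1 v
  exact smul_zero c

theorem EndV.mul_rsmul_sub {n : ℕ} {P X r : EndV n} (h : P * r = 0) (σ τ : ℝ) :
    P * (σ • X - τ • r) = σ • (P * X) := by
  rw [mul_sub, EndV.mul_rsmul, EndV.mul_rsmul, h, EndV.rsmul_zero, sub_zero]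

theorem EndV.rsmul_sub_mul {n : ℕ} {P X r : EndV n} (h : r * P = 0) (σ τ : ℝ) :
    (σ • X - τ • r) * P = σ • (X * P) := by
  rw [sub_mul, EndV.rsmul_mul, EndV.rsmul_mul, h, EndV.rsmul_zero, sub_zero]

theorem tendsto_comp_comp {a b c d : ℕ} {l : Filter ℝ} {f : ℝ → V a →L[ℂ] V b}
    {L : V a →L[ℂ] V b} (hf : Tendsto f l (𝓝 L)) (X : V b →L[ℂ] V c) (Y : V d →L[ℂ] V a) :
    Tendsto (fun t => X ∘L f t ∘L Y) l (𝓝 (X ∘L L ∘L Y)) :=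
  ((continuous_const.clm_comp (continuous_id.clm_comp continuous_const)).tendsto L).comp hf

theorem isBigO_comp_comp {a b c d : ℕ} {l : Filter ℝ} {f : ℝ → V a →L[ℂ] V b} {g : ℝ → ℝ}
    (hf : f =O[l] g) (X : V b →L[ℂ] V c) (Y : V d →L[ℂ] V a) :
    (fun t => X ∘L f t ∘L Y) =O[l] g := by
  refine (Asymptotics.IsBigO.of_bound (‖X‖ * ‖Y‖) (Eventually.of_forall fun t => ?_)).trans hf
  refine (ContinuousLinearMap.opNorm_comp_le _ _).trans ?_
  rw [mul_assoc]
  gcongr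
  rw [mul_comm]
  exact ContinuousLinearMap.opNorm_comp_le _ _

theorem one_sub_coproj {k m : ℕ} (ι : V k →ₗᵢ[ℂ] V m) :
    1 - coproj ι = ι.toContinuousLinearMap ∘L proj ι := by
  ext1 v
  exact one_sub_coproj_apply ι v

namespace NahmSolution

variable {k j : ℕ} {μ₀ μ₁ : ℝ} (N : NahmSolution k j μ₀ μ₁)

theorem large_mem (p : Jump) : ∀ t ∈ Ioc 0 μ₁, largePt μ₁ p + inward p * t ∈ Ioo (-μ₁) μ₁ := by
  intro t ht
  cases p
  · change μ₁ + -1 * t ∈ _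
    exact ⟨by linarith [ht.1, ht.2], by linarith [ht.1]⟩
  · change -μ₁ + 1 * t ∈ _
    exact ⟨by linarith [ht.1], by linarith [ht.1, ht.2]⟩

theorem largePt_mem (h : 0 < μ₁) (p : Jump) : largePt μ₁ p ∈ Icc (-μ₁) μ₁ := by
  cases p
  · exact ⟨by change -μ₁ ≤ μ₁; linarith, le_rfl⟩
  · exact ⟨le_rfl, by change -μ₁ ≤ μ₁; linarith⟩

theorem small_mem (p : Jump) : ∀ t ∈ Ioc 0 ((μ₀ - μ₁ - μ₁) / 2),
    smallPt μ₀ μ₁ p + -inward p * t ∈ Ioo μ₁ (μ₀ - μ₁) := by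
  intro t ht
  cases p
  · change μ₁ + - -1 * t ∈ _
    exact ⟨by linarith [ht.1, ht.2], by linarith [ht.1, ht.2]⟩
  · change μ₀ - μ₁ + -1 * t ∈ _
    exact ⟨by linarith [ht.1, ht.2], by linarith [ht.1]⟩

theorem inward_mul_self (p : Jump) : inward p * inward p = 1 := by
  rcases inward_eq p with h | h <;> rw [h] <;> norm_num

theorem polar_end (hμ₁ : 0 < μ₁) (hj : 0 < j) (p : Jump) :
    EndData j N.TL (largePt μ₁ p) (inward p) μ₁ (coproj (N.ι p)) ∧
    ∀ i, i ≠ 0 → ∃ τ : EndV k,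
      Tendsto (fun z => proj (N.ι p) ∘L N.TL i z ∘L (N.ι p).toContinuousLinearMap) (largeNhds μ₁ p)
        (𝓝 τ) ∧ Tendsto (N.TS i) (smallNhds μ₀ μ₁ p) (𝓝 τ) := by
  obtain ⟨g, hg, hgd, r, hsu, hcond⟩ := N.polar hj p
  set ι := N.ι p
  set q := largePt μ₁ p with hq
  set σ := inward p with hσ
  set Q := coproj ι with hQdef
  have hQ : Q * Q = Q := coproj_mul_self ι
  have hQ' : star Q = Q := star_coproj ι
  have hσ1 : σ = 1 ∨ σ = -1 := inward_eq p
  have hσ2 : σ * σ = 1 := inward_mul_self p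
  have hσ0 : σ ≠ 0 := fun h => by rw [h, mul_zero] at hσ2; exact zero_ne_one hσ2
  have hsub : ∀ t ∈ Ioc 0 μ₁, q + σ * t ∈ Ioo (-μ₁) μ₁ := large_mem p
  have hsub' : ∀ t ∈ Ioo 0 μ₁, q + σ * t ∈ Ioo (-μ₁) μ₁ := fun t ht => hsub t ⟨ht.1, ht.2.le⟩
  have hab : -μ₁ < μ₁ := by linarith
  have hqm : q ∈ Icc (-μ₁) μ₁ := largePt_mem hμ₁ p
  have hun := gauge_unitary hab hqm hg N.smoothL (fun z hz => N.skewL 0 z hz) hgd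
  obtain ⟨C, D, hD, hDd, b0, b1⟩ := exists_deriv_pull hσ1 hab N.smoothL hsub
  set T := pull q σ N.TL with hT
  set γ : ℝ → EndV (k + j) := fun t => g (q + σ * t) with hγ
  have hcontg : ContinuousOn g (Icc (-μ₁) μ₁) := fun z hz => (hgd z hz).continuousWithinAt
  have hγc : ContinuousOn γ (Ioc 0 μ₁) :=
    hcontg.comp (by fun_prop) fun t ht => Ioo_subset_Icc_self (hsub t ht)
  have hγs : ContinuousOn (fun t => star (γ t)) (Ioc 0 μ₁) :=
    (ContinuousLinearMap.adjoint (𝕜 := ℂ) (E := V (k + j)) (F := V (k + j))).continuous.comp_continuousOn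
      hγc
  obtain ⟨Cg, hCg⟩ := isCompact_Icc.exists_bound_of_continuousOn (N.smoothL.continuousOn.mul hcontg).neg
  have hγb : ∀ t ∈ Ioo 0 μ₁, ‖γ t - 1‖ ≤ Cg * t := by
    intro t ht
    have := (convex_Icc (-μ₁) μ₁).norm_image_sub_le_of_norm_hasDerivWithin_le hgd hCg hqm
      (Ioo_subset_Icc_self (hsub' t ht))
    rw [hg] at this
    refine this.trans (le_of_eq ?_)
    rw [add_sub_cancel_left, norm_mul, Real.norm_of_nonneg ht.1.le]
    rcases hσ1 with h | h <;> simp [h]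
  have hgauged : ∀ i, i ≠ 0 → ∀ t, gauged T γ i t =
      σ • (ContinuousLinearMap.adjoint (g (q + σ * t)) * N.TL i (q + σ * t) * g (q + σ * t)) := by
    intro i hi t
    rw [gauged_of_ne hi, hT, pull, EndV.mul_rsmul, EndV.rsmul_mul]
    rfl
  have hXc : ∀ i, i ≠ 0 → ContinuousOn (fun t => gauged T γ i t - t⁻¹ • r i) (Ioc 0 μ₁) := by
    intro i hi
    have : gauged T γ i = fun t => star (γ t) * T i t * γ t := funext fun t => gauged_of_ne hi t
    rw [this]
    exact ((hγs.mul (continuousOn_pull N.nahmL hsub hi)).mul hγc).sub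
      (ContinuousOn.smul (f := fun t : ℝ => t⁻¹)
        (continuousOn_inv₀.mono fun t ht => (ne_of_gt ht.1 : t ≠ 0)) continuousOn_const)
  have hpos : ∀ᶠ t in 𝓝[>] (0 : ℝ), 0 < t := self_mem_nhdsWithin
  -- blocks
  have habs : ∀ t : ℝ, 0 < t → |q + σ * t - q| = t := by
    intro t ht
    rw [add_sub_cancel_left, abs_mul, abs_of_pos ht]
    rcases hσ1 with h | h <;> simp [h]
  have hpow : (fun t : ℝ => |q + σ * t - q| ^ (((j : ℝ) - 1) / 2)) =O[𝓝[>] 0] fun _ => (1 : ℝ) := by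
    refine Asymptotics.IsBigO.of_bound 1 ?_
    filter_upwards [Ioo_mem_nhdsGT zero_lt_one] with t ht
    rw [habs t ht.1, Real.norm_of_nonneg (Real.rpow_nonneg ht.1.le _), norm_one, mul_one]
    refine Real.rpow_le_one ht.1.le ht.2.le ?_
    have : (1 : ℝ) ≤ j := by exact_mod_cast hj
    linarith
  have hblocks : ∀ i, i ≠ 0 →
      ((fun t => Q * (gauged T γ i t - t⁻¹ • r i) * (1 - Q)) =O[𝓝[>] 0]
        fun t => |q + σ * t - q| ^ (((j : ℝ) - 1) / 2)) ∧
      (fun t => gauged T γ i t - t⁻¹ • r i) =O[𝓝[>] 0] fun _ => (1 : ℝ) := by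
    intro i hi
    obtain ⟨⟨τ, hτ, -⟩, o1, o2, o3⟩ := hcond i hi
    rw [largeNhds_eq] at hτ o1 o2 o3
    rw [Asymptotics.isBigO_map] at o1 o2 o3
    have hP : (1 : EndV (k + j)) - Q = ι.toContinuousLinearMap ∘L proj ι := one_sub_coproj ι
    have hPr : (1 - Q) * r i = 0 := by rw [sub_mul, one_mul, hsu.proj_mul hQ hi, sub_self]
    have hrP : r i * (1 - Q) = 0 := by rw [mul_sub, mul_one, hsu.mul_proj hQ hi, sub_self]
    set T' : ℝ → EndV (k + j) := fun t =>
      ContinuousLinearMap.adjoint (g (q + σ * t)) * N.TL i (q + σ * t) * g (q + σ * t) with hT'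
    have hG : ∀ t, gauged T γ i t = σ • T' t := hgauged i hi
    have e1 : ∀ t, (1 - Q) * (gauged T γ i t - t⁻¹ • r i) * (1 - Q) =
        σ • (ι.toContinuousLinearMap ∘L (proj ι ∘L T' t ∘L ι.toContinuousLinearMap) ∘L proj ι) := by
      intro t
      rw [hG, EndV.mul_rsmul_sub hPr, EndV.rsmul_mul, hP]
      rfl
    have e2 : ∀ t, (1 - Q) * (gauged T γ i t - t⁻¹ • r i) * Q =
        σ • (ι.toContinuousLinearMap ∘L (proj ι ∘L T' t ∘L Q) ∘L ContinuousLinearMap.id ℂ _) := by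
      intro t
      rw [hG, EndV.mul_rsmul_sub hPr, EndV.rsmul_mul, hP]
      rfl
    have e3 : ∀ t, Q * (gauged T γ i t - t⁻¹ • r i) * (1 - Q) =
        σ • (ContinuousLinearMap.id ℂ _ ∘L (Q ∘L T' t ∘L ι.toContinuousLinearMap) ∘L proj ι) := by
      intro t
      rw [hG, mul_assoc, EndV.rsmul_sub_mul hrP, EndV.mul_rsmul, hP]
      rfl
    have e4 : ∀ t, Q * (gauged T γ i t - t⁻¹ • r i) * Q =
        σ • (Q * T' t * Q - (q + σ * t - q)⁻¹ • r i) := by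
      intro t
      have hs : (q + σ * t - q)⁻¹ = σ * t⁻¹ := by
        rw [add_sub_cancel_left, mul_inv, inv_eq_of_mul_eq_one_left hσ2]
      have hσt : σ • ((σ * t⁻¹) • r i) = t⁻¹ • r i := by
        ext1 v
        change σ • ((σ * t⁻¹) • r i v) = t⁻¹ • r i v
        rw [smul_smul, ← mul_assoc, hσ2, one_mul]
      have hsub (A B : EndV (k + j)) : σ • (A - B) = σ • A - σ • B := by
        ext1 v
        exact smul_sub σ (A v) (B v)
      rw [hG, hs, mul_sub, sub_mul, EndV.mul_rsmul, EndV.mul_rsmul, EndV.rsmul_mul, EndV.rsmul_mul,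
        hsu.1 i hi, hsub, hσt]
    have b3 : (fun t => Q * (gauged T γ i t - t⁻¹ • r i) * (1 - Q)) =O[𝓝[>] 0]
        fun t => |q + σ * t - q| ^ (((j : ℝ) - 1) / 2) := by
      simp only [e3]
      exact (isBigO_comp_comp o2 _ _).const_smul_left σ
    have b2 : (fun t => (1 - Q) * (gauged T γ i t - t⁻¹ • r i) * Q) =O[𝓝[>] 0]
        fun t => |q + σ * t - q| ^ (((j : ℝ) - 1) / 2) := by
      simp only [e2]
      exact (isBigO_comp_comp o1 _ _).const_smul_left σ
    have b1 : (fun t => (1 - Q) * (gauged T γ i t - t⁻¹ • r i) * (1 - Q)) =O[𝓝[>] 0]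
        fun _ => (1 : ℝ) := by
      simp only [e1]
      have hτ1 : Tendsto (fun t => proj ι ∘L T' t ∘L ι.toContinuousLinearMap) (𝓝[>] 0) (𝓝 τ) :=
        tendsto_map'_iff.1 hτ
      exact (isBigO_comp_comp (hτ1.isBigO_one ℝ) ι.toContinuousLinearMap (proj ι)).const_smul_left σ
    have b4 : (fun t => Q * (gauged T γ i t - t⁻¹ • r i) * Q) =O[𝓝[>] 0] fun _ => (1 : ℝ) := by
      simp only [e4]
      exact o3.const_smul_left σ
    refine ⟨b3, ?_⟩
    refine (((b1.add (b2.trans hpow)).add (b3.trans hpow)).add b4).congr_left fun t => ?_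
    simp only [mul_sub, sub_mul, one_mul, mul_one]
    abel
  have hUX : ∃ K, ∀ i, i ≠ 0 → ∀ t ∈ Ioc 0 μ₁, ‖gauged T γ i t - t⁻¹ • r i‖ ≤ K := by
    refine exists_uniform_bound (P := fun i K => i ≠ 0 → ∀ t ∈ Ioc 0 μ₁,
      ‖gauged T γ i t - t⁻¹ • r i‖ ≤ K) (fun i K K' hKK h hi t ht => (h hi t ht).trans hKK) fun i => ?_
    by_cases hi : i = 0
    · exact ⟨0, fun h => absurd hi h⟩
    · obtain ⟨K, hK⟩ := exists_bound_of_isBigO (hXc i hi) (hblocks i hi).2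
      exact ⟨K, fun _ => hK⟩
  have hUO : ∃ K, 3 ≤ j → ∀ i, i ≠ 0 → ∀ t ∈ Ioc 0 μ₁,
      ‖t⁻¹ • (Q * (gauged T γ i t - t⁻¹ • r i) * (1 - Q))‖ ≤ K := by
    by_cases h3 : 3 ≤ j
    · obtain ⟨K, hK⟩ := exists_uniform_bound (P := fun i K => i ≠ 0 → ∀ t ∈ Ioc 0 μ₁,
        ‖t⁻¹ • (Q * (gauged T γ i t - t⁻¹ • r i) * (1 - Q))‖ ≤ K)
        (fun i K K' hKK h hi t ht => (h hi t ht).trans hKK) fun i => by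
          by_cases hi : i = 0
          · exact ⟨0, fun h => absurd hi h⟩
          · obtain ⟨K, hK⟩ := exists_bound_of_isBigO
              (f := fun t => t⁻¹ • (Q * (gauged T γ i t - t⁻¹ • r i) * (1 - Q)))
              (ContinuousOn.smul (f := fun t : ℝ => t⁻¹)
                (continuousOn_inv₀.mono fun t ht => (ne_of_gt ht.1 : t ≠ 0))
                ((continuousOn_const.mul (hXc i hi)).mul continuousOn_const))
              (by
                have o : (fun t : ℝ => t⁻¹ • (Q * (gauged T γ i t - t⁻¹ • r i) * (1 - Q))) =O[𝓝[>] 0]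
                    fun t => t⁻¹ * |q + σ * t - q| ^ (((j : ℝ) - 1) / 2) :=
                  (Asymptotics.isBigO_refl (fun t : ℝ => t⁻¹) _).smul (hblocks i hi).1
                refine o.trans (Asymptotics.IsBigO.of_bound 1 ?_)
                filter_upwards [Ioo_mem_nhdsGT zero_lt_one] with t ht
                rw [habs t ht.1, norm_mul, norm_inv, Real.norm_of_nonneg ht.1.le,
                  Real.norm_of_nonneg (Real.rpow_nonneg ht.1.le _), norm_one, mul_one]
                have h1 : t ^ (((j : ℝ) - 1) / 2) ≤ t ^ (1 : ℝ) := by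
                  refine Real.rpow_le_rpow_of_exponent_ge ht.1 ht.2.le ?_
                  have : (3 : ℝ) ≤ j := by exact_mod_cast h3
                  linarith
                rw [Real.rpow_one] at h1
                calc t⁻¹ * t ^ (((j : ℝ) - 1) / 2) ≤ t⁻¹ * t := by
                      have := inv_pos.2 ht.1
                      gcongr
                  _ = 1 := inv_mul_cancel₀ ht.1.ne')
            exact ⟨K, fun _ => hK⟩
      exact ⟨K, fun _ => hK⟩
    · exact ⟨0, fun h => absurd h h3⟩
  obtain ⟨KX, hKX⟩ := hUX
  obtain ⟨KO, hKO⟩ := hUO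
  set K := max C (max Cg (max KX KO)) with hK
  have hKC : C ≤ K := le_max_left _ _
  have hKg : Cg ≤ K := (le_max_left _ _).trans (le_max_right _ _)
  have hKX' : KX ≤ K := (le_max_left _ _).trans ((le_max_right _ _).trans (le_max_right _ _))
  have hKO' : KO ≤ K := (le_max_right _ _).trans ((le_max_right _ _).trans (le_max_right _ _))
  have hend : GaugedEnd μ₁ K T D γ Q r := by
    refine ⟨hμ₁, hQ, hQ', hsu, ?_, N.nahmL.pull hσ1 hsub', hDd, hD, ?_,
      fun t ht => (hun _ (Ioo_subset_Icc_self (hsub' t ht))).1,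
      fun t ht => (hun _ (Ioo_subset_Icc_self (hsub' t ht))).2,
      fun t ht => (b0 t ht).trans hKC, fun t ht => (b1 t ht).trans hKC, ?_, ?_⟩
    · intro i t ht
      rw [hT, pull, EndV.star_rsmul]
      have : star (N.TL i (q + σ * t)) = -N.TL i (q + σ * t) := N.skewL i _ (hsub' t ht)
      rw [this]
      exact _root_.smul_neg σ _
    · intro t ht
      have hd := (hgd _ (Ioo_subset_Icc_self (hsub' t ht))).hasDerivAt
        (Icc_mem_nhds (hsub' t ht).1 (hsub' t ht).2)
      refine (HasDerivAt.comp_affine hd).congr_deriv ?_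
      rw [hT, pull, EndV.rsmul_mul]
      exact _root_.smul_neg σ _
    · exact fun t ht => (hγb t ht).trans (mul_le_mul_of_nonneg_right hKg ht.1.le)
    · intro i hi t ht
      have := hKX i hi t ⟨ht.1, ht.2.le⟩
      rw [gauged_of_ne hi] at this
      exact this.trans hKX'
  have hcas : j ≠ 2 → _ := fun hj2 => hsu.casimir hQ hQ' (fun i hi => hend.star_residue hi) hj2
    (finrank_range_coproj ι)
  refine ⟨?_, ?_⟩
  · obtain ⟨K', hpole⟩ := hend.exists_pole
    refine ⟨⟨K', _, _, hpole, hcas⟩, fun hj2 => ?_⟩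
    rcases (by omega : j = 1 ∨ 3 ≤ j) with rfl | h3
    · have hr0 := hsu.eq_zero_of_finrank_eq_one hQ (finrank_range_coproj ι)
      obtain ⟨K', hK'⟩ := hend.exists_pole_bound
      refine (endData_of_bound (j := 1) (K := K') hσ1 hμ₁ hab hQ hQ' N.nahmL N.smoothL hsub
        fun i hi t ht => ?_).regular hj2
      have := hK' i hi t ht
      rwa [hr0 i hi, EndV.rsmul_zero, sub_zero] at this
    · refine hend.secondDerivRegular fun i hi t ht => ?_
      have h1 := hKO h3 i hi t ⟨ht.1, ht.2.le⟩
      rw [norm_smul, norm_inv, Real.norm_of_nonneg ht.1.le, inv_mul_le_iff₀ ht.1] at h1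
      rw [mul_comm K]
      exact h1.trans (mul_le_mul_of_nonneg_left hKO' ht.1.le)
  · intro i hi
    obtain ⟨⟨τ, hτ, hτS⟩, -, -, -⟩ := hcond i hi
    refine ⟨τ, ?_, hτS⟩
    have hτ' : Tendsto (fun t => proj ι ∘L (ContinuousLinearMap.adjoint (g (q + σ * t)) *
        N.TL i (q + σ * t) * g (q + σ * t)) ∘L ι.toContinuousLinearMap) (𝓝[>] 0) (𝓝 τ) := by
      rw [largeNhds_eq] at hτ
      exact tendsto_map'_iff.1 hτ
    rw [largeNhds_eq, tendsto_map'_iff]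
    have hP : (1 : EndV (k + j)) - Q = ι.toContinuousLinearMap ∘L proj ι := one_sub_coproj ι
    have h1 : Tendsto (fun t => (1 - Q) * gauged T γ i t * (1 - Q)) (𝓝[>] 0)
        (𝓝 (σ • (ι.toContinuousLinearMap ∘L τ ∘L proj ι))) := by
      refine ((tendsto_comp_comp hτ' ι.toContinuousLinearMap (proj ι)).const_smul σ).congr fun t => ?_
      rw [hgauged i hi, hP, EndV.mul_rsmul, EndV.rsmul_mul]
      rfl
    have h2 := hend.tendsto_block hi h1
    have h3 := (tendsto_comp_comp h2 (proj ι) ι.toContinuousLinearMap).const_smul σ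
    have hlim : σ • (proj ι ∘L (σ • (ι.toContinuousLinearMap ∘L τ ∘L proj ι)) ∘L
        ι.toContinuousLinearMap) = τ := by
      ext1 v
      change σ • proj ι (σ • ι (τ (proj ι (ι v)))) = τ v
      rw [proj_apply_map, ContinuousLinearMap.map_smul_of_tower, proj_apply_map, smul_smul, hσ2, one_smul]
    rw [hlim] at h3
    refine h3.congr fun t => ?_
    ext1 v
    change σ • proj ι ((1 - Q) (σ • N.TL i (q + σ * t) ((1 - Q) (ι v)))) = _
    rw [one_sub_coproj_apply, one_sub_coproj_apply, proj_apply_map, proj_apply_map,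
      ContinuousLinearMap.map_smul_of_tower, smul_smul, hσ2, one_smul]
    rfl

end NahmSolution

end CaloronNahm

namespace CaloronNahm

section Halves

variable {a b : ℝ} {E : Type*} [NormedAddCommGroup E]

theorem image_affine_left : (fun t : ℝ => a + 1 * t) '' Ioo 0 ((b - a) / 2) = Ioo a ((a + b) / 2) := by
  simp only [one_mul, image_const_add_Ioo, add_zero]
  congr 1
  ring

theorem image_affine_right :
    (fun t : ℝ => b + -1 * t) '' Ioo 0 ((b - a) / 2) = Ioo ((a + b) / 2) b := by
  simp only [neg_mul, one_mul, ← sub_eq_add_neg, image_const_sub_Ioo, sub_zero]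
  congr 1
  ring

theorem affine_left_mem {t : ℝ} (ht : t ∈ Ioo 0 ((b - a) / 2)) : a + 1 * t ∈ Ioo a b := by
  constructor <;> linarith [ht.1, ht.2]

theorem affine_right_mem {t : ℝ} (ht : t ∈ Ioo 0 ((b - a) / 2)) : b + -1 * t ∈ Ioo a b := by
  constructor <;> linarith [ht.1, ht.2]

theorem eLpNorm_le_halves (f : ℝ → E) : eLpNorm f 2 (volume.restrict (Ioo a b)) ≤
    eLpNorm (fun t => f (a + 1 * t)) 2 (volume.restrict (Ioo 0 ((b - a) / 2))) +
      eLpNorm (fun t => f (b + -1 * t)) 2 (volume.restrict (Ioo 0 ((b - a) / 2))) := by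
  rw [eLpNorm_comp_affine (Or.inl rfl), eLpNorm_comp_affine (Or.inr rfl), image_affine_left,
    image_affine_right]
  refine le_trans ?_ (eLpNorm_restrict_union_le f _ _)
  refine eLpNorm_mono_measure f ?_
  have hae : (Ioo a b : Set ℝ) ≤ᵐ[volume] (Ioo a ((a + b) / 2) ∪ Ioo ((a + b) / 2) b : Set ℝ) := by
    have h₂ : ∀ᵐ z : ℝ, z ≠ (a + b) / 2 := by simp [ae_iff, measure_singleton]
    filter_upwards [h₂] with z hz hzm
    rcases lt_or_gt_of_ne hz with h | h
    · exact Or.inl ⟨hzm.1, h⟩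
    · exact Or.inr ⟨h, hzm.2⟩
  exact Measure.restrict_mono_ae hae

theorem image_affine_subset {p σ δ : ℝ} (hsub : ∀ t ∈ Ioo 0 δ, p + σ * t ∈ Ioo a b) :
    (fun t : ℝ => p + σ * t) '' Ioo 0 δ ⊆ Ioo a b := by
  rintro _ ⟨t, ht, rfl⟩
  exact hsub t ht

theorem HasWeakDeriv.const_rsmul {n : ℕ} {u u' : ℝ → V n} (h : HasWeakDeriv a b u u') (c : ℝ) :
    HasWeakDeriv a b (fun z => c • u z) (fun z => c • u' z) :=
  h.clm (c • ContinuousLinearMap.id ℝ (V n))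

theorem eLpNorm_comp_affine_le {p σ δ : ℝ} (hσ : σ = 1 ∨ σ = -1)
    (hsub : ∀ t ∈ Ioo 0 δ, p + σ * t ∈ Ioo a b) (f : ℝ → E) :
    eLpNorm (fun t => f (p + σ * t)) 2 (volume.restrict (Ioo 0 δ)) ≤
      eLpNorm f 2 (volume.restrict (Ioo a b)) := by
  rw [eLpNorm_comp_affine hσ]
  exact eLpNorm_mono_measure f (Measure.restrict_mono (image_affine_subset hsub) le_rfl)

theorem ae_comp_affine_of_ae {p σ δ : ℝ} (hσ : σ = 1 ∨ σ = -1)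
    (hsub : ∀ t ∈ Ioo 0 δ, p + σ * t ∈ Ioo a b) {P : ℝ → Prop}
    (h : ∀ᵐ z ∂(volume.restrict (Ioo a b)), P z) :
    ∀ᵐ t ∂(volume.restrict (Ioo 0 δ)), P (p + σ * t) :=
  (ae_comp_affine hσ _).2 (ae_restrict_of_ae_restrict_of_subset (image_affine_subset hsub) h)

theorem IsL2.comp_affine {n : ℕ} {u : ℝ → V n} {p σ δ : ℝ} (hu : IsL2 a b u) (hσ : σ = 1 ∨ σ = -1)
    (hsub : ∀ t ∈ Ioo 0 δ, p + σ * t ∈ Ioo a b) : IsL2 0 δ (fun t => u (p + σ * t)) :=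
  MemLp.comp_measurePreserving (hu.mono_measure (Measure.restrict_mono (image_affine_subset hsub) le_rfl))
    (measurePreserving_affine_restrict hσ _)

theorem isL2_of_halves {n : ℕ} {u : ℝ → V n}
    (hm : AEStronglyMeasurable u (volume.restrict (Ioo a b)))
    (h₁ : IsL2 0 ((b - a) / 2) (fun t => u (a + 1 * t)))
    (h₂ : IsL2 0 ((b - a) / 2) (fun t => u (b + -1 * t))) : IsL2 a b u :=
  ⟨hm, (eLpNorm_le_halves u).trans_lt (ENNReal.add_lt_top.2 ⟨h₁.2, h₂.2⟩)⟩

theorem eLpNorm_rsmul_sign [NormedSpace ℝ E] {σ : ℝ} (hσ : σ = 1 ∨ σ = -1) (f : ℝ → E)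
    (μ : Measure ℝ) : eLpNorm (fun t => σ • f t) 2 μ = eLpNorm f 2 μ := by
  refine eLpNorm_congr_norm_ae (Eventually.of_forall fun t => ?_)
  rcases hσ with rfl | rfl <;> simp

theorem isL2_rsmul_sign {n : ℕ} {u : ℝ → V n} {σ : ℝ} (hσ : σ = 1 ∨ σ = -1)
    (hu : IsL2 a b (fun t => σ • u t)) : IsL2 a b u := by
  have h : IsL2 a b (fun t => σ • σ • u t) := MemLp.const_smul hu σ
  refine h.congr (Eventually.of_forall fun t => ?_)
  rcases hσ with rfl | rfl <;> simp

end Halves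

section End

variable {n j : ℕ} {p σ δ : ℝ} {Q : EndV n} {T : Fin 4 → ℝ → EndV n}

theorem nahmAlpha_pull (t : ℝ) : nahmAlpha (pull p σ T) t = σ • nahmAlpha T (p + σ * t) := by
  ext1 v
  change σ • T 0 (p + σ * t) v - Complex.I • σ • T 3 (p + σ * t) v =
    σ • (T 0 (p + σ * t) v - Complex.I • T 3 (p + σ * t) v)
  rw [smul_sub, smul_comm]

theorem nahmBeta_pull (t : ℝ) : nahmBeta (pull p σ T) t = σ • nahmBeta T (p + σ * t) := by
  ext1 v
  change σ • T 1 (p + σ * t) v + Complex.I • σ • T 2 (p + σ * t) v =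
    σ • (T 1 (p + σ * t) v + Complex.I • T 2 (p + σ * t) v)
  rw [smul_add, smul_comm]

namespace EndData

theorem exists_bound_mul (h : EndData j T p σ δ Q) (hσ : σ = 1 ∨ σ = -1) :
    ∃ C : ℝ, 0 ≤ C ∧ ∀ s s' : ℝ → V n,
    HasWeakDeriv 0 δ (fun t => s (p + σ * t)) (fun t => σ • s' (p + σ * t)) →
    Tendsto (fun t => Q (s (p + σ * t))) (𝓝[>] 0) (𝓝 0) →
    eLpNorm (fun t => t⁻¹ • Q (s (p + σ * t))) 2 (volume.restrict (Ioo 0 δ)) ≤ ENNReal.ofReal C *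
      (eLpNorm (fun t => s' (p + σ * t)) 2 (volume.restrict (Ioo 0 δ)) +
        eLpNorm (fun t => s (p + σ * t)) 2 (volume.restrict (Ioo 0 δ))) ∧
    eLpNorm (fun t => nahmAlpha T (p + σ * t) (s (p + σ * t))) 2 (volume.restrict (Ioo 0 δ)) ≤
      ENNReal.ofReal C * (eLpNorm (fun t => s' (p + σ * t)) 2 (volume.restrict (Ioo 0 δ)) +
        eLpNorm (fun t => s (p + σ * t)) 2 (volume.restrict (Ioo 0 δ))) ∧
    eLpNorm (fun t => nahmBeta T (p + σ * t) (s (p + σ * t))) 2 (volume.restrict (Ioo 0 δ)) ≤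
      ENNReal.ofReal C * (eLpNorm (fun t => s' (p + σ * t)) 2 (volume.restrict (Ioo 0 δ)) +
        eLpNorm (fun t => s (p + σ * t)) 2 (volume.restrict (Ioo 0 δ))) := by
  obtain ⟨K, A, B, hP, -⟩ := h.pole
  obtain ⟨C, hC, H⟩ := hP.exists_bound_mul
  refine ⟨C, hC, fun s s' hs h0 => ?_⟩
  have := H _ _ hs h0
  simp only [nahmAlpha_pull, nahmBeta_pull, rsmul_apply_eq] at this
  rwa [eLpNorm_rsmul_sign hσ (fun t => s' (p + σ * t)),
    eLpNorm_rsmul_sign hσ (fun t => nahmAlpha T (p + σ * t) (s (p + σ * t))),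
    eLpNorm_rsmul_sign hσ (fun t => nahmBeta T (p + σ * t) (s (p + σ * t)))] at this

theorem exists_elliptic_bound (h : EndData j T p σ δ Q) (hσ : σ = 1 ∨ σ = -1) :
    ∃ C : ℝ, 0 ≤ C ∧ ∀ s s' : ℝ → V n,
    HasWeakDeriv 0 δ (fun t => s (p + σ * t)) (fun t => σ • s' (p + σ * t)) →
    Tendsto (fun t => Q (s (p + σ * t))) (𝓝[>] 0) (𝓝 0) →
    eLpNorm (fun t => s' (p + σ * t)) 2 (volume.restrict (Ioo 0 δ)) ≤ ENNReal.ofReal C *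
      (eLpNorm (fun t => s' (p + σ * t) + nahmAlpha T (p + σ * t) (s (p + σ * t))) 2
        (volume.restrict (Ioo 0 δ)) +
        eLpNorm (fun t => nahmBeta T (p + σ * t) (s (p + σ * t))) 2 (volume.restrict (Ioo 0 δ)) +
        eLpNorm (fun t => s (p + σ * t)) 2 (volume.restrict (Ioo 0 δ))) := by
  obtain ⟨K, A, B, hP, -⟩ := h.pole
  obtain ⟨C, hC, H⟩ := hP.exists_elliptic_bound
  refine ⟨C, hC, fun s s' hs h0 => ?_⟩
  have := H _ _ hs h0
  simp only [nahmAlpha_pull, nahmBeta_pull, rsmul_apply_eq, ← smul_add] at this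
  rwa [eLpNorm_rsmul_sign hσ (fun t => s' (p + σ * t)),
    eLpNorm_rsmul_sign hσ (fun t => s' (p + σ * t) + nahmAlpha T (p + σ * t) (s (p + σ * t))),
    eLpNorm_rsmul_sign hσ (fun t => nahmBeta T (p + σ * t) (s (p + σ * t)))] at this

variable {a b : ℝ} {h₁ h₂ h₁' h₂' f₁ f₂ : ℝ → V n}

theorem pulled_eqs (hσ : σ = 1 ∨ σ = -1) (hsub : ∀ t ∈ Ioo 0 δ, p + σ * t ∈ Ioo a b)
    (q₁ : ∀ᵐ t ∂(volume.restrict (Ioo a b)), h₁' t =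
      star (nahmAlpha T t) (h₁ t) - Complex.I • star (nahmBeta T t) (h₂ t) + f₁ t)
    (q₂ : ∀ᵐ t ∂(volume.restrict (Ioo a b)), h₂' t =
      -nahmAlpha T t (h₂ t) + Complex.I • nahmBeta T t (h₁ t) + f₂ t) :
    (∀ᵐ t ∂(volume.restrict (Ioo 0 δ)), σ • h₁' (p + σ * t) =
      star (nahmAlpha (pull p σ T) t) (h₁ (p + σ * t)) -
        Complex.I • star (nahmBeta (pull p σ T) t) (h₂ (p + σ * t)) + σ • f₁ (p + σ * t)) ∧
    ∀ᵐ t ∂(volume.restrict (Ioo 0 δ)), σ • h₂' (p + σ * t) =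
      -nahmAlpha (pull p σ T) t (h₂ (p + σ * t)) +
        Complex.I • nahmBeta (pull p σ T) t (h₁ (p + σ * t)) + σ • f₂ (p + σ * t) := by
  constructor
  · filter_upwards [ae_comp_affine_of_ae hσ hsub q₁] with t ht
    rw [ht, nahmAlpha_pull, nahmBeta_pull, EndV.star_rsmul, EndV.star_rsmul, rsmul_apply_eq,
      rsmul_apply_eq, smul_add, smul_sub, smul_comm σ Complex.I]
  · filter_upwards [ae_comp_affine_of_ae hσ hsub q₂] with t ht
    rw [ht, nahmAlpha_pull, nahmBeta_pull, rsmul_apply_eq, rsmul_apply_eq, smul_add, smul_add,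
      smul_neg, smul_comm σ Complex.I]

theorem isL2_deriv (h : EndData j T p σ δ Q) (hj : j ≠ 2) (hσ : σ = 1 ∨ σ = -1)
    (hsub : ∀ t ∈ Ioo 0 δ, p + σ * t ∈ Ioo a b)
    (w₁ : HasWeakDeriv a b h₁ h₁') (w₂ : HasWeakDeriv a b h₂ h₂')
    (l₁ : IsL2 a b h₁) (l₂ : IsL2 a b h₂) (m₁ : IsL2 a b f₁) (m₂ : IsL2 a b f₂)
    (q₁ : ∀ᵐ t ∂(volume.restrict (Ioo a b)), h₁' t =
      star (nahmAlpha T t) (h₁ t) - Complex.I • star (nahmBeta T t) (h₂ t) + f₁ t)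
    (q₂ : ∀ᵐ t ∂(volume.restrict (Ioo a b)), h₂' t =
      -nahmAlpha T t (h₂ t) + Complex.I • nahmBeta T t (h₁ t) + f₂ t) :
    IsL2 0 δ (fun t => h₁' (p + σ * t)) ∧ IsL2 0 δ (fun t => h₂' (p + σ * t)) := by
  obtain ⟨K, A, B, hP, hcas⟩ := h.pole
  obtain ⟨e₁, e₂⟩ := pulled_eqs hσ hsub q₁ q₂
  obtain ⟨r₁, r₂⟩ := hP.memLp_deriv (hcas hj) (w₁.comp_affine hσ hsub) (w₂.comp_affine hσ hsub)
    (l₁.comp_affine hσ hsub) (l₂.comp_affine hσ hsub)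
    (MemLp.const_smul (m₁.comp_affine hσ hsub) σ) (MemLp.const_smul (m₂.comp_affine hσ hsub) σ) e₁ e₂
  exact ⟨isL2_rsmul_sign hσ r₁, isL2_rsmul_sign hσ r₂⟩

theorem exists_limits (h : EndData j T p σ δ Q) (hσ : σ = 1 ∨ σ = -1)
    (hsub : ∀ t ∈ Ioo 0 δ, p + σ * t ∈ Ioo a b)
    (w₁ : HasWeakDeriv a b h₁ h₁') (w₂ : HasWeakDeriv a b h₂ h₂')
    (l₁ : IsL2 a b h₁) (l₂ : IsL2 a b h₂) (m₁ : IsL2 a b f₁) (m₂ : IsL2 a b f₂)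
    (q₁ : ∀ᵐ t ∂(volume.restrict (Ioo a b)), h₁' t =
      star (nahmAlpha T t) (h₁ t) - Complex.I • star (nahmBeta T t) (h₂ t) + f₁ t)
    (q₂ : ∀ᵐ t ∂(volume.restrict (Ioo a b)), h₂' t =
      -nahmAlpha T t (h₂ t) + Complex.I • nahmBeta T t (h₁ t) + f₂ t) :
    (∃ e, Tendsto (fun t => (1 - Q) (h₁ (p + σ * t))) (𝓝[>] 0) (𝓝 e)) ∧
      ∃ e, Tendsto (fun t => (1 - Q) (h₂ (p + σ * t))) (𝓝[>] 0) (𝓝 e) := by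
  obtain ⟨K, A, B, hP, -⟩ := h.pole
  obtain ⟨e₁, e₂⟩ := pulled_eqs hσ hsub q₁ q₂
  have v₁ := w₁.comp_affine hσ hsub
  have v₂ := w₂.comp_affine hσ hsub
  obtain ⟨r₁, r₂⟩ := hP.memLp_deriv_sub_proj v₁ v₂
    (l₁.comp_affine hσ hsub) (l₂.comp_affine hσ hsub)
    (MemLp.const_smul (m₁.comp_affine hσ hsub) σ) (MemLp.const_smul (m₂.comp_affine hσ hsub) σ) e₁ e₂
  obtain ⟨c₁, -, lim₁, -⟩ := (v₁.rclm (1 - Q)).exists_eq_integral hP.pos r₁.integrableOn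
  obtain ⟨c₂, -, lim₂, -⟩ := (v₂.rclm (1 - Q)).exists_eq_integral hP.pos r₂.integrableOn
  exact ⟨⟨c₁, lim₁⟩, ⟨c₂, lim₂⟩⟩

theorem isL2_second_deriv (h : EndData j T p σ δ Q) (hj : j ≠ 2) (hσ : σ = 1 ∨ σ = -1)
    (hsub : ∀ t ∈ Ioo 0 δ, p + σ * t ∈ Ioo a b) {s s' s'' G' H' : ℝ → V n}
    (w : HasWeakDeriv a b s s') (w' : HasWeakDeriv a b s' s'')
    (wG : HasWeakDeriv a b (fun z => s' z + nahmAlpha T z (s z)) G')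
    (wH : HasWeakDeriv a b (fun z => nahmBeta T z (s z)) H')
    (ls : IsL2 a b s) (ls' : IsL2 a b s') (lG : IsL2 a b G') (lH : IsL2 a b H')
    (h0 : Tendsto (fun t => Q (s (p + σ * t))) (𝓝[>] 0) (𝓝 0)) :
    IsL2 0 δ (fun t => s'' (p + σ * t)) := by
  obtain ⟨C, -, hC⟩ := h.exists_bound_mul hσ
  have v := w.comp_affine hσ hsub
  have hQm : AEStronglyMeasurable (fun t : ℝ => t⁻¹ • Q (s (p + σ * t))) (volume.restrict (Ioo 0 δ)) :=
    (v.rclm Q).aestronglyMeasurable_inv_smul le_rfl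
  have lQ : IsL2 0 δ (fun t => t⁻¹ • Q (s (p + σ * t))) := by
    refine ⟨hQm, (hC s s' v h0).1.trans_lt (ENNReal.mul_lt_top ENNReal.ofReal_lt_top ?_)⟩
    exact ENNReal.add_lt_top.2 ⟨(ls'.comp_affine hσ hsub).2, (ls.comp_affine hσ hsub).2⟩
  have v' := (w'.comp_affine hσ hsub).const_rsmul σ
  have vG : HasWeakDeriv 0 δ (fun t => σ • s' (p + σ * t) + nahmAlpha (pull p σ T) t (s (p + σ * t)))
      (fun t => σ • σ • G' (p + σ * t)) := by
    refine ((wG.comp_affine hσ hsub).const_rsmul σ).congr fun t _ => ?_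
    beta_reduce
    rw [nahmAlpha_pull, rsmul_apply_eq, ← smul_add]
  have vH : HasWeakDeriv 0 δ (fun t => nahmBeta (pull p σ T) t (s (p + σ * t)))
      (fun t => σ • σ • H' (p + σ * t)) := by
    refine ((wH.comp_affine hσ hsub).const_rsmul σ).congr fun t _ => ?_
    beta_reduce
    rw [nahmBeta_pull, rsmul_apply_eq]
  have k₁ : IsL2 0 δ (fun t => σ • s' (p + σ * t)) := MemLp.const_smul (ls'.comp_affine hσ hsub) σ
  have k₂ : IsL2 0 δ (fun t => σ • σ • G' (p + σ * t)) :=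
    MemLp.const_smul (MemLp.const_smul (lG.comp_affine hσ hsub) σ) σ
  have k₃ : IsL2 0 δ (fun t => σ • σ • H' (p + σ * t)) :=
    MemLp.const_smul (MemLp.const_smul (lH.comp_affine hσ hsub) σ) σ
  have key := h.regular hj _ _ _ _ _ v v' vG vH (ls.comp_affine hσ hsub) k₁ lQ k₂ k₃
  exact isL2_rsmul_sign hσ (isL2_rsmul_sign hσ key)

end EndData

end End

/-- Nahm data on the interval `(a, b)`; the polar parts at the two ends live on the ranges of the
projections `Qa` and `Qb`. -/
structure NahmInterval {n : ℕ} (j : ℕ) (a b : ℝ) (T : Fin 4 → ℝ → EndV n) (Qa Qb : EndV n) : Prop where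
  lt : a < b
  nahm : IsNahm T (Ioo a b)
  smooth : ContDiffOn ℝ ∞ (T 0) (Icc a b)
  left : EndData j T a 1 ((b - a) / 2) Qa
  right : EndData j T b (-1) ((b - a) / 2) Qb

/-- The polar components of a section vanish at the two ends. -/
def PolarVanish {n : ℕ} (a b : ℝ) (Qa Qb : EndV n) (s : ℝ → V n) : Prop :=
  Tendsto (fun z => Qa (s z)) (𝓝[>] a) (𝓝 0) ∧ Tendsto (fun z => Qb (s z)) (𝓝[<] b) (𝓝 0)

namespace NahmInterval

variable {n j : ℕ} {a b : ℝ} {T : Fin 4 → ℝ → EndV n} {Qa Qb : EndV n}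

theorem _root_.CaloronNahm.PolarVanish.left {s : ℝ → V n} (h : PolarVanish a b Qa Qb s) :
    Tendsto (fun t => Qa (s (a + 1 * t))) (𝓝[>] 0) (𝓝 0) := by
  have := h.1
  rw [← map_affine_one] at this
  exact tendsto_map'_iff.1 this

theorem _root_.CaloronNahm.PolarVanish.right {s : ℝ → V n} (h : PolarVanish a b Qa Qb s) :
    Tendsto (fun t => Qb (s (b + -1 * t))) (𝓝[>] 0) (𝓝 0) := by
  have := h.2
  rw [← map_affine_neg_one] at this
  exact tendsto_map'_iff.1 this

theorem exists_bound_mul (h : NahmInterval j a b T Qa Qb) :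
    ∃ C : ℝ, 0 ≤ C ∧ ∀ s s' : ℝ → V n, HasWeakDeriv a b s s' → PolarVanish a b Qa Qb s →
    eLpNorm (fun z => nahmAlpha T z (s z)) 2 (volume.restrict (Ioo a b)) ≤ ENNReal.ofReal C *
      (eLpNorm s' 2 (volume.restrict (Ioo a b)) + eLpNorm s 2 (volume.restrict (Ioo a b))) ∧
    eLpNorm (fun z => nahmBeta T z (s z)) 2 (volume.restrict (Ioo a b)) ≤ ENNReal.ofReal C *
      (eLpNorm s' 2 (volume.restrict (Ioo a b)) + eLpNorm s 2 (volume.restrict (Ioo a b))) := by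
  obtain ⟨C, hC, H⟩ := h.left.exists_bound_mul (Or.inl rfl)
  obtain ⟨D, hD, K⟩ := h.right.exists_bound_mul (Or.inr rfl)
  refine ⟨C + D, by positivity, fun s s' hs h0 => ?_⟩
  obtain ⟨-, H₁, H₂⟩ := H s s' (hs.comp_affine (Or.inl rfl) fun _ => affine_left_mem) h0.left
  obtain ⟨-, K₁, K₂⟩ := K s s' (hs.comp_affine (Or.inr rfl) fun _ => affine_right_mem) h0.right
  rw [ENNReal.ofReal_add hC hD, add_mul]
  have e₁ : ∀ f : ℝ → V n, _ := fun f => eLpNorm_comp_affine_le (a := a) (b := b) (Or.inl rfl)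
    (fun t => affine_left_mem) f
  have e₂ : ∀ f : ℝ → V n, _ := fun f => eLpNorm_comp_affine_le (a := a) (b := b) (Or.inr rfl)
    (fun t => affine_right_mem) f
  constructor
  · refine (eLpNorm_le_halves _).trans (add_le_add (H₁.trans ?_) (K₁.trans ?_))
    · exact mul_le_mul_right (add_le_add (e₁ _) (e₁ _)) _
    · exact mul_le_mul_right (add_le_add (e₂ _) (e₂ _)) _
  · refine (eLpNorm_le_halves _).trans (add_le_add (H₂.trans ?_) (K₂.trans ?_))
    · exact mul_le_mul_right (add_le_add (e₁ _) (e₁ _)) _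
    · exact mul_le_mul_right (add_le_add (e₂ _) (e₂ _)) _

theorem exists_elliptic_bound (h : NahmInterval j a b T Qa Qb) :
    ∃ C : ℝ, 0 ≤ C ∧ ∀ s s' : ℝ → V n, HasWeakDeriv a b s s' → PolarVanish a b Qa Qb s →
    eLpNorm s' 2 (volume.restrict (Ioo a b)) ≤ ENNReal.ofReal C *
      (eLpNorm (fun z => s' z + nahmAlpha T z (s z)) 2 (volume.restrict (Ioo a b)) +
        eLpNorm (fun z => nahmBeta T z (s z)) 2 (volume.restrict (Ioo a b)) +
        eLpNorm s 2 (volume.restrict (Ioo a b))) := by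
  obtain ⟨C, hC, H⟩ := h.left.exists_elliptic_bound (Or.inl rfl)
  obtain ⟨D, hD, K⟩ := h.right.exists_elliptic_bound (Or.inr rfl)
  refine ⟨C + D, by positivity, fun s s' hs h0 => ?_⟩
  have H₁ := H s s' (hs.comp_affine (Or.inl rfl) fun _ => affine_left_mem) h0.left
  have K₁ := K s s' (hs.comp_affine (Or.inr rfl) fun _ => affine_right_mem) h0.right
  rw [ENNReal.ofReal_add hC hD, add_mul]
  have e₁ : ∀ f : ℝ → V n, _ := fun f => eLpNorm_comp_affine_le (a := a) (b := b) (Or.inl rfl)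
    (fun t => affine_left_mem) f
  have e₂ : ∀ f : ℝ → V n, _ := fun f => eLpNorm_comp_affine_le (a := a) (b := b) (Or.inr rfl)
    (fun t => affine_right_mem) f
  refine (eLpNorm_le_halves _).trans (add_le_add (H₁.trans ?_) (K₁.trans ?_))
  · exact mul_le_mul_right (add_le_add (add_le_add (e₁ fun z => s' z + nahmAlpha T z (s z))
      (e₁ fun z => nahmBeta T z (s z))) (e₁ _)) _
  · exact mul_le_mul_right (add_le_add (add_le_add (e₂ fun z => s' z + nahmAlpha T z (s z))
      (e₂ fun z => nahmBeta T z (s z))) (e₂ _)) _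

section Adjoint

variable {h₁ h₂ h₁' h₂' f₁ f₂ : ℝ → V n}

theorem isL2_deriv (h : NahmInterval j a b T Qa Qb) (hj : j ≠ 2)
    (w₁ : HasWeakDeriv a b h₁ h₁') (w₂ : HasWeakDeriv a b h₂ h₂')
    (l₁ : IsL2 a b h₁) (l₂ : IsL2 a b h₂) (m₁ : IsL2 a b f₁) (m₂ : IsL2 a b f₂)
    (q₁ : ∀ᵐ t ∂(volume.restrict (Ioo a b)), h₁' t =
      star (nahmAlpha T t) (h₁ t) - Complex.I • star (nahmBeta T t) (h₂ t) + f₁ t)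
    (q₂ : ∀ᵐ t ∂(volume.restrict (Ioo a b)), h₂' t =
      -nahmAlpha T t (h₂ t) + Complex.I • nahmBeta T t (h₁ t) + f₂ t) :
    IsL2 a b h₁' ∧ IsL2 a b h₂' := by
  obtain ⟨r₁, r₂⟩ := h.left.isL2_deriv hj (Or.inl rfl) (fun t => affine_left_mem) w₁ w₂ l₁ l₂ m₁ m₂
    q₁ q₂
  obtain ⟨k₁, k₂⟩ := h.right.isL2_deriv hj (Or.inr rfl) (fun t => affine_right_mem) w₁ w₂ l₁ l₂ m₁
    m₂ q₁ q₂
  exact ⟨isL2_of_halves w₁.aestronglyMeasurable_deriv r₁ k₁,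
    isL2_of_halves w₂.aestronglyMeasurable_deriv r₂ k₂⟩

end Adjoint

theorem isL2_second_deriv (h : NahmInterval j a b T Qa Qb) (hj : j ≠ 2) {s s' s'' G' H' : ℝ → V n}
    (w : HasWeakDeriv a b s s') (w' : HasWeakDeriv a b s' s'')
    (wG : HasWeakDeriv a b (fun z => s' z + nahmAlpha T z (s z)) G')
    (wH : HasWeakDeriv a b (fun z => nahmBeta T z (s z)) H')
    (ls : IsL2 a b s) (ls' : IsL2 a b s') (lG : IsL2 a b G') (lH : IsL2 a b H')
    (h0 : PolarVanish a b Qa Qb s) : IsL2 a b s'' :=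
  isL2_of_halves w'.aestronglyMeasurable_deriv
    (h.left.isL2_second_deriv hj (Or.inl rfl) (fun _ => affine_left_mem) w w' wG wH ls ls' lG lH
      h0.left)
    (h.right.isL2_second_deriv hj (Or.inr rfl) (fun _ => affine_right_mem) w w' wG wH ls ls' lG lH
      h0.right)

theorem continuousOn_zero (h : NahmInterval j a b T Qa Qb) : ContinuousOn (T 0) (Ioo a b) :=
  h.smooth.continuousOn.mono Ioo_subset_Icc_self

theorem continuousOn_alpha (h : NahmInterval j a b T Qa Qb) :
    ContinuousOn (nahmAlpha T) (Ioo a b) :=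
  h.continuousOn_zero.sub ((h.nahm.continuousOn (by decide)).const_smul Complex.I)

theorem continuousOn_beta (h : NahmInterval j a b T Qa Qb) : ContinuousOn (nahmBeta T) (Ioo a b) :=
  (h.nahm.continuousOn (by decide)).add ((h.nahm.continuousOn (by decide)).const_smul Complex.I)

end NahmInterval

end CaloronNahm

namespace CaloronNahm

theorem EndData.exists_norm_le {n j : ℕ} {p σ δ : ℝ} {Q : EndV n} {T : Fin 4 → ℝ → EndV n}
    (h : EndData j T p σ δ Q) (hσ : σ = 1 ∨ σ = -1) : ∃ K, ∀ t ∈ Ioo 0 δ, ∀ v,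
    ‖(1 - Q) (nahmAlpha T (p + σ * t) v)‖ ≤ K * ‖v‖ ∧
      ‖(1 - Q) (nahmBeta T (p + σ * t) v)‖ ≤ K * ‖v‖ := by
  obtain ⟨K, A, B, hP, -⟩ := h.pole
  have key : ∀ (X Y : EndV n) (t : ℝ) (v : V n), Q * Y = Y → ‖σ • X - t⁻¹ • Y‖ ≤ K →
      ‖(1 - Q) (X v)‖ ≤ ‖1 - Q‖ * K * ‖v‖ := by
    intro X Y t v hY hb
    have e : (1 - Q) (σ • X v) = (1 - Q) ((σ • X - t⁻¹ • Y) v) := by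
      have hQ : Q (Y v) = Y v := congrArg (fun Z : EndV n => Z v) hY
      change _ = (1 - Q) (σ • X v - t⁻¹ • Y v)
      have h0 : (1 - Q) (Y v) = 0 := by
        change Y v - Q (Y v) = 0
        rw [hQ, sub_self]
      rw [map_sub, ContinuousLinearMap.map_smul_of_tower (1 - Q) t⁻¹, h0, smul_zero, sub_zero]
    have n : ‖(1 - Q) (X v)‖ = ‖(1 - Q) (σ • X v)‖ := by
      rw [ContinuousLinearMap.map_smul_of_tower, norm_smul]
      rcases hσ with rfl | rfl <;> simp
    rw [n, e, mul_assoc]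
    exact ((1 - Q).le_opNorm _).trans (mul_le_mul_of_nonneg_left
      ((ContinuousLinearMap.le_opNorm _ _).trans (mul_le_mul_of_nonneg_right hb (norm_nonneg v)))
      (norm_nonneg _))
  refine ⟨‖1 - Q‖ * K, fun t ht v => ⟨key _ A t v hP.res.proj_mul_left ?_, key _ B t v hP.res.proj_mul_right ?_⟩⟩
  · rw [← nahmAlpha_pull]
    exact hP.bound_left t ht
  · rw [← nahmBeta_pull]
    exact hP.bound_right t ht

theorem tendsto_clm_apply {n : ℕ} {l : Filter ℝ} {X : ℝ → EndV n} {u : ℝ → V n} {Y : EndV n} {v : V n}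
    (hX : Tendsto X l (𝓝 Y)) (hu : Tendsto u l (𝓝 v)) : Tendsto (fun z => X z (u z)) l (𝓝 (Y v)) :=
  ((isBoundedBilinearMap_apply (𝕜 := ℂ) (E := V n) (F := V n)).continuous.tendsto (Y, v)).comp
    (hX.prodMk_nhds hu)

theorem laxA_apply {n : ℕ} (t : Fin 4 → EndV n) (ζ : ℂ) (v : V n) :
    laxA t ζ v = (t 1 v + Complex.I • t 2 v) - (2 * Complex.I * ζ) • t 3 v +
      ζ ^ 2 • (t 1 v - Complex.I • t 2 v) := rfl

namespace NahmSolution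

variable {k j : ℕ} {μ₀ μ₁ : ℝ} (N : NahmSolution k j μ₀ μ₁)

theorem exists_limits (hμ₁ : 0 < μ₁) (hμ : μ₁ < μ₀ - μ₁) (p : Jump) : ∃ tL tS : Fin 4 → EndV k,
    (∀ i, Tendsto (fun z => proj (N.ι p) ∘L N.TL i z ∘L (N.ι p).toContinuousLinearMap)
      (largeNhds μ₁ p) (𝓝 (tL i)) ∧ Tendsto (N.TS i) (smallNhds μ₀ μ₁ p) (𝓝 (tS i))) ∧
    tL 0 = tS 0 ∧ (0 < j → tL = tS) ∧ (j = 0 → ∀ (ζ : ℂ) (v : V k),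
      jumpSign p • (laxA tS ζ v - laxA tL ζ v) =
        (inner ℂ (N.α p 1) v - ζ * inner ℂ (N.α p 0) v) • (N.α p 0 + ζ • N.α p 1)) := by
  have hL : Tendsto (N.TL 0) (largeNhds μ₁ p) (𝓝 (N.TL 0 (largePt μ₁ p))) := by
    refine (N.smoothL.continuousOn _ (largePt_mem hμ₁ p)).mono_left ?_
    cases p
    · exact nhdsWithin_le_iff.2 (mem_of_superset (Ioo_mem_nhdsLT (by linarith : -μ₁ < μ₁))
        Ioo_subset_Icc_self)
    · exact nhdsWithin_le_iff.2 (mem_of_superset (Ioo_mem_nhdsGT (by linarith : -μ₁ < μ₁))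
        Ioo_subset_Icc_self)
  have hS : Tendsto (N.TS 0) (smallNhds μ₀ μ₁ p) (𝓝 (N.TS 0 (smallPt μ₀ μ₁ p))) := by
    have hm : smallPt μ₀ μ₁ p ∈ Icc μ₁ (μ₀ - μ₁) := by
      cases p
      · exact left_mem_Icc.2 hμ.le
      · exact right_mem_Icc.2 hμ.le
    refine (N.smoothS.continuousOn _ hm).mono_left ?_
    cases p
    · exact nhdsWithin_le_iff.2 (mem_of_superset (Ioo_mem_nhdsGT hμ) Ioo_subset_Icc_self)
    · exact nhdsWithin_le_iff.2 (mem_of_superset (Ioo_mem_nhdsLT hμ) Ioo_subset_Icc_self)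
  have hL' := tendsto_comp_comp hL (proj (N.ι p)) (N.ι p).toContinuousLinearMap
  rw [N.glue p] at hL'
  set t₀ := N.TS 0 (smallPt μ₀ μ₁ p)
  rcases Nat.eq_zero_or_pos j with hj | hj
  · obtain ⟨tL, tS, hlim, hlax⟩ := N.rankOne hj p
    refine ⟨Function.update tL 0 t₀, Function.update tS 0 t₀, fun i => ?_, by simp,
      fun h => absurd hj h.ne', fun _ ζ v => ?_⟩
    · by_cases hi : i = 0
      · subst hi
        simpa using ⟨hL', hS⟩
      · simpa [hi] using hlim i hi
    · simpa [laxA] using hlax ζ v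
  · obtain ⟨-, H⟩ := N.polar_end hμ₁ hj p
    choose! τ h1 h2 using H
    refine ⟨Function.update τ 0 t₀, Function.update τ 0 t₀, fun i => ?_, rfl, fun _ => rfl,
      fun h => absurd h hj.ne'⟩
    by_cases hi : i = 0
    · subst hi
      simpa using ⟨hL', hS⟩
    · simpa [hi] using ⟨h1 i hi, h2 i hi⟩

theorem large_end (hμ₁ : 0 < μ₁) (hμ : μ₁ < μ₀ - μ₁) (p : Jump) :
    EndData j N.TL (largePt μ₁ p) (inward p) μ₁ (coproj (N.ι p)) := by
  rcases Nat.eq_zero_or_pos j with hj | hj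
  · subst hj
    obtain ⟨tL, _, hlim, -⟩ := N.exists_limits hμ₁ hμ p
    refine endData_of_isBigO (inward_eq p) hμ₁ (by linarith) (coproj_mul_self _) (star_coproj _) N.nahmL
      N.smoothL (large_mem p) fun i _ => ?_
    have hid : (N.ι p).toContinuousLinearMap ∘L proj (N.ι p) = 1 := by
      rw [← one_sub_coproj, coproj_eq_zero, sub_zero]
    have hl := (hlim i).1
    rw [largeNhds_eq] at hl
    have hl' := tendsto_comp_comp (tendsto_map'_iff.1 hl) (N.ι p).toContinuousLinearMap (proj (N.ι p))
    have e : (fun t => pull (largePt μ₁ p) (inward p) N.TL i t) = fun t => inward p •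
        ((N.ι p).toContinuousLinearMap ∘L ((fun z => proj (N.ι p) ∘L N.TL i z ∘L
          (N.ι p).toContinuousLinearMap) ∘ fun t => largePt μ₁ p + inward p * t) t ∘L
            proj (N.ι p)) := by
      funext t
      rw [pull]
      congr 1
      have hv : ∀ v, N.ι p (proj (N.ι p) v) = v := fun v => congrArg (fun X : EndV (k + 0) => X v) hid
      ext1 v
      change _ = N.ι p (proj (N.ι p) (N.TL i _ (N.ι p (proj (N.ι p) v))))
      rw [hv, hv]
    rw [e]
    exact (hl'.isBigO_one ℝ).const_smul_left (inward p)
  · exact (N.polar_end hμ₁ hj p).1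

theorem small_end (hμ₁ : 0 < μ₁) (hμ : μ₁ < μ₀ - μ₁) (p : Jump) :
    EndData j N.TS (smallPt μ₀ μ₁ p) (-inward p) ((μ₀ - μ₁ - μ₁) / 2) 0 := by
  obtain ⟨_, tS, hlim, -⟩ := N.exists_limits hμ₁ hμ p
  refine endData_of_isBigO (neg_inward_eq p) (by linarith) hμ (mul_zero _) EndV.star_zero N.nahmS
    N.smoothS (small_mem p) fun i _ => ?_
  have hl := (hlim i).2
  rw [smallNhds_eq] at hl
  exact ((tendsto_map'_iff.1 hl).isBigO_one ℝ).const_smul_left (-inward p)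

theorem large_interval (hμ₁ : 0 < μ₁) (hμ : μ₁ < μ₀ - μ₁) :
    NahmInterval j (-μ₁) μ₁ N.TL (coproj (N.ι .minus)) (coproj (N.ι .plus)) := by
  have e : (μ₁ - -μ₁) / 2 = μ₁ := by ring
  refine ⟨by linarith, N.nahmL, N.smoothL, ?_, ?_⟩
  · rw [e]; exact N.large_end hμ₁ hμ .minus
  · rw [e]; exact N.large_end hμ₁ hμ .plus

theorem small_interval (hμ₁ : 0 < μ₁) (hμ : μ₁ < μ₀ - μ₁) :
    NahmInterval j μ₁ (μ₀ - μ₁) N.TS 0 0 := by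
  refine ⟨hμ, N.nahmS, N.smoothS, ?_, ?_⟩
  · have := N.small_end hμ₁ hμ .plus
    rwa [show -inward .plus = 1 from neg_neg 1] at this
  · exact N.small_end hμ₁ hμ .minus

/-- The limits of `α` and `β` at a jump point, and their jumps. -/
structure JumpLimits (p : Jump) (aL bL aS bS : EndV k) : Prop where
  large_left : ∀ (s : ℝ → V (k + j)) (ℓ : V k), Tendsto s (largeNhds μ₁ p) (𝓝 (N.ι p ℓ)) →
    Tendsto (fun z => proj (N.ι p) (nahmAlpha N.TL z (s z))) (largeNhds μ₁ p) (𝓝 (aL ℓ))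
  large_right : ∀ (s : ℝ → V (k + j)) (ℓ : V k), Tendsto s (largeNhds μ₁ p) (𝓝 (N.ι p ℓ)) →
    Tendsto (fun z => proj (N.ι p) (nahmBeta N.TL z (s z))) (largeNhds μ₁ p) (𝓝 (bL ℓ))
  small_left : ∀ (s : ℝ → V k) (ℓ : V k), Tendsto s (smallNhds μ₀ μ₁ p) (𝓝 ℓ) →
    Tendsto (fun z => nahmAlpha N.TS z (s z)) (smallNhds μ₀ μ₁ p) (𝓝 (aS ℓ))
  small_right : ∀ (s : ℝ → V k) (ℓ : V k), Tendsto s (smallNhds μ₀ μ₁ p) (𝓝 ℓ) →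
    Tendsto (fun z => nahmBeta N.TS z (s z)) (smallNhds μ₀ μ₁ p) (𝓝 (bS ℓ))
  polar : 0 < j → aL = aS ∧ bL = bS
  rankOne : j = 0 → ∀ v, jumpSign p • (bS v - bL v) = (inner ℂ (N.α p 1) v : ℂ) • N.α p 0 ∧
    jumpSign p • (aS v - aL v) = (1 / 2 : ℂ) •
      ((inner ℂ (N.α p 1) v : ℂ) • N.α p 1 - (inner ℂ (N.α p 0) v : ℂ) • N.α p 0)

theorem large_tendsto (hμ₁ : 0 < μ₁) {p : Jump} {X : ℝ → EndV (k + j)}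
    {τ : EndV k} (hX : Tendsto (fun z => proj (N.ι p) ∘L X z ∘L (N.ι p).toContinuousLinearMap)
      (largeNhds μ₁ p) (𝓝 τ)) {K : ℝ}
    (hK : ∀ t ∈ Ioo 0 μ₁, ∀ v, ‖(1 - coproj (N.ι p)) (X (largePt μ₁ p + inward p * t) v)‖ ≤ K * ‖v‖)
    {s : ℝ → V (k + j)} {ℓ : V k} (hs : Tendsto s (largeNhds μ₁ p) (𝓝 (N.ι p ℓ))) :
    Tendsto (fun z => proj (N.ι p) (X z (s z))) (largeNhds μ₁ p) (𝓝 (τ ℓ)) := by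
  have h1 : Tendsto (fun z => proj (N.ι p) (s z)) (largeNhds μ₁ p) (𝓝 ℓ) := by
    have := ((proj (N.ι p)).continuous.tendsto _).comp hs
    rwa [proj_apply_map] at this
  have h2 : Tendsto (fun z => coproj (N.ι p) (s z)) (largeNhds μ₁ p) (𝓝 0) := by
    have := ((coproj (N.ι p)).continuous.tendsto _).comp hs
    rwa [coproj_map] at this
  have h3 : Tendsto (fun z => proj (N.ι p) (X z (coproj (N.ι p) (s z)))) (largeNhds μ₁ p) (𝓝 0) := by
    have h4 : Tendsto (fun z => K * ‖coproj (N.ι p) (s z)‖) (largeNhds μ₁ p) (𝓝 0) := by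
      simpa using h2.norm.const_mul K
    refine squeeze_zero_norm' ?_ h4
    rw [largeNhds_eq, eventually_map]
    filter_upwards [Ioo_mem_nhdsGT hμ₁] with t ht
    have e := hK t ht (coproj (N.ι p) (s (largePt μ₁ p + inward p * t)))
    rwa [one_sub_coproj_apply, LinearIsometry.norm_map] at e
  have h5 := (tendsto_clm_apply hX h1).add h3
  rw [add_zero] at h5
  refine h5.congr fun z => ?_
  change proj (N.ι p) (X z (N.ι p (proj (N.ι p) (s z)))) + _ = _
  rw [← map_add, ← map_add, coproj_apply, add_sub_cancel]

theorem exists_jumpLimits (hμ₁ : 0 < μ₁) (hμ : μ₁ < μ₀ - μ₁) (p : Jump) :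
    ∃ aL bL aS bS, N.JumpLimits p aL bL aS bS := by
  obtain ⟨tL, tS, hlim, h0, hpol, hrank⟩ := N.exists_limits hμ₁ hμ p
  obtain ⟨K, hK⟩ := (N.large_end hμ₁ hμ p).exists_norm_le (inward_eq p)
  refine ⟨tL 0 - Complex.I • tL 3, tL 1 + Complex.I • tL 2, tS 0 - Complex.I • tS 3,
    tS 1 + Complex.I • tS 2, fun s ℓ hs => ?_, fun s ℓ hs => ?_, fun s ℓ hs => ?_, fun s ℓ hs => ?_,
    fun hj => by rw [hpol hj]; exact ⟨rfl, rfl⟩, fun hj v => ?_⟩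
  · refine N.large_tendsto hμ₁ (((hlim 0).1.sub ((hlim 3).1.const_smul Complex.I)).congr
      fun z => ?_) (fun t ht v => (hK t ht v).1) hs
    ext1 v
    change _ = proj (N.ι p) (N.TL 0 z (N.ι p v) - Complex.I • N.TL 3 z (N.ι p v))
    rw [map_sub, map_smul]
    rfl
  · refine N.large_tendsto hμ₁ (((hlim 1).1.add ((hlim 2).1.const_smul Complex.I)).congr
      fun z => ?_) (fun t ht v => (hK t ht v).2) hs
    ext1 v
    change _ = proj (N.ι p) (N.TL 1 z (N.ι p v) + Complex.I • N.TL 2 z (N.ι p v))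
    rw [map_add, map_smul]
    rfl
  · exact tendsto_clm_apply ((hlim 0).2.sub ((hlim 3).2.const_smul Complex.I)) hs
  · exact tendsto_clm_apply ((hlim 1).2.add ((hlim 2).2.const_smul Complex.I)) hs
  · have r := hrank hj
    have r0 := r 0 v
    have r1 := r 1 v
    have r2 := r (-1) v
    simp only [laxA_apply] at r0 r1 r2
    change jumpSign p • ((tS 1 v + Complex.I • tS 2 v) - (tL 1 v + Complex.I • tL 2 v)) = _ ∧
      jumpSign p • ((tS 0 v - Complex.I • tS 3 v) - (tL 0 v - Complex.I • tL 3 v)) = _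
    constructor
    · linear_combination (norm := module) r0
    · rw [h0]
      linear_combination (norm := module) (1 / 4 : ℂ) • r1 - (1 / 4 : ℂ) • r2

end NahmSolution

end CaloronNahm

namespace CaloronNahm

theorem IsL2.integrableOn_inner {n : ℕ} {a b : ℝ} {u v : ℝ → V n} (hu : IsL2 a b u)
    (hv : IsL2 a b v) : IntegrableOn (fun z => (inner ℂ (u z) (v z) : ℂ)) (Ioo a b) := by
  have h : Integrable (fun z => ‖u z‖ * ‖v z‖) (volume.restrict (Ioo a b)) :=
    MemLp.integrable_mul hu.norm hv.norm
  exact h.mono' (hu.aestronglyMeasurable.inner hv.aestronglyMeasurable)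
    (Eventually.of_forall fun z => norm_inner_le_norm (u z) (v z))

theorem eq_zero_of_tendsto_of_integrableOn {f : ℝ → ℂ} {M : ℂ} {δ : ℝ} (hδ : 0 < δ)
    (hf : Tendsto f (𝓝[>] 0) (𝓝 M)) (hi : IntegrableOn (fun t : ℝ => t⁻¹ • f t) (Ioo 0 δ)) :
    M = 0 := by
  by_contra hM
  have hM' : 0 < ‖M‖ / 2 := by have := norm_pos_iff.2 hM; positivity
  have h1 : ∀ᶠ t in 𝓝[>] (0 : ℝ), ‖M‖ / 2 < ‖f t‖ :=
    hf.norm.eventually (lt_mem_nhds (by linarith))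
  obtain ⟨η, hη, h2⟩ := mem_nhdsGT_iff_exists_Ioo_subset.1 h1
  obtain ⟨t, ht, h3⟩ := exists_mul_lt_of_integrableOn hδ hi.norm (lt_min hη hM')
  have h4 := h2 (⟨ht.1, ht.2.trans_le ((min_le_left _ _).trans (min_le_left _ _))⟩ : t ∈ Ioo 0 η)
  have h5 : t * ‖t⁻¹ • f t‖ = ‖f t‖ := by
    rw [norm_smul, norm_inv, Real.norm_of_nonneg ht.1.le, mul_inv_cancel_left₀ ht.1.ne']
  rw [h5] at h3
  exact absurd (h3.trans_le (min_le_right _ _)) (not_lt.2 (le_of_lt h4))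

variable {n j : ℕ} {a b : ℝ} {T : Fin 4 → ℝ → EndV n}

theorem EndData.isL2_inv_smul {p σ δ : ℝ} {Q : EndV n} (h : EndData j T p σ δ Q)
    (hσ : σ = 1 ∨ σ = -1) (hsub : ∀ t ∈ Ioo 0 δ, p + σ * t ∈ Ioo a b) {s s' : ℝ → V n}
    (w : HasWeakDeriv a b s s') (ls : IsL2 a b s) (ls' : IsL2 a b s')
    (h0 : Tendsto (fun t => Q (s (p + σ * t))) (𝓝[>] 0) (𝓝 0)) :
    IsL2 0 δ (fun t => t⁻¹ • Q (s (p + σ * t))) := by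
  obtain ⟨C, -, hC⟩ := h.exists_bound_mul hσ
  have v := w.comp_affine hσ hsub
  refine ⟨(v.rclm Q).aestronglyMeasurable_inv_smul le_rfl,
    (hC s s' v h0).1.trans_lt (ENNReal.mul_lt_top ENNReal.ofReal_lt_top ?_)⟩
  exact ENNReal.add_lt_top.2 ⟨(ls'.comp_affine hσ hsub).2, (ls.comp_affine hσ hsub).2⟩

theorem EndData.tendsto_inner {p σ δ : ℝ} {Q : EndV n} (h : EndData j T p σ δ Q)
    (hσ : σ = 1 ∨ σ = -1) (hsub : ∀ t ∈ Ioo 0 δ, p + σ * t ∈ Ioo a b) {s s' g : ℝ → V n}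
    (w : HasWeakDeriv a b s s') (ls : IsL2 a b s) (ls' : IsL2 a b s') (lg : IsL2 a b g)
    (h0 : Tendsto (fun t => Q (s (p + σ * t))) (𝓝[>] 0) (𝓝 0)) {c : ℂ} {sp gp : V n}
    (hc : Tendsto (fun t => (inner ℂ (s (p + σ * t)) (g (p + σ * t)) : ℂ)) (𝓝[>] 0) (𝓝 c))
    (hs : Tendsto (fun t => s (p + σ * t)) (𝓝[>] 0) (𝓝 sp))
    (hg : Tendsto (fun t => (1 - Q) (g (p + σ * t))) (𝓝[>] 0) (𝓝 gp)) : c = inner ℂ sp gp := by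
  have lQ := h.isL2_inv_smul hσ hsub w ls ls' h0
  obtain ⟨K, A, B, hP, -⟩ := h.pole
  have hsplit : ∀ u v : V n, inner ℂ u v - inner ℂ u ((1 - Q) v) = (inner ℂ (Q u) v : ℂ) := by
    intro u v
    have e : (1 - Q) v = v - Q v := rfl
    rw [e, inner_sub_right, sub_sub_cancel]
    nth_rw 1 [← hP.res.proj_star]
    exact ContinuousLinearMap.adjoint_inner_right Q u v
  have hM : Tendsto (fun t => (inner ℂ (Q (s (p + σ * t))) (g (p + σ * t)) : ℂ)) (𝓝[>] 0)
      (𝓝 (c - inner ℂ sp gp)) :=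
    (hc.sub (hs.inner hg)).congr fun t => hsplit _ _
  refine sub_eq_zero.1 (eq_zero_of_tendsto_of_integrableOn hP.pos hM ?_)
  refine (lQ.integrableOn_inner (lg.comp_affine hσ hsub)).congr (Eventually.of_forall fun t => ?_)
  beta_reduce
  rw [← Complex.coe_smul, inner_smul_left, Complex.conj_ofReal]
  rfl

namespace NahmInterval

variable {Qa Qb : EndV n}

theorem green (h : NahmInterval j a b T Qa Qb) {y w : ℂ} {s s' h₁ h₁' h₂ g₁ g₂ : ℝ → V n}
    (ws : HasWeakDeriv a b s s') (ls : IsL2 a b s) (ls' : IsL2 a b s') (hs : PolarVanish a b Qa Qb s)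
    (w₁ : HasWeakDeriv a b h₁ h₁') (l₁ : IsL2 a b h₁) (l₂ : IsL2 a b h₂)
    (q₁ : ∀ᵐ z ∂(volume.restrict (Ioo a b)), h₁' z =
      star (nahmAlpha T z) (h₁ z) + (Complex.I * (starRingEnd ℂ) y) • h₁ z -
        Complex.I • (star (nahmBeta T z) (h₂ z) + (Complex.I * (starRingEnd ℂ) w) • h₂ z))
    (e₁ : ∀ᵐ z ∂(volume.restrict (Ioo a b)), g₁ z =
      Complex.I • (s' z + nahmAlpha T z (s z) - (Complex.I * y) • s z))
    (e₂ : ∀ᵐ z ∂(volume.restrict (Ioo a b)), g₂ z = -(nahmBeta T z (s z) - (Complex.I * w) • s z))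
    (lg₁ : IsL2 a b g₁) (lg₂ : IsL2 a b g₂) {sa sb ga gb : V n}
    (hsa : Tendsto s (𝓝[>] a) (𝓝 sa)) (hsb : Tendsto s (𝓝[<] b) (𝓝 sb))
    (hga : Tendsto (fun z => (1 - Qa) (h₁ z)) (𝓝[>] a) (𝓝 ga))
    (hgb : Tendsto (fun z => (1 - Qb) (h₁ z)) (𝓝[<] b) (𝓝 gb)) :
    ∫ z in Ioo a b, ((inner ℂ (g₁ z) (h₁ z) : ℂ) + inner ℂ (g₂ z) (h₂ z)) =
      -Complex.I * (inner ℂ sb gb - inner ℂ sa ga) := by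
  have hint : IntegrableOn (fun z => (inner ℂ (g₁ z) (h₁ z) : ℂ) + inner ℂ (g₂ z) (h₂ z)) (Ioo a b) :=
    (lg₁.integrableOn_inner l₁).add (lg₂.integrableOn_inner l₂)
  have hF : HasWeakDeriv a b (fun z => (inner ℂ (s z) (h₁ z) : ℂ))
      (fun z => Complex.I * ((inner ℂ (g₁ z) (h₁ z) : ℂ) + inner ℂ (g₂ z) (h₂ z))) := by
    refine (ws.inner_prod w₁).congr_deriv ?_
    filter_upwards [q₁, e₁, e₂] with z hq he₁ he₂
    have r₁ : inner ℂ (s z) (star (nahmAlpha T z) (h₁ z)) = (inner ℂ (nahmAlpha T z (s z)) (h₁ z) : ℂ) :=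
      ContinuousLinearMap.adjoint_inner_right _ _ _
    have r₂ : inner ℂ (s z) (star (nahmBeta T z) (h₂ z)) = (inner ℂ (nahmBeta T z (s z)) (h₂ z) : ℂ) :=
      ContinuousLinearMap.adjoint_inner_right _ _ _
    rw [hq, he₁, he₂]
    simp only [inner_sub_right, inner_add_right, inner_smul_right, inner_sub_left, inner_add_left,
      inner_smul_left, inner_neg_left, map_mul, Complex.conj_I, r₁, r₂]
    linear_combination
      ((inner ℂ (s' z) (h₁ z) : ℂ) + inner ℂ (nahmAlpha T z (s z)) (h₁ z) +
        Complex.I * (starRingEnd ℂ) y * inner ℂ (s z) (h₁ z)) * Complex.I_sq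
  obtain ⟨c, -, lima, limb⟩ := hF.exists_eq_integral h.lt (hint.const_mul Complex.I)
  have ca : c = inner ℂ sa ga := by
    rw [← map_affine_one] at lima hsa hga
    exact h.left.tendsto_inner (Or.inl rfl) (fun _ => affine_left_mem) ws ls ls' l₁ hs.left
      (tendsto_map'_iff.1 lima) (tendsto_map'_iff.1 hsa) (tendsto_map'_iff.1 hga)
  have cb : c + ∫ z in a..b, Complex.I * ((inner ℂ (g₁ z) (h₁ z) : ℂ) + inner ℂ (g₂ z) (h₂ z)) =
      inner ℂ sb gb := by
    rw [← map_affine_neg_one] at limb hsb hgb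
    exact h.right.tendsto_inner (Or.inr rfl) (fun _ => affine_right_mem) ws ls ls' l₁ hs.right
      (tendsto_map'_iff.1 limb) (tendsto_map'_iff.1 hsb) (tendsto_map'_iff.1 hgb)
  rw [intervalIntegral.integral_of_le h.lt.le, integral_Ioc_eq_integral_Ioo,
    integral_const_mul] at cb
  rw [← cb, ca]
  linear_combination (∫ z in Ioo a b, ((inner ℂ (g₁ z) (h₁ z) : ℂ) + inner ℂ (g₂ z) (h₂ z))) *
    Complex.I_sq

end NahmInterval

end CaloronNahm

namespace CaloronNahm

section Primitives

variable {n : ℕ} {a b : ℝ}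

/-- Initial values and square integrable derivatives on `(a, b)`. -/
abbrev PrimData (n : ℕ) (a b : ℝ) := V n × Lp (V n) 2 (volume.restrict (Ioo a b))

/-- The section with given initial value and derivative. -/
noncomputable def prim (x : PrimData n a b) (z : ℝ) : V n := x.1 + ∫ t in a..z, x.2 t

theorem lp_isL2 (ψ : Lp (V n) 2 (volume.restrict (Ioo a b))) : IsL2 a b ψ := Lp.memLp ψ

theorem lp_intervalIntegrable (ψ : Lp (V n) 2 (volume.restrict (Ioo a b))) {x y : ℝ}
    (hx : x ∈ Icc a b) (hy : y ∈ Icc a b) : IntervalIntegrable ψ volume x y :=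
  intervalIntegrable_of_integrableOn_Ioo (lp_isL2 ψ).integrableOn hx hy

theorem prim_hasWeakDeriv (x : PrimData n a b) : HasWeakDeriv a b (prim x) x.2 :=
  HasWeakDeriv.of_integral
    (fun _ hx _ hy => lp_intervalIntegrable x.2 (Ioo_subset_Icc_self hx) (Ioo_subset_Icc_self hy))
    (fun _ hy => lp_intervalIntegrable x.2 (left_mem_Icc.2 (hy.1.trans hy.2).le)
      (Ioo_subset_Icc_self hy)) x.1

theorem prim_left (x : PrimData n a b) : prim x a = x.1 := by simp [prim]

theorem prim_add (x y : PrimData n a b) {z : ℝ} (hz : z ∈ Icc a b) :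
    prim (x + y) z = prim x z + prim y z := by
  have ha : a ∈ Icc a b := left_mem_Icc.2 (hz.1.trans hz.2)
  have h := intervalIntegral.integral_congr_ae (μ := volume) (f := (x + y).2) (g := fun t => x.2 t + y.2 t)
    (ae_uIoc_of_ae_Ioo (Lp.coeFn_add x.2 y.2) ha hz)
  rw [prim, h, intervalIntegral.integral_add (lp_intervalIntegrable x.2 ha hz)
    (lp_intervalIntegrable y.2 ha hz), prim, prim]
  exact add_add_add_comm _ _ _ _

theorem prim_smul (c : ℂ) (x : PrimData n a b) {z : ℝ} (hz : z ∈ Icc a b) :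
    prim (c • x) z = c • prim x z := by
  have ha : a ∈ Icc a b := left_mem_Icc.2 (hz.1.trans hz.2)
  have h := intervalIntegral.integral_congr_ae (μ := volume) (f := (c • x).2) (g := fun t => c • x.2 t)
    (ae_uIoc_of_ae_Ioo (Lp.coeFn_smul c x.2) ha hz)
  rw [prim, h, intervalIntegral.integral_smul, prim, smul_add]
  rfl

theorem norm_integral_le (ψ : Lp (V n) 2 (volume.restrict (Ioo a b))) {x y : ℝ} (hx : x ∈ Icc a b)
    (hy : y ∈ Icc a b) (hxy : x ≤ y) : ‖∫ t in x..y, ψ t‖ ≤ √(y - x) * ‖ψ‖ := by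
  have hle : eLpNorm ψ 2 (volume.restrict (Ioc x y)) ≤ eLpNorm ψ 2 (volume.restrict (Ioo a b)) := by
    rw [← restrict_Ioo_eq_restrict_Ioc]
    exact eLpNorm_mono_measure _ (Measure.restrict_mono (Ioo_subset_Ioo hx.1 hy.2) le_rfl)
  have hm : AEStronglyMeasurable ψ (volume.restrict (Ioc x y)) := by
    rw [← restrict_Ioo_eq_restrict_Ioc]
    exact (Lp.aestronglyMeasurable ψ).mono_measure
      (Measure.restrict_mono (Ioo_subset_Ioo hx.1 hy.2) le_rfl)
  have h1 := eLpNorm_le_eLpNorm_mul_rpow_measure_univ (p := 1) (q := 2) one_le_two hm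
  have h2 : eLpNorm ψ 1 (volume.restrict (Ioc x y)) ≤
      ENNReal.ofReal (√(y - x) * ‖ψ‖) := by
    refine h1.trans ?_
    rw [mul_comm, ENNReal.ofReal_mul (Real.sqrt_nonneg _)]
    refine mul_le_mul' (le_of_eq ?_) (hle.trans (le_of_eq ?_))
    · rw [Measure.restrict_apply_univ, Real.volume_Ioc, Real.sqrt_eq_rpow,
        ENNReal.ofReal_rpow_of_nonneg (by linarith) (by norm_num)]
      norm_num
    · rw [Lp.norm_def, ENNReal.ofReal_toReal (Lp.eLpNorm_ne_top ψ)]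
  rw [intervalIntegral.integral_of_le hxy]
  refine (norm_integral_le_integral_norm _).trans ?_
  have h3 : ENNReal.ofReal (∫ t in Ioc x y, ‖ψ t‖) = eLpNorm ψ 1 (volume.restrict (Ioc x y)) := by
    rw [eLpNorm_one_eq_lintegral_enorm]
    refine (ofReal_integral_norm_eq_lintegral_enorm ?_)
    exact ((lp_intervalIntegrable ψ hx hy).1)
  rw [← h3] at h2
  exact (ENNReal.ofReal_le_ofReal_iff (by positivity)).1 h2

theorem prim_sub_prim (x : PrimData n a b) {y z : ℝ} (hy : y ∈ Icc a b) (hz : z ∈ Icc a b) :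
    prim x z - prim x y = ∫ t in y..z, x.2 t := by
  have ha : a ∈ Icc a b := left_mem_Icc.2 (hz.1.trans hz.2)
  rw [prim, prim, add_sub_add_left_eq_sub, intervalIntegral.integral_interval_sub_left
    (lp_intervalIntegrable x.2 ha hz) (lp_intervalIntegrable x.2 ha hy)]

theorem norm_prim_le (x : PrimData n a b) {z : ℝ} (hz : z ∈ Icc a b) :
    ‖prim x z‖ ≤ (1 + √(b - a)) * ‖x‖ := by
  have ha : a ∈ Icc a b := left_mem_Icc.2 (hz.1.trans hz.2)
  have h1 := norm_integral_le x.2 ha hz hz.1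
  have h2 : √(z - a) ≤ √(b - a) := Real.sqrt_le_sqrt (by linarith [hz.2])
  have h3 : ‖x.1‖ ≤ ‖x‖ := norm_fst_le x
  have h4 : ‖x.2‖ ≤ ‖x‖ := norm_snd_le x
  calc ‖prim x z‖ ≤ ‖x.1‖ + √(z - a) * ‖x.2‖ := (norm_add_le _ _).trans (by gcongr)
    _ ≤ ‖x‖ + √(b - a) * ‖x‖ := by gcongr
    _ = _ := by ring

/-- Evaluation at a point of the closed interval. -/
noncomputable def evalAt {z : ℝ} (hz : z ∈ Icc a b) : PrimData n a b →L[ℂ] V n :=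
  LinearMap.mkContinuous
    { toFun := fun x => prim x z
      map_add' := fun x y => prim_add x y hz
      map_smul' := fun c x => prim_smul c x hz } (1 + √(b - a)) fun x => norm_prim_le x hz

theorem prim_tendsto (hab : a < b) (x : PrimData n a b) :
    Tendsto (prim x) (𝓝[>] a) (𝓝 (prim x a)) ∧ Tendsto (prim x) (𝓝[<] b) (𝓝 (prim x b)) := by
  have hc := intervalIntegral.continuousOn_primitive_interval (μ := volume) (f := x.2) (a := a)
    (b := b) (by
      rw [uIcc_of_le hab.le]
      exact (integrableOn_Icc_iff_integrableOn_Ioo (by simp) (by simp)).2 (lp_isL2 x.2).integrableOn)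
  rw [uIcc_of_le hab.le] at hc
  have hc' : ContinuousOn (prim x) (Icc a b) := (continuousOn_const (c := x.1)).add hc
  exact ⟨(hc' a (left_mem_Icc.2 hab.le)).mono_left (nhdsWithin_le_iff.2 (mem_of_superset
      (Ioo_mem_nhdsGT hab) Ioo_subset_Icc_self)),
    (hc' b (right_mem_Icc.2 hab.le)).mono_left (nhdsWithin_le_iff.2 (mem_of_superset
      (Ioo_mem_nhdsLT hab) Ioo_subset_Icc_self))⟩

theorem eLpNorm_le_of_bound {f : ℝ → V n} {C : ℝ} (hab : a ≤ b) (hC : ∀ z ∈ Ioo a b, ‖f z‖ ≤ C) :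
    eLpNorm f 2 (volume.restrict (Ioo a b)) ≤ ENNReal.ofReal (√(b - a) * C) := by
  refine (eLpNorm_le_of_ae_bound (C := C) (by
    filter_upwards [ae_restrict_mem measurableSet_Ioo] with z hz using hC z hz)).trans (le_of_eq ?_)
  rw [Measure.restrict_apply_univ, Real.volume_Ioo, ENNReal.ofReal_mul (Real.sqrt_nonneg _),
    Real.sqrt_eq_rpow, ENNReal.ofReal_rpow_of_nonneg (by linarith) (by norm_num)]
  norm_num

theorem prim_isL2 (hab : a ≤ b) (x : PrimData n a b) : IsL2 a b (prim x) :=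
  ⟨(prim_hasWeakDeriv x).aestronglyMeasurable, (eLpNorm_le_of_bound hab fun _ hz =>
    norm_prim_le x (Ioo_subset_Icc_self hz)).trans_lt ENNReal.ofReal_lt_top⟩

theorem exists_lp_clm {P : Type*} [NormedAddCommGroup P] [NormedSpace ℂ P] (Φ : P → ℝ → V n)
    (hm : ∀ x, AEStronglyMeasurable (Φ x) (volume.restrict (Ioo a b)))
    (hadd : ∀ x y, ∀ z ∈ Ioo a b, Φ (x + y) z = Φ x z + Φ y z)
    (hsmul : ∀ (c : ℂ) x, ∀ z ∈ Ioo a b, Φ (c • x) z = c • Φ x z) {C : ℝ} (hC0 : 0 ≤ C)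
    (hC : ∀ x, eLpNorm (Φ x) 2 (volume.restrict (Ioo a b)) ≤ ENNReal.ofReal (C * ‖x‖)) :
    ∃ L : P →L[ℂ] Lp (V n) 2 (volume.restrict (Ioo a b)), ∀ x,
      L x =ᵐ[volume.restrict (Ioo a b)] Φ x := by
  have hmem : ∀ x, MemLp (Φ x) 2 (volume.restrict (Ioo a b)) := fun x =>
    ⟨hm x, (hC x).trans_lt ENNReal.ofReal_lt_top⟩
  refine ⟨LinearMap.mkContinuous
    { toFun := fun x => (hmem x).toLp
      map_add' := fun x y => ?_
      map_smul' := fun c x => ?_ } C fun x => ?_, fun x => (hmem x).coeFn_toLp⟩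
  · rw [← MemLp.toLp_add]
    refine MemLp.toLp_congr _ _ ?_
    filter_upwards [ae_restrict_mem measurableSet_Ioo] with z hz using hadd x y z hz
  · refine (MemLp.toLp_congr _ ((hmem x).const_smul c) ?_).trans (MemLp.toLp_const_smul c (hmem x))
    filter_upwards [ae_restrict_mem measurableSet_Ioo] with z hz using hsmul c x z hz
  · change ‖(hmem x).toLp‖ ≤ _
    rw [Lp.norm_toLp]
    exact ENNReal.toReal_le_of_le_ofReal (by positivity) (hC x)

/-- Sections whose polar components vanish at the ends. -/
noncomputable def polarSub (hab : a ≤ b) (Qa Qb : EndV n) : Submodule ℂ (PrimData n a b) :=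
  LinearMap.ker ((Qa ∘L evalAt (left_mem_Icc.2 hab) : PrimData n a b →L[ℂ] V n) :
      PrimData n a b →ₗ[ℂ] V n) ⊓
    LinearMap.ker ((Qb ∘L evalAt (right_mem_Icc.2 hab) : PrimData n a b →L[ℂ] V n) :
      PrimData n a b →ₗ[ℂ] V n)

theorem mem_polarSub (hab : a ≤ b) {Qa Qb : EndV n} {x : PrimData n a b} :
    x ∈ polarSub hab Qa Qb ↔ Qa (prim x a) = 0 ∧ Qb (prim x b) = 0 := Iff.rfl

theorem isClosed_polarSub (hab : a ≤ b) (Qa Qb : EndV n) :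
    IsClosed (polarSub hab Qa Qb : Set (PrimData n a b)) :=
  (ContinuousLinearMap.isClosed_ker (Qa ∘L evalAt (left_mem_Icc.2 hab))).inter
    (ContinuousLinearMap.isClosed_ker (Qb ∘L evalAt (right_mem_Icc.2 hab)))

instance (hab : a ≤ b) (Qa Qb : EndV n) : CompleteSpace (polarSub hab Qa Qb) :=
  (isClosed_polarSub hab Qa Qb).completeSpace_coe

theorem polarVanish_of_mem (hab : a < b) {Qa Qb : EndV n} {x : PrimData n a b}
    (hx : x ∈ polarSub hab.le Qa Qb) : PolarVanish a b Qa Qb (prim x) := by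
  obtain ⟨h1, h2⟩ := prim_tendsto hab x
  obtain ⟨e1, e2⟩ := (mem_polarSub hab.le).1 hx
  constructor
  · have := (Qa.continuous.tendsto _).comp h1
    rwa [e1] at this
  · have := (Qb.continuous.tendsto _).comp h2
    rwa [e2] at this

/-- The first component of `D₁` in terms of the initial value and the derivative. -/
noncomputable def primNabla (T : Fin 4 → ℝ → EndV n) (y : ℂ) (x : PrimData n a b) (z : ℝ) : V n :=
  Complex.I • (x.2 z + nahmAlpha T z (prim x z) - (Complex.I * y) • prim x z)

/-- The second component of `D₁` in terms of the initial value and the derivative. -/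
noncomputable def primMult (T : Fin 4 → ℝ → EndV n) (w : ℂ) (x : PrimData n a b) (z : ℝ) : V n :=
  -(nahmBeta T z (prim x z) - (Complex.I * w) • prim x z)

theorem norm_prim_le_of_grid {N : ℕ} (hN : 0 < N) (hab : a < b) (x : PrimData n a b)
    (hx : ∀ i : Fin N, prim x (a + i * ((b - a) / N)) = 0) {z : ℝ} (hz : z ∈ Ioo a b) :
    ‖prim x z‖ ≤ √((b - a) / N) * ‖x.2‖ := by
  have hN' : (0 : ℝ) < N := by exact_mod_cast hN
  set d := (b - a) / N with hd
  have hd0 : 0 < d := div_pos (by linarith) hN'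
  have hNd : N * d = b - a := by rw [hd]; field_simp
  set i := ⌊(z - a) / d⌋₊ with hi
  have hq : 0 ≤ (z - a) / d := div_nonneg (by linarith [hz.1]) hd0.le
  have h1 : (i : ℝ) * d ≤ z - a := (le_div_iff₀ hd0).1 (Nat.floor_le hq)
  have h2 : z - a < (i + 1) * d := (div_lt_iff₀ hd0).1 (Nat.lt_floor_add_one _)
  have h3 : i < N := by
    have : (i : ℝ) * d < N * d := by rw [hNd]; linarith [hz.2]
    exact_mod_cast lt_of_mul_lt_mul_right this hd0.le
  have hg : a + i * d ∈ Icc a b := ⟨by have : 0 ≤ (i : ℝ) * d := by positivity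
                                       linarith, by linarith [hz.2]⟩
  have h4 := prim_sub_prim x hg (Ioo_subset_Icc_self hz)
  have h5 : prim x (a + i * d) = 0 := hx ⟨i, h3⟩
  rw [h5, sub_zero] at h4
  rw [h4]
  refine (norm_integral_le x.2 hg (Ioo_subset_Icc_self hz) (by linarith)).trans ?_
  gcongr
  linarith

end Primitives

end CaloronNahm

namespace CaloronNahm

theorem eLpNorm_eq_of_ae {n : ℕ} {μ : Measure ℝ} {u : Lp (V n) 2 μ} {f : ℝ → V n} (h : u =ᵐ[μ] f) :
    eLpNorm f 2 μ = ENNReal.ofReal ‖u‖ := by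
  rw [← eLpNorm_congr_ae h, Lp.norm_def, ENNReal.ofReal_toReal (Lp.eLpNorm_ne_top u)]

theorem ofReal_mul_add {c x y : ℝ} (hc : 0 ≤ c) (hx : 0 ≤ x) (hy : 0 ≤ y) :
    ENNReal.ofReal c * (ENNReal.ofReal x + ENNReal.ofReal y) = ENNReal.ofReal (c * (x + y)) := by
  rw [← ENNReal.ofReal_add hx hy, ← ENNReal.ofReal_mul hc]

theorem exists_small_step (c : ℝ) {d : ℝ} : ∃ N : ℕ, 0 < N ∧ c * √(d / N) ≤ 1 / 2 := by
  have h1 : Tendsto (fun N : ℕ => c * √(d / N)) atTop (𝓝 0) := by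
    have h2 := (Real.continuous_sqrt.tendsto 0).comp (tendsto_const_div_atTop_nhds_zero_nat d)
    rw [Real.sqrt_zero] at h2
    simpa using h2.const_mul c
  obtain ⟨N, hN, hN'⟩ := ((h1.eventually (ge_mem_nhds (by norm_num : (0 : ℝ) < 1 / 2))).and
    (eventually_gt_atTop 0)).exists
  exact ⟨N, hN', hN⟩

theorem le_of_elliptic_bound {E : Type*} [NormedAddCommGroup E] [NormedSpace ℂ E] {p q r : E} {y w : ℂ}
    {D x : ℝ} (hD : 0 ≤ D) (h : x ≤ D * (‖p‖ + ‖q‖ + ‖r‖))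
    (hr : D * (‖y‖ + ‖w‖ + 1) * ‖r‖ ≤ 1 / 2 * x) :
    x ≤ 2 * D * (‖Complex.I • (p - (Complex.I * y) • r)‖ + ‖-(q - (Complex.I * w) • r)‖) := by
  have n1 : ‖p‖ ≤ ‖Complex.I • (p - (Complex.I * y) • r)‖ + ‖y‖ * ‖r‖ := by
    have := norm_add_le (p - (Complex.I * y) • r) ((Complex.I * y) • r)
    rw [sub_add_cancel, norm_smul (Complex.I * y), norm_mul, Complex.norm_I, one_mul] at this
    rwa [norm_smul, Complex.norm_I, one_mul]
  have n2 : ‖q‖ ≤ ‖-(q - (Complex.I * w) • r)‖ + ‖w‖ * ‖r‖ := by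
    have := norm_add_le (q - (Complex.I * w) • r) ((Complex.I * w) • r)
    rw [sub_add_cancel, norm_smul, norm_mul, Complex.norm_I, one_mul] at this
    rwa [norm_neg]
  have e := mul_le_mul_of_nonneg_left (add_le_add_left (add_le_add n1 n2) ‖r‖) hD
  linarith

namespace NahmInterval

variable {n j : ℕ} {a b : ℝ} {T : Fin 4 → ℝ → EndV n} {Qa Qb : EndV n}

theorem exists_operators (h : NahmInterval j a b T Qa Qb) (y w : ℂ) :
    ∃ O₁ O₂ : polarSub h.lt.le Qa Qb →L[ℂ] Lp (V n) 2 (volume.restrict (Ioo a b)),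
      (∀ x, O₁ x =ᵐ[volume.restrict (Ioo a b)] primNabla T y x.1) ∧
      (∀ x, O₂ x =ᵐ[volume.restrict (Ioo a b)] primMult T w x.1) ∧
      ∃ (N : ℕ) (Ev : polarSub h.lt.le Qa Qb →L[ℂ] (Fin N → V n)) (C : ℝ), 0 ≤ C ∧
        ∀ x, Ev x = 0 → ‖x‖ ≤ C * (‖O₁ x‖ + ‖O₂ x‖) := by
  have hab := h.lt
  set P := polarSub h.lt.le Qa Qb with hP
  set r := √(b - a) with hr
  have hr0 : 0 ≤ r := Real.sqrt_nonneg _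
  obtain ⟨C, hC, HC⟩ := h.exists_bound_mul
  obtain ⟨D, hD, HD⟩ := h.exists_elliptic_bound
  have hv : ∀ x : P, PolarVanish a b Qa Qb (prim x.1) := fun x => polarVanish_of_mem hab x.2
  have hw : ∀ x : P, HasWeakDeriv a b (prim x.1) x.1.2 := fun x => prim_hasWeakDeriv x.1
  have nψ : ∀ x : P, eLpNorm x.1.2 2 (volume.restrict (Ioo a b)) = ENNReal.ofReal ‖x.1.2‖ :=
    fun x => eLpNorm_eq_of_ae EventuallyEq.rfl
  have nle : ∀ x : P, ‖x.1.2‖ ≤ ‖x‖ := fun x => norm_snd_le x.1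
  have b0 : ∀ x : P, eLpNorm (prim x.1) 2 (volume.restrict (Ioo a b)) ≤
      ENNReal.ofReal (r * (1 + r) * ‖x‖) := by
    intro x
    rw [mul_assoc]
    exact eLpNorm_le_of_bound hab.le fun z hz => norm_prim_le x.1 (Ioo_subset_Icc_self hz)
  have b1 : ∀ x : P, ENNReal.ofReal C * (eLpNorm x.1.2 2 (volume.restrict (Ioo a b)) +
      eLpNorm (prim x.1) 2 (volume.restrict (Ioo a b))) ≤
      ENNReal.ofReal (C * (1 + r * (1 + r)) * ‖x‖) := by
    intro x
    refine (mul_le_mul_right (add_le_add ((nψ x).le.trans (ENNReal.ofReal_le_ofReal (nle x)))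
      (b0 x)) _).trans (le_of_eq ?_)
    rw [ofReal_mul_add hC (norm_nonneg _) (by positivity)]
    congr 1
    ring
  obtain ⟨L₀, hL₀⟩ := exists_lp_clm (a := a) (b := b) (fun x : P => prim x.1)
    (fun x => (hw x).aestronglyMeasurable) (fun x y z hz => prim_add x.1 y.1 (Ioo_subset_Icc_self hz))
    (fun c x z hz => prim_smul c x.1 (Ioo_subset_Icc_self hz)) (by positivity) b0
  obtain ⟨Lα, hLα⟩ := exists_lp_clm (a := a) (b := b) (fun (x : P) z => nahmAlpha T z (prim x.1 z))
    (fun x => aestronglyMeasurable_apply h.continuousOn_alpha (hw x).aestronglyMeasurable)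
    (fun x y z hz => (congrArg (nahmAlpha T z) (prim_add x.1 y.1 (Ioo_subset_Icc_self hz))).trans
      (map_add _ _ _))
    (fun c x z hz => (congrArg (nahmAlpha T z) (prim_smul c x.1 (Ioo_subset_Icc_self hz))).trans
      (map_smul _ _ _)) (by positivity)
    (fun x => ((HC _ _ (hw x) (hv x)).1).trans (b1 x))
  obtain ⟨Lβ, hLβ⟩ := exists_lp_clm (a := a) (b := b) (fun (x : P) z => nahmBeta T z (prim x.1 z))
    (fun x => aestronglyMeasurable_apply h.continuousOn_beta (hw x).aestronglyMeasurable)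
    (fun x y z hz => (congrArg (nahmBeta T z) (prim_add x.1 y.1 (Ioo_subset_Icc_self hz))).trans
      (map_add _ _ _))
    (fun c x z hz => (congrArg (nahmBeta T z) (prim_smul c x.1 (Ioo_subset_Icc_self hz))).trans
      (map_smul _ _ _)) (by positivity)
    (fun x => ((HC _ _ (hw x) (hv x)).2).trans (b1 x))
  set Lψ : P →L[ℂ] Lp (V n) 2 (volume.restrict (Ioo a b)) :=
    (ContinuousLinearMap.snd ℂ _ _).comp P.subtypeL with hLψ
  have eψ : ∀ x, Lψ x = x.1.2 := fun x => rfl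
  refine ⟨Complex.I • (Lψ + Lα - (Complex.I * y) • L₀), -(Lβ - (Complex.I * w) • L₀), fun x => ?_,
    fun x => ?_, ?_⟩
  · filter_upwards [hL₀ x, hLα x, Lp.coeFn_smul Complex.I (Lψ x + Lα x - (Complex.I * y) • L₀ x),
      Lp.coeFn_sub (Lψ x + Lα x) ((Complex.I * y) • L₀ x), Lp.coeFn_add (Lψ x) (Lα x),
      Lp.coeFn_smul (Complex.I * y) (L₀ x)] with z e1 e2 e3 e4 e5 e6
    refine e3.trans ?_
    rw [Pi.smul_apply, e4, Pi.sub_apply, e5, Pi.add_apply, e6, Pi.smul_apply, e1, e2]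
    rfl
  · filter_upwards [hL₀ x, hLβ x, Lp.coeFn_neg (Lβ x - (Complex.I * w) • L₀ x),
      Lp.coeFn_sub (Lβ x) ((Complex.I * w) • L₀ x), Lp.coeFn_smul (Complex.I * w) (L₀ x)] with
      z e1 e2 e3 e4 e5
    refine e3.trans ?_
    rw [Pi.neg_apply, e4, Pi.sub_apply, e5, Pi.smul_apply, e1, e2]
    rfl
  · obtain ⟨N, hN, hNle⟩ := exists_small_step (D * (‖y‖ + ‖w‖ + 1) * r) (d := b - a)
    have hN' : (0 : ℝ) < N := by exact_mod_cast hN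
    have hg : ∀ i : Fin N, a + i * ((b - a) / N) ∈ Icc a b := by
      intro i
      have h1 : (i : ℝ) ≤ N := by exact_mod_cast i.2.le
      have h2 : 0 ≤ (b - a) / N := div_nonneg (by linarith) hN'.le
      have h3 : (i : ℝ) * ((b - a) / N) ≤ N * ((b - a) / N) := by gcongr
      have h4 : N * ((b - a) / N) = b - a := by field_simp
      have h5 : 0 ≤ (i : ℝ) * ((b - a) / N) := by positivity
      constructor <;> linarith
    refine ⟨N, ContinuousLinearMap.pi fun i => (evalAt (hg i)).comp P.subtypeL, 2 * D, by positivity,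
      fun x hx => ?_⟩
    have hx' : ∀ i : Fin N, prim x.1 (a + i * ((b - a) / N)) = 0 := fun i => congrFun hx i
    have e0 : x.1.1 = 0 := by
      have := hx' ⟨0, hN⟩
      simpa [prim_left] using this
    have s0 : ‖L₀ x‖ ≤ r * √((b - a) / N) * ‖x.1.2‖ := by
      have := eLpNorm_le_of_bound hab.le fun z hz => norm_prim_le_of_grid hN hab x.1 hx' hz
      rw [eLpNorm_eq_of_ae (hL₀ x)] at this
      rw [mul_assoc]
      exact (ENNReal.ofReal_le_ofReal_iff (by positivity)).1 this
    have ell : ‖x.1.2‖ ≤ D * (‖Lψ x + Lα x‖ + ‖Lβ x‖ + ‖L₀ x‖) := by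
      have := HD _ _ (hw x) (hv x)
      have e1 : (Lψ x + Lα x : Lp (V n) 2 _) =ᵐ[volume.restrict (Ioo a b)]
          fun z => x.1.2 z + nahmAlpha T z (prim x.1 z) := by
        filter_upwards [Lp.coeFn_add (Lψ x) (Lα x), hLα x] with z e1 e2
        rw [e1, Pi.add_apply, e2]
        rfl
      rw [nψ, eLpNorm_eq_of_ae e1, eLpNorm_eq_of_ae (hLβ x), eLpNorm_eq_of_ae (hL₀ x),
        ← ENNReal.ofReal_add (norm_nonneg _) (norm_nonneg _),
        ofReal_mul_add hD (by positivity) (norm_nonneg _)] at this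
      exact (ENNReal.ofReal_le_ofReal_iff (by positivity)).1 this
    have hx2 : ‖x‖ = ‖x.1.2‖ := by
      change ‖x.1‖ = _
      rw [Prod.norm_def, e0, norm_zero, max_eq_right (norm_nonneg _)]
    have key : D * (‖y‖ + ‖w‖ + 1) * ‖L₀ x‖ ≤ 1 / 2 * ‖x.1.2‖ := by
      calc D * (‖y‖ + ‖w‖ + 1) * ‖L₀ x‖ ≤ D * (‖y‖ + ‖w‖ + 1) * (r * √((b - a) / N) * ‖x.1.2‖) := by
            gcongr
        _ = D * (‖y‖ + ‖w‖ + 1) * r * √((b - a) / N) * ‖x.1.2‖ := by ring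
        _ ≤ 1 / 2 * ‖x.1.2‖ := by gcongr
    rw [hx2]
    exact le_of_elliptic_bound hD ell key

end NahmInterval

section Projection

variable {F Y G : Type*} [NormedAddCommGroup F] [NormedSpace ℂ F] [CompleteSpace F]
  [NormedAddCommGroup Y] [InnerProductSpace ℂ Y] [CompleteSpace Y]
  [NormedAddCommGroup G] [NormedSpace ℂ G] [FiniteDimensional ℂ G]

theorem exists_orthogonal_of_coercive (A : F →L[ℂ] Y) (Ev : F →L[ℂ] G) {C : ℝ}
    (hC : ∀ x, Ev x = 0 → ‖x‖ ≤ C * ‖A x‖) (u : Y) : ∃ x, ∀ y, inner ℂ (A y) (u - A x) = 0 := by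
  set S : Submodule ℂ F := LinearMap.ker (Ev : F →ₗ[ℂ] G) with hS
  have hSc : IsClosed (S : Set F) := ContinuousLinearMap.isClosed_ker Ev
  have : CompleteSpace S := hSc.completeSpace_coe
  have hanti : AntilipschitzWith (Real.toNNReal C) (A.comp S.subtypeL) := by
    refine AddMonoidHomClass.antilipschitz_of_bound _ fun x => ?_
    refine (hC x.1 x.2).trans ?_
    rw [Real.coe_toNNReal']
    exact mul_le_mul_of_nonneg_right (le_max_left _ _) (norm_nonneg _)
  have hcl : IsClosed (range (A.comp S.subtypeL)) :=
    hanti.isClosed_range (A.comp S.subtypeL).uniformContinuous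
  have hcofg : S.CoFG := Submodule.CoFG.ker _
  have hmap : IsClosed (S.map (A : F →ₗ[ℂ] Y) : Set Y) := by
    convert hcl using 1
    ext v
    simp
  have hR : IsClosed ((LinearMap.range (A : F →ₗ[ℂ] Y) : Submodule ℂ Y) : Set Y) :=
    LinearMap.isClosed_range_of_isClosed_map_of_finiteDimensional_quotient hmap
  have : CompleteSpace (LinearMap.range (A : F →ₗ[ℂ] Y)) := hR.completeSpace_coe
  obtain ⟨x, hx⟩ := (LinearMap.range (A : F →ₗ[ℂ] Y)).starProjection_apply_mem u
  refine ⟨x, fun y => ?_⟩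
  have h1 := Submodule.sub_starProjection_mem_orthogonal (K := LinearMap.range (A : F →ₗ[ℂ] Y)) u
  rw [← hx] at h1
  exact h1 (A y) ⟨y, rfl⟩

end Projection

end CaloronNahm

namespace CaloronNahm

section Pair

variable {F Y₁ Y₂ : Type*} [NormedAddCommGroup F] [NormedSpace ℂ F] [NormedAddCommGroup Y₁]
  [InnerProductSpace ℂ Y₁] [NormedAddCommGroup Y₂] [InnerProductSpace ℂ Y₂]

/-- The operator with two given components in a Hilbert sum. -/
noncomputable def pairL2 (A : F →L[ℂ] Y₁) (B : F →L[ℂ] Y₂) : F →L[ℂ] WithLp 2 (Y₁ × Y₂) :=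
  (WithLp.prodContinuousLinearEquiv 2 ℂ Y₁ Y₂).symm.toContinuousLinearMap ∘L A.prod B

theorem norm_pairL2_sq (A : F →L[ℂ] Y₁) (B : F →L[ℂ] Y₂) (x : F) :
    ‖pairL2 A B x‖ ^ 2 = ‖A x‖ ^ 2 + ‖B x‖ ^ 2 :=
  WithLp.prod_norm_sq_eq_of_L2 (pairL2 A B x)

theorem norm_left_le_pairL2 (A : F →L[ℂ] Y₁) (B : F →L[ℂ] Y₂) (x : F) : ‖A x‖ ≤ ‖pairL2 A B x‖ := by
  refine (sq_le_sq₀ (norm_nonneg _) (norm_nonneg _)).1 ?_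
  rw [norm_pairL2_sq]
  exact le_add_of_nonneg_right (sq_nonneg _)

theorem norm_right_le_pairL2 (A : F →L[ℂ] Y₁) (B : F →L[ℂ] Y₂) (x : F) : ‖B x‖ ≤ ‖pairL2 A B x‖ := by
  refine (sq_le_sq₀ (norm_nonneg _) (norm_nonneg _)).1 ?_
  rw [norm_pairL2_sq]
  exact le_add_of_nonneg_left (sq_nonneg _)

theorem inner_pairL2 (A : F →L[ℂ] Y₁) (B : F →L[ℂ] Y₂) (x y : F) (u : Y₁) (v : Y₂) :
    inner ℂ (pairL2 A B y) (WithLp.toLp 2 (u, v) - pairL2 A B x) =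
      (inner ℂ (A y) (u - A x) + inner ℂ (B y) (v - B x) : ℂ) :=
  WithLp.prod_inner_apply _ _

variable {P R H K E G : Type*} [NormedAddCommGroup P] [NormedSpace ℂ P] [CompleteSpace P]
  [NormedAddCommGroup R] [NormedSpace ℂ R] [CompleteSpace R]
  [NormedAddCommGroup H] [InnerProductSpace ℂ H] [CompleteSpace H]
  [NormedAddCommGroup K] [InnerProductSpace ℂ K] [CompleteSpace K]
  [NormedAddCommGroup E] [NormedSpace ℂ E] [FiniteDimensional ℂ E]
  [NormedAddCommGroup G] [NormedSpace ℂ G] [FiniteDimensional ℂ G]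

theorem exists_orthogonal_of_coercive_pair {O₁ O₂ : P →L[ℂ] H} {R₁ R₂ : R →L[ℂ] K} {EL : P →L[ℂ] E}
    {ES : R →L[ℂ] G} {CL CS : ℝ} (hCL : 0 ≤ CL) (hCS : 0 ≤ CS)
    (HL : ∀ x, EL x = 0 → ‖x‖ ≤ CL * (‖O₁ x‖ + ‖O₂ x‖))
    (HS : ∀ x, ES x = 0 → ‖x‖ ≤ CS * (‖R₁ x‖ + ‖R₂ x‖)) (F : Submodule ℂ (P × R))
    (hF : IsClosed (F : Set (P × R))) (J₁ J₂ : P × R →L[ℂ] ℂ) (u₁ u₂ : H) (v₁ v₂ : K) (c₁ c₂ : ℂ) :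
    ∃ x ∈ F, ∀ t ∈ F, (inner ℂ (O₁ t.1) (u₁ - O₁ x.1) + inner ℂ (O₂ t.1) (u₂ - O₂ x.1) : ℂ) +
      (inner ℂ (R₁ t.2) (v₁ - R₁ x.2) + inner ℂ (R₂ t.2) (v₂ - R₂ x.2)) +
      (inner ℂ (J₁ t) (c₁ - J₁ x) + inner ℂ (J₂ t) (c₂ - J₂ x)) = 0 := by
  have : CompleteSpace F := hF.completeSpace_coe
  set fL : F →L[ℂ] P := ContinuousLinearMap.fst ℂ P R ∘L F.subtypeL
  set fS : F →L[ℂ] R := ContinuousLinearMap.snd ℂ P R ∘L F.subtypeL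
  set AL := pairL2 (O₁ ∘L fL) (O₂ ∘L fL)
  set AS := pairL2 (R₁ ∘L fS) (R₂ ∘L fS)
  set A := pairL2 (pairL2 AL AS) (pairL2 (J₁ ∘L F.subtypeL) (J₂ ∘L F.subtypeL))
  set Ev := (EL ∘L fL).prod (ES ∘L fS)
  have hcoer : ∀ x, Ev x = 0 → ‖x‖ ≤ 2 * (CL + CS) * ‖A x‖ := by
    intro x hx
    have hx1 : EL (fL x) = 0 := congrArg Prod.fst hx
    have hx2 : ES (fS x) = 0 := congrArg Prod.snd hx
    have a0 : ‖pairL2 AL AS x‖ ≤ ‖A x‖ := norm_left_le_pairL2 _ _ x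
    have a1 : ‖AL x‖ ≤ ‖A x‖ := (norm_left_le_pairL2 AL AS x).trans a0
    have a2 : ‖AS x‖ ≤ ‖A x‖ := (norm_right_le_pairL2 AL AS x).trans a0
    have b1 : ‖O₁ (fL x)‖ ≤ ‖A x‖ := (norm_left_le_pairL2 (O₁ ∘L fL) (O₂ ∘L fL) x).trans a1
    have b2 : ‖O₂ (fL x)‖ ≤ ‖A x‖ := (norm_right_le_pairL2 (O₁ ∘L fL) (O₂ ∘L fL) x).trans a1
    have b3 : ‖R₁ (fS x)‖ ≤ ‖A x‖ := (norm_left_le_pairL2 (R₁ ∘L fS) (R₂ ∘L fS) x).trans a2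
    have b4 : ‖R₂ (fS x)‖ ≤ ‖A x‖ := (norm_right_le_pairL2 (R₁ ∘L fS) (R₂ ∘L fS) x).trans a2
    have n0 := norm_nonneg (A x)
    have c1 : ‖fL x‖ ≤ 2 * (CL + CS) * ‖A x‖ := by
      refine (HL _ hx1).trans ((mul_le_mul_of_nonneg_left (add_le_add b1 b2) hCL).trans ?_)
      nlinarith [mul_nonneg hCS n0]
    have c2 : ‖fS x‖ ≤ 2 * (CL + CS) * ‖A x‖ := by
      refine (HS _ hx2).trans ((mul_le_mul_of_nonneg_left (add_le_add b3 b4) hCS).trans ?_)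
      nlinarith [mul_nonneg hCL n0]
    exact max_le c1 c2
  obtain ⟨x, hx⟩ := exists_orthogonal_of_coercive A Ev hcoer
    (WithLp.toLp 2 (WithLp.toLp 2 (WithLp.toLp 2 (u₁, u₂), WithLp.toLp 2 (v₁, v₂)),
      WithLp.toLp 2 (c₁, c₂)))
  refine ⟨x.1, x.2, fun t ht => ?_⟩
  have key := hx ⟨t, ht⟩
  rwa [inner_pairL2, inner_pairL2, inner_pairL2, inner_pairL2, inner_pairL2] at key

end Pair

theorem inner_lp_add {n : ℕ} {a b : ℝ} {f₁ f₂ g₁ g₂ : Lp (V n) 2 (volume.restrict (Ioo a b))}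
    {f₁' f₂' g₁' g₂' : ℝ → V n} (h₁ : f₁ =ᵐ[volume.restrict (Ioo a b)] f₁')
    (h₂ : f₂ =ᵐ[volume.restrict (Ioo a b)] f₂') (k₁ : g₁ =ᵐ[volume.restrict (Ioo a b)] g₁')
    (k₂ : g₂ =ᵐ[volume.restrict (Ioo a b)] g₂') :
    (inner ℂ f₁ g₁ + inner ℂ f₂ g₂ : ℂ) =
      ∫ z in Ioo a b, ((inner ℂ (f₁' z) (g₁' z) : ℂ) + inner ℂ (f₂' z) (g₂' z)) := by
  rw [L2.inner_def, L2.inner_def, ← integral_add (L2.integrable_inner f₁ g₁) (L2.integrable_inner f₂ g₂)]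
  refine integral_congr_ae ?_
  filter_upwards [h₁, h₂, k₁, k₂] with z e1 e2 e3 e4
  rw [e1, e2, e3, e4]

theorem toLp_sub_ae {n : ℕ} {a b : ℝ} {f : ℝ → V n} (hf : IsL2 a b f)
    {g : Lp (V n) 2 (volume.restrict (Ioo a b))} {g' : ℝ → V n}
    (hg : g =ᵐ[volume.restrict (Ioo a b)] g') :
    (hf.toLp - g : Lp (V n) 2 _) =ᵐ[volume.restrict (Ioo a b)] fun z => f z - g' z := by
  filter_upwards [Lp.coeFn_sub hf.toLp g, hf.coeFn_toLp, hg] with z e1 e2 e3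
  rw [e1, Pi.sub_apply, e2, e3]

namespace NahmSolution

variable {k j : ℕ} {μ₀ μ₁ : ℝ} (N : NahmSolution k j μ₀ μ₁)

/-- The sections on the two intervals are glued by the isometries at the jump points. -/
def Glued (xL : PrimData (k + j) (-μ₁) μ₁) (xS : PrimData k μ₁ (μ₀ - μ₁)) : Prop :=
  ∀ p, prim xL (largePt μ₁ p) = N.ι p (prim xS (smallPt μ₀ μ₁ p))

/-- The coefficient of the jump of `D₁ s` as a function of the value of `s`. -/
noncomputable def jumpFun (p : Jump) : V k →L[ℂ] ℂ := if j = 0 then innerSL ℂ (N.α p 1) else 0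

theorem Glued.mem {N : NahmSolution k j μ₀ μ₁} {xL : PrimData (k + j) (-μ₁) μ₁}
    {xS : PrimData k μ₁ (μ₀ - μ₁)} (h : N.Glued xL xS) (hab : -μ₁ ≤ μ₁) :
    xL ∈ polarSub hab (coproj (N.ι .minus)) (coproj (N.ι .plus)) := by
  rw [mem_polarSub]
  have h1 : prim xL (-μ₁) = _ := h .minus
  have h2 : prim xL μ₁ = _ := h .plus
  rw [h1, h2]
  exact ⟨coproj_map (N.ι .minus) _, coproj_map (N.ι .plus) _⟩

theorem smallPt_mem (hμ : μ₁ < μ₀ - μ₁) (p : Jump) : smallPt μ₀ μ₁ p ∈ Icc μ₁ (μ₀ - μ₁) := by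
  cases p
  · exact left_mem_Icc.2 hμ.le
  · exact right_mem_Icc.2 hμ.le

/-- The coefficient of the jump of `D₁ s`. -/
noncomputable def jumpVal {PL : Submodule ℂ (PrimData (k + j) (-μ₁) μ₁)}
    {PS : Submodule ℂ (PrimData k μ₁ (μ₀ - μ₁))} (hμ : μ₁ < μ₀ - μ₁) (p : Jump) : PL × PS →L[ℂ] ℂ :=
  N.jumpFun p ∘L (evalAt (smallPt_mem hμ p) ∘L PS.subtypeL) ∘L ContinuousLinearMap.snd ℂ PL PS

theorem exists_glued_submodule (hμ₁ : 0 < μ₁) (hμ : μ₁ < μ₀ - μ₁) (hab : -μ₁ ≤ μ₁)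
    (hab' : μ₁ ≤ μ₀ - μ₁) :
    ∃ F : Submodule ℂ (polarSub hab (coproj (N.ι .minus)) (coproj (N.ι .plus)) ×
        polarSub (n := k) hab' 0 0), IsClosed F.carrier ∧ ∀ x, x ∈ F ↔ N.Glued x.1.1 x.2.1 := by
  set PL := polarSub hab (coproj (N.ι .minus)) (coproj (N.ι .plus))
  set PS := polarSub (n := k) hab' 0 0
  set κ : ∀ p, PL × PS →L[ℂ] V (k + j) := fun p =>
    (evalAt (largePt_mem hμ₁ p) ∘L PL.subtypeL) ∘L ContinuousLinearMap.fst ℂ PL PS -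
      (N.ι p).toContinuousLinearMap ∘L
        (evalAt (smallPt_mem hμ p) ∘L PS.subtypeL) ∘L ContinuousLinearMap.snd ℂ PL PS with hκ
  refine ⟨LinearMap.ker (κ .plus : PL × PS →ₗ[ℂ] V (k + j)) ⊓
    LinearMap.ker (κ .minus : PL × PS →ₗ[ℂ] V (k + j)),
    (ContinuousLinearMap.isClosed_ker (κ .plus)).inter (ContinuousLinearMap.isClosed_ker (κ .minus)),
    fun x => ?_⟩
  have e : ∀ p, κ p x = prim x.1.1 (largePt μ₁ p) - N.ι p (prim x.2.1 (smallPt μ₀ μ₁ p)) :=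
    fun p => rfl
  have h : x ∈ LinearMap.ker (κ .plus : PL × PS →ₗ[ℂ] V (k + j)) ⊓
    LinearMap.ker (κ .minus : PL × PS →ₗ[ℂ] V (k + j)) ↔ κ .plus x = 0 ∧ κ .minus x = 0 := Iff.rfl
  rw [h, e, e, sub_eq_zero, sub_eq_zero]
  constructor
  · rintro ⟨h1, h2⟩ p
    cases p
    · exact h1
    · exact h2
  · exact fun h => ⟨h _, h _⟩

theorem exists_projection (hμ₁ : 0 < μ₁) (hμ : μ₁ < μ₀ - μ₁) (y w : ℂ) {u₁ u₂ : ℝ → V (k + j)}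
    {v₁ v₂ : ℝ → V k} (hu₁ : IsL2 (-μ₁) μ₁ u₁) (hu₂ : IsL2 (-μ₁) μ₁ u₂)
    (hv₁ : IsL2 μ₁ (μ₀ - μ₁) v₁) (hv₂ : IsL2 μ₁ (μ₀ - μ₁) v₂) (c : Jump → ℂ) :
    ∃ xL xS, N.Glued xL xS ∧ ∀ tL tS, N.Glued tL tS →
      (∫ z in Ioo (-μ₁) μ₁, ((inner ℂ (primNabla N.TL y tL z) (u₁ z - primNabla N.TL y xL z) : ℂ) +
        inner ℂ (primMult N.TL w tL z) (u₂ z - primMult N.TL w xL z))) +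
      (∫ z in Ioo μ₁ (μ₀ - μ₁), ((inner ℂ (primNabla N.TS y tS z) (v₁ z - primNabla N.TS y xS z) : ℂ) +
        inner ℂ (primMult N.TS w tS z) (v₂ z - primMult N.TS w xS z))) +
      ((starRingEnd ℂ) (N.jumpFun .plus (prim tS (smallPt μ₀ μ₁ .plus))) *
          (c .plus - N.jumpFun .plus (prim xS (smallPt μ₀ μ₁ .plus))) +
        (starRingEnd ℂ) (N.jumpFun .minus (prim tS (smallPt μ₀ μ₁ .minus))) *
          (c .minus - N.jumpFun .minus (prim xS (smallPt μ₀ μ₁ .minus)))) = 0 := by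
  have hL := N.large_interval hμ₁ hμ
  have hS := N.small_interval hμ₁ hμ
  obtain ⟨O₁, O₂, hO₁, hO₂, NL, EL, CL, hCL, HL⟩ := hL.exists_operators y w
  obtain ⟨R₁, R₂, hR₁, hR₂, NS, ES, CS, hCS, HS⟩ := hS.exists_operators y w
  obtain ⟨F, hFc, hFmem⟩ := N.exists_glued_submodule hμ₁ hμ hL.lt.le hS.lt.le
  obtain ⟨x, hxF, hx⟩ := exists_orthogonal_of_coercive_pair hCL hCS HL HS F hFc
    (N.jumpVal hμ .plus) (N.jumpVal hμ .minus) hu₁.toLp hu₂.toLp hv₁.toLp hv₂.toLp (c .plus) (c .minus)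
  refine ⟨x.1.1, x.2.1, (hFmem x).1 hxF, fun tL tS ht => ?_⟩
  have memS : tS ∈ polarSub hS.lt.le (0 : EndV k) 0 := (mem_polarSub _).2 ⟨rfl, rfl⟩
  have key := hx (⟨tL, ht.mem hL.lt.le⟩, ⟨tS, memS⟩) ((hFmem _).2 ht)
  have kL := inner_lp_add (hO₁ ⟨tL, ht.mem hL.lt.le⟩) (hO₂ ⟨tL, ht.mem hL.lt.le⟩)
    (toLp_sub_ae hu₁ (hO₁ x.1)) (toLp_sub_ae hu₂ (hO₂ x.1))
  have kS := inner_lp_add (hR₁ ⟨tS, memS⟩) (hR₂ ⟨tS, memS⟩) (toLp_sub_ae hv₁ (hR₁ x.2))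
    (toLp_sub_ae hv₂ (hR₂ x.2))
  have iC : ∀ z z' : ℂ, (inner ℂ z z' : ℂ) = (starRingEnd ℂ) z * z' := fun z z' => by
    rw [mul_comm]; rfl
  rw [← kL, ← kS, ← iC, ← iC]
  exact key

end NahmSolution

end CaloronNahm

namespace CaloronNahm

section DuBoisReymond

variable {n : ℕ} {a b : ℝ}

theorem integral_primitive_by_parts {c d : ℝ} (hcd : c < d) (x y : PrimData n c d) (hx : x.1 = 0)
    (hx' : prim x d = 0) :
    ∫ z in Ioo c d, ((inner ℂ (x.2 z) (prim y z) : ℂ) + inner ℂ (prim x z) (y.2 z)) = 0 := by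
  have hi : IntegrableOn (fun z => (inner ℂ (x.2 z) (prim y z) : ℂ) + inner ℂ (prim x z) (y.2 z))
      (Ioo c d) :=
    ((lp_isL2 x.2).integrableOn_inner (prim_isL2 hcd.le y)).add
      ((prim_isL2 hcd.le x).integrableOn_inner (lp_isL2 y.2))
  obtain ⟨e, -, l1, l2⟩ := ((prim_hasWeakDeriv x).inner_prod (prim_hasWeakDeriv y)).exists_eq_integral
    hcd hi
  obtain ⟨x1, x2⟩ := prim_tendsto hcd x
  obtain ⟨y1, y2⟩ := prim_tendsto hcd y
  have k1 := x1.inner (𝕜 := ℂ) y1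
  have k2 := x2.inner (𝕜 := ℂ) y2
  rw [prim_left, hx, inner_zero_left] at k1
  rw [hx', inner_zero_left] at k2
  have e1 := tendsto_nhds_unique l1 k1
  have e2 := tendsto_nhds_unique l2 k2
  rw [e1, zero_add, intervalIntegral.integral_of_le hcd.le, integral_Ioc_eq_integral_Ioo] at e2
  exact e2

theorem exists_ae_eq_primitive {c d : ℝ} (hcd : c < d) {f g : ℝ → V n} (hf : IsL2 c d f)
    (hg : IsL2 c d g)
    (h : ∀ x : PrimData n c d, x.1 = 0 → prim x d = 0 →
      ∫ z in Ioo c d, ((inner ℂ (x.2 z) (f z) : ℂ) + inner ℂ (prim x z) (g z)) = 0) :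
    ∃ m, ∀ᵐ z ∂(volume.restrict (Ioo c d)), f z = m + ∫ t in c..z, g t := by
  set y : PrimData n c d := (0, hg.toLp) with hy
  have hyg : y.2 =ᵐ[volume.restrict (Ioo c d)] g := hg.coeFn_toLp
  have hφ : IsL2 c d (fun z => f z - prim y z) := hf.fsub (prim_isL2 hcd.le y)
  set m : V n := (d - c)⁻¹ • ∫ z in Ioo c d, (f z - prim y z) with hm
  have hdc : (d - c) ≠ 0 := (sub_pos.2 hcd).ne'
  have hconst : IsL2 c d (fun _ => m) := by
    have : IsFiniteMeasure (volume.restrict (Ioo c d)) := ⟨by simp⟩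
    exact memLp_const m
  have hψ : IsL2 c d (fun z => f z - prim y z - m) := hφ.fsub hconst
  set x : PrimData n c d := (0, hψ.toLp) with hx
  have hxψ : x.2 =ᵐ[volume.restrict (Ioo c d)] fun z => f z - prim y z - m := hψ.coeFn_toLp
  have hx0 : ∫ z in Ioo c d, x.2 z = 0 := by
    rw [integral_congr_ae hxψ, integral_sub hφ.integrableOn hconst.integrableOn, setIntegral_const,
      Measure.real, Real.volume_Ioo, ENNReal.toReal_ofReal (sub_pos.2 hcd).le, hm,
      smul_inv_smul₀ hdc, sub_self]
  have hxd : prim x d = 0 := by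
    have : prim x d = 0 + ∫ t in c..d, x.2 t := rfl
    rw [this, zero_add, intervalIntegral.integral_of_le hcd.le, integral_Ioc_eq_integral_Ioo, hx0]
  have h1 := h x rfl hxd
  have h2 := integral_primitive_by_parts hcd x y rfl hxd
  have lx : IsL2 c d x.2 := lp_isL2 x.2
  have i1 : Integrable (fun z => (inner ℂ (x.2 z) (f z) : ℂ) + inner ℂ (prim x z) (g z))
      (volume.restrict (Ioo c d)) :=
    (lx.integrableOn_inner hf).add ((prim_isL2 hcd.le x).integrableOn_inner hg)
  have i2 : Integrable (fun z => (inner ℂ (x.2 z) (prim y z) : ℂ) + inner ℂ (prim x z) (y.2 z))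
      (volume.restrict (Ioo c d)) :=
    (lx.integrableOn_inner (prim_isL2 hcd.le y)).add ((prim_isL2 hcd.le x).integrableOn_inner (lp_isL2 y.2))
  have i3 : Integrable (fun z => (inner ℂ (x.2 z) m : ℂ)) (volume.restrict (Ioo c d)) :=
    lx.integrableOn_inner hconst
  have h3 : ∫ z in Ioo c d, (inner ℂ (x.2 z) m : ℂ) = 0 := by
    have : ∀ z, (inner ℂ (x.2 z) m : ℂ) = (starRingEnd ℂ) (inner ℂ m (x.2 z)) := fun z =>
      (inner_conj_symm _ _).symm
    simp only [this]
    rw [integral_conj, integral_inner lx.integrableOn, hx0, inner_zero_right, map_zero]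
  have h4 : ∫ z in Ioo c d, ((‖x.2 z‖ ^ 2 : ℝ) : ℂ) = 0 := by
    have e : ∫ z in Ioo c d, ((((inner ℂ (x.2 z) (f z) : ℂ) + inner ℂ (prim x z) (g z)) -
        ((inner ℂ (x.2 z) (prim y z) : ℂ) + inner ℂ (prim x z) (y.2 z))) - inner ℂ (x.2 z) m) = 0 := by
      have i12 : Integrable (fun z => ((inner ℂ (x.2 z) (f z) : ℂ) + inner ℂ (prim x z) (g z)) -
          ((inner ℂ (x.2 z) (prim y z) : ℂ) + inner ℂ (prim x z) (y.2 z)))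
          (volume.restrict (Ioo c d)) := i1.sub i2
      rw [integral_sub i12 i3, integral_sub i1 i2, h1, h2, h3, sub_zero, sub_zero]
    rw [← e]
    refine integral_congr_ae ?_
    filter_upwards [hxψ, hyg] with z e1 e2
    have e3 : ((‖x.2 z‖ ^ 2 : ℝ) : ℂ) = inner ℂ (x.2 z) (f z - prim y z - m) := by
      rw [← e1]
      push_cast
      exact (inner_self_eq_norm_sq_to_K (𝕜 := ℂ) (x.2 z)).symm
    rw [e3, e2, inner_sub_right, inner_sub_right]
    ring
  rw [integral_complex_ofReal, Complex.ofReal_eq_zero,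
    integral_eq_zero_iff_of_nonneg (fun z => sq_nonneg _) (by simpa using lx.norm.integrable_sq)] at h4
  refine ⟨m, ?_⟩
  filter_upwards [h4, hxψ, ae_restrict_mem measurableSet_Ioo] with z e1 e2 hz
  have e4 : x.2 z = 0 := by simpa using e1
  rw [e2, sub_eq_zero, sub_eq_iff_eq_add] at e4
  rw [e4]
  congr 1
  have : prim y z = 0 + ∫ t in c..z, y.2 t := rfl
  rw [this, zero_add]
  exact intervalIntegral.integral_congr_ae
    (ae_uIoc_of_ae_Ioo hyg (left_mem_Icc.2 hcd.le) (Ioo_subset_Icc_self hz))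

theorem exists_hasWeakDeriv_of_weak (hab : a < b) {f g : ℝ → V n}
    (hf : ∀ c ∈ Ioo a b, ∀ d ∈ Ioo a b, IsL2 c d f) (hg : ∀ c ∈ Ioo a b, ∀ d ∈ Ioo a b, IsL2 c d g)
    (h : ∀ c ∈ Ioo a b, ∀ d ∈ Ioo a b, c < d → ∀ x : PrimData n c d, x.1 = 0 → prim x d = 0 →
      ∫ z in Ioo c d, ((inner ℂ (x.2 z) (f z) : ℂ) + inner ℂ (prim x z) (g z)) = 0) :
    ∃ H, HasWeakDeriv a b H g ∧ f =ᵐ[volume.restrict (Ioo a b)] H := by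
  have hgi : ∀ x ∈ Ioo a b, ∀ y ∈ Ioo a b, IntervalIntegrable g volume x y := by
    have key : ∀ x ∈ Ioo a b, ∀ y ∈ Ioo a b, x ≤ y → IntervalIntegrable g volume x y :=
      fun x hx y hy hxy => intervalIntegrable_of_integrableOn_Ioo (hg x hx y hy).integrableOn
        (left_mem_Icc.2 hxy) (right_mem_Icc.2 hxy)
    intro x hx y hy
    rcases le_total x y with hxy | hxy
    · exact key x hx y hy hxy
    · exact (key y hy x hx hxy).symm
  obtain ⟨c₀, hc₀, hc₀'⟩ := exists_between hab
  obtain ⟨d₀, hd₀, hd₀'⟩ := exists_between hc₀'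
  have mc₀ : c₀ ∈ Ioo a b := ⟨hc₀, hc₀'⟩
  have md₀ : d₀ ∈ Ioo a b := ⟨hc₀.trans hd₀, hd₀'⟩
  have key : ∀ c ∈ Ioo a b, ∀ d ∈ Ioo a b, c < d →
      ∃ m, ∀ᵐ z ∂(volume.restrict (Ioo c d)), f z = m + ∫ t in c₀..z, g t := by
    intro c hc d hd hcd
    obtain ⟨m, hm⟩ := exists_ae_eq_primitive hcd (hf c hc d hd) (hg c hc d hd) (h c hc d hd hcd)
    refine ⟨m - ∫ t in c₀..c, g t, ?_⟩
    filter_upwards [hm, ae_restrict_mem measurableSet_Ioo] with z hz hzm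
    rw [hz, ← intervalIntegral.integral_add_adjacent_intervals (hgi c₀ mc₀ c hc)
      (hgi c hc z ⟨hc.1.trans hzm.1, hzm.2.trans hd.2⟩)]
    abel
  obtain ⟨m₀, hm₀⟩ := key c₀ mc₀ d₀ md₀ hd₀
  refine ⟨fun z => m₀ + ∫ t in c₀..z, g t, HasWeakDeriv.of_integral hgi (hgi c₀ mc₀) m₀, ?_⟩
  refine ae_Ioo_of_forall_subinterval fun c hc d hd hcd => ?_
  have mc : min c c₀ ∈ Ioo a b := ⟨lt_min hc.1 hc₀, (min_le_left _ _).trans_lt hc.2⟩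
  have md : max d d₀ ∈ Ioo a b := ⟨hd.1.trans_le (le_max_left _ _), max_lt hd.2 hd₀'⟩
  obtain ⟨m, hm⟩ := key _ mc _ md ((min_le_left _ _).trans_lt (hcd.trans_le (le_max_left _ _)))
  have hsub₀ : Ioo c₀ d₀ ⊆ Ioo (min c c₀) (max d d₀) :=
    Ioo_subset_Ioo (min_le_right _ _) (le_max_right _ _)
  have hsub : Ioo c d ⊆ Ioo (min c c₀) (max d d₀) :=
    Ioo_subset_Ioo (min_le_left _ _) (le_max_left _ _)
  have hmm : m = m₀ := by
    have hne : (ae (volume.restrict (Ioo c₀ d₀))).NeBot := by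
      rw [ae_neBot, Ne, Measure.restrict_eq_zero, Real.volume_Ioo]
      simpa using hd₀
    obtain ⟨z, h1, h2⟩ := (hm₀.and (ae_restrict_of_ae_restrict_of_subset hsub₀ hm)).exists
    rw [h1] at h2
    exact (add_right_cancel h2).symm
  rw [hmm] at hm
  exact (ae_restrict_iff' measurableSet_Ioo).1 (ae_restrict_of_ae_restrict_of_subset hsub hm)

theorem exists_extension {c d : ℝ} (hc : c ∈ Ioo a b) (hd : d ∈ Ioo a b) (hcd : c < d)
    (x : PrimData n c d) (h0 : x.1 = 0) (hx : prim x d = 0) :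
    ∃ e : PrimData n a b, e.1 = 0 ∧ prim e b = 0 ∧ (e.2 =ᵐ[volume.restrict (Ioo c d)] x.2) ∧
      (∀ z ∈ Ioo c d, prim e z = prim x z) ∧ (∀ᵐ z, z ∈ Ioo a b \ Ioo c d → e.2 z = 0) ∧
      ∀ z ∈ Ioo a b \ Ioo c d, prim e z = 0 := by
  have hsub : Ioo c d ⊆ Ioo a b := Ioo_subset_Ioo hc.1.le hd.2.le
  have hab : a < b := hc.1.trans hc.2
  have hres : (volume.restrict (Ioo a b)).restrict (Ioo c d) = volume.restrict (Ioo c d) := by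
    rw [Measure.restrict_restrict measurableSet_Ioo, inter_eq_left.2 hsub]
  have hmem : IsL2 a b ((Ioo c d).indicator x.2) := by
    rw [IsL2, memLp_indicator_iff_restrict measurableSet_Ioo, hres]
    exact lp_isL2 x.2
  set e : PrimData n a b := (0, hmem.toLp) with he
  have hae : e.2 =ᵐ[volume.restrict (Ioo a b)] (Ioo c d).indicator x.2 := hmem.coeFn_toLp
  have ha : a ∈ Icc a b := left_mem_Icc.2 hab.le
  have hc' : c ∈ Icc a b := Ioo_subset_Icc_self hc
  have hd' : d ∈ Icc a b := Ioo_subset_Icc_self hd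
  have hint : ∀ y ∈ Icc a b, ∀ z ∈ Icc a b,
      ∫ t in y..z, e.2 t = ∫ t in y..z, (Ioo c d).indicator x.2 t := fun y hy z hz =>
    intervalIntegral.integral_congr_ae (ae_uIoc_of_ae_Ioo hae hy hz)
  have hout : ∀ y ∈ Icc a b, ∀ z ∈ Icc a b, y ≤ z → (z ≤ c ∨ d ≤ y) → ∫ t in y..z, e.2 t = 0 := by
    intro y hy z hz hyz ho
    rw [hint y hy z hz]
    refine intervalIntegral.integral_zero_ae (Eventually.of_forall fun t ht => ?_)
    rw [uIoc_of_le hyz] at ht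
    have htm : t ∉ Ioo c d := fun hm => by
      rcases ho with ho | ho
      · exact absurd hm.1 (not_lt.2 (ht.2.trans ho))
      · exact absurd hm.2 (not_lt.2 (ho.trans ht.1.le))
    simp only [indicator_of_notMem htm]
  have hc0 : prim e c = 0 := by
    have : prim e c = 0 + ∫ t in a..c, e.2 t := rfl
    rw [this, hout a ha c hc' hc.1.le (Or.inl le_rfl), add_zero]
  have hin : ∀ z ∈ Ioc c d, prim e z = prim x z := by
    intro z hz
    have hz' : z ∈ Icc a b := ⟨(hc.1.trans hz.1).le, hz.2.trans hd.2.le⟩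
    have h1 := prim_sub_prim e hc' hz'
    rw [hc0, sub_zero] at h1
    have h2 : prim x z = 0 + ∫ t in c..z, x.2 t := by rw [prim, h0]
    rw [h1, h2, hint c hc' z hz', zero_add]
    have h₂ : ∀ᵐ z : ℝ, z ≠ d := by simp [ae_iff, measure_singleton]
    refine intervalIntegral.integral_congr_ae ?_
    filter_upwards [h₂] with t ht htm
    rw [uIoc_of_le hz.1.le] at htm
    have htm' : t ∈ Ioo c d := ⟨htm.1, lt_of_le_of_ne (htm.2.trans hz.2) ht⟩
    simp only [indicator_of_mem htm']
  have hd0 : prim e d = 0 := by rw [hin d ⟨hcd, le_rfl⟩, hx]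
  have hend : ∀ z ∈ Icc d b, prim e z = 0 := by
    intro z hz
    have hz' : z ∈ Icc a b := ⟨hd.1.le.trans hz.1, hz.2⟩
    have h1 := prim_sub_prim e hd' hz'
    rwa [hd0, sub_zero, hout d hd' z hz' hz.1 (Or.inr le_rfl)] at h1
  refine ⟨e, rfl, hend b ⟨hd.2.le, le_rfl⟩, ?_, fun z hz => hin z ⟨hz.1, hz.2.le⟩, ?_, ?_⟩
  · filter_upwards [ae_restrict_of_ae_restrict_of_subset hsub hae, ae_restrict_mem measurableSet_Ioo]
      with z h1 h2
    rw [h1, indicator_of_mem h2]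
  · rw [EventuallyEq, ae_restrict_iff' measurableSet_Ioo] at hae
    filter_upwards [hae] with z h1 h2
    rw [h1 h2.1, indicator_of_notMem h2.2]
  · intro z hz
    rcases le_or_gt z c with h | h
    · have : prim e z = 0 + ∫ t in a..z, e.2 t := rfl
      rw [this, hout a ha z (Ioo_subset_Icc_self hz.1) hz.1.1.le (Or.inl h), add_zero]
    · exact hend z ⟨not_lt.1 fun h' => hz.2 ⟨h, h'⟩, hz.1.2.le⟩

end DuBoisReymond

end CaloronNahm

namespace CaloronNahm

section Regularity

variable {n j : ℕ} {a b : ℝ} {T : Fin 4 → ℝ → EndV n} {Qa Qb : EndV n}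

theorem inner_nabla_add_inner_mult (A B : EndV n) (y w : ℂ) (s' s f₁ f₂ : V n) :
    (inner ℂ (Complex.I • (s' + A s - (Complex.I * y) • s)) f₁ : ℂ) +
        inner ℂ (-(B s - (Complex.I * w) • s)) f₂ =
      -Complex.I * (inner ℂ s' f₁ + inner ℂ s (star A f₁ + (Complex.I * (starRingEnd ℂ) y) • f₁ -
        Complex.I • (star B f₂ + (Complex.I * (starRingEnd ℂ) w) • f₂))) := by
  simp only [inner_smul_left, inner_add_left, inner_sub_left, inner_neg_left, inner_add_right,
    inner_sub_right, inner_smul_right, inner_star_right, map_mul, Complex.conj_I]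
  linear_combination (-(inner ℂ (B s) f₂ : ℂ) - (starRingEnd ℂ) w * inner ℂ s f₂ * Complex.I) *
    Complex.I_mul_I

theorem IsL2.apply_continuousOn {X : ℝ → EndV n} {u : ℝ → V n} (hu : IsL2 a b u)
    (hX : ContinuousOn X (Ioo a b)) {c d : ℝ} (hc : c ∈ Ioo a b) (hd : d ∈ Ioo a b) :
    IsL2 c d (fun z => X z (u z)) := by
  have hsub : Icc c d ⊆ Ioo a b := fun z hz => ⟨hc.1.trans_le hz.1, hz.2.trans_lt hd.2⟩
  obtain ⟨C, hC⟩ := isCompact_Icc.exists_bound_of_continuousOn (hX.mono hsub)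
  exact (hu.mono (Ioo_subset_Icc_self.trans hsub)).apply_bounded
    (hX.mono (Ioo_subset_Icc_self.trans hsub))
    fun z hz => hC z (Ioo_subset_Icc_self hz)

theorem _root_.ContinuousOn.star_endV {X : ℝ → EndV n} {S : Set ℝ} (hX : ContinuousOn X S) :
    ContinuousOn (fun z => star (X z)) S :=
  ContinuousLinearMap.adjoint.continuous.comp_continuousOn hX

namespace NahmInterval

theorem isL2_primNabla (h : NahmInterval j a b T Qa Qb) (y : ℂ) {x : PrimData n a b}
    (hx : x ∈ polarSub h.lt.le Qa Qb) : IsL2 a b (primNabla T y x) := by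
  obtain ⟨O₁, -, e₁, -⟩ := h.exists_operators y 0
  exact (memLp_congr_ae (e₁ ⟨x, hx⟩)).1 (lp_isL2 _)

theorem isL2_primMult (h : NahmInterval j a b T Qa Qb) (w : ℂ) {x : PrimData n a b}
    (hx : x ∈ polarSub h.lt.le Qa Qb) : IsL2 a b (primMult T w x) := by
  obtain ⟨-, O₂, -, e₂, -⟩ := h.exists_operators 0 w
  exact (memLp_congr_ae (e₂ ⟨x, hx⟩)).1 (lp_isL2 _)

theorem exists_regular_of_weak (h : NahmInterval j a b T Qa Qb) (y w : ℂ) {f₁ f₂ : ℝ → V n}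
    (l₁ : IsL2 a b f₁) (l₂ : IsL2 a b f₂)
    (H : ∀ e : PrimData n a b, prim e a = 0 → prim e b = 0 →
      ∫ z in Ioo a b, ((inner ℂ (primNabla T y e z) (f₁ z) : ℂ) + inner ℂ (primMult T w e z) (f₂ z))
        = 0) :
    ∃ H₁ H₁', HasWeakDeriv a b H₁ H₁' ∧ f₁ =ᵐ[volume.restrict (Ioo a b)] H₁ ∧
      ∀ᵐ z ∂(volume.restrict (Ioo a b)), H₁' z = star (nahmAlpha T z) (H₁ z) +
        (Complex.I * (starRingEnd ℂ) y) • H₁ z -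
          Complex.I • (star (nahmBeta T z) (f₂ z) + (Complex.I * (starRingEnd ℂ) w) • f₂ z) := by
  set g : ℝ → V n := fun z => star (nahmAlpha T z) (f₁ z) + (Complex.I * (starRingEnd ℂ) y) • f₁ z -
    Complex.I • (star (nahmBeta T z) (f₂ z) + (Complex.I * (starRingEnd ℂ) w) • f₂ z) with hg
  have lg : ∀ c ∈ Ioo a b, ∀ d ∈ Ioo a b, IsL2 c d g := by
    intro c hc d hd
    have hsub : Ioo c d ⊆ Ioo a b := Ioo_subset_Ioo hc.1.le hd.2.le
    exact ((l₁.apply_continuousOn h.continuousOn_alpha.star_endV hc hd).fadd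
      ((l₁.mono hsub).csmul _)).fsub (((l₂.apply_continuousOn
        h.continuousOn_beta.star_endV hc hd).fadd
          ((l₂.mono hsub).csmul _)).csmul _)
  obtain ⟨H₁, w₁, q₁⟩ := exists_hasWeakDeriv_of_weak h.lt
    (fun c hc d hd => l₁.mono (Ioo_subset_Ioo hc.1.le hd.2.le)) lg
    (fun c hc d hd hcd x h0 hx => by
      obtain ⟨e, e0, eb, e1, e2, e3, e4⟩ := exists_extension hc hd hcd x h0 hx
      have hsub : Ioo c d ⊆ Ioo a b := Ioo_subset_Ioo hc.1.le hd.2.le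
      have he := H e (by rw [prim_left, e0]) eb
      have key : ∫ z in Ioo c d, ((inner ℂ (x.2 z) (f₁ z) : ℂ) + inner ℂ (prim x z) (g z)) =
          ∫ z in Ioo a b, (Ioo c d).indicator
            (fun z => (inner ℂ (x.2 z) (f₁ z) : ℂ) + inner ℂ (prim x z) (g z)) z := by
        rw [setIntegral_indicator measurableSet_Ioo, inter_eq_right.2 hsub]
      rw [key]
      have hI : (-Complex.I) ≠ 0 := neg_ne_zero.2 Complex.I_ne_zero
      refine (mul_eq_zero.1 ?_).resolve_left hI
      rw [← integral_const_mul, ← he]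
      refine integral_congr_ae ?_
      rw [EventuallyEq, ae_restrict_iff' measurableSet_Ioo] at e1
      filter_upwards [ae_restrict_of_ae e1, ae_restrict_of_ae e3, ae_restrict_mem measurableSet_Ioo]
        with z k1 k3 hz
      by_cases hm : z ∈ Ioo c d
      · rw [indicator_of_mem hm, primNabla, primMult, inner_nabla_add_inner_mult, k1 hm, e2 z hm]
      · rw [indicator_of_notMem hm, primNabla, primMult, k3 ⟨hz, hm⟩, e4 z ⟨hz, hm⟩]
        simp)
  refine ⟨H₁, g, w₁, q₁, ?_⟩
  filter_upwards [q₁] with z hz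
  rw [hg, ← hz]

end NahmInterval

end Regularity

end CaloronNahm

namespace CaloronNahm

section Dirac

variable {n j : ℕ} {a b : ℝ} {T : Fin 4 → ℝ → EndV n} {Qa Qb : EndV n} {y w : ℂ}
  {s h₁ h₂ : ℝ → V n}

theorem dz_eq_of_hasDerivAt {u : ℝ → V n} {v : V n} {z : ℝ} (hz : z ∈ Ioo a b)
    (h : HasDerivAt u v z) : dz a b u z = v := by
  rw [dz, indicator_of_mem hz, h.deriv]

theorem hasDerivAt_dz {u : ℝ → V n} {z : ℝ} (hz : z ∈ Ioo a b) (h : DifferentiableAt ℝ u z) :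
    HasDerivAt u (dz a b u z) z := by
  rw [dz, indicator_of_mem hz]
  exact h.hasDerivAt

theorem hasDerivAt_mult (hT : IsNahm T (Ioo a b)) {z : ℝ} (hz : z ∈ Ioo a b) {s' : V n}
    (hs : HasDerivAt s s' z) :
    HasDerivAt (mult T w s) ((nahmBeta T z * nahmAlpha T z - nahmAlpha T z * nahmBeta T z) (s z) +
      nahmBeta T z s' - (Complex.I * w) • s') z := by
  have h1 := (hT.hasDerivAt_beta hz)
  have h2 : HasDerivAt (fun t => nahmBeta T t (s t))
      ((nahmBeta T z * nahmAlpha T z - nahmAlpha T z * nahmBeta T z) (s z) + nahmBeta T z s') z := by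
    have h3 := ((isBoundedBilinearMap_endV_apply n).hasFDerivAt (nahmBeta T z, s z)).comp_hasDerivAt z (h1.prodMk hs)
    refine h3.congr_deriv ?_
    exact add_comm _ _
  exact h2.sub (hs.const_smul (Complex.I * w))

theorem nabla_mult (hT : IsNahm T (Ioo a b)) {z : ℝ} (hz : z ∈ Ioo a b)
    (hs : DifferentiableAt ℝ s z) :
    nabla a b T y (mult T w s) z = mult T w (nabla a b T y s) z := by
  have h1 := dz_eq_of_hasDerivAt hz (hasDerivAt_mult (w := w) hT hz (hasDerivAt_dz hz hs))
  have e1 : nabla a b T y (mult T w s) z = Complex.I • (dz a b (mult T w s) z +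
    nahmAlpha T z (nahmBeta T z (s z) - (Complex.I * w) • s z) -
      (Complex.I * y) • (nahmBeta T z (s z) - (Complex.I * w) • s z)) := rfl
  have e2 : mult T w (nabla a b T y s) z =
    nahmBeta T z (Complex.I • (dz a b s z + nahmAlpha T z (s z) - (Complex.I * y) • s z)) -
      (Complex.I * w) • Complex.I • (dz a b s z + nahmAlpha T z (s z) - (Complex.I * y) • s z) := rfl
  have e3 : (nahmBeta T z * nahmAlpha T z - nahmAlpha T z * nahmBeta T z) (s z) =
    nahmBeta T z (nahmAlpha T z (s z)) - nahmAlpha T z (nahmBeta T z (s z)) := rfl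
  rw [e1, e2, h1, e3]
  simp only [map_smul, map_add, map_sub]
  module

/-- Square integrable solutions of the Dirac equation on one interval. -/
structure IsDirac (a b : ℝ) (T : Fin 4 → ℝ → EndV n) (y w : ℂ) (h₁ h₂ : ℝ → V n) : Prop where
  ac₁ : LocAC a b h₁
  ac₂ : LocAC a b h₂
  l2₁ : IsL2 a b h₁
  l2₂ : IsL2 a b h₂
  d2 : mult T w h₁ + nabla a b T y h₂ =ᵐ[volume.restrict (Ioo a b)] 0
  d1adj : nablaAdj a b T y h₁ - multAdj T w h₂ =ᵐ[volume.restrict (Ioo a b)] 0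

namespace IsDirac

theorem eq_left (h : IsDirac a b T y w h₁ h₂) : ∀ᵐ z ∂(volume.restrict (Ioo a b)), dz a b h₁ z =
    star (nahmAlpha T z) (h₁ z) + (Complex.I * (starRingEnd ℂ) y) • h₁ z -
      Complex.I • (star (nahmBeta T z) (h₂ z) + (Complex.I * (starRingEnd ℂ) w) • h₂ z) := by
  filter_upwards [h.d1adj] with z hz
  have hz' : Complex.I • (dz a b h₁ z - star (nahmAlpha T z) (h₁ z) -
      (Complex.I * (starRingEnd ℂ) y) • h₁ z) -
        (star (nahmBeta T z) (h₂ z) + (Complex.I * (starRingEnd ℂ) w) • h₂ z) = 0 := hz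
  linear_combination (norm := skip) (-Complex.I) • hz'
  match_scalars <;> (ring_nf; try simp only [Complex.I_sq, Complex.I_pow_three]; try ring)

theorem eq_right (h : IsDirac a b T y w h₁ h₂) : ∀ᵐ z ∂(volume.restrict (Ioo a b)), dz a b h₂ z =
    -nahmAlpha T z (h₂ z) + Complex.I • nahmBeta T z (h₁ z) + ((Complex.I * y) • h₂ z + w • h₁ z) := by
  filter_upwards [h.d2] with z hz
  have hz' : nahmBeta T z (h₁ z) - (Complex.I * w) • h₁ z + Complex.I • (dz a b h₂ z +
      nahmAlpha T z (h₂ z) - (Complex.I * y) • h₂ z) = 0 := hz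
  linear_combination (norm := skip) (-Complex.I) • hz'
  match_scalars <;> (ring_nf; try simp only [Complex.I_sq, Complex.I_pow_three]; try ring)

theorem eq_left' (h : IsDirac a b T y w h₁ h₂) : ∀ᵐ z ∂(volume.restrict (Ioo a b)), dz a b h₁ z =
    star (nahmAlpha T z) (h₁ z) - Complex.I • star (nahmBeta T z) (h₂ z) +
      ((Complex.I * (starRingEnd ℂ) y) • h₁ z + (starRingEnd ℂ) w • h₂ z) := by
  filter_upwards [h.eq_left] with z hz
  rw [hz]
  match_scalars <;> (ring_nf; try simp only [Complex.I_sq]; try ring)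

theorem isL2_dz (h : IsDirac a b T y w h₁ h₂) (hT : NahmInterval j a b T Qa Qb) (hj : j ≠ 2) :
    IsL2 a b (dz a b h₁) ∧ IsL2 a b (dz a b h₂) :=
  hT.isL2_deriv hj h.ac₁.hasWeakDeriv h.ac₂.hasWeakDeriv h.l2₁ h.l2₂
    ((h.l2₁.csmul _).fadd (h.l2₂.csmul _)) ((h.l2₂.csmul _).fadd (h.l2₁.csmul _)) h.eq_left' h.eq_right

theorem exists_limits_left (h : IsDirac a b T y w h₁ h₂) (hT : NahmInterval j a b T Qa Qb) :
    (∃ e, Tendsto (fun z => (1 - Qa) (h₁ z)) (𝓝[>] a) (𝓝 e)) ∧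
      ∃ e, Tendsto (fun z => (1 - Qa) (h₂ z)) (𝓝[>] a) (𝓝 e) := by
  have k := hT.left.exists_limits (Or.inl rfl) (fun t => affine_left_mem) h.ac₁.hasWeakDeriv
    h.ac₂.hasWeakDeriv h.l2₁ h.l2₂ ((h.l2₁.csmul _).fadd (h.l2₂.csmul _))
    ((h.l2₂.csmul _).fadd (h.l2₁.csmul _)) h.eq_left' h.eq_right
  rw [← map_affine_one]
  simpa only [tendsto_map'_iff, Function.comp_def] using k

theorem exists_limits_right (h : IsDirac a b T y w h₁ h₂) (hT : NahmInterval j a b T Qa Qb) :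
    (∃ e, Tendsto (fun z => (1 - Qb) (h₁ z)) (𝓝[<] b) (𝓝 e)) ∧
      ∃ e, Tendsto (fun z => (1 - Qb) (h₂ z)) (𝓝[<] b) (𝓝 e) := by
  have k := hT.right.exists_limits (Or.inr rfl) (fun t => affine_right_mem) h.ac₁.hasWeakDeriv
    h.ac₂.hasWeakDeriv h.l2₁ h.l2₂ ((h.l2₁.csmul _).fadd (h.l2₂.csmul _))
    ((h.l2₂.csmul _).fadd (h.l2₁.csmul _)) h.eq_left' h.eq_right
  rw [← map_affine_neg_one]
  simpa only [tendsto_map'_iff, Function.comp_def] using k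

end IsDirac

theorem HasWeakDeriv.hasDerivAt_of_continuousOn {f f' : ℝ → V n} (h : HasWeakDeriv a b f f')
    (hc : ContinuousOn f' (Ioo a b)) {z : ℝ} (hz : z ∈ Ioo a b) : HasDerivAt f (f' z) z := by
  have h1 : HasDerivAt (fun t => f z + ∫ r in z..t, f' r) (f' z) z :=
    (intervalIntegral.integral_hasDerivAt_right (h z hz z hz).1
      (hc.stronglyMeasurableAtFilter isOpen_Ioo z hz) (hc.continuousAt (isOpen_Ioo.mem_nhds hz))).const_add _
  refine h1.congr_of_eventuallyEq ?_
  filter_upwards [isOpen_Ioo.mem_nhds hz] with t ht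
  rw [← (h z hz t ht).2]
  abel

/-- A decomposition of a pair into a solution of the Dirac equation and the image of a section. -/
structure DiracSplit (a b : ℝ) (T : Fin 4 → ℝ → EndV n) (y w : ℂ) (u₁ u₂ s h₁ h₂ : ℝ → V n) :
    Prop where
  supp : ∀ z ∉ Ioo a b, s z = 0
  supp₁ : ∀ z ∉ Ioo a b, h₁ z = 0
  supp₂ : ∀ z ∉ Ioo a b, h₂ z = 0
  diff : ∀ z ∈ Ioo a b, DifferentiableAt ℝ s z
  ac : LocAC a b (dz a b s)
  l2 : IsL2 a b s
  dirac : IsDirac a b T y w h₁ h₂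
  eq_left : u₁ = h₁ + nabla a b T y s
  eq_right : u₂ = h₂ + -mult T w s

theorem NahmInterval.exists_hasWeakDeriv_alpha (h : NahmInterval j a b T Qa Qb) :
    ∃ α', HasWeakDeriv a b (nahmAlpha T) α' := by
  obtain ⟨-, D, cD, hD, -, -⟩ := exists_deriv_zero h.lt h.smooth
  have c0 := h.continuousOn_zero
  have c1 := h.nahm.continuousOn (i := 1) (by decide)
  have c2 := h.nahm.continuousOn (i := 2) (by decide)
  have c3 := h.nahm.continuousOn (i := 3) (by decide)
  exact ⟨_, HasWeakDeriv.of_hasDerivAt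
    (fun z hz => (hD z hz).sub ((h.nahm.hasDerivAt hz).2.2.const_smul Complex.I))
    ((cD.mono Ioo_subset_Icc_self).sub ((((c1.mul c2).sub (c2.mul c1)).sub
      ((c0.mul c3).sub (c3.mul c0))).const_smul Complex.I))⟩

theorem NahmInterval.hasWeakDeriv_beta (h : NahmInterval j a b T Qa Qb) :
    HasWeakDeriv a b (nahmBeta T)
      (fun z => nahmBeta T z * nahmAlpha T z - nahmAlpha T z * nahmBeta T z) :=
  HasWeakDeriv.of_hasDerivAt (fun _ hz => h.nahm.hasDerivAt_beta hz)
    ((h.continuousOn_beta.mul h.continuousOn_alpha).sub (h.continuousOn_alpha.mul h.continuousOn_beta))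

theorem nabla_eq_zero_of_notMem {z : ℝ} (hz : z ∉ Ioo a b) (hs : s z = 0) :
    nabla a b T y s z = 0 := by
  simp [nabla, dz, hz, hs]

theorem mult_eq_zero_of_eq_zero {z : ℝ} (hs : s z = 0) : mult T w s z = 0 := by
  simp [mult, hs]

theorem NahmInterval.exists_split (h : NahmInterval j a b T Qa Qb) {x : PrimData n a b}
    (hx : x ∈ polarSub h.lt.le Qa Qb) {u₁ u₂ : ℝ → V n} (c₁ : LocAC a b u₁) (c₂ : LocAC a b u₂)
    (l₁ : IsL2 a b u₁) (l₂ : IsL2 a b u₂) (supp₁ : ∀ z ∉ Ioo a b, u₁ z = 0)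
    (supp₂ : ∀ z ∉ Ioo a b, u₂ z = 0)
    (hd : mult T w u₁ + nabla a b T y u₂ =ᵐ[volume.restrict (Ioo a b)] 0)
    (H : ∀ e : PrimData n a b, prim e a = 0 → prim e b = 0 →
      ∫ z in Ioo a b, ((inner ℂ (primNabla T y e z) (u₁ z - primNabla T y x z) : ℂ) +
        inner ℂ (primMult T w e z) (u₂ z - primMult T w x z)) = 0) :
    ∃ s h₁ h₂, EqOn s (prim x) (Ioo a b) ∧ DiracSplit a b T y w u₁ u₂ s h₁ h₂ := by
  obtain ⟨H₁, H₁', w₁, q₁, q₁'⟩ := h.exists_regular_of_weak y w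
    (l₁.fsub (h.isL2_primNabla y hx)) (l₂.fsub (h.isL2_primMult w hx)) H
  obtain ⟨α', wα⟩ := h.exists_hasWeakDeriv_alpha
  set r : ℝ → V n := fun z => (-Complex.I) • (u₁ z - H₁ z) - nahmAlpha T z (prim x z) +
    (Complex.I * y) • prim x z with hr
  have wx := prim_hasWeakDeriv x
  have wr : HasWeakDeriv a b r _ :=
    (((c₁.hasWeakDeriv.sub w₁).csmul (-Complex.I)).sub (wα.apply wx)).add (wx.csmul (Complex.I * y))
  have wxr : HasWeakDeriv a b (prim x) r := wx.congr_deriv (by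
    filter_upwards [q₁] with z hz
    have hz' : u₁ z - Complex.I • (x.2 z + nahmAlpha T z (prim x z) - (Complex.I * y) • prim x z) = H₁ z :=
      hz
    rw [hr]
    simp only [← hz']
    match_scalars <;> (ring_nf; try simp only [Complex.I_sq, Complex.I_pow_three]; try ring))
  set s : ℝ → V n := (Ioo a b).indicator (prim x) with hs
  have es : EqOn s (prim x) (Ioo a b) := fun z hz => indicator_of_mem hz _
  have ds : ∀ z ∈ Ioo a b, HasDerivAt s (r z) z := fun z hz =>
    (wxr.hasDerivAt_of_continuousOn wr.continuousOn hz).congr_of_eventuallyEq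
      (es.eventuallyEq_of_mem (isOpen_Ioo.mem_nhds hz))
  have edz : EqOn (dz a b s) r (Ioo a b) := fun z hz => dz_eq_of_hasDerivAt hz (ds z hz)
  have s0 : ∀ z ∉ Ioo a b, s z = 0 := fun z hz => indicator_of_notMem hz _
  have ws : HasWeakDeriv a b s (dz a b s) := (wxr.congr es).congr_deriv
    ((ae_restrict_mem measurableSet_Ioo).mono fun z hz => (edz hz).symm)
  have e1 : u₁ = (Ioo a b).indicator H₁ + nabla a b T y s := by
    funext z
    by_cases hz : z ∈ Ioo a b
    · have : nabla a b T y s z = Complex.I • (r z + nahmAlpha T z (prim x z) -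
        (Complex.I * y) • prim x z) := by rw [← es hz, ← edz hz]; rfl
      rw [Pi.add_apply, indicator_of_mem hz, this, hr]
      match_scalars <;> (ring_nf; try simp only [Complex.I_sq]; try ring)
    · rw [Pi.add_apply, indicator_of_notMem hz, nabla_eq_zero_of_notMem hz (s0 z hz), add_zero,
        supp₁ z hz]
  have e2 : u₂ = (u₂ + mult T w s) + -mult T w s := (add_neg_cancel_right u₂ (mult T w s)).symm
  have eH : EqOn ((Ioo a b).indicator H₁) H₁ (Ioo a b) := fun z hz => indicator_of_mem hz _
  have wm : HasWeakDeriv a b (mult T w s) _ := (h.hasWeakDeriv_beta.apply ws).sub (ws.csmul (Complex.I * w))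
  have acm : LocAC a b (mult T w s) := wm.locAC
  have ls : IsL2 a b s := (prim_isL2 h.lt.le x).congr
    ((ae_restrict_mem measurableSet_Ioo).mono fun z hz => es hz)
  have em : ∀ z ∈ Ioo a b, mult T w s z = -primMult T w x z := fun z hz => by
    rw [primMult, neg_neg, ← es hz]
    rfl
  refine ⟨s, (Ioo a b).indicator H₁, u₂ + mult T w s, es, s0, fun z hz => indicator_of_notMem hz _,
    fun z hz => by rw [Pi.add_apply, supp₂ z hz, mult_eq_zero_of_eq_zero (s0 z hz), add_zero],
    fun z hz => (ds z hz).differentiableAt, (wr.congr edz).locAC, ls,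
    ⟨(w₁.congr eH).locAC, c₂.add acm, ?_, ?_, ?_, ?_⟩, e1, e2⟩
  · refine (l₁.fsub (h.isL2_primNabla y hx)).congr ?_
    filter_upwards [q₁, ae_restrict_mem measurableSet_Ioo] with z k1 hz
    rw [eH hz, k1]
  · refine (l₂.fsub (h.isL2_primMult w hx)).congr ?_
    filter_upwards [ae_restrict_mem measurableSet_Ioo] with z hz
    rw [Pi.add_apply, em z hz, sub_eq_add_neg]
  · filter_upwards [hd, dz_add_ae c₂ acm, ae_restrict_mem measurableSet_Ioo] with z k1 k2 hz
    have k3 := nabla_mult (y := y) (w := w) h.nahm hz (ds z hz).differentiableAt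
    have k4 : mult T w u₁ z = mult T w ((Ioo a b).indicator H₁) z + mult T w (nabla a b T y s) z := by
      conv_lhs => rw [e1]
      rw [mult_add]
      rfl
    have k1' : mult T w u₁ z + nabla a b T y u₂ z = 0 := k1
    change mult T w ((Ioo a b).indicator H₁) z + nabla a b T y (u₂ + mult T w s) z = 0
    rw [nabla_add_apply k2, k3, ← k1', k4]
    abel
  · filter_upwards [q₁', (w₁.congr eH).dz_ae, ae_restrict_mem measurableSet_Ioo] with z k1 k2 hz
    have k3 : u₂ z - primMult T w x z = u₂ z + mult T w s z := by rw [em z hz, sub_eq_add_neg]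
    rw [k3, ← k2, ← eH hz] at k1
    change Complex.I • (dz a b ((Ioo a b).indicator H₁) z -
      star (nahmAlpha T z) ((Ioo a b).indicator H₁ z) -
        (Complex.I * (starRingEnd ℂ) y) • (Ioo a b).indicator H₁ z) -
          (star (nahmBeta T z) (u₂ z + mult T w s z) +
            (Complex.I * (starRingEnd ℂ) w) • (u₂ z + mult T w s z)) = 0
    rw [k1]
    match_scalars <;> (ring_nf; try simp only [Complex.I_sq, Complex.I_pow_three]; try ring)

end Dirac

end CaloronNahm

namespace CaloronNahm

theorem nabla_neg {n : ℕ} {a b : ℝ} (T : Fin 4 → ℝ → EndV n) (y : ℂ) (u : ℝ → V n) :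
    nabla a b T y (-u) = -nabla a b T y u := by
  have h := nabla_smul (a := a) (b := b) T y (-1) u
  simpa only [neg_smul, one_smul] using h

theorem mult_nabla_add_nabla_mult {n : ℕ} {a b : ℝ} {T : Fin 4 → ℝ → EndV n} {y w : ℂ}
    {s : ℝ → V n} (hT : IsNahm T (Ioo a b)) (hs : ∀ z ∈ Ioo a b, DifferentiableAt ℝ s z) :
    mult T w (nabla a b T y s) + nabla a b T y (-mult T w s) =ᵐ[volume.restrict (Ioo a b)] 0 := by
  filter_upwards [ae_restrict_mem measurableSet_Ioo] with z hz
  rw [nabla_neg, Pi.add_apply, Pi.neg_apply, nabla_mult hT hz (hs z hz), add_neg_cancel]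
  rfl

theorem toLp_eq_zero_iff {n : ℕ} {a b : ℝ} {u : ℝ → V n} (hu : IsL2 a b u) :
    MemLp.toLp u hu = 0 ↔ u =ᵐ[volume.restrict (Ioo a b)] 0 := by
  rw [Lp.eq_zero_iff_ae_eq_zero]
  exact ⟨fun h => (MemLp.coeFn_toLp hu).symm.trans h, fun h => (MemLp.coeFn_toLp hu).trans h⟩

namespace NahmSolution

variable {k j : ℕ} {μ₀ μ₁ : ℝ} {N : NahmSolution k j μ₀ μ₁} {x : Fin 4 → ℝ}

theorem D2val_D1val {s : Sec k j} (hs : SecDiff μ₀ μ₁ s) :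
    SecAEEq μ₀ μ₁ (N.D2val x (N.D1val x s)) 0 :=
  ⟨mult_nabla_add_nabla_mult N.nahmL hs.1, mult_nabla_add_nabla_mult N.nahmS hs.2⟩

theorem toL2_eq_zero_iff {s : Sec k j} (hs : SecL2 μ₀ μ₁ s) :
    toL2 s hs = 0 ↔ SecAEEq μ₀ μ₁ s 0 := by
  rw [toL2, Prod.mk_eq_zero]
  exact and_congr (toLp_eq_zero_iff hs.1) (toLp_eq_zero_iff hs.2)

theorem D2_comp_D1 : (N.D2 x) ∘ₗ (N.D1 x) = 0 := by
  ext1 s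
  exact (toL2_eq_zero_iff (N.D1 x s).2.dom).2 (D2val_D1val s.2.diff)

theorem mem_cocycles {u : Sec k j × Sec k j} :
    u ∈ N.cocycles x ↔ N.MemE1 x u ∧ SecAEEq μ₀ μ₁ (N.D2val x u) 0 := by
  constructor
  · rintro ⟨v, hv, rfl⟩
    exact ⟨v.2, (toL2_eq_zero_iff v.2.dom).1 (LinearMap.mem_ker.1 hv)⟩
  · rintro ⟨h1, h2⟩
    exact ⟨⟨u, h1⟩, LinearMap.mem_ker.2 ((toL2_eq_zero_iff h1.dom).2 h2), rfl⟩

theorem mem_coboundaries {u : Sec k j × Sec k j} :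
    u ∈ N.coboundaries x ↔ ∃ s, N.MemE0 x s ∧ N.D1val x s = u := by
  constructor
  · rintro ⟨_, ⟨s, rfl⟩, rfl⟩
    exact ⟨s.1, s.2, rfl⟩
  · rintro ⟨s, hs, rfl⟩
    exact ⟨_, ⟨⟨s, hs⟩, rfl⟩, rfl⟩

namespace MemHarmonic

variable {u : Sec k j × Sec k j}

theorem large (h : N.MemHarmonic x u) : IsDirac (-μ₁) μ₁ N.TL (N.yy x) (N.ww x) u.1.1 u.2.1 :=
  ⟨h.ac₁.1, h.ac₂.1, h.l2₁.1, h.l2₂.1, h.d2.1, h.d1adj.1⟩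

theorem small (h : N.MemHarmonic x u) :
    IsDirac μ₁ (μ₀ - μ₁) N.TS (N.yy x) (N.ww x) u.1.2 u.2.2 :=
  ⟨h.ac₁.2, h.ac₂.2, h.l2₁.2, h.l2₂.2, h.d2.2, h.d1adj.2⟩

theorem memE1 (h : N.MemHarmonic x u) (hμ₁ : 0 < μ₁) (hμ : μ₁ < μ₀ - μ₁) : N.MemE1 x u where
  supp₁ := h.supp₁
  supp₂ := h.supp₂
  ac₁ := h.ac₁
  ac₂ := h.ac₂
  l2₁ := h.l2₁
  l2₂ := h.l2₂
  sobolev hj :=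
    ⟨⟨(h.large.isL2_dz (N.large_interval hμ₁ hμ) hj).1, (h.small.isL2_dz (N.small_interval hμ₁ hμ) hj).1⟩,
      ⟨(h.large.isL2_dz (N.large_interval hμ₁ hμ) hj).2, (h.small.isL2_dz (N.small_interval hμ₁ hμ) hj).2⟩⟩
  graph _ := SecL2.zero.congr h.d1adj
  dom := SecL2.zero.congr h.d2
  jump := h.jump

theorem mem_cocycles (h : N.MemHarmonic x u) (hμ₁ : 0 < μ₁) (hμ : μ₁ < μ₀ - μ₁) : u ∈ N.cocycles x :=
  NahmSolution.mem_cocycles.2 ⟨h.memE1 hμ₁ hμ, h.d2⟩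

end MemHarmonic

/-- The boundary values of a section in `L̃²₂` and the jump of `D₁ s`. -/
theorem jump_D1val {p : Jump} {aL bL aS bS : EndV k} (J : N.JumpLimits p aL bL aS bS)
    {s : Sec k j} {ℓ a b : V k} (h1 : Tendsto s.1 (largeNhds μ₁ p) (𝓝 (N.ι p ℓ)))
    (h2 : Tendsto s.2 (smallNhds μ₀ μ₁ p) (𝓝 ℓ))
    (h3 : Tendsto (fun z => proj (N.ι p) ((secDz μ₀ μ₁ s).1 z)) (largeNhds μ₁ p) (𝓝 a))
    (h4 : Tendsto (secDz μ₀ μ₁ s).2 (smallNhds μ₀ μ₁ p) (𝓝 b))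
    (h5 : jumpSign p • (b - a) = N.jumpOp p ℓ) :
    ∃ A B : V k × V k,
      Tendsto (fun z => proj (N.ι p) ((N.D1val x s).1.1 z)) (largeNhds μ₁ p) (𝓝 A.1) ∧
      Tendsto (fun z => proj (N.ι p) ((N.D1val x s).2.1 z)) (largeNhds μ₁ p) (𝓝 A.2) ∧
      Tendsto (N.D1val x s).1.2 (smallNhds μ₀ μ₁ p) (𝓝 B.1) ∧
      Tendsto (N.D1val x s).2.2 (smallNhds μ₀ μ₁ p) (𝓝 B.2) ∧
      jumpSign p • (B - A) = N.jumpFun p ℓ • N.jumpVec p := by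
  have hℓ : Tendsto (fun z => proj (N.ι p) (s.1 z)) (largeNhds μ₁ p) (𝓝 ℓ) := by
    have := ((proj (N.ι p)).continuous.tendsto _).comp h1
    rwa [proj_apply_map] at this
  refine ⟨(Complex.I • (a + aL ℓ - (Complex.I * N.yy x) • ℓ), -(bL ℓ - (Complex.I * N.ww x) • ℓ)),
    (Complex.I • (b + aS ℓ - (Complex.I * N.yy x) • ℓ), -(bS ℓ - (Complex.I * N.ww x) • ℓ)),
    ?_, ?_, ?_, ?_, ?_⟩
  · refine (((h3.add (J.large_left s.1 ℓ h1)).sub (hℓ.const_smul (Complex.I * N.yy x))).const_smul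
      Complex.I).congr fun z => ?_
    change _ = proj (N.ι p) (Complex.I • ((secDz μ₀ μ₁ s).1 z + nahmAlpha N.TL z (s.1 z) -
      (Complex.I * N.yy x) • s.1 z))
    simp only [map_smul, map_add, map_sub]
  · refine (((J.large_right s.1 ℓ h1)).sub (hℓ.const_smul (Complex.I * N.ww x))).neg.congr fun z => ?_
    change _ = proj (N.ι p) (-(nahmBeta N.TL z (s.1 z) - (Complex.I * N.ww x) • s.1 z))
    simp only [map_smul, map_neg, map_sub]
  · exact ((h4.add (J.small_left s.2 ℓ h2)).sub (h2.const_smul (Complex.I * N.yy x))).const_smul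
      Complex.I
  · exact ((J.small_right s.2 ℓ h2).sub (h2.const_smul (Complex.I * N.ww x))).neg
  · by_cases hj : j = 0
    · obtain ⟨r1, r2⟩ := J.rankOne hj ℓ
      rw [jumpOp, if_pos hj] at h5
      rw [jumpFun, jumpVec, if_pos hj, if_pos hj, innerSL_apply_apply]
      refine Prod.ext ?_ ?_
      · simp only [Prod.smul_fst, Prod.fst_sub]
        linear_combination (norm := module) Complex.I • h5 + Complex.I • r2
      · simp only [Prod.smul_snd, Prod.snd_sub]
        linear_combination (norm := module) -r1
    · obtain ⟨rfl, rfl⟩ := J.polar (Nat.pos_of_ne_zero hj)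
      rw [jumpOp, if_neg hj] at h5
      rw [jumpFun, jumpVec, if_neg hj, if_neg hj, smul_zero]
      refine Prod.ext ?_ ?_
      · simp only [Prod.smul_fst, Prod.fst_sub, Prod.fst_zero]
        linear_combination (norm := module) Complex.I • h5
      · simp only [Prod.smul_snd, Prod.snd_sub, Prod.snd_zero]
        module

end NahmSolution

end CaloronNahm

namespace CaloronNahm

theorem exists_primData {n : ℕ} {a b : ℝ} (hab : a < b) (va vb : V n) :
    ∃ t : PrimData n a b, prim t a = va ∧ prim t b = vb := by
  have : IsFiniteMeasure (volume.restrict (Ioo a b)) := ⟨by simp⟩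
  have hc : IsL2 a b (fun _ => (b - a)⁻¹ • (vb - va)) := memLp_const _
  set ψ : Lp (V n) 2 (volume.restrict (Ioo a b)) := hc.toLp with hψ
  refine ⟨(va, ψ), prim_left _, ?_⟩
  have h : ∫ t in a..b, ψ t = ∫ t in a..b, (b - a)⁻¹ • (vb - va) :=
    intervalIntegral.integral_congr_ae
      (ae_uIoc_of_ae_Ioo hc.coeFn_toLp (left_mem_Icc.2 hab.le) (right_mem_Icc.2 hab.le))
  have h' : prim ((va, ψ) : PrimData n a b) b = va + ∫ t in a..b, ψ t := rfl
  rw [h', h, intervalIntegral.integral_const, smul_inv_smul₀ (sub_pos.2 hab).ne', add_sub_cancel]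

namespace NahmSolution

variable {k j : ℕ} {μ₀ μ₁ : ℝ} {N : NahmSolution k j μ₀ μ₁} {x : Fin 4 → ℝ}

/-- Weak solutions of `D₁* (f, c) = 0`, tested against glued sections. -/
def IsWeak (N : NahmSolution k j μ₀ μ₁) (y w : ℂ) (f₁ f₂ : ℝ → V (k + j)) (g₁ g₂ : ℝ → V k)
    (c : Jump → ℂ) : Prop :=
  ∀ tL tS, N.Glued tL tS →
    (∫ z in Ioo (-μ₁) μ₁, ((inner ℂ (primNabla N.TL y tL z) (f₁ z) : ℂ) +
      inner ℂ (primMult N.TL w tL z) (f₂ z))) +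
    (∫ z in Ioo μ₁ (μ₀ - μ₁), ((inner ℂ (primNabla N.TS y tS z) (g₁ z) : ℂ) +
      inner ℂ (primMult N.TS w tS z) (g₂ z))) +
    ((starRingEnd ℂ) (N.jumpFun .plus (prim tS (smallPt μ₀ μ₁ .plus))) * c .plus +
      (starRingEnd ℂ) (N.jumpFun .minus (prim tS (smallPt μ₀ μ₁ .minus))) * c .minus) = 0

theorem prim_zero {n : ℕ} {a b z : ℝ} (hz : z ∈ Icc a b) : prim (0 : PrimData n a b) z = 0 :=
  map_zero (evalAt hz)

theorem integral_test_zero {n : ℕ} {a b : ℝ} (T : Fin 4 → ℝ → EndV n) (y w : ℂ) (f₁ f₂ : ℝ → V n) :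
    ∫ z in Ioo a b, ((inner ℂ (primNabla T y (0 : PrimData n a b) z) (f₁ z) : ℂ) +
      inner ℂ (primMult T w (0 : PrimData n a b) z) (f₂ z)) = 0 := by
  refine integral_eq_zero_of_ae ?_
  filter_upwards [Lp.coeFn_zero (V n) 2 (volume.restrict (Ioo a b)), ae_restrict_mem measurableSet_Ioo]
    with z h1 hz
  have h1' : (0 : PrimData n a b).2 z = 0 := h1
  rw [primNabla, primMult, h1', prim_zero (Ioo_subset_Icc_self hz)]
  simp

namespace IsWeak

variable {y w : ℂ} {f₁ f₂ : ℝ → V (k + j)} {g₁ g₂ : ℝ → V k} {c : Jump → ℂ}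

theorem large (h : N.IsWeak y w f₁ f₂ g₁ g₂ c) (hμ : μ₁ < μ₀ - μ₁) (e : PrimData (k + j) (-μ₁) μ₁)
    (ha : prim e (-μ₁) = 0) (hb : prim e μ₁ = 0) :
    ∫ z in Ioo (-μ₁) μ₁, ((inner ℂ (primNabla N.TL y e z) (f₁ z) : ℂ) +
      inner ℂ (primMult N.TL w e z) (f₂ z)) = 0 := by
  have h0 : ∀ p, prim (0 : PrimData k μ₁ (μ₀ - μ₁)) (smallPt μ₀ μ₁ p) = 0 := fun p =>
    prim_zero (smallPt_mem hμ p)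
  have key := h e 0 (fun p => by
    rw [h0, map_zero]
    cases p
    · exact hb
    · exact ha)
  rw [integral_test_zero, h0, h0] at key
  simpa using key

theorem small (h : N.IsWeak y w f₁ f₂ g₁ g₂ c) (hμ₁ : 0 < μ₁) (e : PrimData k μ₁ (μ₀ - μ₁))
    (ha : prim e μ₁ = 0) (hb : prim e (μ₀ - μ₁) = 0) :
    ∫ z in Ioo μ₁ (μ₀ - μ₁), ((inner ℂ (primNabla N.TS y e z) (g₁ z) : ℂ) +
      inner ℂ (primMult N.TS w e z) (g₂ z)) = 0 := by
  have h0 : ∀ p, prim e (smallPt μ₀ μ₁ p) = 0 := fun p => by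
    cases p
    · exact ha
    · exact hb
  have hm : ∀ p, largePt μ₁ p ∈ Icc (-μ₁) μ₁ := fun p => by
    cases p <;> constructor <;> simp only [largePt] <;> linarith
  have key := h 0 e (fun p => by rw [h0, map_zero, prim_zero (hm p)])
  rw [integral_test_zero, h0, h0] at key
  simpa using key

end IsWeak

/-- Green's formula on the circle. -/
theorem green {y w : ℂ} (hμ₁ : 0 < μ₁) (hμ : μ₁ < μ₀ - μ₁) {h₁ h₂ : ℝ → V (k + j)} {g₁ g₂ : ℝ → V k}
    (hL : IsDirac (-μ₁) μ₁ N.TL y w h₁ h₂) (hS : IsDirac μ₁ (μ₀ - μ₁) N.TS y w g₁ g₂)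
    {a b : Jump → V k}
    (ha : ∀ p, Tendsto (fun z => proj (N.ι p) (h₁ z)) (largeNhds μ₁ p) (𝓝 (a p)))
    (hb : ∀ p, Tendsto g₁ (smallNhds μ₀ μ₁ p) (𝓝 (b p)))
    {sL sL' n₁ n₂ : ℝ → V (k + j)} {sS sS' m₁ m₂ : ℝ → V k} {ℓ : Jump → V k}
    (wL : HasWeakDeriv (-μ₁) μ₁ sL sL') (wS : HasWeakDeriv μ₁ (μ₀ - μ₁) sS sS')
    (lL : IsL2 (-μ₁) μ₁ sL) (lL' : IsL2 (-μ₁) μ₁ sL') (lS : IsL2 μ₁ (μ₀ - μ₁) sS)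
    (lS' : IsL2 μ₁ (μ₀ - μ₁) sS')
    (eL : ∀ p, Tendsto sL (largeNhds μ₁ p) (𝓝 (N.ι p (ℓ p))))
    (eS : ∀ p, Tendsto sS (smallNhds μ₀ μ₁ p) (𝓝 (ℓ p)))
    (e₁ : ∀ᵐ z ∂(volume.restrict (Ioo (-μ₁) μ₁)), n₁ z =
      Complex.I • (sL' z + nahmAlpha N.TL z (sL z) - (Complex.I * y) • sL z))
    (e₂ : ∀ᵐ z ∂(volume.restrict (Ioo (-μ₁) μ₁)), n₂ z =
      -(nahmBeta N.TL z (sL z) - (Complex.I * w) • sL z))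
    (e₃ : ∀ᵐ z ∂(volume.restrict (Ioo μ₁ (μ₀ - μ₁))), m₁ z =
      Complex.I • (sS' z + nahmAlpha N.TS z (sS z) - (Complex.I * y) • sS z))
    (e₄ : ∀ᵐ z ∂(volume.restrict (Ioo μ₁ (μ₀ - μ₁))), m₂ z =
      -(nahmBeta N.TS z (sS z) - (Complex.I * w) • sS z))
    (ln₁ : IsL2 (-μ₁) μ₁ n₁) (ln₂ : IsL2 (-μ₁) μ₁ n₂)
    (lm₁ : IsL2 μ₁ (μ₀ - μ₁) m₁) (lm₂ : IsL2 μ₁ (μ₀ - μ₁) m₂) :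
    (∫ z in Ioo (-μ₁) μ₁, ((inner ℂ (n₁ z) (h₁ z) : ℂ) + inner ℂ (n₂ z) (h₂ z))) +
      (∫ z in Ioo μ₁ (μ₀ - μ₁), ((inner ℂ (m₁ z) (g₁ z) : ℂ) + inner ℂ (m₂ z) (g₂ z))) =
    Complex.I * (inner ℂ (ℓ .plus) (jumpSign .plus • (b .plus - a .plus)) +
      inner ℂ (ℓ .minus) (jumpSign .minus • (b .minus - a .minus))) := by
  have qL : ∀ p, Tendsto (fun z => (1 - coproj (N.ι p)) (h₁ z)) (largeNhds μ₁ p)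
      (𝓝 (N.ι p (a p))) := fun p => by
    simp only [one_sub_coproj_apply]
    exact ((N.ι p).continuous.tendsto _).comp (ha p)
  have pL : ∀ p, Tendsto (fun z => coproj (N.ι p) (sL z)) (largeNhds μ₁ p) (𝓝 0) := fun p => by
    have := ((coproj (N.ι p)).continuous.tendsto _).comp (eL p)
    rwa [coproj_map] at this
  have qS : ∀ p, Tendsto (fun z => (1 - (0 : EndV k)) (g₁ z)) (smallNhds μ₀ μ₁ p) (𝓝 (b p)) := fun p => by
    rw [sub_zero]
    exact hb p
  have pS : ∀ f : Filter ℝ, Tendsto (fun z => (0 : EndV k) (sS z)) f (𝓝 0) := fun f => by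
    exact tendsto_const_nhds
  have gL := (N.large_interval hμ₁ hμ).green wL lL lL' ⟨pL .minus, pL .plus⟩ hL.ac₁.hasWeakDeriv
    hL.l2₁ hL.l2₂ hL.eq_left e₁ e₂ ln₁ ln₂ (eL .minus) (eL .plus) (qL .minus) (qL .plus)
  have gS := (N.small_interval hμ₁ hμ).green wS lS lS' ⟨pS _, pS _⟩ hS.ac₁.hasWeakDeriv
    hS.l2₁ hS.l2₂ hS.eq_left e₃ e₄ lm₁ lm₂ (eS .plus) (eS .minus) (qS .plus) (qS .minus)
  rw [gL, gS]
  simp only [LinearIsometry.inner_map_map, jumpSign, one_smul, neg_smul, inner_neg_right, inner_sub_right]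
  ring

theorem jumpFun_eq (p : Jump) (ℓ : V k) :
    (starRingEnd ℂ) (N.jumpFun p ℓ) = -Complex.I * inner ℂ ℓ (N.jumpVec p).1 := by
  by_cases hj : j = 0
  · rw [jumpFun, jumpVec, if_pos hj, if_pos hj, innerSL_apply_apply, inner_conj_symm, inner_smul_right,
      ← mul_assoc, neg_mul, Complex.I_mul_I, neg_neg, one_mul]
  · rw [jumpFun, jumpVec, if_neg hj, if_neg hj]
    simp

theorem IsWeak.jump {y w : ℂ} {f₁ f₂ h₁ h₂ : ℝ → V (k + j)} {g₁ g₂ g₃ g₄ : ℝ → V k} {c : Jump → ℂ}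
    (h : N.IsWeak y w f₁ f₂ g₃ g₄ c) (hμ₁ : 0 < μ₁) (hμ : μ₁ < μ₀ - μ₁)
    (hL : IsDirac (-μ₁) μ₁ N.TL y w h₁ h₂) (hS : IsDirac μ₁ (μ₀ - μ₁) N.TS y w g₁ g₂)
    (q₁ : f₁ =ᵐ[volume.restrict (Ioo (-μ₁) μ₁)] h₁) (q₂ : f₂ =ᵐ[volume.restrict (Ioo (-μ₁) μ₁)] h₂)
    (q₃ : g₃ =ᵐ[volume.restrict (Ioo μ₁ (μ₀ - μ₁))] g₁)
    (q₄ : g₄ =ᵐ[volume.restrict (Ioo μ₁ (μ₀ - μ₁))] g₂) {a b : Jump → V k}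
    (ha : ∀ p, Tendsto (fun z => proj (N.ι p) (h₁ z)) (largeNhds μ₁ p) (𝓝 (a p)))
    (hb : ∀ p, Tendsto g₁ (smallNhds μ₀ μ₁ p) (𝓝 (b p))) (p : Jump) :
    jumpSign p • (b p - a p) = c p • (N.jumpVec p).1 := by
  have hIL := N.large_interval hμ₁ hμ
  have hIS := N.small_interval hμ₁ hμ
  have key : ∀ ℓ : Jump → V k,
      (inner ℂ (ℓ .plus) (jumpSign .plus • (b .plus - a .plus) - c .plus • (N.jumpVec .plus).1) : ℂ) +
        inner ℂ (ℓ .minus) (jumpSign .minus • (b .minus - a .minus) - c .minus • (N.jumpVec .minus).1)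
          = 0 := by
    intro ℓ
    obtain ⟨tL, hLa, hLb⟩ := exists_primData hIL.lt (N.ι .minus (ℓ .minus)) (N.ι .plus (ℓ .plus))
    obtain ⟨tS, hSa, hSb⟩ := exists_primData hIS.lt (ℓ .plus) (ℓ .minus)
    have eS : ∀ p, prim tS (smallPt μ₀ μ₁ p) = ℓ p := fun p => by
      cases p
      · exact hSa
      · exact hSb
    have hG : N.Glued tL tS := fun p => by
      rw [eS]
      cases p
      · exact hLb
      · exact hLa
    have mL := hG.mem hIL.lt.le
    have mS : tS ∈ polarSub hIS.lt.le (0 : EndV k) 0 := (mem_polarSub _).2 ⟨rfl, rfl⟩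
    obtain ⟨tLa, tLb⟩ := prim_tendsto hIL.lt tL
    obtain ⟨tSa, tSb⟩ := prim_tendsto hIS.lt tS
    rw [hLa] at tLa
    rw [hLb] at tLb
    rw [hSa] at tSa
    rw [hSb] at tSb
    have k1 := N.green hμ₁ hμ hL hS ha hb (ℓ := ℓ) (prim_hasWeakDeriv tL) (prim_hasWeakDeriv tS)
      (prim_isL2 hIL.lt.le tL) (lp_isL2 tL.2) (prim_isL2 hIS.lt.le tS) (lp_isL2 tS.2)
      (fun p => by cases p; exacts [tLb, tLa]) (fun p => by cases p; exacts [tSa, tSb])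
      (Eventually.of_forall fun z => rfl) (Eventually.of_forall fun z => rfl)
      (Eventually.of_forall fun z => rfl) (Eventually.of_forall fun z => rfl)
      (hIL.isL2_primNabla y mL) (hIL.isL2_primMult w mL) (hIS.isL2_primNabla y mS)
      (hIS.isL2_primMult w mS)
    have k2 := h tL tS hG
    have i1 : ∫ z in Ioo (-μ₁) μ₁, ((inner ℂ (primNabla N.TL y tL z) (f₁ z) : ℂ) +
        inner ℂ (primMult N.TL w tL z) (f₂ z)) = ∫ z in Ioo (-μ₁) μ₁,
          ((inner ℂ (primNabla N.TL y tL z) (h₁ z) : ℂ) + inner ℂ (primMult N.TL w tL z) (h₂ z)) := by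
      refine integral_congr_ae ?_
      filter_upwards [q₁, q₂] with z e1 e2
      rw [e1, e2]
    have i2 : ∫ z in Ioo μ₁ (μ₀ - μ₁), ((inner ℂ (primNabla N.TS y tS z) (g₃ z) : ℂ) +
        inner ℂ (primMult N.TS w tS z) (g₄ z)) = ∫ z in Ioo μ₁ (μ₀ - μ₁),
          ((inner ℂ (primNabla N.TS y tS z) (g₁ z) : ℂ) + inner ℂ (primMult N.TS w tS z) (g₂ z)) := by
      refine integral_congr_ae ?_
      filter_upwards [q₃, q₄] with z e1 e2
      rw [e1, e2]
    rw [i1, i2] at k2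
    have k3 := k1.symm.trans (eq_neg_of_add_eq_zero_left k2)
    rw [eS, eS, jumpFun_eq, jumpFun_eq] at k3
    refine (mul_eq_zero.1 ?_).resolve_left Complex.I_ne_zero
    simp only [inner_sub_right, inner_smul_right] at k3 ⊢
    linear_combination k3
  rw [← sub_eq_zero, ← inner_self_eq_zero (𝕜 := ℂ)]
  cases p
  · have := key (fun q => match q with
      | .plus => jumpSign .plus • (b .plus - a .plus) - c .plus • (N.jumpVec .plus).1
      | .minus => 0)
    simpa only [inner_zero_left, add_zero] using this
  · have := key (fun q => match q with
      | .minus => jumpSign .minus • (b .minus - a .minus) - c .minus • (N.jumpVec .minus).1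
      | .plus => 0)
    simpa only [inner_zero_left, zero_add] using this

end NahmSolution

end CaloronNahm

namespace CaloronNahm

theorem hasWeakDeriv_dz {n : ℕ} {a b : ℝ} {s : ℝ → V n} (hs : ∀ z ∈ Ioo a b, DifferentiableAt ℝ s z)
    (hac : LocAC a b (dz a b s)) : HasWeakDeriv a b s (dz a b s) :=
  HasWeakDeriv.of_hasDerivAt (fun _ hz => hasDerivAt_dz hz (hs _ hz)) hac.hasWeakDeriv.continuousOn

namespace DiracSplit

variable {n j : ℕ} {a b : ℝ} {T : Fin 4 → ℝ → EndV n} {Qa Qb : EndV n} {y w : ℂ}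
  {u₁ u₂ s h₁ h₂ : ℝ → V n}

theorem dz_eq (d : DiracSplit a b T y w u₁ u₂ s h₁ h₂) (z : ℝ) :
    dz a b s z = (-Complex.I) • (u₁ z - h₁ z) - nahmAlpha T z (s z) + (Complex.I * y) • s z := by
  have e : u₁ z = h₁ z + Complex.I • (dz a b s z + nahmAlpha T z (s z) - (Complex.I * y) • s z) :=
    congrFun d.eq_left z
  rw [e]
  match_scalars <;> (ring_nf; try simp only [Complex.I_sq, Complex.I_pow_three]; try ring)

theorem right_eq (d : DiracSplit a b T y w u₁ u₂ s h₁ h₂) (z : ℝ) :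
    h₂ z = u₂ z + (nahmBeta T z (s z) - (Complex.I * w) • s z) := by
  have e : u₂ z = h₂ z + -(nahmBeta T z (s z) - (Complex.I * w) • s z) := congrFun d.eq_right z
  rw [e]
  abel

theorem hasWeakDeriv (d : DiracSplit a b T y w u₁ u₂ s h₁ h₂) : HasWeakDeriv a b s (dz a b s) :=
  hasWeakDeriv_dz d.diff d.ac

theorem isL2_dz_dz (d : DiracSplit a b T y w u₁ u₂ s h₁ h₂) (h : NahmInterval j a b T Qa Qb)
    (hj : j ≠ 2) (c₁ : LocAC a b u₁) (c₂ : LocAC a b u₂) (l₁ : IsL2 a b (dz a b u₁))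
    (l₂ : IsL2 a b (dz a b u₂)) (ls : IsL2 a b (dz a b s)) (h0 : PolarVanish a b Qa Qb s) :
    IsL2 a b (dz a b (dz a b s)) := by
  obtain ⟨k₁, k₂⟩ := d.dirac.isL2_dz h hj
  have wG := (((c₁.hasWeakDeriv.sub d.dirac.ac₁.hasWeakDeriv).csmul (-Complex.I)).add
    (d.hasWeakDeriv.csmul (Complex.I * y))).congr
      (g := fun z => dz a b s z + nahmAlpha T z (s z)) (fun z _ => by
        change dz a b s z + nahmAlpha T z (s z) = (-Complex.I) • (u₁ z - h₁ z) + (Complex.I * y) • s z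
        rw [d.dz_eq z]
        abel)
  have wH := ((d.dirac.ac₂.hasWeakDeriv.sub c₂.hasWeakDeriv).add
    (d.hasWeakDeriv.csmul (Complex.I * w))).congr
      (g := fun z => nahmBeta T z (s z)) (fun z _ => by
        change nahmBeta T z (s z) = h₂ z - u₂ z + (Complex.I * w) • s z
        rw [d.right_eq z]
        abel)
  exact h.isL2_second_deriv hj d.hasWeakDeriv d.ac.hasWeakDeriv wG wH d.l2 ls
    (((l₁.fsub k₁).csmul _).fadd (ls.csmul _)) ((k₂.fsub l₂).fadd (ls.csmul _)) h0

end DiracSplit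

namespace NahmSolution

variable {k j : ℕ} {μ₀ μ₁ : ℝ} {N : NahmSolution k j μ₀ μ₁} {x : Fin 4 → ℝ}

/-- The one-sided limits of a solution of the Dirac equation at the jump points. -/
theorem exists_limits_of_isDirac {y w : ℂ} (hμ₁ : 0 < μ₁) (hμ : μ₁ < μ₀ - μ₁)
    {h₁ h₂ : ℝ → V (k + j)} {g₁ g₂ : ℝ → V k} (hL : IsDirac (-μ₁) μ₁ N.TL y w h₁ h₂)
    (hS : IsDirac μ₁ (μ₀ - μ₁) N.TS y w g₁ g₂) (p : Jump) :
    ∃ a b, Tendsto (fun z => proj (N.ι p) (h₁ z)) (largeNhds μ₁ p) (𝓝 a) ∧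
      Tendsto g₁ (smallNhds μ₀ μ₁ p) (𝓝 b) := by
  have key : ∀ {f : Filter ℝ}, (∃ e, Tendsto (fun z => (1 - coproj (N.ι p)) (h₁ z)) f (𝓝 e)) →
      ∃ a, Tendsto (fun z => proj (N.ι p) (h₁ z)) f (𝓝 a) := by
    rintro f ⟨e, he⟩
    refine ⟨proj (N.ι p) e, (((proj (N.ι p)).continuous.tendsto _).comp he).congr fun z => ?_⟩
    change proj (N.ι p) ((1 - coproj (N.ι p)) (h₁ z)) = _
    rw [one_sub_coproj_apply, proj_apply_map]
  have key' : ∀ {f : Filter ℝ}, (∃ e, Tendsto (fun z => (1 - (0 : EndV k)) (g₁ z)) f (𝓝 e)) →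
      ∃ b, Tendsto g₁ f (𝓝 b) := by
    rintro f ⟨e, he⟩
    rw [sub_zero] at he
    exact ⟨e, he⟩
  have hIL := N.large_interval hμ₁ hμ
  have hIS := N.small_interval hμ₁ hμ
  cases p
  · obtain ⟨a, ha⟩ := key (hL.exists_limits_right hIL).1
    obtain ⟨b, hb⟩ := key' (hS.exists_limits_left hIS).1
    exact ⟨a, b, ha, hb⟩
  · obtain ⟨a, ha⟩ := key (hL.exists_limits_left hIL).1
    obtain ⟨b, hb⟩ := key' (hS.exists_limits_right hIS).1
    exact ⟨a, b, ha, hb⟩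

/-- The jump conditions for the two parts of a decomposition. -/
theorem jump_of_split {p : Jump} {aL bL aS bS : EndV k} (J : N.JumpLimits p aL bL aS bS)
    {u h : Sec k j × Sec k j} {s : Sec k j}
    (dL : DiracSplit (-μ₁) μ₁ N.TL (N.yy x) (N.ww x) u.1.1 u.2.1 s.1 h.1.1 h.2.1)
    (dS : DiracSplit μ₁ (μ₀ - μ₁) N.TS (N.yy x) (N.ww x) u.1.2 u.2.2 s.2 h.1.2 h.2.2)
    {ℓ a b : V k} {A B : V k × V k} {c : ℂ} (sL : Tendsto s.1 (largeNhds μ₁ p) (𝓝 (N.ι p ℓ)))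
    (sS : Tendsto s.2 (smallNhds μ₀ μ₁ p) (𝓝 ℓ))
    (h1 : Tendsto (fun z => proj (N.ι p) (h.1.1 z)) (largeNhds μ₁ p) (𝓝 a))
    (h2 : Tendsto h.1.2 (smallNhds μ₀ μ₁ p) (𝓝 b))
    (u1 : Tendsto (fun z => proj (N.ι p) (u.1.1 z)) (largeNhds μ₁ p) (𝓝 A.1))
    (u2 : Tendsto (fun z => proj (N.ι p) (u.2.1 z)) (largeNhds μ₁ p) (𝓝 A.2))
    (u3 : Tendsto u.1.2 (smallNhds μ₀ μ₁ p) (𝓝 B.1))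
    (u4 : Tendsto u.2.2 (smallNhds μ₀ μ₁ p) (𝓝 B.2))
    (hu : jumpSign p • (B - A) = c • N.jumpVec p)
    (hh : jumpSign p • (b - a) = (c - N.jumpFun p ℓ) • (N.jumpVec p).1) :
    N.JumpCond1 h p ∧ N.JumpCond2 s p := by
  have hℓ : Tendsto (fun z => proj (N.ι p) (s.1 z)) (largeNhds μ₁ p) (𝓝 ℓ) := by
    have := ((proj (N.ι p)).continuous.tendsto _).comp sL
    rwa [proj_apply_map] at this
  have hu1 : jumpSign p • (B.1 - A.1) = c • (N.jumpVec p).1 := congrArg Prod.fst hu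
  have hu2 : jumpSign p • (B.2 - A.2) = c • (N.jumpVec p).2 := congrArg Prod.snd hu
  have t1 := (u2.add ((J.large_right s.1 ℓ sL).sub (hℓ.const_smul (Complex.I * N.ww x)))).congr
    (f₂ := fun z => proj (N.ι p) (h.2.1 z)) fun z => by
      rw [dL.right_eq z]
      simp only [map_smul, map_add, map_sub]
  have t2 := (u4.add ((J.small_right s.2 ℓ sS).sub (sS.const_smul (Complex.I * N.ww x)))).congr
    (f₂ := h.2.2) fun z => (dS.right_eq z).symm
  have t3 := ((((u1.sub h1).const_smul (-Complex.I)).sub (J.large_left s.1 ℓ sL)).add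
    (hℓ.const_smul (Complex.I * N.yy x))).congr
    (f₂ := fun z => proj (N.ι p) ((secDz μ₀ μ₁ s).1 z)) fun z => by
      change _ = proj (N.ι p) (dz (-μ₁) μ₁ s.1 z)
      rw [dL.dz_eq z]
      simp only [map_smul, map_add, map_sub]
  have t4 := ((((u3.sub h2).const_smul (-Complex.I)).sub (J.small_left s.2 ℓ sS)).add
    (sS.const_smul (Complex.I * N.yy x))).congr
    (f₂ := (secDz μ₀ μ₁ s).2) fun z => (dS.dz_eq z).symm
  refine ⟨⟨(a, _), (b, _), c - N.jumpFun p ℓ, h1, t1, h2, t2, ?_⟩, ⟨ℓ, _, _, sL, sS, t3, t4, ?_⟩⟩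
  · refine Prod.ext hh ?_
    simp only [Prod.smul_snd, Prod.snd_sub]
    by_cases hj : j = 0
    · obtain ⟨r1, r2⟩ := J.rankOne hj ℓ
      rw [jumpVec, if_pos hj] at hu2
      rw [jumpFun, jumpVec, if_pos hj, if_pos hj, innerSL_apply_apply]
      linear_combination (norm := module) hu2 + r1
    · obtain ⟨rfl, rfl⟩ := J.polar (Nat.pos_of_ne_zero hj)
      rw [jumpVec, if_neg hj] at hu2
      rw [jumpVec, if_neg hj]
      simp only [Prod.snd_zero, smul_zero] at hu2 ⊢
      linear_combination (norm := module) hu2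
  · by_cases hj : j = 0
    · obtain ⟨r1, r2⟩ := J.rankOne hj ℓ
      rw [jumpVec, if_pos hj] at hu1
      rw [jumpFun, jumpVec, if_pos hj, if_pos hj, innerSL_apply_apply] at hh
      rw [jumpOp, if_pos hj]
      have hI : Complex.I • Complex.I • N.α p 1 = -N.α p 1 := by
        rw [smul_smul, Complex.I_mul_I, neg_one_smul]
      linear_combination (norm := module) (-Complex.I) • hu1 + Complex.I • hh - r2 -
        (inner ℂ (N.α p 1) ℓ : ℂ) • hI
    · obtain ⟨rfl, rfl⟩ := J.polar (Nat.pos_of_ne_zero hj)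
      rw [jumpVec, if_neg hj] at hu1
      rw [jumpVec, if_neg hj] at hh
      rw [jumpOp, if_neg hj]
      simp only [Prod.fst_zero, smul_zero] at hu1 hh
      linear_combination (norm := module) (-Complex.I) • hu1 + Complex.I • hh

theorem exists_circle_split (hμ₁ : 0 < μ₁) (hμ : μ₁ < μ₀ - μ₁) {u : Sec k j × Sec k j}
    (hu : N.MemE1 x u) (hd : SecAEEq μ₀ μ₁ (N.D2val x u) 0) (c : Jump → ℂ) :
    ∃ (s : Sec k j) (h : Sec k j × Sec k j) (xL : PrimData (k + j) (-μ₁) μ₁)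
      (xS : PrimData k μ₁ (μ₀ - μ₁)), N.Glued xL xS ∧ EqOn s.1 (prim xL) (Ioo (-μ₁) μ₁) ∧
      EqOn s.2 (prim xS) (Ioo μ₁ (μ₀ - μ₁)) ∧
      DiracSplit (-μ₁) μ₁ N.TL (N.yy x) (N.ww x) u.1.1 u.2.1 s.1 h.1.1 h.2.1 ∧
      DiracSplit μ₁ (μ₀ - μ₁) N.TS (N.yy x) (N.ww x) u.1.2 u.2.2 s.2 h.1.2 h.2.2 ∧
      ∀ a b : Jump → V k,
        (∀ p, Tendsto (fun z => proj (N.ι p) (h.1.1 z)) (largeNhds μ₁ p) (𝓝 (a p))) →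
        (∀ p, Tendsto h.1.2 (smallNhds μ₀ μ₁ p) (𝓝 (b p))) →
        ∀ p, jumpSign p • (b p - a p) =
          (c p - N.jumpFun p (prim xS (smallPt μ₀ μ₁ p))) • (N.jumpVec p).1 := by
  have hIL := N.large_interval hμ₁ hμ
  have hIS := N.small_interval hμ₁ hμ
  obtain ⟨xL, xS, hG, hO⟩ := N.exists_projection hμ₁ hμ (N.yy x) (N.ww x) hu.l2₁.1 hu.l2₂.1 hu.l2₁.2
    hu.l2₂.2 c
  have hW : N.IsWeak (N.yy x) (N.ww x) (fun z => u.1.1 z - primNabla N.TL (N.yy x) xL z)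
      (fun z => u.2.1 z - primMult N.TL (N.ww x) xL z)
      (fun z => u.1.2 z - primNabla N.TS (N.yy x) xS z)
      (fun z => u.2.2 z - primMult N.TS (N.ww x) xS z)
      (fun p => c p - N.jumpFun p (prim xS (smallPt μ₀ μ₁ p))) := hO
  have mS : xS ∈ polarSub hIS.lt.le (0 : EndV k) 0 := (mem_polarSub _).2 ⟨rfl, rfl⟩
  obtain ⟨sL, h₁, h₂, eL, dL⟩ := hIL.exists_split (hG.mem hIL.lt.le) hu.ac₁.1 hu.ac₂.1 hu.l2₁.1 hu.l2₂.1
    hu.supp₁.1 hu.supp₂.1 hd.1 (fun e => hW.large hμ e)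
  obtain ⟨sS, g₁, g₂, eS, dS⟩ := hIS.exists_split mS hu.ac₁.2 hu.ac₂.2 hu.l2₁.2 hu.l2₂.2
    hu.supp₁.2 hu.supp₂.2 hd.2 (fun e => hW.small hμ₁ e)
  refine ⟨(sL, sS), ((h₁, g₁), (h₂, g₂)), xL, xS, hG, eL, eS, dL, dS, fun a b ha hb p => ?_⟩
  have aeL : dz (-μ₁) μ₁ sL =ᵐ[volume.restrict (Ioo (-μ₁) μ₁)] xL.2 :=
    ((prim_hasWeakDeriv xL).congr eL).dz_ae
  have aeS : dz μ₁ (μ₀ - μ₁) sS =ᵐ[volume.restrict (Ioo μ₁ (μ₀ - μ₁))] xS.2 :=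
    ((prim_hasWeakDeriv xS).congr eS).dz_ae
  refine hW.jump hμ₁ hμ dL.dirac dS.dirac ?_ ?_ ?_ ?_ ha hb p
  · filter_upwards [aeL, ae_restrict_mem measurableSet_Ioo] with z e1 hz
    have e2 := congrFun dL.eq_left z
    have e3 : nabla (-μ₁) μ₁ N.TL (N.yy x) sL z = primNabla N.TL (N.yy x) xL z := by
      rw [primNabla, ← e1, ← eL hz]
      rfl
    rw [e2, Pi.add_apply, e3, add_sub_cancel_right]
  · filter_upwards [ae_restrict_mem measurableSet_Ioo] with z hz
    rw [dL.right_eq z, primMult, eL hz, sub_neg_eq_add]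
  · filter_upwards [aeS, ae_restrict_mem measurableSet_Ioo] with z e1 hz
    have e2 := congrFun dS.eq_left z
    have e3 : nabla μ₁ (μ₀ - μ₁) N.TS (N.yy x) sS z = primNabla N.TS (N.yy x) xS z := by
      rw [primNabla, ← e1, ← eS hz]
      rfl
    rw [e2, Pi.add_apply, e3, add_sub_cancel_right]
  · filter_upwards [ae_restrict_mem measurableSet_Ioo] with z hz
    rw [dS.right_eq z, primMult, eS hz, sub_neg_eq_add]

theorem exists_harmonic_add_coboundary (hμ₁ : 0 < μ₁) (hμ : μ₁ < μ₀ - μ₁) {u : Sec k j × Sec k j}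
    (hu : N.MemE1 x u) (hd : SecAEEq μ₀ μ₁ (N.D2val x u) 0) :
    ∃ s h, N.MemE0 x s ∧ N.MemHarmonic x h ∧ u = h + N.D1val x s := by
  have hIL := N.large_interval hμ₁ hμ
  have hIS := N.small_interval hμ₁ hμ
  choose A B c u1 u2 u3 u4 hc using hu.jump
  obtain ⟨s, h, xL, xS, hG, eL, eS, dL, dS, hJ⟩ := exists_circle_split hμ₁ hμ hu hd c
  choose a b ha hb using exists_limits_of_isDirac hμ₁ hμ dL.dirac dS.dirac
  have wxL := (prim_hasWeakDeriv xL).congr eL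
  have wxS := (prim_hasWeakDeriv xS).congr eS
  obtain ⟨tLa, tLb⟩ := prim_tendsto hIL.lt xL
  obtain ⟨tSa, tSb⟩ := prim_tendsto hIS.lt xS
  have qLa : Tendsto s.1 (𝓝[>] (-μ₁)) (𝓝 (prim xL (-μ₁))) := tLa.congr' (by
    filter_upwards [Ioo_mem_nhdsGT hIL.lt] with z hz using (eL hz).symm)
  have qLb : Tendsto s.1 (𝓝[<] μ₁) (𝓝 (prim xL μ₁)) := tLb.congr' (by
    filter_upwards [Ioo_mem_nhdsLT hIL.lt] with z hz using (eL hz).symm)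
  have qSa : Tendsto s.2 (𝓝[>] μ₁) (𝓝 (prim xS μ₁)) := tSa.congr' (by
    filter_upwards [Ioo_mem_nhdsGT hIS.lt] with z hz using (eS hz).symm)
  have qSb : Tendsto s.2 (𝓝[<] (μ₀ - μ₁)) (𝓝 (prim xS (μ₀ - μ₁))) := tSb.congr' (by
    filter_upwards [Ioo_mem_nhdsLT hIS.lt] with z hz using (eS hz).symm)
  have sL : ∀ p, Tendsto s.1 (largeNhds μ₁ p) (𝓝 (N.ι p (prim xS (smallPt μ₀ μ₁ p)))) := fun p => by
    rw [← hG p]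
    cases p
    exacts [qLb, qLa]
  have sS : ∀ p, Tendsto s.2 (smallNhds μ₀ μ₁ p) (𝓝 (prim xS (smallPt μ₀ μ₁ p))) := fun p => by
    cases p
    exacts [qSa, qSb]
  have jump : ∀ p, N.JumpCond1 h p ∧ N.JumpCond2 s p := fun p => by
    obtain ⟨aL, bL, aS, bS, J⟩ := N.exists_jumpLimits hμ₁ hμ p
    exact jump_of_split J dL dS (sL p) (sS p) (ha p) (hb p) (u1 p) (u2 p) (u3 p) (u4 p) (hc p)
      (hJ a b ha hb p)
  have hh : N.MemHarmonic x h :=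
    ⟨⟨dL.supp₁, dS.supp₁⟩, ⟨dL.supp₂, dS.supp₂⟩, ⟨dL.dirac.ac₁, dS.dirac.ac₁⟩,
      ⟨dL.dirac.ac₂, dS.dirac.ac₂⟩, ⟨dL.dirac.l2₁, dS.dirac.l2₁⟩, ⟨dL.dirac.l2₂, dS.dirac.l2₂⟩,
      ⟨dL.dirac.d2, dS.dirac.d2⟩, ⟨dL.dirac.d1adj, dS.dirac.d1adj⟩, fun p => (jump p).1⟩
  have heq : u = h + N.D1val x s :=
    Prod.ext (Prod.ext dL.eq_left dS.eq_left) (Prod.ext dL.eq_right dS.eq_right)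
  have lL : IsL2 (-μ₁) μ₁ (dz (-μ₁) μ₁ s.1) := (memLp_congr_ae wxL.dz_ae).2 (lp_isL2 xL.2)
  have lS : IsL2 μ₁ (μ₀ - μ₁) (dz μ₁ (μ₀ - μ₁) s.2) := (memLp_congr_ae wxS.dz_ae).2 (lp_isL2 xS.2)
  have pvL : PolarVanish (-μ₁) μ₁ (coproj (N.ι .minus)) (coproj (N.ι .plus)) s.1 := by
    have h1 := ((coproj (N.ι .minus)).continuous.tendsto _).comp (sL .minus)
    have h2 := ((coproj (N.ι .plus)).continuous.tendsto _).comp (sL .plus)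
    rw [coproj_map] at h1 h2
    exact ⟨h1, h2⟩
  have pvS : PolarVanish μ₁ (μ₀ - μ₁) (0 : EndV k) 0 s.2 :=
    ⟨tendsto_const_nhds (x := (0 : V k)), tendsto_const_nhds (x := (0 : V k))⟩
  have hdom : N.MemE1 x (N.D1val x s) := by
    have : N.D1val x s = u + (-1 : ℂ) • h := by
      rw [heq, neg_one_smul]
      abel
    rw [this]
    exact hu.add ((hh.memE1 hμ₁ hμ).smul (-1))
  refine ⟨s, h, ⟨⟨dL.supp, dS.supp⟩, ⟨dL.diff, dS.diff⟩, ⟨dL.ac, dS.ac⟩, ⟨dL.l2, dS.l2⟩, fun hj => ?_,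
    fun p => (jump p).2, hdom⟩, hh, heq⟩
  obtain ⟨k1, k2⟩ := hu.sobolev hj
  exact ⟨⟨lL, lS⟩, dL.isL2_dz_dz hIL hj hu.ac₁.1 hu.ac₂.1 k1.1 k2.1 lL pvL,
    dS.isL2_dz_dz hIS hj hu.ac₁.2 hu.ac₂.2 k1.2 k2.2 lS pvS⟩

end NahmSolution

end CaloronNahm

namespace CaloronNahm

section Pythagoras

variable {n j : ℕ} {a b : ℝ} {T : Fin 4 → ℝ → EndV n} {Qa Qb : EndV n} {y w : ℂ}

theorem NahmInterval.isL2_dz_of_graph (h : NahmInterval j a b T Qa Qb) {s : ℝ → V n}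
    (ws : HasWeakDeriv a b s (dz a b s)) (h0 : PolarVanish a b Qa Qb s) (ls : IsL2 a b s)
    (l₁ : IsL2 a b (nabla a b T y s)) (l₂ : IsL2 a b (-mult T w s)) : IsL2 a b (dz a b s) := by
  obtain ⟨C, -, hC⟩ := h.exists_elliptic_bound
  have k₁ : IsL2 a b (fun z => dz a b s z + nahmAlpha T z (s z)) :=
    ((l₁.csmul (-Complex.I)).fadd (ls.csmul (Complex.I * y))).congr (Eventually.of_forall fun z => by
      have e : nabla a b T y s z = Complex.I • (dz a b s z + nahmAlpha T z (s z) -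
        (Complex.I * y) • s z) := rfl
      rw [e]
      match_scalars <;> (ring_nf; try simp only [Complex.I_sq, Complex.I_pow_three]; try ring))
  have k₂ : IsL2 a b (fun z => nahmBeta T z (s z)) :=
    (l₂.fneg.fadd (ls.csmul (Complex.I * w))).congr (Eventually.of_forall fun z => by
      have e : (-mult T w s) z = -(nahmBeta T z (s z) - (Complex.I * w) • s z) := rfl
      rw [e]
      abel)
  exact ⟨ws.aestronglyMeasurable_deriv, (hC s _ ws h0).trans_lt (ENNReal.mul_lt_top ENNReal.ofReal_lt_top
    (ENNReal.add_lt_top.2 ⟨ENNReal.add_lt_top.2 ⟨k₁.2, k₂.2⟩, ls.2⟩))⟩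

theorem IsL2.integrable_norm_sq {f : ℝ → V n} (hf : IsL2 a b f) :
    IntegrableOn (fun z => ‖f z‖ ^ 2) (Ioo a b) := hf.norm.integrable_sq

theorem integral_norm_sq_add {f₁ f₂ g₁ g₂ : ℝ → V n} (hf₁ : IsL2 a b f₁) (hf₂ : IsL2 a b f₂)
    (hg₁ : IsL2 a b g₁) (hg₂ : IsL2 a b g₂) :
    ∫ z in Ioo a b, (‖(f₁ + g₁) z‖ ^ 2 + ‖(f₂ + g₂) z‖ ^ 2) =
      (∫ z in Ioo a b, (‖f₁ z‖ ^ 2 + ‖f₂ z‖ ^ 2)) + (∫ z in Ioo a b, (‖g₁ z‖ ^ 2 + ‖g₂ z‖ ^ 2)) +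
        2 * (∫ z in Ioo a b, ((inner ℂ (g₁ z) (f₁ z) : ℂ) + inner ℂ (g₂ z) (f₂ z))).re := by
  have i1 : Integrable (fun z => ‖f₁ z‖ ^ 2 + ‖f₂ z‖ ^ 2) (volume.restrict (Ioo a b)) :=
    hf₁.integrable_norm_sq.add hf₂.integrable_norm_sq
  have i2 : Integrable (fun z => ‖g₁ z‖ ^ 2 + ‖g₂ z‖ ^ 2) (volume.restrict (Ioo a b)) :=
    hg₁.integrable_norm_sq.add hg₂.integrable_norm_sq
  have i3 : Integrable (fun z => (inner ℂ (g₁ z) (f₁ z) : ℂ) + inner ℂ (g₂ z) (f₂ z))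
      (volume.restrict (Ioo a b)) := (hg₁.integrableOn_inner hf₁).add (hg₂.integrableOn_inner hf₂)
  have i4 : Integrable (fun z => ((inner ℂ (g₁ z) (f₁ z) : ℂ) + inner ℂ (g₂ z) (f₂ z)).re)
      (volume.restrict (Ioo a b)) := i3.re
  have e3 : ∫ z in Ioo a b, ((inner ℂ (g₁ z) (f₁ z) : ℂ) + inner ℂ (g₂ z) (f₂ z)).re =
      (∫ z in Ioo a b, ((inner ℂ (g₁ z) (f₁ z) : ℂ) + inner ℂ (g₂ z) (f₂ z))).re := integral_re i3
  have i5 : Integrable (fun z => ‖f₁ z‖ ^ 2 + ‖f₂ z‖ ^ 2 + (‖g₁ z‖ ^ 2 + ‖g₂ z‖ ^ 2))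
      (volume.restrict (Ioo a b)) := i1.add i2
  rw [← e3, ← integral_const_mul, ← integral_add i1 i2, ← integral_add i5 (i4.const_mul 2)]
  refine integral_congr_ae (Eventually.of_forall fun z => ?_)
  have k : ∀ f g : V n, ‖f + g‖ ^ 2 = ‖f‖ ^ 2 + ‖g‖ ^ 2 + 2 * (inner ℂ g f : ℂ).re := fun f g => by
    have := norm_add_sq (𝕜 := ℂ) g f
    rw [add_comm f g, this]
    change _ + 2 * (inner ℂ g f : ℂ).re + _ = _
    ring
  simp only [Pi.add_apply, k, Complex.add_re]
  ring

theorem eq_zero_of_integral_norm_sq {f₁ f₂ : ℝ → V n} (h₁ : IsL2 a b f₁) (h₂ : IsL2 a b f₂)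
    (c₁ : ContinuousOn f₁ (Ioo a b)) (c₂ : ContinuousOn f₂ (Ioo a b)) (s₁ : ∀ z ∉ Ioo a b, f₁ z = 0)
    (s₂ : ∀ z ∉ Ioo a b, f₂ z = 0) (h : ∫ z in Ioo a b, (‖f₁ z‖ ^ 2 + ‖f₂ z‖ ^ 2) = 0) :
    f₁ = 0 ∧ f₂ = 0 := by
  have hi : Integrable (fun z => ‖f₁ z‖ ^ 2 + ‖f₂ z‖ ^ 2) (volume.restrict (Ioo a b)) :=
    h₁.integrable_norm_sq.add h₂.integrable_norm_sq
  rw [integral_eq_zero_iff_of_nonneg (fun z => by positivity) hi] at h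
  have k₁ : f₁ =ᵐ[volume.restrict (Ioo a b)] fun _ => 0 := by
    filter_upwards [h] with z hz
    have hz' : ‖f₁ z‖ ^ 2 + ‖f₂ z‖ ^ 2 = 0 := hz
    exact norm_eq_zero.1 (pow_eq_zero_iff two_ne_zero |>.1 (by nlinarith [sq_nonneg ‖f₁ z‖, sq_nonneg ‖f₂ z‖]))
  have k₂ : f₂ =ᵐ[volume.restrict (Ioo a b)] fun _ => 0 := by
    filter_upwards [h] with z hz
    have hz' : ‖f₁ z‖ ^ 2 + ‖f₂ z‖ ^ 2 = 0 := hz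
    exact norm_eq_zero.1 (pow_eq_zero_iff two_ne_zero |>.1 (by nlinarith [sq_nonneg ‖f₁ z‖, sq_nonneg ‖f₂ z‖]))
  have e₁ := Measure.eqOn_open_of_ae_eq k₁ isOpen_Ioo c₁ continuousOn_const
  have e₂ := Measure.eqOn_open_of_ae_eq k₂ isOpen_Ioo c₂ continuousOn_const
  constructor
  · funext z
    by_cases hz : z ∈ Ioo a b
    exacts [e₁ hz, s₁ z hz]
  · funext z
    by_cases hz : z ∈ Ioo a b
    exacts [e₂ hz, s₂ z hz]

end Pythagoras

namespace NahmSolution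

variable {k j : ℕ} {μ₀ μ₁ : ℝ} {N : NahmSolution k j μ₀ μ₁} {x : Fin 4 → ℝ}

theorem largeNhds_neBot (p : Jump) : (largeNhds μ₁ p).NeBot := by
  cases p <;> simp only [largeNhds] <;> infer_instance

theorem smallNhds_neBot (p : Jump) : (smallNhds μ₀ μ₁ p).NeBot := by
  cases p <;> simp only [smallNhds] <;> infer_instance

theorem jumpCoeffSq_eq {u : Sec k j × Sec k j} {p : Jump} {A B : V k × V k} {c : ℂ}
    (u1 : Tendsto (fun z => proj (N.ι p) (u.1.1 z)) (largeNhds μ₁ p) (𝓝 A.1))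
    (u2 : Tendsto (fun z => proj (N.ι p) (u.2.1 z)) (largeNhds μ₁ p) (𝓝 A.2))
    (u3 : Tendsto u.1.2 (smallNhds μ₀ μ₁ p) (𝓝 B.1))
    (u4 : Tendsto u.2.2 (smallNhds μ₀ μ₁ p) (𝓝 B.2))
    (hu : jumpSign p • (B - A) = c • N.jumpVec p) (h0 : N.jumpVec p = 0 → c = 0) :
    N.jumpCoeffSq u p = ‖c‖ ^ 2 := by
  have := largeNhds_neBot (μ₁ := μ₁) p
  have := smallNhds_neBot (μ₀ := μ₀) (μ₁ := μ₁) p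
  have e : N.jumpOf u p = c • N.jumpVec p := by
    rw [jumpOf, u1.limUnder_eq, u2.limUnder_eq, u3.limUnder_eq, u4.limUnder_eq, ← hu]
    rfl
  rw [jumpCoeffSq, e, Prod.smul_fst, Prod.smul_snd, norm_smul, norm_smul]
  by_cases hv : N.jumpVec p = 0
  · rw [h0 hv]
    simp
  · have hpos : ‖(N.jumpVec p).1‖ ^ 2 + ‖(N.jumpVec p).2‖ ^ 2 ≠ 0 := fun h => by
      apply hv
      refine Prod.ext (norm_eq_zero.1 (pow_eq_zero_iff two_ne_zero |>.1 ?_))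
        (norm_eq_zero.1 (pow_eq_zero_iff two_ne_zero |>.1 ?_))
      · nlinarith [sq_nonneg ‖(N.jumpVec p).1‖, sq_nonneg ‖(N.jumpVec p).2‖]
      · nlinarith [sq_nonneg ‖(N.jumpVec p).1‖, sq_nonneg ‖(N.jumpVec p).2‖]
    rw [div_eq_iff hpos]
    ring

/-- The jump condition with a coefficient normalised to vanish when no jump is allowed. -/
theorem JumpCond1.exists_normalized {u : Sec k j × Sec k j} {p : Jump} (h : N.JumpCond1 u p) :
    ∃ (A B : V k × V k) (c : ℂ),
      Tendsto (fun z => proj (N.ι p) (u.1.1 z)) (largeNhds μ₁ p) (𝓝 A.1) ∧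
      Tendsto (fun z => proj (N.ι p) (u.2.1 z)) (largeNhds μ₁ p) (𝓝 A.2) ∧
      Tendsto u.1.2 (smallNhds μ₀ μ₁ p) (𝓝 B.1) ∧
      Tendsto u.2.2 (smallNhds μ₀ μ₁ p) (𝓝 B.2) ∧
      jumpSign p • (B - A) = c • N.jumpVec p ∧ (N.jumpVec p = 0 → c = 0) := by
  obtain ⟨A, B, c, h1, h2, h3, h4, h5⟩ := h
  by_cases hv : N.jumpVec p = 0
  · exact ⟨A, B, 0, h1, h2, h3, h4, by rw [h5, hv, smul_zero, smul_zero], fun _ => rfl⟩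
  · exact ⟨A, B, c, h1, h2, h3, h4, h5, fun h => absurd h hv⟩

theorem jumpFun_eq_zero {p : Jump} (h : N.jumpVec p = 0) (ℓ : V k) : N.jumpFun p ℓ = 0 := by
  have := N.jumpFun_eq p ℓ
  rw [h, Prod.fst_zero, inner_zero_right, mul_zero] at this
  exact (map_eq_zero _).1 this

/-- The square of the norm on the middle term. -/
noncomputable def energy (N : NahmSolution k j μ₀ μ₁) (u : Sec k j × Sec k j) : ℝ :=
  (∫ z in Ioo (-μ₁) μ₁, (‖u.1.1 z‖ ^ 2 + ‖u.2.1 z‖ ^ 2))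
    + (∫ z in Ioo μ₁ (μ₀ - μ₁), (‖u.1.2 z‖ ^ 2 + ‖u.2.2 z‖ ^ 2))
    + (N.jumpCoeffSq u .plus + N.jumpCoeffSq u .minus)

theorem jumpCoeffSq_nonneg (u : Sec k j × Sec k j) (p : Jump) : 0 ≤ N.jumpCoeffSq u p := by
  rw [jumpCoeffSq]
  positivity

theorem energy_nonneg (u : Sec k j × Sec k j) : 0 ≤ N.energy u := by
  have h1 : 0 ≤ ∫ z in Ioo (-μ₁) μ₁, (‖u.1.1 z‖ ^ 2 + ‖u.2.1 z‖ ^ 2) :=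
    integral_nonneg fun z => by positivity
  have h2 : 0 ≤ ∫ z in Ioo μ₁ (μ₀ - μ₁), (‖u.1.2 z‖ ^ 2 + ‖u.2.2 z‖ ^ 2) :=
    integral_nonneg fun z => by positivity
  have h3 := N.jumpCoeffSq_nonneg u .plus
  have h4 := N.jumpCoeffSq_nonneg u .minus
  rw [energy]
  positivity

theorem eq_zero_of_energy_eq_zero {u : Sec k j × Sec k j} (hu : N.MemE1 x u) (h : N.energy u = 0) :
    u = 0 := by
  have h1 : 0 ≤ ∫ z in Ioo (-μ₁) μ₁, (‖u.1.1 z‖ ^ 2 + ‖u.2.1 z‖ ^ 2) :=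
    integral_nonneg fun z => by positivity
  have h2 : 0 ≤ ∫ z in Ioo μ₁ (μ₀ - μ₁), (‖u.1.2 z‖ ^ 2 + ‖u.2.2 z‖ ^ 2) :=
    integral_nonneg fun z => by positivity
  have h3 := N.jumpCoeffSq_nonneg u .plus
  have h4 := N.jumpCoeffSq_nonneg u .minus
  rw [energy] at h
  obtain ⟨e1, e2⟩ := eq_zero_of_integral_norm_sq hu.l2₁.1 hu.l2₂.1 hu.ac₁.1.hasWeakDeriv.continuousOn
    hu.ac₂.1.hasWeakDeriv.continuousOn hu.supp₁.1 hu.supp₂.1 (by linarith)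
  obtain ⟨e3, e4⟩ := eq_zero_of_integral_norm_sq hu.l2₁.2 hu.l2₂.2 hu.ac₁.2.hasWeakDeriv.continuousOn
    hu.ac₂.2.hasWeakDeriv.continuousOn hu.supp₁.2 hu.supp₂.2 (by linarith)
  exact Prod.ext (Prod.ext e1 e3) (Prod.ext e2 e4)

theorem norm_add_sq_of (c d : ℂ) : ‖c + d‖ ^ 2 = ‖c‖ ^ 2 + ‖d‖ ^ 2 + 2 * ((starRingEnd ℂ) d * c).re := by
  rw [Complex.sq_norm, Complex.sq_norm, Complex.sq_norm, Complex.normSq_add]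
  congr 2
  rw [mul_comm]

theorem energy_add (hμ₁ : 0 < μ₁) (hμ : μ₁ < μ₀ - μ₁) {h : Sec k j × Sec k j} {s : Sec k j}
    (hh : N.MemHarmonic x h) (hs : N.MemE0 x s) :
    N.energy (h + N.D1val x s) = N.energy h + N.energy (N.D1val x s) := by
  have hIL := N.large_interval hμ₁ hμ
  have hIS := N.small_interval hμ₁ hμ
  choose A B c h1 h2 h3 h4 hc hc0 using fun p => (hh.jump p).exists_normalized
  choose ℓ a b t1 t2 t3 t4 t5 using hs.jump
  have hD : ∀ p, ∃ A B : V k × V k,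
      Tendsto (fun z => proj (N.ι p) ((N.D1val x s).1.1 z)) (largeNhds μ₁ p) (𝓝 A.1) ∧
      Tendsto (fun z => proj (N.ι p) ((N.D1val x s).2.1 z)) (largeNhds μ₁ p) (𝓝 A.2) ∧
      Tendsto (N.D1val x s).1.2 (smallNhds μ₀ μ₁ p) (𝓝 B.1) ∧
      Tendsto (N.D1val x s).2.2 (smallNhds μ₀ μ₁ p) (𝓝 B.2) ∧
      jumpSign p • (B - A) = N.jumpFun p (ℓ p) • N.jumpVec p := fun p => by
    obtain ⟨aL, bL, aS, bS, J⟩ := N.exists_jumpLimits hμ₁ hμ p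
    exact jump_D1val J (t1 p) (t2 p) (t3 p) (t4 p) (t5 p)
  choose A' B' d1 d2 d3 d4 d5 using hD
  have j1 : ∀ p, N.jumpCoeffSq h p = ‖c p‖ ^ 2 := fun p =>
    jumpCoeffSq_eq (h1 p) (h2 p) (h3 p) (h4 p) (hc p) (hc0 p)
  have j2 : ∀ p, N.jumpCoeffSq (N.D1val x s) p = ‖N.jumpFun p (ℓ p)‖ ^ 2 := fun p =>
    jumpCoeffSq_eq (d1 p) (d2 p) (d3 p) (d4 p) (d5 p) (fun h => jumpFun_eq_zero h _)
  have j3 : ∀ p, N.jumpCoeffSq (h + N.D1val x s) p = ‖c p + N.jumpFun p (ℓ p)‖ ^ 2 := fun p => by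
    refine jumpCoeffSq_eq (A := A p + A' p) (B := B p + B' p) ?_ ?_ ((h3 p).add (d3 p))
      ((h4 p).add (d4 p)) ?_ (fun h => by rw [hc0 p h, jumpFun_eq_zero h, add_zero])
    · exact ((h1 p).add (d1 p)).congr fun z => (map_add (proj (N.ι p)) _ _).symm
    · exact ((h2 p).add (d2 p)).congr fun z => (map_add (proj (N.ι p)) _ _).symm
    · rw [add_smul, ← hc p, ← d5 p]
      module
  have wL := hasWeakDeriv_dz hs.diff.1 hs.ac.1
  have wS := hasWeakDeriv_dz hs.diff.2 hs.ac.2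
  have pvL : PolarVanish (-μ₁) μ₁ (coproj (N.ι .minus)) (coproj (N.ι .plus)) s.1 := by
    have k1 := ((coproj (N.ι .minus)).continuous.tendsto _).comp (t1 .minus)
    have k2 := ((coproj (N.ι .plus)).continuous.tendsto _).comp (t1 .plus)
    rw [coproj_map] at k1 k2
    exact ⟨k1, k2⟩
  have pvS : PolarVanish μ₁ (μ₀ - μ₁) (0 : EndV k) 0 s.2 :=
    ⟨tendsto_const_nhds (x := (0 : V k)), tendsto_const_nhds (x := (0 : V k))⟩
  have lL := hIL.isL2_dz_of_graph wL pvL hs.l2.1 hs.dom.l2₁.1 hs.dom.l2₂.1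
  have lS := hIS.isL2_dz_of_graph wS pvS hs.l2.2 hs.dom.l2₁.2 hs.dom.l2₂.2
  have g := N.green hμ₁ hμ hh.large hh.small h1 h3 (ℓ := ℓ) wL wS hs.l2.1 lL hs.l2.2 lS t1 t2
    (n₁ := (N.D1val x s).1.1) (n₂ := (N.D1val x s).2.1) (m₁ := (N.D1val x s).1.2)
    (m₂ := (N.D1val x s).2.2)
    (Eventually.of_forall fun z => rfl) (Eventually.of_forall fun z => rfl)
    (Eventually.of_forall fun z => rfl) (Eventually.of_forall fun z => rfl)
    hs.dom.l2₁.1 hs.dom.l2₂.1 hs.dom.l2₁.2 hs.dom.l2₂.2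
  have hc1 : ∀ p, jumpSign p • ((B p).1 - (A p).1) = c p • (N.jumpVec p).1 := fun p =>
    congrArg Prod.fst (hc p)
  have hI : ∀ p, Complex.I * (inner ℂ (ℓ p) (c p • (N.jumpVec p).1) : ℂ) =
      -((starRingEnd ℂ) (N.jumpFun p (ℓ p)) * c p) := fun p => by
    rw [jumpFun_eq, inner_smul_right]
    ring
  rw [hc1, hc1, mul_add, hI, hI] at g
  have g' := congrArg Complex.re g
  simp only [Complex.add_re, Complex.neg_re] at g'
  have iL := integral_norm_sq_add hh.l2₁.1 hh.l2₂.1 hs.dom.l2₁.1 hs.dom.l2₂.1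
  have iS := integral_norm_sq_add hh.l2₁.2 hh.l2₂.2 hs.dom.l2₁.2 hs.dom.l2₂.2
  have iL' : ∫ z in Ioo (-μ₁) μ₁, (‖(h + N.D1val x s).1.1 z‖ ^ 2 + ‖(h + N.D1val x s).2.1 z‖ ^ 2) = _ := iL
  have iS' : ∫ z in Ioo μ₁ (μ₀ - μ₁), (‖(h + N.D1val x s).1.2 z‖ ^ 2 + ‖(h + N.D1val x s).2.2 z‖ ^ 2) = _ := iS
  rw [energy, energy, energy, iL', iS', j1, j1, j2, j2, j3, j3, norm_add_sq_of, norm_add_sq_of]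
  linarith

theorem midNorm_le (hμ₁ : 0 < μ₁) (hμ : μ₁ < μ₀ - μ₁) {h u : Sec k j × Sec k j} {s : Sec k j}
    (hh : N.MemHarmonic x h) (hs : N.MemE0 x s) (hu : u = h + N.D1val x s) :
    N.midNorm h ≤ N.midNorm u ∧ (N.midNorm u = N.midNorm h → u = h) := by
  have e : N.energy u = N.energy h + N.energy (N.D1val x s) := by rw [hu, energy_add hμ₁ hμ hh hs]
  have hm : ∀ v, N.midNorm v = √(N.energy v) := fun v => rfl
  have h0 := N.energy_nonneg (N.D1val x s)
  refine ⟨?_, fun h1 => ?_⟩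
  · rw [hm, hm]
    exact Real.sqrt_le_sqrt (by linarith)
  · rw [hm, hm, Real.sqrt_inj (N.energy_nonneg u) (N.energy_nonneg h)] at h1
    rw [hu, eq_zero_of_energy_eq_zero hs.dom (by linarith), add_zero]

/-- The class of a solution of the Dirac equation. -/
noncomputable def harmonicClass (N : NahmSolution k j μ₀ μ₁) (x : Fin 4 → ℝ)
    (hle : N.harmonic x ≤ N.cocycles x) : N.harmonic x →ₗ[ℂ] N.Cohomology x :=
  ((N.coboundaries x).submoduleOf (N.cocycles x)).mkQ ∘ₗ Submodule.inclusion hle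

theorem cls_eq_cls_iff {u v : N.cocycles x} :
    N.cls x u = N.cls x v ↔ ∃ s, N.MemE0 x s ∧ u.1 = v.1 + N.D1val x s := by
  rw [cls, cls, Submodule.Quotient.eq]
  refine (mem_coboundaries (u := ((u - v : N.cocycles x) : Sec k j × Sec k j))).trans ?_
  refine exists_congr fun s => and_congr_right fun _ => ?_
  rw [Submodule.coe_sub, eq_sub_iff_add_eq', eq_comm]

theorem harmonicClass_bijective (hμ₁ : 0 < μ₁) (hμ : μ₁ < μ₀ - μ₁)
    (hle : N.harmonic x ≤ N.cocycles x) : Function.Bijective (N.harmonicClass x hle) := by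
  constructor
  · rw [← LinearMap.ker_eq_bot, LinearMap.ker_eq_bot']
    intro h h0
    have h1 : N.cls x ⟨h.1, hle h.2⟩ = N.cls x 0 := h0
    have h2 : N.cls x 0 = N.cls x ⟨h.1, hle h.2⟩ := h1.symm
    obtain ⟨s, hs, e⟩ := cls_eq_cls_iff.1 h1
    obtain ⟨t, ht, e'⟩ := cls_eq_cls_iff.1 h2
    have m1 := midNorm_le hμ₁ hμ MemHarmonic.zero hs e
    have m2 := midNorm_le hμ₁ hμ h.2 ht e'
    exact Subtype.ext (m2.2 (le_antisymm m1.1 m2.1)).symm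
  · intro q
    obtain ⟨u, rfl⟩ := Submodule.Quotient.mk_surjective _ q
    obtain ⟨hu1, hu2⟩ := NahmSolution.mem_cocycles.1 u.2
    obtain ⟨s, h, hs, hh, e⟩ := exists_harmonic_add_coboundary hμ₁ hμ hu1 hu2
    refine ⟨⟨h, hh⟩, ?_⟩
    have : N.cls x u = N.cls x ⟨h, hle hh⟩ := cls_eq_cls_iff.2 ⟨s, hs, e⟩
    exact this.symm

end NahmSolution

end CaloronNahm

theorem mainTheorem8 (k j : ℕ) (μ₀ μ₁ : ℝ) (hμ₁ : 0 < μ₁) (hμ : μ₁ < μ₀ - μ₁)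
    (N : CaloronNahm.NahmSolution k j μ₀ μ₁) (x : Fin 4 → ℝ) :
    (N.D2 x) ∘ₗ (N.D1 x) = 0 ∧
    ∃ Φ : N.harmonic x ≃ₗ[ℂ] N.Cohomology x,
      ∀ h : N.harmonic x, ∃ hc : h.1 ∈ N.cocycles x,
        Φ h = N.cls x ⟨h.1, hc⟩ ∧
        ∀ u : N.cocycles x, N.cls x u = Φ h →
          N.midNorm h.1 ≤ N.midNorm u.1 ∧ (N.midNorm u.1 = N.midNorm h.1 → u.1 = h.1) := by
  have hle : N.harmonic x ≤ N.cocycles x := fun u hu =>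
    CaloronNahm.NahmSolution.MemHarmonic.mem_cocycles hu hμ₁ hμ
  refine ⟨CaloronNahm.NahmSolution.D2_comp_D1,
    LinearEquiv.ofBijective (N.harmonicClass x hle)
      (CaloronNahm.NahmSolution.harmonicClass_bijective hμ₁ hμ hle),
    fun h => ⟨hle h.2, rfl, fun u hu => ?_⟩⟩
  have hu' : N.cls x u = N.cls x ⟨h.1, hle h.2⟩ := hu
  obtain ⟨s, hs, e⟩ := CaloronNahm.NahmSolution.cls_eq_cls_iff.1 hu'
  exact CaloronNahm.NahmSolution.midNorm_le hμ₁ hμ h.2 hs e
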